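/- **Setting.** Let $n\ge 1$. Fix radial cutoffs $\chi\in\mathcal D(B(0,4/3))$ and $\varphi\in\mathcal D(B(0,8/3)\setminus\overline B(0,3/4))$ on $\mathbb R^n$ with values in $[0,1]$ such that $\chi(\xi)+\sum_{j\ge0}\varphi(2^{-j}\xi)=1$ for all $\xi$; $\sum_{j\in\mathbb Z}\varphi(2^{-j}\xi)=1$ for $\xi\ne0$; $\operatorname{supp}\varphi(2^{-j}\cdot)\cap\operatorname{supp}\varphi(2^{-j'}\cdot)=\emptyset$ if $|j-j'|\ge2$; $\operatorname{supp}\chi\cap\operatorname{supp}\varphi(2^{-j}\cdot)=\emptyset$ if $j\ge1$; $\frac12\le\chi^2(\xi)+\sum_{j\ge0}\varphi^2(2^{-j}\xi)\le1$ for all $\xi$; and $\frac12\le\sum_{j\in\mathbb Z}\varphi^2(2^{-j}\xi)\le1$ for $\xi\neq0$. Put $\dot S_j=\chi(2^{-j}D)$, $\dot\Delta_j=\varphi(2^{-j}D)$ on $\mathcal S'=\mathcal S'(\mathbb R^n)$, and let $\mathcal S'_h$ be the set of $u\in\mathcal S'$ with $\|\dot S_ju\|_{L^\infty}\to0$ as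 $j\to-\infty$. For $f\in\mathcal S'(\mathbb R^n;\mathbb R^n)$ let $S[f](t)=e^{t\Delta}f$. Let $\mathbb P_{ij}=\delta_{ij}-\nabla_i\nabla_j/\Delta$ (Fourier symbol $\delta_{ij}-\xi_i\xi_j/|\xi|^2$), and, for $\phi\in\mathcal S$ and with summation over repeated indices, $$\langle(\mathbb P\nabla\cdot W)_i,\phi\rangle=-\langle W_{jk},\mathbb P_{ij}\nabla_k\phi\rangle,\qquad \langle G[w](t),\phi\rangle=\int_0^t\langle e^{(t-s)\Delta}w(s),\phi\rangle\,ds,$$ $$B[u,v]=G\,\mathbb P\nabla\cdot(u\otimes v),\qquad \widetilde B[u,v]=G\sum_{m\in\mathbb Z}\mathbb P\nabla\cdot\dot\Delta_m\,\mathsf{Bony}(u,v),$$ $$\mathsf{Bony}(u,v)_{ij}=\sum_{m\in\mathbb Z}\dot S_{m-1}u_i\,\dot\Delta_mv_j+\sum_{m\in\mathbb Z}\dot S_{m-1}v_j\,\dot\Delta_mu_i+\sum_{m\in\mathbb Z}\sum_{|\nu|\le1}\dot\Delta_mu_i\,\dot\Delta_{m-\nu}v_j,$$ where $(u\otimes v)_{ij}=u_iv_j$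 is the pointwise product and all series are taken in $\mathcal S'$. Write $s_\ell=-1+\frac n\ell$. A triple $(\alpha,\ell,\epsilon)\in[1,\infty]^2\times(0,1]$ is *admissible* if $$\text{either } s_\ell+\epsilon+\tfrac2\alpha=0\ \text{ and }\ -s_2\le\epsilon+\tfrac2\alpha\le1,\qquad\text{or } s_\ell+\epsilon+\tfrac2\alpha>0\ \text{ and }\ -s_2<\epsilon+\tfrac2\alpha<1.$$ In the first case let $X^\alpha_{\ell,\epsilon}(T)=L^\alpha(0,T;L^\ell(\mathbb R^n))$ and $B_{\alpha,\ell,\epsilon}=B$. In the second case let $B_{\alpha,\ell,\epsilon}=\widetilde B$ and let $X^\alpha_{\ell,\epsilon}(T)$ be the Chemin–Lerner space $\widetilde L^\alpha_T\dot B^{s}_{\ell,\infty}$ with $s=s_\ell+\epsilon+\frac2\alpha$: the weakly* measurable $u$ with $u(t)\in\mathcal S'_h$ for almost every $t\in(0,T)$ and $\sup_{j\in\mathbb Z}2^{js}\|\dot\Delta_ju\|_{L^\alpha(0,T;L^\ell)}<\infty$. For $T\in(0,\infty]$, a solution on $(0,T)$ of $u=S[f]-\mathcal B[u,u]$ ($\mathcal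 B=B$ or $\widetilde B$) is a weakly* measurable function $u:(0,T)\to\mathcal S'(\mathbb R^n;\mathbb R^n)$ with $u(t)=S[f](t)-\mathcal B[u,u](t)$ in $\mathcal S'$ for **all** $t\in(0,T)$. **Proposition.** Let $T\in(0,\infty]$ and $f\in\mathcal S'(\mathbb R^n;\mathbb R^n)$. 1. For every admissible $(\alpha,\ell,\epsilon)$, the equation $u=S[f]-B_{\alpha,\ell,\epsilon}[u,u]$ has at most one solution $u\in\bigcap_{T'\in(0,T)}X^\alpha_{\ell,\epsilon}(T')$: two such solutions agree at every $t\in(0,T)$. 2. In particular, the equation $u=S[f]-B[u,u]$ has at most one solution $u\in\bigcap_{T'\in(0,T)}\bigcup_{\alpha\in(2,\infty]}L^\alpha(0,T';L^\infty(\mathbb R^n))$. -/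

import Mathlib

open scoped ENNReal ContDiff SchwartzMap FourierTransform Topology
open MeasureTheory Filter

namespace MildNS

/-- Euclidean space `ℝⁿ`. -/
abbrev E (n : ℕ) := EuclideanSpace ℝ (Fin n)

/-- Scalar tempered distributions on `ℝⁿ`. -/
abbrev TD (n : ℕ) := 𝓢'(E n, ℂ)

/-- Vector fields with components in `𝓢'`. -/
abbrev VTD (n : ℕ) := Fin n → TD n

/-- A distribution is real if it takes real values on real-valued test functions; the space
`𝓢'(ℝⁿ; ℝⁿ)` consists of the `f : VTD n` all of whose components are real. -/
def IsReal {n : ℕ} (u : TD n) : Prop :=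
  ∀ φ : 𝓢(E n, ℂ), (∀ x, (φ x).im = 0) → (u φ).im = 0

/-! ### Functions as distributions -/

/-- The distribution `u` is (given by) the locally integrable function `g`. -/
def Represents {n : ℕ} (g : E n → ℂ) (u : TD n) : Prop :=
  LocallyIntegrable g ∧
    ∀ φ : 𝓢(E n, ℂ), HasCompactSupport (φ : E n → ℂ) → u φ = ∫ x, g x * φ x

open Classical in
/-- The locally integrable function (unique up to null sets) that gives the distribution `u`;
`0` if there is none. -/
noncomputable def toFun {n : ℕ} (u : TD n) : E n → ℂ :=
  if h : ∃ g : E n → ℂ, Represents g u then h.choose else 0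

open Classical in
/-- The tempered distribution with prescribed values `L φ`; `0` if there is none. -/
noncomputable def ofPairing {n : ℕ} (L : 𝓢(E n, ℂ) → ℂ) : TD n :=
  if h : ∃ w : TD n, ∀ φ, w φ = L φ then h.choose else 0

theorem ofPairing_apply {n : ℕ} {L : 𝓢(E n, ℂ) → ℂ} (h : ∃ w : TD n, ∀ φ, w φ = L φ)
    (φ : 𝓢(E n, ℂ)) : ofPairing L φ = L φ := by
  unfold ofPairing
  rw [dif_pos h]
  exact h.choose_spec φ

/-- The tempered distribution `φ ↦ ∫ g φ` given by a function `g`. -/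
noncomputable def ofFun {n : ℕ} (g : E n → ℂ) : TD n :=
  ofPairing fun φ => ∫ x, g x * φ x

/-- The pointwise product of two distributions that are given by functions. -/
noncomputable def pmul {n : ℕ} (u v : TD n) : TD n :=
  ofFun fun x => toFun u x * toFun v x

/-- `‖u‖_{L^p(ℝⁿ)}`, equal to `∞` if `u` is not given by a function in `L^p`. -/
noncomputable def lpNorm {n : ℕ} (p : ℝ≥0∞) (u : TD n) : ℝ≥0∞ :=
  ⨅ (g : E n → ℂ) (_ : Represents g u), eLpNorm g p volume

/-! ### Littlewood-Paley theory -/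

/-- The pairs `(χ, φ)` of cutoff functions that define the Littlewood-Paley decomposition. -/
structure IsLittlewoodPaleyPair {n : ℕ} (χ φ : E n → ℝ) : Prop where
  smooth_low : ContDiff ℝ ∞ χ
  smooth_high : ContDiff ℝ ∞ φ
  radial_low : ∀ ξ η, ‖ξ‖ = ‖η‖ → χ ξ = χ η
  radial_high : ∀ ξ η, ‖ξ‖ = ‖η‖ → φ ξ = φ η
  range_low : ∀ ξ, χ ξ ∈ Set.Icc (0 : ℝ) 1
  range_high : ∀ ξ, φ ξ ∈ Set.Icc (0 : ℝ) 1
  support_low : tsupport χ ⊆ Metric.ball 0 (4 / 3)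
  support_high : tsupport φ ⊆ Metric.ball 0 (8 / 3) \ Metric.closedBall 0 (3 / 4)
  sum_inhomogeneous : ∀ ξ, χ ξ + ∑' j : ℕ, φ ((2 : ℝ) ^ (-(j : ℤ)) • ξ) = 1
  sum_homogeneous : ∀ ξ, ξ ≠ 0 → ∑' j : ℤ, φ ((2 : ℝ) ^ (-j) • ξ) = 1
  disjoint_high : ∀ j k : ℤ, 2 ≤ |j - k| →
    Disjoint (tsupport fun ξ => φ ((2 : ℝ) ^ (-j) • ξ)) (tsupport fun ξ => φ ((2 : ℝ) ^ (-k) • ξ))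
  disjoint_low : ∀ j : ℤ, 1 ≤ j → Disjoint (tsupport χ) (tsupport fun ξ => φ ((2 : ℝ) ^ (-j) • ξ))
  sq_inhomogeneous : ∀ ξ,
    χ ξ ^ 2 + ∑' j : ℕ, φ ((2 : ℝ) ^ (-(j : ℤ)) • ξ) ^ 2 ∈ Set.Icc (1 / 2 : ℝ) 1
  sq_homogeneous : ∀ ξ, ξ ≠ 0 → ∑' j : ℤ, φ ((2 : ℝ) ^ (-j) • ξ) ^ 2 ∈ Set.Icc (1 / 2 : ℝ) 1

/-- The operator `m(2^{-j} D)`, `D = -i∇`. Mathlib's Fourier transform uses `e^{-2πi x·ξ}`, so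
`D` has the symbol `2π ξ`. With `m = φ` this is `Δ̇_j`, with `m = χ` it is `Ṡ_j`. -/
noncomputable def dyadic {n : ℕ} (m : E n → ℝ) (j : ℤ) : TD n →L[ℂ] TD n :=
  TemperedDistribution.fourierMultiplierCLM ℂ
    fun ξ => ((m ((2 : ℝ) ^ (-j) • (2 * Real.pi) • ξ) : ℝ) : ℂ)

/-- The class `𝓢'_h`: `‖Ṡ_j u‖_{L^∞} → 0` as `j → -∞`. -/
def IsSh {n : ℕ} (χ : E n → ℝ) (u : TD n) : Prop :=
  Tendsto (fun j : ℤ => lpNorm ⊤ (dyadic χ j u)) atBot (𝓝 0)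

/-- The paraproduct `Ṫ_u v = ∑_j Ṡ_{j-1}u Δ̇_j v`, the series being taken in `𝓢'`. -/
noncomputable def paraproduct {n : ℕ} (χ φ : E n → ℝ) (u v : TD n) : TD n :=
  ∑' j : ℤ, pmul (dyadic χ (j - 1) u) (dyadic φ j v)

/-- The remainder `Ṙ(u,v) = ∑_j ∑_{|ν|≤1} Δ̇_j u Δ̇_{j-ν} v`, the series being taken in `𝓢'`. -/
noncomputable def remainder {n : ℕ} (φ : E n → ℝ) (u v : TD n) : TD n :=
  ∑' j : ℤ, ∑ ν ∈ Finset.Icc (-1 : ℤ) 1, pmul (dyadic φ j u) (dyadic φ (j - ν) v)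

/-- The Bony product of two distributions. -/
noncomputable def bony {n : ℕ} (χ φ : E n → ℝ) (u v : TD n) : TD n :=
  paraproduct χ φ u v + paraproduct χ φ v u + remainder φ u v

/-! ### The operators of the fixed point problem -/

/-- The heat operator `e^{tΔ}`, with symbol `e^{-t|2πξ|²}`. -/
noncomputable def heat {n : ℕ} (t : ℝ) : TD n →L[ℂ] TD n :=
  TemperedDistribution.fourierMultiplierCLM ℂ
    fun ξ => ((Real.exp (-t * (2 * Real.pi * ‖ξ‖) ^ 2) : ℝ) : ℂ)

/-- The function `ℙ_{ij} ∇_k φ`, where `ℙ_{ij} = δ_{ij} - ∇_i ∇_j / Δ` has the symbol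
`δ_{ij} - ξ_i ξ_j / |ξ|²`. -/
noncomputable def lerayGrad {n : ℕ} (i j k : Fin n) (φ : 𝓢(E n, ℂ)) : E n → ℂ :=
  𝓕⁻ fun ξ : E n =>
    (2 * Real.pi * Complex.I * (ξ k : ℂ)) *
      (((if i = j then 1 else 0) - ξ i * ξ j / ‖ξ‖ ^ 2 : ℝ) : ℂ) * (𝓕 φ) ξ

/-- `(ℙ∇·W)_i`, defined by `⟨(ℙ∇·W)_i, φ⟩ = -∑_{j,k} ⟨W_{jk}, ℙ_{ij}∇_k φ⟩`, for a matrix `W` of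
distributions that are given by functions in a Lebesgue space. -/
noncomputable def lerayDiv {n : ℕ} (W : Fin n → Fin n → TD n) : VTD n := fun i =>
  ofPairing fun φ => -∑ j, ∑ k, ∫ x, toFun (W j k) x * lerayGrad i j k φ x

/-- `(ℙ∇·)_φ W = ∑_m ℙ∇·Δ̇_m W`, the series being taken in `𝓢'`. -/
noncomputable def lerayDivLP {n : ℕ} (φ : E n → ℝ) (W : Fin n → Fin n → TD n) : VTD n := fun i =>
  ∑' m : ℤ, lerayDiv (fun j k => dyadic φ m (W j k)) i

/-- `⟨G[w](t), φ⟩ = ∫_0^t ⟨e^{(t-s)Δ} w(s), φ⟩ ds`. -/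
noncomputable def duhamel {n : ℕ} (w : ℝ → VTD n) (t : ℝ) : VTD n := fun i =>
  ofPairing fun φ => ∫ s in (0 : ℝ)..t, heat (t - s) (w s i) φ

/-- `B[u,v] = G ℙ∇·(u ⊗ v)`, with the pointwise product. -/
noncomputable def bilin {n : ℕ} (u v : ℝ → VTD n) : ℝ → VTD n :=
  duhamel fun s => lerayDiv fun j k => pmul (u s j) (v s k)

/-- `B̃[u,v] = G (ℙ∇·)_φ Bony(u,v)`. -/
noncomputable def bilinBony {n : ℕ} (χ φ : E n → ℝ) (u v : ℝ → VTD n) : ℝ → VTD n :=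
  duhamel fun s => lerayDivLP φ fun j k => bony χ φ (u s j) (v s k)

/-! ### Exponents and path spaces -/

/-- `s_ℓ = -1 + n/ℓ`. -/
noncomputable def sExp (n : ℕ) (l : ℝ≥0∞) : ℝ := -1 + n * (l⁻¹).toReal

/-- `ε + 2/α`. -/
noncomputable def gain (α : ℝ≥0∞) (ε : ℝ) : ℝ := ε + 2 * (α⁻¹).toReal

/-- The admissibility conditions on `(α, ℓ, ε) ∈ [1,∞]² × (0,1]`. -/
def Admissible (n : ℕ) (α l : ℝ≥0∞) (ε : ℝ) : Prop :=
  1 ≤ α ∧ 1 ≤ l ∧ 0 < ε ∧ ε ≤ 1 ∧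
    ((sExp n l + gain α ε = 0 ∧ -sExp n 2 ≤ gain α ε ∧ gain α ε ≤ 1) ∨
      (0 < sExp n l + gain α ε ∧ -sExp n 2 < gain α ε ∧ gain α ε < 1))

/-- `‖u‖_{L^α(0,T; L^p)}` for a scalar `u`. -/
noncomputable def lebNorm {n : ℕ} (α p : ℝ≥0∞) (T : ℝ) (u : ℝ → TD n) : ℝ≥0∞ :=
  eLpNorm (fun t => lpNorm p (u t)) α (volume.restrict (Set.Ioo 0 T))

/-- Membership of a vector field in `L^α_T L^p`, i.e. of each of its components
(weak* measurability is part of `IsSolution`). -/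
def MemLeb {n : ℕ} (α p : ℝ≥0∞) (T : ℝ) (u : ℝ → VTD n) : Prop :=
  ∀ i, (∀ᵐ t ∂(volume.restrict (Set.Ioo 0 T)), lpNorm p (u t i) < ⊤) ∧
    lebNorm α p T (fun t => u t i) < ⊤

/-- Membership of a vector field in the Chemin-Lerner space `L̃^α_T Ḃ^s_{p,∞}`, i.e. of each of its
components: values in `𝓢'_h` almost everywhere, and
`sup_j 2^{js} ‖Δ̇_j u‖_{L^α_T L^p} < ∞`. -/
def MemCheminLerner {n : ℕ} (χ φ : E n → ℝ) (α p : ℝ≥0∞) (s : ℝ) (T : ℝ) (u : ℝ → VTD n) : Prop :=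
  ∀ i, (∀ᵐ t ∂(volume.restrict (Set.Ioo 0 T)), IsSh χ (u t i)) ∧
    (∀ j : ℤ, ∀ᵐ t ∂(volume.restrict (Set.Ioo 0 T)), lpNorm p (dyadic φ j (u t i)) < ⊤) ∧
    (⨆ j : ℤ, ENNReal.ofReal ((2 : ℝ) ^ ((j : ℝ) * s)) *
      lebNorm α p T (fun t => dyadic φ j (u t i))) < ⊤

open Classical in
/-- Membership in the path space `X^α_{ℓ,ε}(T)`. -/
def MemX {n : ℕ} (χ φ : E n → ℝ) (α l : ℝ≥0∞) (ε : ℝ) (T : ℝ) (u : ℝ → VTD n) : Prop :=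
  if sExp n l + gain α ε = 0 then MemLeb α l T u
  else MemCheminLerner χ φ α l (sExp n l + gain α ε) T u

open Classical in
/-- `B_{α,ℓ,ε}`: equal to `B` if `s_ℓ + ε + 2/α = 0` and to `B̃` otherwise. -/
noncomputable def bilinX {n : ℕ} (χ φ : E n → ℝ) (α l : ℝ≥0∞) (ε : ℝ) (u v : ℝ → VTD n) :
    ℝ → VTD n :=
  if sExp n l + gain α ε = 0 then bilin u v else bilinBony χ φ u v

/-! ### Solutions -/

/-- The interval `(0, T)` for `T ∈ (0, ∞]`. -/
def timeInterval (T : ℝ≥0∞) : Set ℝ := {t | 0 < t ∧ ENNReal.ofReal t < T}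

/-- `u : (0,T) → 𝓢'(ℝⁿ; ℝⁿ)` is weakly* measurable and `u(t) = e^{tΔ} f - b[u,u](t)` in `𝓢'`
for all `t ∈ (0,T)`. Only the values of `u` on `(0,T)` matter. -/
structure IsSolution {n : ℕ} (T : ℝ≥0∞) (f : VTD n)
    (b : (ℝ → VTD n) → (ℝ → VTD n) → ℝ → VTD n) (u : ℝ → VTD n) : Prop where
  real : ∀ t ∈ timeInterval T, ∀ i, IsReal (u t i)
  measurable : ∀ (i : Fin n) (φ : 𝓢(E n, ℂ)),
    Measurable fun t : timeInterval T => u t i φ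
  eq : ∀ t ∈ timeInterval T, ∀ i, u t i = heat t (f i) - b u u t i

end MildNS

open scoped Convolution


namespace MildNS

/-! ### Density of test functions and functions as distributions -/

section Density

variable {V : Type*} [NormedAddCommGroup V] [NormedSpace ℝ V] [FiniteDimensional ℝ V]
  [HasContDiffBump V]

/-! Let z = u - v be the difference of two solutions. The heat terms cancel and bilinearity gives
z(t) = -G[b(z,u) + b(v,z)](t), where b is the spatial nonlinearity: a linear Volterra equation whose
coefficients u, v are only known to be of class L^α in time. Because ε > 0, the problem is strictly
subcritical. There is a norm N in which u and v are L^a in time for some real a with 2 ≤ a ≤ α, and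
in which b followed by e^{τΔ} costs only 1 + τ^{-κ} with κ < 1 - 1/a. Hence N(z(t)) ≤ ∫ C(1 +
(t-s)^{-κ}) (N(u) + N(v)) N(z) ds. Hölder's inequality in time, with β conjugate to a, turns this
into N(z)^β ≤ A · (k ∗ N(z)^β) with the integrable kernel k(τ) = τ^{-κβ}, and a weight e^{-ct} with
c large forces N(z) = 0 almost everywhere. Neither a short time nor small data is needed. The
Duhamel integral ignores null sets, so the equation then gives z(t) = 0 at every t. This argument is
carried by the interface `SpatialBound`, by `ae_eq_zero_of_le_singular` and by
`SpatialBound.eq_of_curve`.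

The rest supplies two instances of the interface. If s_ℓ + ε + 2/α = 0, then N is the L^ℓ norm;
admissibility forces ℓ ≥ 2, so u ⊗ v is in L^{ℓ/2}, and by duality the kernel of ℙ∇e^{τΔ} is needed
between conjugate exponents with 1/q - 1/r = 1/ℓ (`spatialBound_lebesgue`). Otherwise N is the Besov
size sup_j 2^{js - δ|j|} ‖Δ̇_j u‖ (`spatialBound_bony`), after a Bernstein embedding that replaces ℓ
by max(ℓ, 2). The small loss 2^{-δ|j|} makes the powers summable over j, which moves the supremum of
the Chemin-Lerner norm inside the time integral (`MemCheminLerner.lintegral_besovSize`). The Bony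
product tolerates this loss because s > 0 and 0 < g < 1 are open conditions, where g = ε + 2/α.

All estimates are made on test functions, with every operator transposed. The function ℙ_{ij}∇_kφ is
in general not Schwartz, since its symbol is not smooth at 0. It is therefore resolved into dyadic
Schwartz pieces `lam` (`hasSum_lam`), each controlled by Bernstein's inequality and by the decay of
the heat symbol (`exists_nrm_lam_heatS_le`). The L^p norm of a distribution is recovered from its
values on Schwartz functions (`inLp_top_of_bound`, `InLp.lpNorm_le_of_bound`). Blocks of a product
whose spectrum misses the test function vanish (`tri_eq_zero_of_spectrum`). As `toFun`, `ofPairing`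
and `tsum` have default values, each formula for the nonlinearity includes a proof that the
function, functional or limit in question exists. -/

/-- Smooth truncations of a Schwartz function converge to it. -/
theorem exists_seq_hasCompactSupport_tendsto (φ : 𝓢(V, ℂ)) :
    ∃ ψ : ℕ → 𝓢(V, ℂ), (∀ k, HasCompactSupport (ψ k : V → ℂ)) ∧
      Tendsto ψ atTop (𝓝 φ) := by
  let θ : ContDiffBump (0 : V) := ⟨1, 2, one_pos, one_lt_two⟩
  let D : V → ℝ := fun x => 1 - θ x
  have hD : ContDiff ℝ ∞ D := contDiff_const.sub θ.contDiff
  have hDbd : ∀ i : ℕ, ∃ C : ℝ, 0 ≤ C ∧ ∀ x, ‖iteratedFDeriv ℝ i D x‖ ≤ C := by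
    intro i
    have hc : Continuous (iteratedFDeriv ℝ i (θ : V → ℝ)) :=
      ContDiff.continuous_iteratedFDeriv (m := i) (n := i) le_rfl θ.contDiff
    obtain ⟨C, hC⟩ := (θ.hasCompactSupport.iteratedFDeriv (𝕜 := ℝ) i).exists_bound_of_continuous hc
    refine ⟨1 + C, by linarith [norm_nonneg _ |>.trans (hC 0)], fun x => ?_⟩
    have : iteratedFDeriv ℝ i D x =
        iteratedFDeriv ℝ i (fun _ : V => (1 : ℝ)) x - iteratedFDeriv ℝ i (θ : V → ℝ) x := by
      apply iteratedFDeriv_sub_apply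
      · exact contDiffAt_const
      · exact θ.contDiff.contDiffAt
    rw [this]
    refine (norm_sub_le _ _).trans (add_le_add ?_ (hC x))
    rcases Nat.eq_zero_or_pos i with rfl | hi
    · simp
    · rw [iteratedFDeriv_const_of_ne hi.ne']; simp
  choose B hB0 hB using hDbd
  let ε : ℕ → ℝ := fun k => 1 / ((k : ℝ) + 1)
  have hε0 : ∀ k, 0 < ε k := fun k => by positivity
  have hε1 : ∀ k, ε k ≤ 1 := fun k => by
    rw [div_le_one (by positivity)]; linarith [Nat.cast_nonneg (α := ℝ) k]
  have hsm : ∀ k, ContDiff ℝ ∞ (fun x => ((θ (ε k • x) : ℝ) : ℂ) * φ x) := fun k =>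
    (Complex.ofRealCLM.contDiff.comp
      (θ.contDiff.comp (contDiff_const_smul (ε k)))).mul (φ.smooth ⊤)
  have hcs : ∀ k, HasCompactSupport (fun x => ((θ (ε k • x) : ℝ) : ℂ) * φ x) := fun k => by
    have h1 : HasCompactSupport (fun x : V => θ (ε k • x)) :=
      θ.hasCompactSupport.comp_homeomorph (Homeomorph.smulOfNeZero (ε k) (hε0 k).ne')
    exact (h1.comp_left (g := fun r : ℝ => (r : ℂ)) (by simp)).mul_right
  refine ⟨fun k => (hcs k).toSchwartzMap (hsm k), fun k => hcs k, ?_⟩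
  rw [(schwartz_withSeminorms ℝ V ℂ).tendsto_nhds]
  rintro ⟨a, b⟩ η hη
  let S : ℝ := ∑ i ∈ Finset.range (b + 1), (b.choose i : ℝ) * B i *
    SchwartzMap.seminorm ℝ (a + 1) (b - i) φ
  have hS0 : 0 ≤ S := Finset.sum_nonneg fun i _ =>
    mul_nonneg (mul_nonneg (by positivity) (hB0 i)) (apply_nonneg _ _)
  have hlim : Tendsto (fun k => ε k * S) atTop (𝓝 0) := by
    simpa only [zero_mul] using (tendsto_one_div_add_atTop_nhds_zero_nat (𝕜 := ℝ)).mul_const S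
  filter_upwards [hlim.eventually (gt_mem_nhds hη)] with k hk
  refine lt_of_le_of_lt ?_ hk
  rw [← map_neg_eq_map, neg_sub]
  refine SchwartzMap.seminorm_le_bound ℝ a b _ (mul_nonneg (hε0 k).le hS0) fun x => ?_
  have heq : ((φ - (hcs k).toSchwartzMap (hsm k) : 𝓢(V, ℂ)) : V → ℂ) =
      fun x => D (ε k • x) • φ x := by
    ext y
    have : (hcs k).toSchwartzMap (hsm k) y = (θ (ε k • y) : ℂ) * φ y := rfl
    simp [D, sub_mul, this]
  rw [heq]
  -- Where ‖ε x‖ < 1 the factor D(ε x) vanishes on a neighbourhood, with all its derivatives.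
  -- Elsewhere 1 ≤ ε‖x‖, so one extra power of the weight buys the factor ε that tends to 0.
  by_cases hx : ‖ε k • x‖ < 1
  · have h0 : (fun x => D (ε k • x) • φ x) =ᶠ[𝓝 x] fun _ => (0 : ℂ) := by
      have : Continuous fun y : V => ‖ε k • y‖ := by fun_prop
      filter_upwards [this.continuousAt.eventually (gt_mem_nhds hx)] with y hy
      have : θ (ε k • y) = 1 := θ.one_of_mem_closedBall (by simpa using hy.le)
      simp [D, this]
    rw [(h0.iteratedFDeriv ℝ b).self_of_nhds]
    rcases Nat.eq_zero_or_pos b with rfl | hb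
    · simpa using mul_nonneg (hε0 k).le hS0
    · rw [iteratedFDeriv_const_of_ne hb.ne']
      simpa using mul_nonneg (hε0 k).le hS0
  · have hx1 : 1 ≤ ε k * ‖x‖ := by
      rw [norm_smul, Real.norm_of_nonneg (hε0 k).le] at hx; exact not_lt.mp hx
    have hL := norm_iteratedFDeriv_smul_le (𝕜 := ℝ) (f := fun x : V => D (ε k • x))
      (g := (φ : V → ℂ)) (n := b) (N := ∞)
      (hD.comp (contDiff_const_smul (ε k))) (φ.smooth ⊤) x (mod_cast le_top)
    calc ‖x‖ ^ a * ‖iteratedFDeriv ℝ b (fun x => D (ε k • x) • φ x) x‖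
        ≤ (ε k * ‖x‖) * (‖x‖ ^ a * ∑ i ∈ Finset.range (b + 1), (b.choose i : ℝ) *
          ‖iteratedFDeriv ℝ i (fun x => D (ε k • x)) x‖ * ‖iteratedFDeriv ℝ (b - i) φ x‖) := by
          refine le_trans ?_ (le_mul_of_one_le_left (by positivity) hx1)
          gcongr
      _ ≤ (ε k * ‖x‖) * (‖x‖ ^ a * ∑ i ∈ Finset.range (b + 1), (b.choose i : ℝ) *
          B i * ‖iteratedFDeriv ℝ (b - i) φ x‖) := by
          gcongr with i hi
          rw [iteratedFDeriv_comp_const_smul]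
          · rw [norm_smul, norm_pow, Real.norm_of_nonneg (hε0 k).le]
            calc _ ≤ 1 * ‖iteratedFDeriv ℝ i D (ε k • x)‖ := by
                  gcongr; exact pow_le_one₀ (hε0 k).le (hε1 k)
              _ ≤ B i := by rw [one_mul]; exact hB i _
          · exact hD.of_le (mod_cast le_top)
      _ = ε k * ∑ i ∈ Finset.range (b + 1), (b.choose i : ℝ) * B i *
          (‖x‖ ^ (a + 1) * ‖iteratedFDeriv ℝ (b - i) φ x‖) := by
          rw [mul_assoc, Finset.mul_sum, Finset.mul_sum]
          congr 1
          refine Finset.sum_congr rfl fun i _ => ?_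
          ring
      _ ≤ ε k * S := by
          refine mul_le_mul_of_nonneg_left (Finset.sum_le_sum fun i _ => ?_) (hε0 k).le
          refine mul_le_mul_of_nonneg_left ?_ (mul_nonneg (by positivity) (hB0 i))
          exact SchwartzMap.le_seminorm ℝ (a + 1) (b - i) φ x

end Density

end MildNS


namespace MildNS

variable {n : ℕ}

/-- `Represents` tests only against compactly supported functions, for which local integrability
suffices; density and continuity make such tests decisive for tempered distributions. -/
theorem ext_of_hasCompactSupport {u v : TD n}
    (h : ∀ φ : 𝓢(E n, ℂ), HasCompactSupport (φ : E n → ℂ) → u φ = v φ) : u = v := by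
  ext φ
  obtain ⟨ψ, hψ, hlim⟩ := exists_seq_hasCompactSupport_tendsto φ
  have hu := (u.continuous.tendsto φ).comp hlim
  have hv := (v.continuous.tendsto φ).comp hlim
  exact tendsto_nhds_unique hu (hv.congr fun k => (h _ (hψ k)).symm)

/-- This makes the choice in `toFun` harmless: norms and integrals do not depend on the
representative. -/
theorem Represents.ae_eq {g g' : E n → ℂ} {u : TD n} (h : Represents g u)
    (h' : Represents g' u) : g =ᵐ[volume] g' := by
  refine ae_eq_of_integral_contDiff_smul_eq h.1 h'.1 fun θ hθ hc => ?_
  have hs : HasCompactSupport fun x => (θ x : ℂ) :=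
    hc.comp_left (g := fun r : ℝ => (r : ℂ)) (by simp)
  have hsm : ContDiff ℝ ∞ fun x => (θ x : ℂ) := Complex.ofRealCLM.contDiff.comp hθ
  have h1 := h.2 (hs.toSchwartzMap hsm) hs
  rw [h'.2 (hs.toSchwartzMap hsm) hs] at h1
  calc ∫ x, θ x • g x = ∫ x, g x * (hs.toSchwartzMap hsm) x := by
        refine integral_congr_ae (.of_forall fun x => ?_)
        change θ x • g x = g x * (θ x : ℂ)
        simp [mul_comm]
    _ = ∫ x, g' x * (hs.toSchwartzMap hsm) x := h1.symm
    _ = ∫ x, θ x • g' x := by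
        refine integral_congr_ae (.of_forall fun x => ?_)
        change g' x * (θ x : ℂ) = θ x • g' x
        simp [mul_comm]

theorem Represents.toFun {g : E n → ℂ} {u : TD n} (h : Represents g u) :
    Represents (toFun u) u := by
  have hex : ∃ g : E n → ℂ, Represents g u := ⟨g, h⟩
  unfold MildNS.toFun
  rw [dif_pos hex]
  exact hex.choose_spec

theorem Represents.toFun_ae_eq {g : E n → ℂ} {u : TD n} (h : Represents g u) :
    MildNS.toFun u =ᵐ[volume] g := h.toFun.ae_eq h

theorem Represents.sub {g h : E n → ℂ} {u v : TD n} (hu : Represents g u)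
    (hv : Represents h v) : Represents (g - h) (u - v) := by
  refine ⟨hu.1.sub hv.1, fun φ hφ => ?_⟩
  have h1 : ∀ {k : E n → ℂ}, LocallyIntegrable k → Integrable fun x => k x * φ x := fun hk => by
    simpa [mul_comm] using hk.integrable_smul_right_of_hasCompactSupport φ.continuous hφ
  change u φ - v φ = _
  rw [hu.2 φ hφ, hv.2 φ hφ, ← integral_sub (h1 hu.1) (h1 hv.1)]
  simp [sub_mul]

/-! ### Distributions in Lebesgue spaces and Hölder pairings -/

/-- `u` is given by a function in `L^p`. -/
def InLp (p : ℝ≥0∞) (u : TD n) : Prop := ∃ g : E n → ℂ, Represents g u ∧ MemLp g p volume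

theorem InLp.memLp {p : ℝ≥0∞} {u : TD n} (h : InLp p u) : MemLp (toFun u) p volume := by
  obtain ⟨g, hg, hm⟩ := h
  exact hm.ae_eq hg.toFun_ae_eq.symm

theorem InLp.represents {p : ℝ≥0∞} {u : TD n} (h : InLp p u) : Represents (toFun u) u :=
  h.choose_spec.1.toFun

theorem Represents.lpNorm_eq {p : ℝ≥0∞} {u : TD n} {g : E n → ℂ} (h : Represents g u) :
    lpNorm p u = eLpNorm g p volume := by
  unfold lpNorm
  refine le_antisymm (iInf₂_le (f := fun g (_ : Represents g u) => eLpNorm g p volume) g h) (le_iInf₂ fun g' hg' => ?_)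
  rw [eLpNorm_congr_ae (h.ae_eq hg')]

theorem inLp_iff {p : ℝ≥0∞} {u : TD n} : InLp p u ↔ lpNorm p u < ⊤ := by
  constructor
  · rintro ⟨g, hg, hm⟩
    rw [hg.lpNorm_eq]
    exact hm.2
  · intro h
    unfold lpNorm at h
    simp only [iInf_lt_iff] at h
    obtain ⟨g, hg, hlt⟩ := h
    exact ⟨g, hg, hg.1.aestronglyMeasurable, hlt⟩

theorem InLp.lpNorm_eq {p : ℝ≥0∞} {u : TD n} (h : InLp p u) :
    lpNorm p u = eLpNorm (toFun u) p volume := h.represents.lpNorm_eq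

theorem InLp.sub {p : ℝ≥0∞} {u v : TD n} (hu : InLp p u) (hv : InLp p v) : InLp p (u - v) :=
  ⟨_, hu.represents.sub hv.represents, hu.memLp.sub hv.memLp⟩

theorem InLp.toFun_sub {p q : ℝ≥0∞} {u v : TD n} (hu : InLp p u) (hv : InLp q v) :
    toFun (u - v) =ᵐ[volume] toFun u - toFun v :=
  (hu.represents.sub hv.represents).toFun_ae_eq

theorem lpNorm_sub_le {p : ℝ≥0∞} (hp : 1 ≤ p) (u v : TD n) :
    lpNorm p (u - v) ≤ lpNorm p u + lpNorm p v := by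
  by_cases hu : lpNorm p u = ⊤
  · simp [hu]
  by_cases hv : lpNorm p v = ⊤
  · simp [hv]
  have hu' := inLp_iff.2 (lt_top_iff_ne_top.2 hu)
  have hv' := inLp_iff.2 (lt_top_iff_ne_top.2 hv)
  rw [(hu'.represents.sub hv'.represents).lpNorm_eq, hu'.lpNorm_eq, hv'.lpNorm_eq]
  exact eLpNorm_sub_le hu'.memLp.1 hv'.memLp.1 hp

theorem enorm_integral_mul_le {p q : ℝ≥0∞} [p.HolderConjugate q] {f g : E n → ℂ}
    (hf : AEStronglyMeasurable f volume) (hg : AEStronglyMeasurable g volume) :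
    ‖∫ x, f x * g x‖ₑ ≤ eLpNorm f p volume * eLpNorm g q volume := by
  have h1 : eLpNorm (f • g) 1 volume ≤ eLpNorm f p volume * eLpNorm g q volume :=
    eLpNorm_smul_le_mul_eLpNorm hg hf
  rw [eLpNorm_one_eq_lintegral_enorm] at h1
  exact (enorm_integral_le_lintegral_enorm _).trans h1

theorem integrable_mul_of_memLp {p q : ℝ≥0∞} [p.HolderConjugate q] {f g : E n → ℂ}
    (hf : MemLp f p volume) (hg : MemLp g q volume) : Integrable (fun x => f x * g x) := by
  have := hg.smul (r := 1) hf
  exact memLp_one_iff_integrable.1 this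

/-- `‖φ‖_{L^q}` of a Schwartz function, as a real number. -/
noncomputable def nrm (q : ℝ≥0∞) (φ : 𝓢(E n, ℂ)) : ℝ := (eLpNorm φ q volume).toReal

theorem nrm_nonneg (q : ℝ≥0∞) (φ : 𝓢(E n, ℂ)) : 0 ≤ nrm q φ := ENNReal.toReal_nonneg

theorem ofReal_nrm (q : ℝ≥0∞) (φ : 𝓢(E n, ℂ)) :
    ENNReal.ofReal (nrm q φ) = eLpNorm (φ : E n → ℂ) q volume := by
  unfold nrm
  exact ENNReal.ofReal_toReal (φ.eLpNorm_lt_top q volume).ne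

/-- Serves as input to `exists_td_of_bound`: a linear functional bounded by Lebesgue norms of the
test function is then a tempered distribution. -/
theorem exists_seminorm_nrm {q : ℝ≥0∞} (hq : 1 ≤ q) :
    ∃ p : Seminorm ℂ 𝓢(E n, ℂ), Continuous p ∧ ∀ φ, p φ = nrm q φ := by
  have : Fact (1 ≤ q) := ⟨hq⟩
  let L := SchwartzMap.toLpCLM ℂ ℂ q (volume : Measure (E n))
  refine ⟨(normSeminorm ℂ _).comp L.toLinearMap, continuous_norm.comp L.continuous, fun φ => ?_⟩
  change ‖φ.toLp q volume‖ = _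
  rw [SchwartzMap.norm_toLp]; rfl

/-- A linear functional on `𝓢` that is bounded by a continuous seminorm is a distribution. -/
theorem exists_td_of_bound {L : 𝓢(E n, ℂ) → ℂ} (hadd : ∀ φ ψ, L (φ + ψ) = L φ + L ψ)
    (hsmul : ∀ (c : ℂ) φ, L (c • φ) = c * L φ) {p : Seminorm ℂ 𝓢(E n, ℂ)} (hp : Continuous p)
    {C : ℝ} (hC : ∀ φ, ‖L φ‖ ≤ C * p φ) : ∃ w : TD n, ∀ φ, w φ = L φ := by
  let Ll : 𝓢(E n, ℂ) →ₗ[ℂ] ℂ := ⟨⟨L, hadd⟩, hsmul⟩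
  have hcont : Continuous Ll := by
    refine continuous_of_continuousAt_zero Ll ?_
    have h0 : Tendsto (fun φ => C * p φ) (𝓝 0) (𝓝 0) := by
      have := ((hp.tendsto 0).const_mul C)
      simpa using this
    rw [ContinuousAt, map_zero]
    exact squeeze_zero_norm hC h0
  exact ⟨ContinuousLinearMap.toPointwiseConvergenceCLM _ _ _ _ ⟨Ll, hcont⟩, fun φ => rfl⟩

theorem exists_td_of_memLp {p : ℝ≥0∞} (hp : 1 ≤ p) {g : E n → ℂ} (hg : MemLp g p volume) :
    ∃ w : TD n, ∀ φ : 𝓢(E n, ℂ), w φ = ∫ x, g x * φ x := by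
  have : Fact (1 ≤ p) := ⟨hp⟩
  refine ⟨Lp.toTemperedDistribution (hg.toLp g), fun φ => ?_⟩
  rw [Lp.toTemperedDistribution_apply]
  refine integral_congr_ae ?_
  filter_upwards [hg.coeFn_toLp] with x hx
  rw [hx, smul_eq_mul, mul_comm]

/-- For g in L^p the integral itself defines a tempered distribution, which agrees with u on test
functions of compact support and hence everywhere. -/
theorem Represents.apply_of_memLp {p : ℝ≥0∞} (hp : 1 ≤ p) {g : E n → ℂ} {u : TD n}
    (h : Represents g u) (hg : MemLp g p volume) (φ : 𝓢(E n, ℂ)) : u φ = ∫ x, g x * φ x := by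
  obtain ⟨w, hw⟩ := exists_td_of_memLp hp hg
  rw [← hw, ext_of_hasCompactSupport (u := u) (v := w) fun ψ hψ => by rw [h.2 ψ hψ, hw]]

theorem InLp.apply {p : ℝ≥0∞} (hp : 1 ≤ p) {u : TD n} (h : InLp p u) (φ : 𝓢(E n, ℂ)) :
    u φ = ∫ x, toFun u x * φ x := h.represents.apply_of_memLp hp h.memLp φ

theorem ofFun_apply {p : ℝ≥0∞} (hp : 1 ≤ p) {g : E n → ℂ} (hg : MemLp g p volume)
    (φ : 𝓢(E n, ℂ)) : ofFun g φ = ∫ x, g x * φ x :=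
  ofPairing_apply (exists_td_of_memLp hp hg) φ

theorem represents_of_forall {p : ℝ≥0∞} (hp : 1 ≤ p) {g : E n → ℂ} (hg : MemLp g p volume)
    {u : TD n} (h : ∀ φ : 𝓢(E n, ℂ), u φ = ∫ x, g x * φ x) : Represents g u :=
  ⟨hg.locallyIntegrable hp, fun φ _ => h φ⟩

theorem represents_ofFun {p : ℝ≥0∞} (hp : 1 ≤ p) {g : E n → ℂ} (hg : MemLp g p volume) :
    Represents g (ofFun g) := represents_of_forall hp hg (ofFun_apply hp hg)

theorem InLp.enorm_apply_le {p q : ℝ≥0∞} [p.HolderConjugate q] {u : TD n} (h : InLp p u)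
    (φ : 𝓢(E n, ℂ)) : ‖u φ‖ₑ ≤ lpNorm p u * eLpNorm φ q volume := by
  rw [h.apply (ENNReal.HolderConjugate.one_le p q) φ, h.lpNorm_eq]
  exact enorm_integral_mul_le h.memLp.1 (φ.memLp q).1

end MildNS


namespace MildNS

variable {n : ℕ}

/-! ### Mollification -/

/-- A sequence of bump functions shrinking to the origin. -/
noncomputable def mollBump (n k : ℕ) : ContDiffBump (0 : E n) :=
  ⟨1 / ((k : ℝ) + 1), 2 / ((k : ℝ) + 1), by positivity, by gcongr; norm_num⟩

/-- The mollifier `y ↦ ρ_k(x - y)`. -/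
noncomputable def moll (k : ℕ) (x : E n) : 𝓢(E n, ℂ) :=
  HasCompactSupport.toSchwartzMap
    (f := fun y => (((mollBump n k).normed volume (x - y) : ℝ) : ℂ))
    ((((mollBump n k).hasCompactSupport_normed (μ := volume)).comp_homeomorph
      (Homeomorph.subLeft x)).comp_left (g := fun r : ℝ => (r : ℂ)) (by simp))
    (Complex.ofRealCLM.contDiff.comp
      ((mollBump n k).contDiff_normed.comp (contDiff_const.sub contDiff_id)))

theorem moll_apply (k : ℕ) (x y : E n) :
    moll k x y = (((mollBump n k).normed volume (x - y) : ℝ) : ℂ) := rfl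

theorem hasCompactSupport_moll (k : ℕ) (x : E n) : HasCompactSupport (moll k x : E n → ℂ) :=
  ((((mollBump n k).hasCompactSupport_normed (μ := volume)).comp_homeomorph
      (Homeomorph.subLeft x)).comp_left (g := fun r : ℝ => (r : ℂ)) (by simp))

theorem nrm_one_moll (k : ℕ) (x : E n) : nrm 1 (moll k x) = 1 := by
  have h0 : ∀ y, 0 ≤ (mollBump n k).normed volume y := (mollBump n k).nonneg_normed
  have h1 : ∀ y, ‖moll k x y‖ = (mollBump n k).normed volume (x - y) := fun y => by
    rw [moll_apply, Complex.norm_real, Real.norm_of_nonneg (h0 _)]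
  have hint : ∫ y, ‖moll k x y‖ = 1 := by
    simp_rw [h1]
    rw [integral_sub_left_eq_self (fun y => (mollBump n k).normed volume y)]
    exact (mollBump n k).integral_normed
  unfold nrm
  rw [eLpNorm_one_eq_lintegral_enorm, ← ofReal_integral_norm_eq_lintegral_enorm
    (moll k x).integrable, hint]
  simp

theorem Represents.apply_moll {g : E n → ℂ} {u : TD n} (h : Represents g u) (k : ℕ) (x : E n) :
    u (moll k x) = ((mollBump n k).normed volume ⋆[ContinuousLinearMap.lsmul ℝ ℝ, volume] g) x := by
  rw [h.2 _ (hasCompactSupport_moll k x), convolution_eq_swap]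
  refine integral_congr_ae (.of_forall fun y => ?_)
  simp [moll_apply, mul_comm]

theorem Represents.continuous_apply_moll {g : E n → ℂ} {u : TD n} (h : Represents g u) (k : ℕ) :
    Continuous fun x => u (moll k x) := by
  simp_rw [h.apply_moll]
  exact ((mollBump n k).hasCompactSupport_normed).continuous_convolution_left _
    (mollBump n k).continuous_normed h.1

theorem Represents.ae_tendsto_moll {g : E n → ℂ} {u : TD n} (h : Represents g u) :
    ∀ᵐ x, Tendsto (fun k => u (moll k x)) atTop (𝓝 (g x)) := by
  have h1 : Tendsto (fun k => (mollBump n k).rOut) atTop (𝓝 0) := by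
    change Tendsto (fun k : ℕ => 2 / ((k : ℝ) + 1)) atTop (𝓝 0)
    have := (tendsto_one_div_add_atTop_nhds_zero_nat (𝕜 := ℝ)).const_mul 2
    simpa [div_eq_mul_inv] using this
  -- The bounded ratio of the radii is the condition under which mollification converges at Lebesgue
  -- points.
  have h2 : ∀ᶠ k in atTop, (mollBump n k).rOut ≤ 2 * (mollBump n k).rIn :=
    .of_forall fun k => by
      change 2 / ((k : ℝ) + 1) ≤ 2 * (1 / ((k : ℝ) + 1))
      rw [mul_one_div]
  filter_upwards [ContDiffBump.ae_convolution_tendsto_right_of_locallyIntegrable h1 h2 h.1] with x hx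
  simpa only [h.apply_moll] using hx

/-! ### Duality -/

/-- The mollifiers have L^1 norm 1, so their pairings with u are bounded by C, and these pairings
converge to g almost everywhere. -/
theorem Represents.eLpNorm_top_le {g : E n → ℂ} {u : TD n} (h : Represents g u) {C : ℝ}
    (hC : ∀ φ : 𝓢(E n, ℂ), ‖u φ‖ ≤ C * nrm 1 φ) :
    eLpNorm g ⊤ volume ≤ ENNReal.ofReal C := by
  rw [eLpNorm_exponent_top]
  refine eLpNormEssSup_le_of_ae_bound ?_
  filter_upwards [h.ae_tendsto_moll] with x hx
  refine le_of_tendsto hx.norm (.of_forall fun k => ?_)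
  simpa [nrm_one_moll] using hC (moll k x)

/-- A distribution that is bounded in the norm of `L^1` is a bounded function. -/
theorem inLp_top_of_bound {u : TD n} {C : ℝ} (hC : ∀ φ : 𝓢(E n, ℂ), ‖u φ‖ ≤ C * nrm 1 φ) :
    InLp ⊤ u ∧ lpNorm ⊤ u ≤ ENNReal.ofReal C := by
  suffices h : ∃ g, Represents g u by
    obtain ⟨g, hg⟩ := h
    have h1 := hg.eLpNorm_top_le hC
    exact ⟨⟨g, hg, hg.1.aestronglyMeasurable, h1.trans_lt ENNReal.ofReal_lt_top⟩,
      hg.lpNorm_eq ▸ h1⟩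
  -- Since r > n, the weight w = (1 + |x|²)^{-r/4} is in L². By Cauchy-Schwarz the functional φ ↦
  -- u(wφ) is then bounded in L², so it has a Riesz representative, and division by w gives a
  -- locally integrable function for u.
  let r : ℝ := n + 1
  let w : E n → ℝ := fun x => (1 + ‖x‖ ^ 2) ^ (-r / 4)
  let wi : E n → ℝ := fun x => (1 + ‖x‖ ^ 2) ^ (r / 4)
  have hw : Function.HasTemperateGrowth w :=
    Function.hasTemperateGrowth_one_add_norm_sq_rpow (E n) (-r / 4)
  have hwi : Function.HasTemperateGrowth wi :=
    Function.hasTemperateGrowth_one_add_norm_sq_rpow (E n) (r / 4)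
  have hww : ∀ x, w x * wi x = 1 := fun x => by
    have : (0 : ℝ) < 1 + ‖x‖ ^ 2 := by positivity
    simp only [w, wi]
    rw [← Real.rpow_add this]
    simp [neg_div]
  have hw2 : MemLp w 2 (volume : Measure (E n)) := by
    rw [memLp_two_iff_integrable_sq hw.1.continuous.aestronglyMeasurable]
    have := integrable_rpow_neg_one_add_norm_sq (μ := (volume : Measure (E n))) (r := r)
      (by simp [r])
    refine this.congr (.of_forall fun x => ?_)
    have h0 : (0 : ℝ) ≤ 1 + ‖x‖ ^ 2 := by positivity
    simp only [w]
    rw [← Real.rpow_mul_natCast h0]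
    congr 1
    push_cast; ring
  let wS : 𝓢(E n, ℂ) →L[ℂ] 𝓢(E n, ℂ) := SchwartzMap.smulLeftCLM ℂ fun x => (w x : ℂ)
  have hwC : Function.HasTemperateGrowth fun x => (w x : ℂ) :=
    by
    fun_prop
  have hwiC : Function.HasTemperateGrowth fun x => (wi x : ℂ) :=
    by
    fun_prop
  have hwS : ∀ φ x, wS φ x = (w x : ℂ) * φ x := fun φ x =>
    SchwartzMap.smulLeftCLM_apply_apply hwC φ x
  let A : ℝ := (eLpNorm w 2 (volume : Measure (E n))).toReal
  have hHol : ∀ φ, nrm 1 (wS φ) ≤ A * ‖φ.toLp 2 volume‖ := fun φ => by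
    rw [SchwartzMap.norm_toLp]
    unfold nrm
    rw [← ENNReal.toReal_mul]
    refine ENNReal.toReal_mono (ENNReal.mul_lt_top hw2.2 (φ.eLpNorm_lt_top 2 volume)).ne ?_
    have : (wS φ : E n → ℂ) = w • (φ : E n → ℂ) := by ext x; simp [hwS]
    rw [this]
    exact eLpNorm_smul_le_mul_eLpNorm φ.continuous.aestronglyMeasurable hw2.1
  let e : 𝓢(E n, ℂ) →ₗ[ℂ] Lp ℂ 2 (volume : Measure (E n)) :=
    (SchwartzMap.toLpCLM ℂ ℂ 2 (volume : Measure (E n))).toLinearMap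
  let f : 𝓢(E n, ℂ) →ₗ[ℂ] ℂ := ⟨⟨fun φ => u (wS φ), fun _ _ => by simp⟩, fun _ _ => by simp⟩
  have hC0 : 0 ≤ C := by
    have := (norm_nonneg _).trans (hC (moll 0 0))
    rwa [nrm_one_moll, mul_one] at this
  have hbd : ∀ φ, ‖f φ‖ ≤ C * A * ‖e φ‖ := fun φ => by
    calc ‖f φ‖ ≤ C * nrm 1 (wS φ) := hC _
      _ ≤ C * (A * ‖φ.toLp 2 volume‖) := by gcongr; exact hHol φ
      _ = _ := by rw [mul_assoc]; rfl
  have hd : DenseRange e := SchwartzMap.denseRange_toLpCLM ENNReal.ofNat_ne_top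
  let F := f.extendOfNorm e
  let g0 := (InnerProductSpace.toDual ℂ (Lp ℂ 2 (volume : Measure (E n)))).symm F
  have hF : ∀ φ : 𝓢(E n, ℂ), u (wS φ) = ∫ x, (starRingEnd ℂ) (g0 x) * φ x := fun φ => by
    calc u (wS φ) = F (e φ) := (LinearMap.extendOfNorm_eq hd ⟨_, hbd⟩ φ).symm
      _ = inner ℂ g0 (e φ) := by
          rw [← InnerProductSpace.toDual_apply_apply, LinearIsometryEquiv.apply_symm_apply]
      _ = ∫ x, (starRingEnd ℂ) (g0 x) * φ x := by
          rw [L2.inner_def]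
          refine integral_congr_ae ?_
          have : (e φ : E n → ℂ) =ᵐ[volume] φ := φ.coeFn_toLp 2 volume
          filter_upwards [this] with x hx
          rw [hx]; simp [mul_comm]
  refine ⟨fun x => (wi x : ℂ) * (starRingEnd ℂ) (g0 x), ?_, fun φ _ => ?_⟩
  · have h1 : LocallyIntegrable (fun x => (starRingEnd ℂ) (g0 x)) (volume : Measure (E n)) :=
      (Lp.memLp g0).star.locallyIntegrable (by norm_num)
    rw [← locallyIntegrableOn_univ] at h1 ⊢
    exact h1.continuousOn_mul hwiC.1.continuous.continuousOn isOpen_univ.isLocallyClosed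
  · let ψ := SchwartzMap.smulLeftCLM ℂ (fun x => (wi x : ℂ)) φ
    have hψ : wS ψ = φ := by
      ext x
      rw [hwS, SchwartzMap.smulLeftCLM_apply_apply hwiC, smul_eq_mul, ← mul_assoc,
        ← Complex.ofReal_mul, hww]
      simp
    rw [← hψ, hF]
    refine integral_congr_ae (.of_forall fun x => ?_)
    simp only [hψ, ψ]
    rw [SchwartzMap.smulLeftCLM_apply_apply hwiC, smul_eq_mul]
    ring

/-- Boundedness on Schwartz functions in `L^q` extends to all of `L^q`. -/
theorem norm_integral_mul_le_of_schwartz {p q : ℝ≥0∞} [p.HolderConjugate q] (hq : q ≠ ⊤)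
    {g : E n → ℂ} (hg : MemLp g p volume) {C : ℝ}
    (hC : ∀ φ : 𝓢(E n, ℂ), ‖∫ x, g x * φ x‖ ≤ C * nrm q φ) {h : E n → ℂ}
    (hh : MemLp h q volume) : ‖∫ x, g x * h x‖ ≤ C * (eLpNorm h q volume).toReal := by
  have : Fact (1 ≤ p) := ⟨ENNReal.HolderConjugate.one_le p q⟩
  have : Fact (1 ≤ q) := ⟨ENNReal.HolderConjugate.one_le q p⟩
  let B := (ContinuousLinearMap.mul ℂ ℂ).lpPairing (volume : Measure (E n)) p q (hg.toLp g)
  have hB : ∀ k : Lp ℂ q (volume : Measure (E n)), B k = ∫ x, g x * k x := fun k => by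
    simp only [B]
    rw [ContinuousLinearMap.lpPairing_eq_integral]
    refine integral_congr_ae ?_
    filter_upwards [hg.coeFn_toLp] with x hx
    simp [hx]
  have key : ∀ k : Lp ℂ q (volume : Measure (E n)), ‖B k‖ ≤ C * ‖k‖ := by
    intro k
    refine (SchwartzMap.denseRange_toLpCLM (F := ℂ) (E := E n) hq).induction_on
      (p := fun k => ‖B k‖ ≤ C * ‖k‖) k (isClosed_le (by fun_prop) (by fun_prop)) fun φ => ?_
    change ‖B (φ.toLp q volume)‖ ≤ C * ‖φ.toLp q volume‖
    rw [SchwartzMap.norm_toLp, hB]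
    refine le_trans (le_of_eq ?_) (hC φ)
    congr 1
    refine integral_congr_ae ?_
    filter_upwards [φ.coeFn_toLp q volume] with x hx
    rw [hx]
  have h1 := key (hh.toLp h)
  rw [hB, Lp.norm_toLp] at h1
  refine le_trans (le_of_eq ?_) h1
  congr 1
  refine integral_congr_ae ?_
  filter_upwards [hh.coeFn_toLp] with x hx
  rw [hx]

end MildNS


namespace MildNS

variable {n : ℕ}

/-- The norm of a function that is known to be in `L^p` is determined by duality. -/
theorem InLp.lpNorm_le_of_bound {p q : ℝ≥0∞} [p.HolderConjugate q] (hp : 2 ≤ p) {u : TD n}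
    (hu : InLp p u) {C : ℝ} (hC : ∀ φ : 𝓢(E n, ℂ), ‖u φ‖ ≤ C * nrm q φ) :
    lpNorm p u ≤ ENNReal.ofReal C := by
  have hC0 : 0 ≤ C := by
    by_contra hneg
    have h1 := hC (moll 0 0)
    have h2 := nrm_nonneg q (moll (n := n) 0 0)
    have h3 : nrm q (moll (n := n) 0 0) ≠ 0 := by
      intro h0
      have h4 := ofReal_nrm q (moll (n := n) 0 0)
      rw [h0, ENNReal.ofReal_zero, eq_comm, eLpNorm_eq_zero_iff
        (moll 0 0).continuous.aestronglyMeasurable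
        (ENNReal.HolderConjugate.pos q p).ne'] at h4
      have h5 := nrm_one_moll (n := n) 0 0
      unfold nrm at h5
      rw [eLpNorm_congr_ae h4] at h5
      simp at h5
    nlinarith [norm_nonneg (u (moll 0 0)), lt_of_le_of_ne h2 (Ne.symm h3)]
  rw [hu.lpNorm_eq]
  rcases eq_or_ne p ⊤ with rfl | hpt
  · have hq : q = 1 := (ENNReal.HolderConjugate.eq_top_iff_eq_one ⊤ q).1 rfl
    subst hq
    exact hu.represents.eLpNorm_top_le hC
  set g := toFun u
  have hg : MemLp g p volume := hu.memLp
  have hp1 : 1 ≤ p := ENNReal.HolderConjugate.one_le p q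
  have hqt : q ≠ ⊤ := fun h => by
    have := (ENNReal.HolderConjugate.eq_top_iff_eq_one q p).1 h
    rw [this] at hp
    norm_num at hp
  set P := p.toReal with hP
  have hP2 : 2 ≤ P := by
    have := ENNReal.toReal_mono hpt hp
    simpa using this
  have hpP : p = ENNReal.ofReal P := (ENNReal.ofReal_toReal hpt).symm
  -- The extremal function of Hölder's inequality: g h = |g|^P and ‖h‖_q = ‖g‖_p^{P-1}. It is only
  -- in L^q, which is why the bound on Schwartz functions is first extended by density.
  let h : E n → ℂ := fun x => (starRingEnd ℂ) (g x) * ((‖g x‖ ^ (P - 2) : ℝ) : ℂ)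
  have hmeas : AEStronglyMeasurable h volume := by
    have h1 : AEMeasurable g volume := hg.1.aemeasurable
    exact ((Complex.continuous_conj.measurable.comp_aemeasurable h1).mul
      (Complex.continuous_ofReal.measurable.comp_aemeasurable
        (h1.norm.pow_const (P - 2)))).aestronglyMeasurable
  have hnorm : ∀ x, ‖h x‖ = ‖g x‖ ^ (P - 1) := fun x => by
    simp only [h, norm_mul, RCLike.norm_conj, Complex.norm_real]
    rw [Real.norm_of_nonneg (by positivity)]
    rcases eq_or_ne (g x) 0 with h0 | h0
    · simp [h0, Real.zero_rpow (by linarith : P - 1 ≠ 0)]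
    · have : 0 < ‖g x‖ := norm_pos_iff.2 h0
      nth_rewrite 1 [← Real.rpow_one ‖g x‖]
      rw [← Real.rpow_add this]
      congr 1; ring
  have hqP : q * ENNReal.ofReal (P - 1) = p := by
    have hr : q.toReal⁻¹ = 1 - P⁻¹ := by
      have h1 := ENNReal.HolderConjugate.toReal (p := p) (q := q) (by rw [← hP]; linarith)
      have := h1.inv_add_inv_eq_one
      linarith
    have hq0 : q.toReal = P / (P - 1) := by
      rw [← inv_inv q.toReal, hr]
      have : P ≠ 0 := by linarith
      have : P - 1 ≠ 0 := by linarith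
      field_simp
    rw [← ENNReal.ofReal_toReal hqt, ← ENNReal.ofReal_mul ENNReal.toReal_nonneg, hpP, hq0]
    congr 1
    have : P - 1 ≠ 0 := by linarith
    field_simp
  have hlp : eLpNorm h q volume = eLpNorm g p volume ^ (P - 1) := by
    have h1 : eLpNorm h q volume = eLpNorm (fun x => ‖g x‖ ^ (P - 1)) q volume :=
      eLpNorm_congr_norm_ae (.of_forall fun x => by
        rw [hnorm, Real.norm_of_nonneg (by positivity)])
    rw [h1, eLpNorm_norm_rpow g (by linarith), hqP]
  have hmem : MemLp h q volume := ⟨hmeas, by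
    rw [hlp]; exact ENNReal.rpow_lt_top_of_nonneg (by linarith) hg.2.ne⟩
  have key := norm_integral_mul_le_of_schwartz (p := p) hqt hg
    (fun φ => by rw [← hu.apply hp1]; exact hC φ) hmem
  set X := (eLpNorm g p volume).toReal with hX
  have hX0 : 0 ≤ X := ENNReal.toReal_nonneg
  have hint : ‖∫ x, g x * h x‖ = X ^ P := by
    have h1 : ∀ x, g x * h x = ((‖g x‖ ^ P : ℝ) : ℂ) := fun x => by
      simp only [h]
      rw [← mul_assoc, Complex.mul_conj, Complex.normSq_eq_norm_sq, ← Complex.ofReal_mul]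
      congr 1
      rcases eq_or_ne (g x) 0 with h0 | h0
      · simp [h0, Real.zero_rpow (by linarith : P ≠ 0)]
      · have : 0 < ‖g x‖ := norm_pos_iff.2 h0
        rw [← Real.rpow_natCast, ← Real.rpow_add this]
        congr 1; push_cast; ring
    simp_rw [h1]
    rw [integral_complex_ofReal, Complex.norm_real, Real.norm_of_nonneg
      (integral_nonneg fun x => by positivity), hX, hg.eLpNorm_eq_integral_rpow_norm
      (by positivity) hpt, ENNReal.toReal_ofReal (by positivity), ← Real.rpow_mul
      (integral_nonneg fun x => by positivity)]
    rw [inv_mul_cancel₀ (by linarith), Real.rpow_one]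
  rw [hint, hlp, ← ENNReal.toReal_rpow] at key
  have : X ≤ C := by
    rcases hX0.eq_or_lt with h0 | h0
    · rw [← h0]; exact hC0
    · have h1 : X ^ P = X * X ^ (P - 1) := by
        nth_rewrite 2 [← Real.rpow_one X]
        rw [← Real.rpow_add h0]; congr 1; ring
      rw [h1] at key
      exact le_of_mul_le_mul_right key (by positivity)
  rw [← ENNReal.ofReal_toReal hg.2.ne]
  exact ENNReal.ofReal_le_ofReal this

/-! ### Measurability -/

/-- A weakly* measurable curve of functions has a jointly measurable representative. -/
theorem exists_measurable_toFun {a : ℝ → TD n} (ha : ∀ φ, Measurable fun s => a s φ)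
    {μ : Measure ℝ} (hr : ∀ᵐ s ∂μ, ∃ g, Represents g (a s)) :
    ∃ G : ℝ × E n → ℂ, Measurable G ∧ ∀ᵐ s ∂μ, (fun x => G (s, x)) =ᵐ[volume] toFun (a s) := by
  obtain ⟨S, hSsub, hSm, hS0⟩ := exists_measurable_superset_of_null (ae_iff.1 hr)
  have hrS : ∀ s ∉ S, ∃ g, Represents g (a s) := fun s hs => by
    by_contra h
    exact hs (hSsub h)
  classical
  -- The mollified values are continuous in x and measurable in s, hence jointly measurable. On the
  -- null set S, where no representing function need exist, they are replaced by 0. The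
  -- representative G is their limit on the set Z of convergence.
  let b : ℕ → E n → ℝ → ℂ := fun k x s => Sᶜ.indicator (fun s => a s (moll k x)) s
  have hb : ∀ k, Measurable (Function.uncurry (b k)) := fun k => by
    refine measurable_uncurry_of_continuous_of_measurable (fun s => ?_)
      fun x => (ha (moll k x)).indicator hSm.compl
    by_cases hs : s ∈ S
    · simp [b, hs, continuous_const]
    · obtain ⟨g, hg⟩ := hrS s hs
      simpa [b, hs] using hg.continuous_apply_moll k
  let B : ℕ → ℝ × E n → ℂ := fun k p => b k p.2 p.1
  have hB : ∀ k, Measurable (B k) := fun k => (hb k).comp measurable_swap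
  let Z : Set (ℝ × E n) := {p | ∃ c, Tendsto (fun k => B k p) atTop (𝓝 c)}
  have hZ : MeasurableSet Z := measurableSet_exists_tendsto hB
  have hconv : ∀ p, ∃ c, Tendsto (fun k => Z.indicator (B k) p) atTop (𝓝 c) := fun p => by
    by_cases hp : p ∈ Z
    · obtain ⟨c, hc⟩ := hp
      refine ⟨c, hc.congr fun k => ?_⟩
      rw [Set.indicator_of_mem (show p ∈ Z from ⟨c, hc⟩)]
    · exact ⟨0, tendsto_const_nhds.congr fun k => by rw [Set.indicator_of_notMem hp]⟩
  choose G hG using hconv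
  refine ⟨G, measurable_of_tendsto_metrizable (fun k => (hB k).indicator hZ)
    (tendsto_pi_nhds.2 hG), ?_⟩
  have hS0' : ∀ᵐ s ∂μ, s ∉ S := measure_eq_zero_iff_ae_notMem.1 hS0
  filter_upwards [hS0'] with s hs
  obtain ⟨g, hg⟩ := hrS s hs
  filter_upwards [hg.toFun.ae_tendsto_moll] with x hx
  have h1 : Tendsto (fun k => B k (s, x)) atTop (𝓝 (toFun (a s) x)) := by
    simpa [B, b, hs] using hx
  refine tendsto_nhds_unique (hG (s, x)) (h1.congr fun k => ?_)
  rw [Set.indicator_of_mem (show (s, x) ∈ Z from ⟨_, h1⟩)]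

/-- `toFun` is chosen separately at each time, so it need not be jointly measurable. The
representatives of `exists_measurable_toFun` give the same spatial integral at almost every time. -/
theorem aestronglyMeasurable_integral_toFun_mul {a b : ℝ → TD n}
    (ha : ∀ φ, Measurable fun s => a s φ) (hb : ∀ φ, Measurable fun s => b s φ)
    {μ : Measure ℝ} [SFinite μ] (hra : ∀ᵐ s ∂μ, ∃ g, Represents g (a s))
    (hrb : ∀ᵐ s ∂μ, ∃ g, Represents g (b s)) {Ψ : ℝ → E n → ℂ}
    (hΨ : Measurable (Function.uncurry Ψ)) :
    AEStronglyMeasurable (fun s => ∫ x, toFun (a s) x * toFun (b s) x * Ψ s x) μ := by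
  obtain ⟨G, hGm, hG⟩ := exists_measurable_toFun ha hra
  obtain ⟨H, hHm, hH⟩ := exists_measurable_toFun hb hrb
  have hm : StronglyMeasurable fun s => ∫ x, G (s, x) * H (s, x) * Ψ s x :=
    ((hGm.mul hHm).mul hΨ).stronglyMeasurable.integral_prod_right'
  refine hm.aestronglyMeasurable.congr ?_
  filter_upwards [hG, hH] with s h1 h2
  refine integral_congr_ae ?_
  filter_upwards [h1, h2] with x h3 h4
  rw [h3, h4]

/-- For p = ∞ the norm is the supremum of the mollified values over all scales and a countable dense
set of points. For p < ∞ Tonelli's theorem applies to a jointly measurable representative. -/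
theorem aemeasurable_lpNorm {a : ℝ → TD n} (ha : ∀ φ, Measurable fun s => a s φ)
    {μ : Measure ℝ} {p : ℝ≥0∞} (hp : 1 ≤ p) (hr : ∀ᵐ s ∂μ, InLp p (a s)) :
    AEMeasurable (fun s => lpNorm p (a s)) μ := by
  rcases eq_or_ne p ⊤ with rfl | hpt
  · obtain ⟨D, hDc, hDd⟩ := TopologicalSpace.exists_countable_dense (E n)
    have := hDc.to_subtype
    have hm : Measurable fun s => ⨆ k : ℕ, ⨆ x : D, ‖a s (moll k (x : E n))‖ₑ :=
      .iSup fun k => .iSup fun x => (ha _).enorm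
    refine hm.aemeasurable.congr ?_
    filter_upwards [hr] with s hs
    refine le_antisymm (iSup_le fun k => iSup_le fun x => ?_) ?_
    · have h1 := hs.enorm_apply_le (q := 1) (moll k (x : E n))
      have h2 := nrm_one_moll k (x : E n)
      rw [← ofReal_nrm, h2] at h1
      simpa using h1
    · rw [hs.lpNorm_eq, eLpNorm_exponent_top]
      refine essSup_le_of_ae_le _ ?_
      filter_upwards [hs.represents.ae_tendsto_moll] with x hx
      refine le_of_tendsto hx.enorm (.of_forall fun k => ?_)
      refine le_trans ?_ (le_iSup _ k)
      have hc : Continuous fun x => ‖a s (moll k x)‖ₑ :=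
        (hs.represents.continuous_apply_moll k).enorm
      have hcl : IsClosed {x | ‖a s (moll k x)‖ₑ ≤ ⨆ x : D, ‖a s (moll k (x : E n))‖ₑ} :=
        isClosed_le hc continuous_const
      have hsub : D ⊆ {x | ‖a s (moll k x)‖ₑ ≤ ⨆ x : D, ‖a s (moll k (x : E n))‖ₑ} :=
        fun y hy => le_iSup (fun x : D => ‖a s (moll k (x : E n))‖ₑ) ⟨y, hy⟩
      have := hcl.closure_subset_iff.2 hsub
      rw [hDd.closure_eq] at this
      exact this (Set.mem_univ x)
  · obtain ⟨G, hGm, hG⟩ := exists_measurable_toFun ha (hr.mono fun s hs => ⟨_, hs.represents⟩)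
    have hp0 : p ≠ 0 := (zero_lt_one.trans_le hp).ne'
    have hm : Measurable fun s => (∫⁻ x, ‖G (s, x)‖ₑ ^ p.toReal) ^ (1 / p.toReal) :=
      ((hGm.enorm.pow_const _).lintegral_prod_right').pow_const _
    refine hm.aemeasurable.congr ?_
    filter_upwards [hG, hr] with s h1 h2
    rw [h2.lpNorm_eq, ← eLpNorm_congr_ae h1, eLpNorm_eq_lintegral_rpow_enorm_toReal hp0 hpt]

end MildNS


namespace MildNS

variable {n : ℕ}

/-! ### Norms of convolutions -/

/-- Interpolation between `L^q` and `L^∞`. -/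
theorem eLpNorm_le_interpolate {α : Type*} [MeasurableSpace α] {μ : Measure α} {f : α → ℂ}
    (hf : AEStronglyMeasurable f μ) {q r : ℝ≥0∞} (hq0 : q ≠ 0) (hqt : q ≠ ⊤) (hqr : q ≤ r) :
    eLpNorm f r μ ≤ eLpNorm f ⊤ μ ^ (1 - q.toReal * r⁻¹.toReal) *
      eLpNorm f q μ ^ (q.toReal * r⁻¹.toReal) := by
  rcases eq_or_ne r ⊤ with rfl | hrt
  · simp
  have hr0 : r ≠ 0 := (lt_of_lt_of_le (pos_iff_ne_zero.2 hq0) hqr).ne'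
  set Q := q.toReal
  set R := r.toReal
  have hQ : 0 < Q := ENNReal.toReal_pos hq0 hqt
  have hQR : Q ≤ R := ENNReal.toReal_mono hrt hqr
  have hR : 0 < R := hQ.trans_le hQR
  rw [ENNReal.toReal_inv, eLpNorm_eq_lintegral_rpow_enorm_toReal hr0 hrt,
    eLpNorm_eq_lintegral_rpow_enorm_toReal hq0 hqt]
  set S := eLpNorm f ⊤ μ
  have h1 : ∫⁻ x, ‖f x‖ₑ ^ R ∂μ ≤ S ^ (R - Q) * ∫⁻ x, ‖f x‖ₑ ^ Q ∂μ := by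
    calc ∫⁻ x, ‖f x‖ₑ ^ R ∂μ ≤ ∫⁻ x, S ^ (R - Q) * ‖f x‖ₑ ^ Q ∂μ := by
          refine lintegral_mono_ae ?_
          have : ∀ᵐ x ∂μ, ‖f x‖ₑ ≤ S := by
            simpa [S, eLpNorm_exponent_top] using enorm_ae_le_eLpNormEssSup f μ
          filter_upwards [this] with x hx
          calc ‖f x‖ₑ ^ R = ‖f x‖ₑ ^ (R - Q) * ‖f x‖ₑ ^ Q := by
                rw [← ENNReal.rpow_add_of_nonneg _ _ (by linarith) hQ.le]; congr 1; ring
            _ ≤ _ := by gcongr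
      _ ≤ _ := by
          rw [lintegral_const_mul'' _ (hf.enorm.pow_const _)]
  calc (∫⁻ x, ‖f x‖ₑ ^ R ∂μ) ^ (1 / R) ≤ (S ^ (R - Q) * ∫⁻ x, ‖f x‖ₑ ^ Q ∂μ) ^ (1 / R) := by
        gcongr
    _ = _ := by
        rw [ENNReal.mul_rpow_of_nonneg _ _ (by positivity), ← ENNReal.rpow_mul, ← ENNReal.rpow_mul]
        congr 2
        · change (R - Q) * (1 / R) = 1 - Q * R⁻¹
          field_simp
        · change 1 / R = 1 / Q * (Q * R⁻¹)
          field_simp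

/-- Hölder's inequality for the splitting k = k^{1-1/Q} k^{1/Q}, that is, Jensen's inequality for
the measure k dμ before normalization. -/
theorem lintegral_mul_rpow_le {α : Type*} [MeasurableSpace α] {μ : Measure α} {k f : α → ℝ≥0∞}
    (hk : AEMeasurable k μ) (hf : AEMeasurable f μ) {Q : ℝ} (hQ : 1 ≤ Q) :
    ∫⁻ x, k x * f x ∂μ ≤
      (∫⁻ x, k x ∂μ) ^ (1 - 1 / Q) * (∫⁻ x, k x * f x ^ Q ∂μ) ^ (1 / Q) := by
  rcases hQ.eq_or_lt with rfl | hQ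
  · simp
  have hQ0 : 0 < Q := by linarith
  have hc : (Real.conjExponent Q).HolderConjugate Q := (Real.HolderConjugate.conjExponent hQ).symm
  have hc' : 1 / Real.conjExponent Q = 1 - 1 / Q := by
    have := hc.inv_add_inv_eq_one
    rw [one_div, one_div]; linarith
  have hcp : 0 < Real.conjExponent Q := hc.pos
  have h := ENNReal.lintegral_mul_le_Lp_mul_Lq μ hc (f := fun x => k x ^ (1 - 1 / Q))
    (g := fun x => k x ^ (1 / Q) * f x) (hk.pow_const _) ((hk.pow_const _).mul hf)
  have hnn : 0 ≤ 1 - 1 / Q := by rw [← hc']; positivity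
  calc ∫⁻ x, k x * f x ∂μ = ∫⁻ x, k x ^ (1 - 1 / Q) * (k x ^ (1 / Q) * f x) ∂μ := by
        refine lintegral_congr fun x => ?_
        rw [← mul_assoc, ← ENNReal.rpow_add_of_nonneg _ _ hnn (by positivity)]
        simp
    _ ≤ _ := h
    _ = _ := by
        rw [hc']
        congr 2
        · congr 1
          funext x
          rw [← hc', ← ENNReal.rpow_mul, one_div_mul_cancel hcp.ne', ENNReal.rpow_one]
        · congr 1
          funext x
          rw [ENNReal.mul_rpow_of_nonneg _ _ hQ0.le, ← ENNReal.rpow_mul,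
            one_div_mul_cancel hQ0.ne', ENNReal.rpow_one]

/-- Young's inequality for the convolution with a bounded integrable function. -/
theorem eLpNorm_le_of_convolution_bound {K φ f : E n → ℂ} (hK : Measurable K) (hφ : Measurable φ)
    {A B : ℝ≥0∞} (hA : ∫⁻ x, ‖K x‖ₑ = A) (hB : ∀ x, ‖K x‖ₑ ≤ B)
    (hfm : AEStronglyMeasurable f volume)
    (hf : ∀ x, ‖f x‖ₑ ≤ ∫⁻ y, ‖K (x - y)‖ₑ * ‖φ y‖ₑ) {q r : ℝ≥0∞} (hq : 1 ≤ q) (hqt : q ≠ ⊤)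
    (hqr : q ≤ r) :
    eLpNorm f r volume ≤ (A ^ (1 - 1 / q.toReal) * B ^ (1 / q.toReal) * eLpNorm φ q volume) ^
      (1 - q.toReal * r⁻¹.toReal) * (A * eLpNorm φ q volume) ^ (q.toReal * r⁻¹.toReal) := by
  have hq0 : q ≠ 0 := (zero_lt_one.trans_le hq).ne'
  set Q := q.toReal
  have hQ : 1 ≤ Q := by simpa using ENNReal.toReal_mono hqt hq
  have hQ0 : 0 < Q := by linarith
  have hKx : ∀ x, Measurable fun y => ‖K (x - y)‖ₑ := fun x =>
    (hK.comp (measurable_const.sub measurable_id)).enorm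
  -- Both endpoints r = ∞ and r = q follow from this pointwise bound; interpolation between them
  -- gives every r ≥ q.
  have hJ : ∀ x, ‖f x‖ₑ ≤ A ^ (1 - 1 / Q) * (∫⁻ y, ‖K (x - y)‖ₑ * ‖φ y‖ₑ ^ Q) ^ (1 / Q) := fun x =>
    calc ‖f x‖ₑ ≤ _ := hf x
      _ ≤ _ := lintegral_mul_rpow_le (hKx x).aemeasurable hφ.enorm.aemeasurable hQ
      _ = _ := by rw [lintegral_sub_left_eq_self (fun y => ‖K y‖ₑ), hA]
  have hφQ : (∫⁻ y, ‖φ y‖ₑ ^ Q) ^ (1 / Q) = eLpNorm φ q volume :=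
    (eLpNorm_eq_lintegral_rpow_enorm_toReal hq0 hqt).symm
  have htop : eLpNorm f ⊤ volume ≤ A ^ (1 - 1 / Q) * B ^ (1 / Q) * eLpNorm φ q volume := by
    rw [eLpNorm_exponent_top]
    refine essSup_le_of_ae_le _ (.of_forall fun x => (hJ x).trans ?_)
    rw [mul_assoc, ← hφQ, ← ENNReal.mul_rpow_of_nonneg _ _ (by positivity : 0 ≤ 1 / Q)]
    refine mul_le_mul_right (ENNReal.rpow_le_rpow ?_ (by positivity)) _
    rw [← lintegral_const_mul _ (hφ.enorm.pow_const _)]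
    exact lintegral_mono fun y => mul_le_mul_left (hB _) _
  have hlq : eLpNorm f q volume ≤ A * eLpNorm φ q volume := by
    rw [eLpNorm_eq_lintegral_rpow_enorm_toReal hq0 hqt, ← hφQ]
    have hmeas : Measurable fun p : E n × E n => ‖K (p.1 - p.2)‖ₑ * ‖φ p.2‖ₑ ^ Q :=
      (hK.comp (measurable_fst.sub measurable_snd)).enorm.mul
        ((hφ.comp measurable_snd).enorm.pow_const _)
    have hint : ∫⁻ x, ∫⁻ y, ‖K (x - y)‖ₑ * ‖φ y‖ₑ ^ Q = A * ∫⁻ y, ‖φ y‖ₑ ^ Q := by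
      rw [lintegral_lintegral_swap hmeas.aemeasurable, ← lintegral_const_mul _
        (hφ.enorm.pow_const _)]
      refine lintegral_congr fun y => ?_
      rw [lintegral_mul_const _ (f := fun x => ‖K (x - y)‖ₑ)
        (hK.comp (measurable_id.sub measurable_const)).enorm,
        lintegral_sub_right_eq_self (fun y => ‖K y‖ₑ), hA]
    calc (∫⁻ x, ‖f x‖ₑ ^ Q) ^ (1 / Q)
        ≤ (∫⁻ x, (A ^ (1 - 1 / Q)) ^ Q * ∫⁻ y, ‖K (x - y)‖ₑ * ‖φ y‖ₑ ^ Q) ^ (1 / Q) := by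
          gcongr with x
          calc ‖f x‖ₑ ^ Q ≤ (A ^ (1 - 1 / Q) *
                (∫⁻ y, ‖K (x - y)‖ₑ * ‖φ y‖ₑ ^ Q) ^ (1 / Q)) ^ Q := by gcongr; exact hJ x
            _ = _ := by
              rw [ENNReal.mul_rpow_of_nonneg _ _ hQ0.le, ← ENNReal.rpow_mul _ (1 / Q),
                one_div_mul_cancel hQ0.ne', ENNReal.rpow_one]
      _ = ((A ^ (1 - 1 / Q)) ^ Q * (A * ∫⁻ y, ‖φ y‖ₑ ^ Q)) ^ (1 / Q) := by
          rw [lintegral_const_mul _ hmeas.lintegral_prod_right', hint]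
      _ = A * (∫⁻ y, ‖φ y‖ₑ ^ Q) ^ (1 / Q) := by
          have h0 : 0 ≤ 1 / Q := by positivity
          have h1 : 0 ≤ 1 - 1 / Q := by
            rw [sub_nonneg, div_le_one hQ0]; exact hQ
          rw [← mul_assoc, ENNReal.mul_rpow_of_nonneg _ _ h0, ← ENNReal.rpow_mul]
          congr 1
          nth_rewrite 2 [← ENNReal.rpow_one A]
          rw [← ENNReal.rpow_add_of_nonneg _ _ (by positivity) zero_le_one, ← ENNReal.rpow_mul]
          nth_rewrite 2 [← ENNReal.rpow_one A]
          congr 1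
          field_simp
          ring
  refine (eLpNorm_le_interpolate hfm hq0 hqt hqr).trans ?_
  have ht : 0 ≤ Q * r⁻¹.toReal := by positivity
  have ht' : 0 ≤ 1 - Q * r⁻¹.toReal := by
    rw [ENNReal.toReal_inv, sub_nonneg]
    rcases eq_or_ne r ⊤ with rfl | hrt
    · simp
    · have h1 : Q ≤ r.toReal := ENNReal.toReal_mono hrt hqr
      rw [← div_eq_mul_inv]
      exact div_le_one_of_le₀ h1 (by linarith)
  exact mul_le_mul' (ENNReal.rpow_le_rpow htop ht') (ENNReal.rpow_le_rpow hlq ht)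

/-! ### Fourier multipliers on Schwartz functions -/

/-- The Fourier multiplier with symbol `m`, acting on Schwartz functions. -/
noncomputable abbrev mult (m : E n → ℂ) : 𝓢(E n, ℂ) →L[ℂ] 𝓢(E n, ℂ) :=
  SchwartzMap.fourierMultiplierCLM ℂ m

/-- The Schwartz function `ξ ↦ a (c • ξ)`. -/
noncomputable def dilate (a : 𝓢(E n, ℂ)) (c : ℝ) (hc : c ≠ 0) : 𝓢(E n, ℂ) :=
  SchwartzMap.compCLMOfContinuousLinearEquiv ℂ
    (ContinuousLinearEquiv.smulLeft (Units.mk0 c hc) : E n ≃L[ℝ] E n) a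

theorem dilate_apply (a : 𝓢(E n, ℂ)) (c : ℝ) (hc : c ≠ 0) (ξ : E n) :
    dilate a c hc ξ = a (c • ξ) := rfl

theorem fourierInv_dilate (a : 𝓢(E n, ℂ)) {c : ℝ} (hc : 0 < c) (x : E n) :
    𝓕⁻ (dilate a c hc.ne') x = (c ^ n)⁻¹ • 𝓕⁻ a (c⁻¹ • x) := by
  rw [SchwartzMap.fourierInv_coe, SchwartzMap.fourierInv_coe, Real.fourierInv_eq,
    Real.fourierInv_eq]
  have := Measure.integral_comp_smul (volume : Measure (E n))
    (fun η => Real.fourierChar (inner ℝ η (c⁻¹ • x)) • a η) c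
  simp only [finrank_euclideanSpace, Fintype.card_fin] at this
  rw [abs_of_pos (by positivity)] at this
  rw [← this]
  refine integral_congr_ae (.of_forall fun η => ?_)
  simp only [dilate_apply]
  rw [inner_smul_left, inner_smul_right]
  congr 3
  simp [hc.ne']

theorem mult_eq_convolution (a φ : 𝓢(E n, ℂ)) (x : E n) :
    mult a φ x = ∫ y, 𝓕⁻ a (x - y) * φ y := by
  have h1 : mult a φ = SchwartzMap.convolution (ContinuousLinearMap.mul ℂ ℂ) (𝓕⁻ a : 𝓢(E n, ℂ)) φ := by
    simp only [SchwartzMap.convolution]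
    change (𝓕⁻ (SchwartzMap.smulLeftCLM ℂ a (𝓕 φ) : 𝓢(E n, ℂ)) : 𝓢(E n, ℂ)) =
      𝓕⁻ (SchwartzMap.pairing (ContinuousLinearMap.mul ℂ ℂ)
        (𝓕 (𝓕⁻ a : 𝓢(E n, ℂ)) : 𝓢(E n, ℂ)) (𝓕 φ : 𝓢(E n, ℂ)) : 𝓢(E n, ℂ))
    congr 1
    ext ξ
    rw [SchwartzMap.smulLeftCLM_apply_apply a.hasTemperateGrowth, SchwartzMap.pairing_apply_apply,
      FourierTransform.fourier_fourierInv_eq]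
    rfl
  rw [h1, SchwartzMap.convolution_apply, convolution_eq_swap]
  rfl

/-- Bernstein's inequality. -/
theorem exists_nrm_mult_dilate_le (a : 𝓢(E n, ℂ)) {q r : ℝ≥0∞} (hq : 1 ≤ q)
    (hqr : q ≤ r) : ∃ C : ℝ, 0 ≤ C ∧ ∀ (c : ℝ), 0 < c → ∀ φ : 𝓢(E n, ℂ),
      nrm r (mult (fun ξ => a (c • ξ)) φ) ≤
        C * c ^ (-(n * (q⁻¹.toReal - r⁻¹.toReal))) * nrm q φ := by
  have hq0 : q ≠ 0 := (zero_lt_one.trans_le hq).ne'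
  set k : 𝓢(E n, ℂ) := 𝓕⁻ a with hk
  obtain ⟨M, hM0, hM⟩ : ∃ M : ℝ, 0 ≤ M ∧ ∀ x, ‖k x‖ ≤ M :=
    ⟨_, apply_nonneg _ _, k.norm_le_seminorm ℝ⟩
  set I : ℝ := ∫ x, ‖k x‖ with hI
  have hI0 : 0 ≤ I := integral_nonneg fun x => norm_nonneg _
  -- The kernel of a(cD) is c^{-n} k(x/c). Its L^1 norm does not depend on c and its supremum scales
  -- as c^{-n}; Young's inequality converts this into the power c^{-n(1/q-1/r)}.
  have hconv : ∀ c (hc : 0 < c) (φ : 𝓢(E n, ℂ)),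
      ∫⁻ x, ‖𝓕⁻ (dilate a c hc.ne') x‖ₑ = ENNReal.ofReal I ∧
      (∀ x, ‖𝓕⁻ (dilate a c hc.ne') x‖ₑ ≤ ENNReal.ofReal ((c ^ n)⁻¹ * M)) ∧
      ∀ x, ‖mult (fun ξ => a (c • ξ)) φ x‖ₑ ≤
        ∫⁻ y, ‖𝓕⁻ (dilate a c hc.ne') (x - y)‖ₑ * ‖φ y‖ₑ := by
    intro c hc φ
    set K : 𝓢(E n, ℂ) := 𝓕⁻ (dilate a c hc.ne') with hKdef
    have hKx : ∀ x, K x = (c ^ n)⁻¹ • k (c⁻¹ • x) := fourierInv_dilate a hc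
    have hKn : ∀ x, ‖K x‖ = (c ^ n)⁻¹ * ‖k (c⁻¹ • x)‖ := fun x => by
      rw [hKx, norm_smul, Real.norm_of_nonneg (by positivity)]
    have hKI : ∫⁻ x, ‖K x‖ₑ = ENNReal.ofReal I := by
      rw [← ofReal_integral_norm_eq_lintegral_enorm K.integrable]
      congr 1
      simp_rw [hKn]
      rw [integral_const_mul, Measure.integral_comp_smul volume (fun x => ‖k x‖) c⁻¹]
      simp only [finrank_euclideanSpace, Fintype.card_fin, smul_eq_mul]
      rw [abs_of_pos (by positivity)]
      rw [inv_pow, inv_inv, ← mul_assoc, inv_mul_cancel₀ (by positivity), one_mul]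
    have hKB : ∀ x, ‖K x‖ₑ ≤ ENNReal.ofReal ((c ^ n)⁻¹ * M) := fun x => by
      rw [← ofReal_norm, hKn]
      exact ENNReal.ofReal_le_ofReal (by gcongr; exact hM _)
    refine ⟨hKI, hKB, fun x => ?_⟩
    have := mult_eq_convolution (dilate a c hc.ne') φ x
    change ‖mult (dilate a c hc.ne' : E n → ℂ) φ x‖ₑ ≤ _
    rw [this]
    refine (enorm_integral_le_lintegral_enorm _).trans (le_of_eq ?_)
    exact lintegral_congr fun y => enorm_mul _ _
  rcases eq_or_ne q ⊤ with rfl | hqt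
  · obtain rfl : r = ⊤ := top_le_iff.1 hqr
    refine ⟨I, hI0, fun c hc φ => ?_⟩
    obtain ⟨h1, h2, h3⟩ := hconv c hc φ
    simp only [sub_self, mul_zero, neg_zero, Real.rpow_zero, mul_one]
    rw [← ENNReal.ofReal_le_ofReal_iff (mul_nonneg hI0 (nrm_nonneg _ _)),
      ENNReal.ofReal_mul hI0, ofReal_nrm, ofReal_nrm, ← h1]
    rw [eLpNorm_exponent_top]
    refine essSup_le_of_ae_le _ (.of_forall fun x => (h3 x).trans ?_)
    have hm : Measurable fun y => ‖𝓕⁻ (dilate a c hc.ne') (x - y)‖ₑ :=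
      ((SchwartzMap.continuous _).measurable.comp (measurable_const.sub measurable_id)).enorm
    rw [← lintegral_sub_left_eq_self (fun y => ‖𝓕⁻ (dilate a c hc.ne') y‖ₑ) x,
      ← lintegral_mul_const _ hm]
    refine lintegral_mono_ae ?_
    filter_upwards [enorm_ae_le_eLpNormEssSup (φ : E n → ℂ) volume] with y hy
    rw [eLpNorm_exponent_top]
    gcongr
  set Q := q.toReal with hQdef
  have hQ : 1 ≤ Q := by simpa using ENNReal.toReal_mono hqt hq
  set t := Q * r⁻¹.toReal with htdef
  have ht0 : 0 ≤ t := by positivity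
  have ht1 : 0 ≤ 1 - t := by
    rw [htdef, ENNReal.toReal_inv, sub_nonneg]
    rcases eq_or_ne r ⊤ with rfl | hrt
    · simp
    · have h1 : Q ≤ r.toReal := ENNReal.toReal_mono hrt hqr
      rw [← div_eq_mul_inv]
      exact div_le_one_of_le₀ h1 (by linarith)
  have hQ1 : 0 ≤ 1 - 1 / Q := by rw [sub_nonneg, div_le_one (by linarith)]; exact hQ
  refine ⟨(I ^ (1 - 1 / Q) * M ^ (1 / Q)) ^ (1 - t) * I ^ t, by positivity, fun c hc φ => ?_⟩
  obtain ⟨hKI, hKB, hKf⟩ := hconv c hc φ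
  have key := eLpNorm_le_of_convolution_bound (f := mult (fun ξ => a (c • ξ)) φ)
    (SchwartzMap.continuous (𝓕⁻ (dilate a c hc.ne'))).measurable φ.continuous.measurable hKI hKB
    (SchwartzMap.continuous _).aestronglyMeasurable hKf hq hqt hqr
  rw [← ofReal_nrm, ← ofReal_nrm, ENNReal.ofReal_rpow_of_nonneg hI0 hQ1,
    ENNReal.ofReal_rpow_of_nonneg (by positivity) (by positivity), ← ENNReal.ofReal_mul
    (by positivity), ← ENNReal.ofReal_mul (by positivity), ← ENNReal.ofReal_mul (by positivity),
    ENNReal.ofReal_rpow_of_nonneg (mul_nonneg (by positivity) (nrm_nonneg _ _)) ht1,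
    ENNReal.ofReal_rpow_of_nonneg (mul_nonneg hI0 (nrm_nonneg _ _)) ht0,
    ← ENNReal.ofReal_mul (Real.rpow_nonneg (mul_nonneg (by positivity) (nrm_nonneg _ _)) _),
    ENNReal.ofReal_le_ofReal_iff (mul_nonneg
      (Real.rpow_nonneg (mul_nonneg (by positivity) (nrm_nonneg _ _)) _)
      (Real.rpow_nonneg (mul_nonneg hI0 (nrm_nonneg _ _)) _))] at key
  refine key.trans (le_of_eq ?_)
  have hN := nrm_nonneg q φ
  set N := nrm q φ
  have hcn : ((c ^ n)⁻¹ : ℝ) = c ^ (-(n : ℝ)) := by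
    rw [Real.rpow_neg hc.le, Real.rpow_natCast]
  have hqq : q⁻¹.toReal = 1 / Q := by rw [ENNReal.toReal_inv, one_div]
  have hNN : N ^ (1 - t) * N ^ t = N := by
    rw [← Real.rpow_add_of_nonneg hN ht1 ht0]; simp
  rw [Real.mul_rpow (by positivity) hN, Real.mul_rpow hI0 hN, hcn,
    Real.mul_rpow (by positivity) hM0, ← Real.rpow_mul hc.le,
    show I ^ (1 - 1 / Q) * (c ^ (-(n : ℝ) * (1 / Q)) * M ^ (1 / Q)) =
      (I ^ (1 - 1 / Q) * M ^ (1 / Q)) * c ^ (-(n : ℝ) * (1 / Q)) by ring,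
    Real.mul_rpow (by positivity) (by positivity), ← Real.rpow_mul hc.le, hqq]
  have hexp : -(n : ℝ) * (1 / Q) * (1 - t) = -(n * (1 / Q - r⁻¹.toReal)) := by
    rw [htdef]; field_simp
  rw [hexp]
  calc _ = (I ^ (1 - 1 / Q) * M ^ (1 / Q)) ^ (1 - t) * I ^ t *
        c ^ (-(n * (1 / Q - r⁻¹.toReal))) * (N ^ (1 - t) * N ^ t) := by ring
    _ = _ := by rw [hNN]

end MildNS


namespace MildNS

variable {n : ℕ}

/-! ### The heat semigroup and the Laplacian on Schwartz functions -/

theorem contDiff_normSq_const : ContDiff ℝ ∞ fun ξ : E n => (2 * Real.pi * ‖ξ‖) ^ 2 := by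
  simp_rw [mul_pow]
  exact contDiff_const.mul (contDiff_norm_sq ℝ)

theorem hasTemperateGrowth_normSq_const :
    Function.HasTemperateGrowth fun ξ : E n => (2 * Real.pi * ‖ξ‖) ^ 2 := by
  have := (Function.HasTemperateGrowth.const (E := E n) ((2 * Real.pi) ^ 2)).mul
    (Function.hasTemperateGrowth_norm_sq (E n))
  refine (congrArg Function.HasTemperateGrowth (funext fun ξ => ?_)).mp this
  exact (mul_pow _ _ _).symm

/-- The derivatives of y ↦ e^{-y} composed with y = |2πξ|² have size e^{-y} times at most a power of
1 + |ξ|, and 1 + |ξ| ≤ 2 + y lets the exponential absorb every power. -/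
theorem gaussian_decay (k m : ℕ) : ∃ C : ℝ, ∀ ξ : E n, ‖ξ‖ ^ k *
    ‖iteratedFDeriv ℝ m (fun ξ : E n => Real.exp (-(2 * Real.pi * ‖ξ‖) ^ 2)) ξ‖ ≤ C := by
  obtain ⟨K, C, hC0, hC⟩ := (hasTemperateGrowth_normSq_const (n := n)).norm_iteratedFDeriv_le_uniform m
  let N := k + K * m
  refine ⟨m.factorial * (C + 1) ^ m * (N.factorial * Real.exp 2), fun ξ => ?_⟩
  set y := (2 * Real.pi * ‖ξ‖) ^ 2 with hy
  have hξ := norm_nonneg ξ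
  have h1 : ‖iteratedFDeriv ℝ m ((fun y : ℝ => Real.exp (-y)) ∘
      (fun ξ : E n => (2 * Real.pi * ‖ξ‖) ^ 2)) ξ‖ ≤
      m.factorial * Real.exp (-y) * ((C + 1) * (1 + ‖ξ‖) ^ K) ^ m := by
    refine norm_iteratedFDeriv_comp_le (N := ∞) (Real.contDiff_exp.comp contDiff_neg)
      contDiff_normSq_const (mod_cast le_top) ξ (fun i _ => ?_) fun i hi him => ?_
    · rw [norm_iteratedFDeriv_eq_norm_iteratedDeriv]
      have : iteratedDeriv i (fun y : ℝ => Real.exp (-y)) = fun y => (-1) ^ i * Real.exp (-y) := by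
        have := iteratedDeriv_comp_neg i Real.exp
        ext y
        rw [this, iteratedDeriv_eq_iterate, Real.iter_deriv_exp, smul_eq_mul]
      change ‖iteratedDeriv i (fun y : ℝ => Real.exp (-y)) _‖ ≤ _
      rw [this]
      simp [hy]
    · have h2 : 1 ≤ (1 + ‖ξ‖) ^ K := one_le_pow₀ (by linarith)
      have h3 : 1 ≤ (C + 1) * (1 + ‖ξ‖) ^ K := by nlinarith
      calc _ ≤ C * (1 + ‖ξ‖) ^ K := hC i him ξ
        _ ≤ (C + 1) * (1 + ‖ξ‖) ^ K := by nlinarith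
        _ ≤ _ := le_self_pow₀ h3 (by omega)
  have h2 : (fun y : ℝ => Real.exp (-y)) ∘ (fun ξ : E n => (2 * Real.pi * ‖ξ‖) ^ 2) =
      fun ξ : E n => Real.exp (-(2 * Real.pi * ‖ξ‖) ^ 2) := rfl
  rw [h2] at h1
  have h3 : (1 + ‖ξ‖) ^ N * Real.exp (-y) ≤ N.factorial * Real.exp 2 := by
    have h4 := Real.pow_div_factorial_le_exp (1 + ‖ξ‖) (by linarith) N
    rw [div_le_iff₀ (by positivity)] at h4
    have h5 : 1 + ‖ξ‖ ≤ 2 + y := by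
      have : ‖ξ‖ ^ 2 ≤ y := by
        rw [hy, mul_pow]
        have := Real.pi_gt_three
        exact le_mul_of_one_le_left (sq_nonneg _) (by nlinarith)
      nlinarith [sq_nonneg (‖ξ‖ - 1)]
    calc _ ≤ (Real.exp (1 + ‖ξ‖) * N.factorial) * Real.exp (-y) := by gcongr
      _ ≤ (Real.exp (2 + y) * N.factorial) * Real.exp (-y) := by gcongr
      _ = N.factorial * Real.exp 2 := by
        rw [Real.exp_add, Real.exp_neg]
        field_simp
  calc _ ≤ (1 + ‖ξ‖) ^ k * (m.factorial * Real.exp (-y) * ((C + 1) * (1 + ‖ξ‖) ^ K) ^ m) := by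
        gcongr; linarith
    _ = m.factorial * (C + 1) ^ m * ((1 + ‖ξ‖) ^ N * Real.exp (-y)) := by
        simp only [N]; rw [pow_add, pow_mul, mul_pow]; ring
    _ ≤ _ := by gcongr

theorem contDiff_gaussian :
    ContDiff ℝ ∞ fun ξ : E n => Real.exp (-(2 * Real.pi * ‖ξ‖) ^ 2) :=
  Real.contDiff_exp.comp contDiff_normSq_const.neg

/-- The symbol `e^{-|2πξ|²}` as a Schwartz function. -/
noncomputable def gaussSym (n : ℕ) : 𝓢(E n, ℂ) :=
  SchwartzMap.postcompCLM (𝕜 := ℝ) Complex.ofRealCLM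
    (⟨fun ξ : E n => Real.exp (-(2 * Real.pi * ‖ξ‖) ^ 2), contDiff_gaussian, gaussian_decay⟩ :
      𝓢(E n, ℝ))

theorem gaussSym_apply (ξ : E n) :
    gaussSym n ξ = ((Real.exp (-(2 * Real.pi * ‖ξ‖) ^ 2) : ℝ) : ℂ) := rfl

/-- The symbol `|2πξ|²` of `-Δ`. -/
noncomputable def lapSym (ξ : E n) : ℂ := (((2 * Real.pi * ‖ξ‖) ^ 2 : ℝ) : ℂ)

theorem hasTemperateGrowth_lapSym : Function.HasTemperateGrowth (lapSym (n := n)) := by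
  have := hasTemperateGrowth_normSq_const (n := n)
  unfold lapSym
  fun_prop

theorem lapSym_smul (c : ℝ) (ξ : E n) : lapSym (c • ξ) = (c : ℂ) ^ 2 * lapSym ξ := by
  unfold lapSym
  rw [norm_smul, ← Complex.ofReal_pow, ← Complex.ofReal_mul, Real.norm_eq_abs]
  congr 1
  rw [← sq_abs c]
  ring

/-- The operator `-Δ`. -/
noncomputable def lap : 𝓢(E n, ℂ) →L[ℂ] 𝓢(E n, ℂ) := mult lapSym

/-- The symbol of the heat operator at time `τ`. -/
noncomputable def heatSym (τ : ℝ) (ξ : E n) : ℂ :=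
  ((Real.exp (-τ * (2 * Real.pi * ‖ξ‖) ^ 2) : ℝ) : ℂ)

/-- The heat operator on Schwartz functions. -/
noncomputable def heatS (τ : ℝ) : 𝓢(E n, ℂ) →L[ℂ] 𝓢(E n, ℂ) := mult (heatSym τ)

/-- The heat symbols are dilates of one Schwartz function, with factor √τ, so the multiplier bounds
for dilated symbols are uniform in τ. -/
theorem heatSym_eq {τ : ℝ} (hτ : 0 < τ) :
    heatSym (n := n) τ = fun ξ => gaussSym n (Real.sqrt τ • ξ) := by
  ext ξ
  rw [gaussSym_apply, heatSym, norm_smul, Real.norm_of_nonneg (Real.sqrt_nonneg _)]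
  congr 3
  have := Real.sq_sqrt hτ.le
  linear_combination (4 * Real.pi ^ 2 * ‖ξ‖ ^ 2) * this

theorem hasTemperateGrowth_comp_smul (a : 𝓢(E n, ℂ)) {c : ℝ} (hc : c ≠ 0) :
    Function.HasTemperateGrowth fun ξ : E n => a (c • ξ) :=
  (dilate a c hc).hasTemperateGrowth

theorem hasTemperateGrowth_heatSym {τ : ℝ} (hτ : 0 < τ) :
    Function.HasTemperateGrowth (heatSym (n := n) τ) := by
  rw [heatSym_eq hτ]
  exact hasTemperateGrowth_comp_smul _ (Real.sqrt_pos.2 hτ).ne'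

theorem mult_mult {m₁ m₂ : E n → ℂ} (h₁ : Function.HasTemperateGrowth m₁)
    (h₂ : Function.HasTemperateGrowth m₂) (φ : 𝓢(E n, ℂ)) :
    mult m₁ (mult m₂ φ) = mult (fun ξ => m₁ ξ * m₂ ξ) φ :=
  SchwartzMap.fourierMultiplierCLM_fourierMultiplierCLM_apply h₁ h₂ φ

theorem mult_const_mul {m : E n → ℂ} (h : Function.HasTemperateGrowth m) (c : ℂ)
    (φ : 𝓢(E n, ℂ)) : mult (fun ξ => c * m ξ) φ = c • mult m φ := by
  have := SchwartzMap.fourierMultiplierCLM_smul (F := ℂ) h c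
  exact DFunLike.congr_fun this φ

theorem nrm_smul (q : ℝ≥0∞) (c : ℂ) (φ : 𝓢(E n, ℂ)) : nrm q (c • φ) = ‖c‖ * nrm q φ := by
  unfold nrm
  have : ((c • φ : 𝓢(E n, ℂ)) : E n → ℂ) = c • (φ : E n → ℂ) := rfl
  rw [this, eLpNorm_const_smul, ENNReal.toReal_mul, toReal_enorm]

theorem exists_nrm_heatS_le {q : ℝ≥0∞} (hq : 1 ≤ q) : ∃ C : ℝ, 0 ≤ C ∧
    ∀ τ, 0 < τ → ∀ φ : 𝓢(E n, ℂ), nrm q (heatS τ φ) ≤ C * nrm q φ := by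
  obtain ⟨C, hC0, hC⟩ := exists_nrm_mult_dilate_le (gaussSym n) hq le_rfl
  refine ⟨C, hC0, fun τ hτ φ => ?_⟩
  have := hC (Real.sqrt τ) (Real.sqrt_pos.2 hτ) φ
  simpa [heatS, heatSym_eq hτ] using this

theorem lap_heatS {τ : ℝ} (hτ : 0 < τ) (φ : 𝓢(E n, ℂ)) : lap (heatS τ φ) = heatS τ (lap φ) := by
  unfold lap heatS
  rw [mult_mult hasTemperateGrowth_lapSym (hasTemperateGrowth_heatSym hτ),
    mult_mult (hasTemperateGrowth_heatSym hτ) hasTemperateGrowth_lapSym]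
  simp_rw [mul_comm]

/-! ### Annular symbols -/

/-- A symbol that is divisible by `|2πξ|²` gains two derivatives. -/
theorem exists_nrm_annular_le_lap {a a' : 𝓢(E n, ℂ)} (h : ∀ ξ, a ξ = lapSym ξ * a' ξ)
    {q r : ℝ≥0∞} (hq : 1 ≤ q) (hqr : q ≤ r) : ∃ C : ℝ, 0 ≤ C ∧ ∀ c : ℝ, 0 < c →
      ∀ φ : 𝓢(E n, ℂ), nrm r (mult (fun ξ => a (c • ξ)) φ) ≤
        C * c ^ (-(n * (q⁻¹.toReal - r⁻¹.toReal))) * c ^ 2 * nrm q (lap φ) := by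
  obtain ⟨C, hC0, hC⟩ := exists_nrm_mult_dilate_le a' hq hqr
  refine ⟨C, hC0, fun c hc φ => ?_⟩
  have hT := hasTemperateGrowth_comp_smul a' hc.ne'
  have h1 : mult (fun ξ => a (c • ξ)) φ = ((c : ℂ) ^ 2) • mult (fun ξ => a' (c • ξ)) (lap φ) := by
    have hTT : Function.HasTemperateGrowth fun ξ => a' (c • ξ) * lapSym ξ :=
      hT.mul hasTemperateGrowth_lapSym
    rw [lap, mult_mult hT hasTemperateGrowth_lapSym, ← mult_const_mul hTT]
    congr 2
    ext ξ
    rw [h, lapSym_smul]; ring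
  rw [h1, nrm_smul, norm_pow, Complex.norm_real, Real.norm_of_nonneg hc.le]
  calc _ ≤ c ^ 2 * (C * c ^ (-(n * (q⁻¹.toReal - r⁻¹.toReal))) * nrm q (lap φ)) := by
        gcongr; exact hC c hc _
    _ = _ := by ring

/-- Annular symbols composed with the heat operator. -/
theorem exists_nrm_annular_heatS_le {a a' : 𝓢(E n, ℂ)} (h : ∀ ξ, a ξ = lapSym ξ * a' ξ)
    {q r : ℝ≥0∞} (hq : 1 ≤ q) (hqr : q ≤ r) : ∃ C : ℝ, 0 ≤ C ∧ ∀ c : ℝ, 0 < c →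
      ∀ τ : ℝ, 0 < τ → ∀ η : ℝ, 0 ≤ η → η ≤ 1 → ∀ φ : 𝓢(E n, ℂ),
      nrm r (mult (fun ξ => a (c • ξ)) (heatS τ φ)) ≤
        C * c ^ (-(n * (q⁻¹.toReal - r⁻¹.toReal))) * (τ / c ^ 2) ^ (-η) * nrm q φ := by
  obtain ⟨C₁, hC₁0, hC₁⟩ := exists_nrm_mult_dilate_le a hq hqr
  obtain ⟨C₂, hC₂0, hC₂⟩ := exists_nrm_heatS_le (n := n) hq
  obtain ⟨C₃, hC₃0, hC₃⟩ := exists_nrm_mult_dilate_le a' hq hqr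
  let gs2 : 𝓢(E n, ℂ) := SchwartzMap.smulLeftCLM ℂ lapSym (gaussSym n)
  have hgs2 : ∀ ξ, gs2 ξ = lapSym ξ * gaussSym n ξ := fun ξ =>
    SchwartzMap.smulLeftCLM_apply_apply hasTemperateGrowth_lapSym _ ξ
  obtain ⟨C₄, hC₄0, hC₄⟩ := exists_nrm_mult_dilate_le gs2 hq (le_refl q)
  refine ⟨max (C₁ * C₂) (C₃ * C₄), by positivity, fun c hc τ hτ η hη0 hη1 φ => ?_⟩
  set w := c ^ (-(n * (q⁻¹.toReal - r⁻¹.toReal))) with hw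
  have hw0 : 0 ≤ w := by positivity
  have hN := nrm_nonneg q φ
  have hy : 0 < τ / c ^ 2 := by positivity
  have hTa := hasTemperateGrowth_comp_smul a hc.ne'
  have hTa' := hasTemperateGrowth_comp_smul a' hc.ne'
  have hTg := hasTemperateGrowth_comp_smul gs2 (Real.sqrt_pos.2 hτ).ne'
  have hTT : Function.HasTemperateGrowth fun ξ => a' (c • ξ) * gs2 (Real.sqrt τ • ξ) :=
    hTa'.mul hTg
  -- With y = τ/c²: if y ≥ 1, the factor |2πξ|² of the annular symbol is moved to the Gaussian,
  -- which yields y^{-1} ≤ y^{-η}; if y ≤ 1, plain boundedness suffices because 1 ≤ y^{-η}. The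
  -- constant is therefore the same for all η in [0,1].
  rcases le_total 1 (τ / c ^ 2) with hy1 | hy1
  · have h1 : mult (fun ξ => a (c • ξ)) (heatS τ φ) = (((τ / c ^ 2)⁻¹ : ℝ) : ℂ) •
        mult (fun ξ => a' (c • ξ)) (mult (fun ξ => gs2 (Real.sqrt τ • ξ)) φ) := by
      rw [heatS, mult_mult hTa (hasTemperateGrowth_heatSym hτ), mult_mult hTa' hTg,
        ← mult_const_mul hTT, heatSym_eq hτ]
      congr 2
      ext ξ
      rw [h, hgs2, lapSym_smul, lapSym_smul]
      have h2 : ((Real.sqrt τ : ℝ) : ℂ) ^ 2 = (τ : ℂ) := by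
        rw [← Complex.ofReal_pow, Real.sq_sqrt hτ.le]
      rw [h2]
      have h3 : (τ : ℂ) ≠ 0 := by exact_mod_cast hτ.ne'
      push_cast
      field_simp
    rw [h1, nrm_smul, Complex.norm_real, Real.norm_of_nonneg (by positivity)]
    have h2 : (τ / c ^ 2)⁻¹ ≤ (τ / c ^ 2) ^ (-η) := by
      rw [← Real.rpow_neg_one]
      exact Real.rpow_le_rpow_of_exponent_le hy1 (by linarith)
    have h3 := hC₄ (Real.sqrt τ) (Real.sqrt_pos.2 hτ) φ
    simp only [sub_self, mul_zero, neg_zero, Real.rpow_zero, mul_one] at h3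
    calc _ ≤ (τ / c ^ 2)⁻¹ * (C₃ * w * (C₄ * nrm q φ)) := by
          refine mul_le_mul_of_nonneg_left ((hC₃ c hc _).trans ?_) (by positivity)
          gcongr
      _ ≤ (τ / c ^ 2) ^ (-η) * (C₃ * w * (C₄ * nrm q φ)) := by gcongr
      _ = (C₃ * C₄) * w * (τ / c ^ 2) ^ (-η) * nrm q φ := by ring
      _ ≤ _ := by gcongr; exact le_max_right _ _
  · have h2 : 1 ≤ (τ / c ^ 2) ^ (-η) :=
      Real.one_le_rpow_of_pos_of_le_one_of_nonpos hy hy1 (by linarith)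
    calc _ ≤ C₁ * w * (C₂ * nrm q φ) := (hC₁ c hc _).trans (by gcongr; exact hC₂ τ hτ φ)
      _ = (C₁ * C₂) * w * 1 * nrm q φ := by ring
      _ ≤ _ := by gcongr; exact le_max_left _ _

/-- A smooth compactly supported symbol that vanishes near the origin is divisible by `|2πξ|²`. -/
theorem exists_annular_factor {a : 𝓢(E n, ℂ)} (hc : HasCompactSupport (a : E n → ℂ))
    (h0 : (0 : E n) ∉ tsupport (a : E n → ℂ)) :
    ∃ a' : 𝓢(E n, ℂ), ∀ ξ, a ξ = lapSym ξ * a' ξ := by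
  have hne : ∀ ξ : E n, ξ ≠ 0 → lapSym ξ ≠ 0 := fun ξ hξ => by
    unfold lapSym
    have : 0 < ‖ξ‖ := norm_pos_iff.2 hξ
    exact_mod_cast (by positivity : (0 : ℝ) < (2 * Real.pi * ‖ξ‖) ^ 2).ne'
  have hsm : ContDiff ℝ ∞ fun ξ => (lapSym ξ)⁻¹ * a ξ := by
    rw [contDiff_iff_contDiffAt]
    intro ξ
    by_cases hξ : ξ ∈ tsupport (a : E n → ℂ)
    · have : ξ ≠ 0 := fun h => h0 (h ▸ hξ)
      exact (hasTemperateGrowth_lapSym.1.contDiffAt.inv (hne ξ this)).mul (a.smooth ⊤).contDiffAt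
    · have h1 : (fun ξ => (lapSym ξ)⁻¹ * a ξ) =ᶠ[𝓝 ξ] fun _ => 0 := by
        filter_upwards [(isClosed_tsupport _).isOpen_compl.mem_nhds hξ] with y hy
        rw [image_eq_zero_of_notMem_tsupport hy, mul_zero]
      exact contDiffAt_const.congr_of_eventuallyEq h1
  refine ⟨(hc.mul_left (f := fun ξ => (lapSym ξ)⁻¹)).toSchwartzMap hsm, fun ξ => ?_⟩
  change a ξ = lapSym ξ * ((lapSym ξ)⁻¹ * a ξ)
  by_cases hξ : ξ = 0
  · subst hξ
    rw [image_eq_zero_of_notMem_tsupport h0]; simp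
  · rw [mul_inv_cancel_left₀ (hne ξ hξ)]

/-! ### Multipliers on distributions -/

/-- The transpose of a multiplier has the reflected symbol m(-ξ); evenness removes the reflection,
so the same operator acts on test functions. -/
theorem fourierMultiplier_apply_of_even {m : E n → ℂ} (hm : Function.HasTemperateGrowth m)
    (heven : ∀ ξ, m (-ξ) = m ξ) (u : TD n) (φ : 𝓢(E n, ℂ)) :
    TemperedDistribution.fourierMultiplierCLM ℂ m u φ = u (mult m φ) := by
  rw [TemperedDistribution.fourierMultiplierCLM_apply_apply]
  congr 1
  have h1 : ∀ f : 𝓢(E n, ℂ), ∀ x, 𝓕⁻ f x = 𝓕 f (-x) := fun f x => rfl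
  have key : ∀ f : 𝓢(E n, ℂ), SchwartzMap.smulLeftCLM ℂ m (𝓕⁻ f) =
      SchwartzMap.compCLMOfContinuousLinearEquiv ℂ
        (LinearIsometryEquiv.neg ℝ (E := E n) : E n ≃L[ℝ] E n)
        (SchwartzMap.smulLeftCLM ℂ m (𝓕 f)) := fun f => by
    ext ξ
    rw [SchwartzMap.smulLeftCLM_apply_apply hm, h1]
    change _ = SchwartzMap.smulLeftCLM ℂ m (𝓕 f) (-ξ)
    rw [SchwartzMap.smulLeftCLM_apply_apply hm, heven]
  rw [key]
  ext x
  change _ = 𝓕⁻ (SchwartzMap.smulLeftCLM ℂ m (𝓕 φ)) x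
  rw [h1, SchwartzMap.fourier_coe, SchwartzMap.fourier_coe]
  have := Real.fourier_comp_linearIsometry (LinearIsometryEquiv.neg ℝ (E := E n))
    (SchwartzMap.smulLeftCLM ℂ m (𝓕 φ) : E n → ℂ) x
  exact this

theorem heat_apply {τ : ℝ} (hτ : 0 < τ) (u : TD n) (φ : 𝓢(E n, ℂ)) :
    heat τ u φ = u (heatS τ φ) :=
  fourierMultiplier_apply_of_even (hasTemperateGrowth_heatSym hτ)
    (fun ξ => by unfold heatSym; rw [norm_neg]) u φ

end MildNS


namespace MildNS

variable {n : ℕ}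

/-! ### Powers of two -/

theorem two_zpow_rpow (m : ℤ) (x : ℝ) : ((2 : ℝ) ^ m) ^ x = (2 : ℝ) ^ ((m : ℝ) * x) := by
  rw [← Real.rpow_intCast, ← Real.rpow_mul (by norm_num)]

theorem summable_two_rpow_neg_abs {δ : ℝ} (hδ : 0 < δ) :
    Summable fun m : ℤ => (2 : ℝ) ^ (-(δ * |(m : ℝ)|)) := by
  have h : Summable fun k : ℕ => (2 : ℝ) ^ (-(δ * |(((k : ℤ)) : ℝ)|)) := by
    have h1 : ∀ k : ℕ, (2 : ℝ) ^ (-(δ * |(((k : ℤ)) : ℝ)|)) = ((2 : ℝ) ^ (-δ)) ^ k := fun k => by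
      rw [← Real.rpow_natCast, ← Real.rpow_mul (by norm_num)]
      congr 1
      have : |(((k : ℤ)) : ℝ)| = k := by simp
      rw [this]; ring
    simp_rw [h1]
    refine summable_geometric_of_lt_one (by positivity) ?_
    exact Real.rpow_lt_one_of_one_lt_of_neg (by norm_num) (by linarith)
  refine Summable.of_nat_of_neg h ?_
  simpa using h

/-! ### Cutoffs as Schwartz symbols -/

/-- Smooth even compactly supported functions. -/
structure IsCutoff (m : E n → ℝ) : Prop where
  smooth : ContDiff ℝ ∞ m
  compact : HasCompactSupport m
  even : ∀ ξ, m (-ξ) = m ξ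

theorem hasCompactSupport_comp_smul {F : Type*} [Zero F] {m : E n → F} (hm : HasCompactSupport m)
    {c : ℝ} (hc : c ≠ 0) : HasCompactSupport fun ξ => m (c • ξ) :=
  hm.comp_homeomorph (Homeomorph.smulOfNeZero c hc)

theorem two_pi_ne_zero : (2 * Real.pi) ≠ 0 := by positivity

/-- The symbol `m(2π ξ)` as a Schwartz function. -/
noncomputable def symS {m : E n → ℝ} (hm : IsCutoff m) : 𝓢(E n, ℂ) :=
  HasCompactSupport.toSchwartzMap (f := fun ξ => ((m ((2 * Real.pi) • ξ) : ℝ) : ℂ))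
    ((hasCompactSupport_comp_smul hm.compact two_pi_ne_zero).comp_left
      (g := fun x : ℝ => (x : ℂ)) Complex.ofReal_zero)
    (Complex.ofRealCLM.contDiff.comp (hm.smooth.comp (contDiff_const_smul _)))

theorem symS_apply {m : E n → ℝ} (hm : IsCutoff m) (ξ : E n) :
    symS hm ξ = ((m ((2 * Real.pi) • ξ) : ℝ) : ℂ) := rfl

theorem symS_dyadic {m : E n → ℝ} (hm : IsCutoff m) (j : ℤ) :
    (fun ξ => symS hm ((2 : ℝ) ^ (-j) • ξ)) =
      fun ξ => ((m ((2 : ℝ) ^ (-j) • (2 * Real.pi) • ξ) : ℝ) : ℂ) := by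
  ext ξ
  rw [symS_apply, smul_comm]

theorem two_zpow_ne_zero (j : ℤ) : (2 : ℝ) ^ j ≠ 0 := by positivity

/-- The operator `m(2^{-j}D)` on Schwartz functions. -/
noncomputable def dyS {m : E n → ℝ} (hm : IsCutoff m) (j : ℤ) : 𝓢(E n, ℂ) →L[ℂ] 𝓢(E n, ℂ) :=
  mult fun ξ => symS hm ((2 : ℝ) ^ (-j) • ξ)

theorem hasTemperateGrowth_dyadicSym {m : E n → ℝ} (hm : IsCutoff m) (j : ℤ) :
    Function.HasTemperateGrowth fun ξ => symS hm ((2 : ℝ) ^ (-j) • ξ) :=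
  hasTemperateGrowth_comp_smul _ (two_zpow_ne_zero _)

theorem dyadic_apply {m : E n → ℝ} (hm : IsCutoff m) (j : ℤ) (u : TD n) (φ : 𝓢(E n, ℂ)) :
    dyadic m j u φ = u (dyS hm j φ) := by
  unfold dyadic dyS
  rw [← symS_dyadic hm]
  refine fourierMultiplier_apply_of_even (hasTemperateGrowth_dyadicSym hm j) (fun ξ => ?_) u φ
  rw [symS_apply, symS_apply, smul_neg, smul_neg, hm.even]

theorem fourier_mult {m : E n → ℂ} (hm : Function.HasTemperateGrowth m) (φ : 𝓢(E n, ℂ))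
    (ξ : E n) : (𝓕 (mult m φ) : 𝓢(E n, ℂ)) ξ = m ξ * (𝓕 φ : 𝓢(E n, ℂ)) ξ := by
  unfold mult
  rw [SchwartzMap.fourierMultiplierCLM_apply, FourierTransform.fourier_fourierInv_eq,
    SchwartzMap.smulLeftCLM_apply_apply hm, smul_eq_mul]

theorem ext_of_fourier {φ ψ : 𝓢(E n, ℂ)}
    (h : ∀ ξ, (𝓕 φ : 𝓢(E n, ℂ)) ξ = (𝓕 ψ : 𝓢(E n, ℂ)) ξ) : φ = ψ := by
  have : (𝓕 φ : 𝓢(E n, ℂ)) = 𝓕 ψ := SchwartzMap.ext h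
  rw [← FourierTransform.fourierInv_fourier_eq (F := 𝓢(E n, ℂ)) φ, this,
    FourierTransform.fourierInv_fourier_eq (F := 𝓢(E n, ℂ))]

theorem fourier_dyS {m : E n → ℝ} (hm : IsCutoff m) (j : ℤ) (φ : 𝓢(E n, ℂ)) (ξ : E n) :
    (𝓕 (dyS hm j φ) : 𝓢(E n, ℂ)) ξ = symS hm ((2 : ℝ) ^ (-j) • ξ) * (𝓕 φ : 𝓢(E n, ℂ)) ξ :=
  fourier_mult (hasTemperateGrowth_dyadicSym hm j) φ ξ

/-- The gap `1/q - 1/r` between reciprocal exponents. -/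
noncomputable def invGap (q r : ℝ≥0∞) : ℝ := q⁻¹.toReal - r⁻¹.toReal

theorem exists_nrm_dyS_le {m : E n → ℝ} (hm : IsCutoff m) {q r : ℝ≥0∞} (hq : 1 ≤ q)
    (hqr : q ≤ r) : ∃ C : ℝ, 0 ≤ C ∧ ∀ (j : ℤ) (φ : 𝓢(E n, ℂ)),
      nrm r (dyS hm j φ) ≤ C * (2 : ℝ) ^ ((j : ℝ) * (n * invGap q r)) * nrm q φ := by
  obtain ⟨C, hC0, hC⟩ := exists_nrm_mult_dilate_le (symS hm) hq hqr
  refine ⟨C, hC0, fun j φ => ?_⟩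
  have := hC ((2 : ℝ) ^ (-j)) (by positivity) φ
  rw [two_zpow_rpow] at this
  refine this.trans_eq ?_
  congr 3
  unfold invGap
  push_cast
  ring

theorem heatS_comm_mult {m : E n → ℂ} (hm : Function.HasTemperateGrowth m) {τ : ℝ} (hτ : 0 < τ)
    (φ : 𝓢(E n, ℂ)) : mult m (heatS τ φ) = heatS τ (mult m φ) := by
  unfold heatS
  rw [mult_mult hm (hasTemperateGrowth_heatSym hτ), mult_mult (hasTemperateGrowth_heatSym hτ) hm]
  simp_rw [mul_comm]

/-! ### The Leray projection composed with a gradient -/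

/-- The symbol of `ℙ_{ij}∇_k`. -/
noncomputable def lsym (i j k : Fin n) (ξ : E n) : ℂ :=
  (2 * Real.pi * Complex.I * (ξ k : ℂ)) *
    (((if i = j then 1 else 0) - ξ i * ξ j / ‖ξ‖ ^ 2 : ℝ) : ℂ)

theorem lsym_smul (i j k : Fin n) {c : ℝ} (hc : c ≠ 0) (ξ : E n) :
    lsym i j k (c • ξ) = c * lsym i j k ξ := by
  unfold lsym
  have h1 : (c • ξ) i * (c • ξ) j / ‖c • ξ‖ ^ 2 = ξ i * ξ j / ‖ξ‖ ^ 2 := by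
    rw [norm_smul, mul_pow, Real.norm_eq_abs, sq_abs, PiLp.smul_apply, PiLp.smul_apply,
      smul_eq_mul, smul_eq_mul, mul_mul_mul_comm, ← sq, mul_div_mul_left _ _ (by positivity)]
  rw [h1, PiLp.smul_apply, smul_eq_mul]
  push_cast
  ring

theorem norm_lsym_le (i j k : Fin n) (ξ : E n) : ‖lsym i j k ξ‖ ≤ 4 * Real.pi * ‖ξ‖ := by
  unfold lsym
  have hk : |ξ k| ≤ ‖ξ‖ := by simpa using PiLp.norm_apply_le ξ k
  have h1 : |(if i = j then (1 : ℝ) else 0) - ξ i * ξ j / ‖ξ‖ ^ 2| ≤ 2 := by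
    have h2 : |ξ i * ξ j / ‖ξ‖ ^ 2| ≤ 1 := by
      rw [abs_div, abs_mul, abs_of_nonneg (sq_nonneg ‖ξ‖)]
      refine div_le_one_of_le₀ ?_ (sq_nonneg _)
      have hi : |ξ i| ≤ ‖ξ‖ := by simpa using PiLp.norm_apply_le ξ i
      have hj : |ξ j| ≤ ‖ξ‖ := by simpa using PiLp.norm_apply_le ξ j
      rw [sq]
      gcongr
    have h3 : |(if i = j then (1 : ℝ) else 0)| ≤ 1 := by split_ifs <;> simp
    rw [abs_le] at h2 h3 ⊢
    constructor <;> linarith [h2.1, h2.2, h3.1, h3.2]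
  rw [norm_mul, norm_mul, Complex.norm_real, Complex.norm_real, Real.norm_eq_abs, Real.norm_eq_abs]
  have h2 : ‖(2 * Real.pi * Complex.I : ℂ)‖ = 2 * Real.pi := by
    simp [Real.pi_pos.le]
  rw [h2]
  have := Real.pi_pos
  calc 2 * Real.pi * |ξ k| * _ ≤ 2 * Real.pi * ‖ξ‖ * 2 := by gcongr
    _ = _ := by ring

theorem measurable_lsym (i j k : Fin n) : Measurable (lsym i j k) := by
  unfold lsym
  fun_prop

theorem contDiffAt_lsym (i j k : Fin n) {ξ : E n} (hξ : ξ ≠ 0) :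
    ContDiffAt ℝ ∞ (lsym i j k) ξ := by
  have hc : ∀ i : Fin n, ContDiff ℝ ∞ fun ξ : E n => ξ i := fun i =>
    (EuclideanSpace.proj (𝕜 := ℝ) i).contDiff
  unfold lsym
  have h1 : ContDiffAt ℝ ∞ (fun ξ : E n => ((if i = j then (1:ℝ) else 0) - ξ i * ξ j / ‖ξ‖ ^ 2)) ξ :=
    contDiffAt_const.sub (((hc i).contDiffAt.mul (hc j).contDiffAt).div
      (contDiff_norm_sq ℝ).contDiffAt (by simpa using hξ))
  exact (contDiffAt_const.mul (Complex.ofRealCLM.contDiff.contDiffAt.comp ξ (hc k).contDiffAt)).mul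
    (Complex.ofRealCLM.contDiff.contDiffAt.comp ξ h1)

/-- Cutoffs that vanish near the origin. -/
structure IsAnnular (m : E n → ℝ) : Prop extends IsCutoff m where
  zero_notMem : (0 : E n) ∉ tsupport m

theorem tsupport_symS {m : E n → ℝ} (hm : IsAnnular m) :
    (0 : E n) ∉ tsupport (symS hm.toIsCutoff : E n → ℂ) := by
  intro h
  have h0 := hm.zero_notMem
  rw [notMem_tsupport_iff_eventuallyEq] at h0
  refine (notMem_tsupport_iff_eventuallyEq.2 ?_) h
  have hcont : Tendsto (fun ξ : E n => (2 * Real.pi) • ξ) (𝓝 0) (𝓝 0) := by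
    have : Continuous fun ξ : E n => (2 * Real.pi) • ξ := continuous_const_smul _
    simpa using this.tendsto 0
  filter_upwards [hcont.eventually h0] with ξ hξ
  rw [symS_apply, hξ]; simp

/-- The symbol `m(2πξ) (δ_{ij} - ξ_i ξ_j/|ξ|²) 2π i ξ_k` as a Schwartz function. -/
noncomputable def lamS {m : E n → ℝ} (hm : IsAnnular m) (i j k : Fin n) : 𝓢(E n, ℂ) :=
  HasCompactSupport.toSchwartzMap (f := fun ξ => symS hm.toIsCutoff ξ * lsym i j k ξ)
    (HasCompactSupport.mul_right (f := symS hm.toIsCutoff)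
      ((hasCompactSupport_comp_smul hm.compact two_pi_ne_zero).comp_left
        (g := fun x : ℝ => (x : ℂ)) Complex.ofReal_zero)) (by
    rw [contDiff_iff_contDiffAt]
    intro ξ
    by_cases hξ : ξ ∈ tsupport (symS hm.toIsCutoff : E n → ℂ)
    · have : ξ ≠ 0 := fun h => tsupport_symS hm (h ▸ hξ)
      exact ((symS hm.toIsCutoff).smooth ⊤).contDiffAt.mul (contDiffAt_lsym i j k this)
    · have h1 : (fun ξ => symS hm.toIsCutoff ξ * lsym i j k ξ) =ᶠ[𝓝 ξ] fun _ => 0 := by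
        filter_upwards [(isClosed_tsupport _).isOpen_compl.mem_nhds hξ] with y hy
        rw [image_eq_zero_of_notMem_tsupport hy, zero_mul]
      exact contDiffAt_const.congr_of_eventuallyEq h1)

theorem lamS_apply {m : E n → ℝ} (hm : IsAnnular m) (i j k : Fin n) (ξ : E n) :
    lamS hm i j k ξ = symS hm.toIsCutoff ξ * lsym i j k ξ := rfl

theorem exists_lamS_factor {m : E n → ℝ} (hm : IsAnnular m) (i j k : Fin n) :
    ∃ a' : 𝓢(E n, ℂ), ∀ ξ, lamS hm i j k ξ = lapSym ξ * a' ξ := by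
  refine exists_annular_factor (HasCompactSupport.mul_right (f := symS hm.toIsCutoff)
      ((hasCompactSupport_comp_smul hm.compact two_pi_ne_zero).comp_left
        (g := fun x : ℝ => (x : ℂ)) Complex.ofReal_zero)) fun h => tsupport_symS hm ?_
  exact tsupport_mul_subset_left h

theorem exists_symS_factor {m : E n → ℝ} (hm : IsAnnular m) :
    ∃ a' : 𝓢(E n, ℂ), ∀ ξ, symS hm.toIsCutoff ξ = lapSym ξ * a' ξ :=
  exists_annular_factor ((hasCompactSupport_comp_smul hm.compact two_pi_ne_zero).comp_left
        (g := fun x : ℝ => (x : ℂ)) Complex.ofReal_zero) (tsupport_symS hm)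

/-- The operator `m(2^{-p}D) ℙ_{ij} ∇_k`. -/
noncomputable def lam {m : E n → ℝ} (hm : IsAnnular m) (i j k : Fin n) (p : ℤ) :
    𝓢(E n, ℂ) →L[ℂ] 𝓢(E n, ℂ) :=
  ((2 : ℂ) ^ p) • mult fun ξ => lamS hm i j k ((2 : ℝ) ^ (-p) • ξ)

theorem lam_apply {m : E n → ℝ} (hm : IsAnnular m) (i j k : Fin n) (p : ℤ) (φ : 𝓢(E n, ℂ)) :
    lam hm i j k p φ = ((2 : ℂ) ^ p) • mult (fun ξ => lamS hm i j k ((2 : ℝ) ^ (-p) • ξ)) φ := rfl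

theorem fourier_lam {m : E n → ℝ} (hm : IsAnnular m) (i j k : Fin n) (p : ℤ) (φ : 𝓢(E n, ℂ))
    (ξ : E n) : (𝓕 (lam hm i j k p φ) : 𝓢(E n, ℂ)) ξ =
      symS hm.toIsCutoff ((2 : ℝ) ^ (-p) • ξ) * (lsym i j k ξ * (𝓕 φ : 𝓢(E n, ℂ)) ξ) := by
  rw [lam_apply, FourierTransform.fourier_smul]
  change (2 : ℂ) ^ p * (𝓕 (mult _ φ) : 𝓢(E n, ℂ)) ξ = _
  rw [fourier_mult (hasTemperateGrowth_comp_smul _ (two_zpow_ne_zero _)), lamS_apply,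
    lsym_smul _ _ _ (two_zpow_ne_zero _)]
  have : (2 : ℂ) ^ p * (2 : ℂ) ^ (-p) = 1 := by
    rw [← zpow_add₀ (by norm_num)]; simp
  push_cast
  linear_combination (symS hm.toIsCutoff ((2 : ℝ) ^ (-p) • ξ) * lsym i j k ξ *
    (𝓕 φ : 𝓢(E n, ℂ)) ξ) * this

theorem norm_two_zpow (p : ℤ) : ‖(2 : ℂ) ^ p‖ = (2 : ℝ) ^ (p : ℝ) := by
  rw [norm_zpow, Complex.norm_ofNat, Real.rpow_intCast]

/-- The gradient contributes 2^p. For p ≤ 0 this already decays; for p ≥ 0 two derivatives are moved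
onto φ, which gains 2^{-2p}. The bound is thus summable over all scales. -/
theorem exists_nrm_lam_le {m : E n → ℝ} (hm : IsAnnular m) (i j k : Fin n) {r : ℝ≥0∞}
    (hr : 1 ≤ r) : ∃ C : ℝ, 0 ≤ C ∧ ∀ (p : ℤ) (φ : 𝓢(E n, ℂ)),
      nrm r (lam hm i j k p φ) ≤ C * (2 : ℝ) ^ (-|(p : ℝ)|) * (nrm r φ + nrm r (lap φ)) := by
  obtain ⟨a', ha'⟩ := exists_lamS_factor hm i j k
  obtain ⟨C₁, hC₁0, hC₁⟩ := exists_nrm_mult_dilate_le (lamS hm i j k) hr le_rfl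
  obtain ⟨C₂, hC₂0, hC₂⟩ := exists_nrm_annular_le_lap ha' hr le_rfl
  refine ⟨max C₁ C₂, by positivity, fun p φ => ?_⟩
  have h1 := hC₁ ((2 : ℝ) ^ (-p)) (by positivity) φ
  have h2 := hC₂ ((2 : ℝ) ^ (-p)) (by positivity) φ
  simp only [sub_self, mul_zero, neg_zero, Real.rpow_zero, mul_one] at h1 h2
  rw [lam_apply, nrm_smul, norm_two_zpow]
  have hn1 := nrm_nonneg r φ
  have hn2 := nrm_nonneg r (lap φ)
  rcases le_total (p : ℝ) 0 with hp | hp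
  · rw [abs_of_nonpos hp, neg_neg]
    calc _ ≤ (2 : ℝ) ^ (p : ℝ) * (C₁ * nrm r φ) := by gcongr
      _ = C₁ * (2 : ℝ) ^ (p : ℝ) * nrm r φ := by ring
      _ ≤ _ := by gcongr; exacts [le_max_left _ _, by linarith]
  · rw [abs_of_nonneg hp]
    have h3 : (2 : ℝ) ^ (p : ℝ) * ((2 : ℝ) ^ (-p)) ^ 2 = (2 : ℝ) ^ (-(p : ℝ)) := by
      rw [← Real.rpow_natCast, two_zpow_rpow, ← Real.rpow_add (by norm_num)]
      congr 1; push_cast; ring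
    calc _ ≤ (2 : ℝ) ^ (p : ℝ) * (C₂ * ((2 : ℝ) ^ (-p)) ^ 2 * nrm r (lap φ)) := by gcongr
      _ = C₂ * ((2 : ℝ) ^ (p : ℝ) * ((2 : ℝ) ^ (-p)) ^ 2) * nrm r (lap φ) := by ring
      _ = C₂ * (2 : ℝ) ^ (-(p : ℝ)) * nrm r (lap φ) := by rw [h3]
      _ ≤ _ := by gcongr; exacts [le_max_right _ _, by linarith]

/-- In the exponent of 2^p, the 1 comes from the gradient, the gap from Bernstein's inequality, and
-2η from the heat kernel at the price τ^{-η}. As C does not depend on η, later proofs may choose η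
according to the sign of p. -/
theorem exists_nrm_lam_heatS_le {m : E n → ℝ} (hm : IsAnnular m) (i j k : Fin n) {q r : ℝ≥0∞}
    (hq : 1 ≤ q) (hqr : q ≤ r) : ∃ C : ℝ, 0 ≤ C ∧ ∀ (p : ℤ) (τ : ℝ), 0 < τ → ∀ η : ℝ,
      0 ≤ η → η ≤ 1 → ∀ φ : 𝓢(E n, ℂ), nrm r (lam hm i j k p (heatS τ φ)) ≤
        C * (2 : ℝ) ^ ((p : ℝ) * (1 + n * invGap q r - 2 * η)) * τ ^ (-η) * nrm q φ := by
  obtain ⟨a', ha'⟩ := exists_lamS_factor hm i j k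
  obtain ⟨C, hC0, hC⟩ := exists_nrm_annular_heatS_le ha' hq hqr
  refine ⟨C, hC0, fun p τ hτ η hη0 hη1 φ => ?_⟩
  have h1 := hC ((2 : ℝ) ^ (-p)) (by positivity) τ hτ η hη0 hη1 φ
  rw [two_zpow_rpow, Real.div_rpow hτ.le (by positivity), ← Real.rpow_natCast, two_zpow_rpow,
    ← Real.rpow_mul (by norm_num)] at h1
  rw [lam_apply, nrm_smul, norm_two_zpow]
  calc _ ≤ (2 : ℝ) ^ (p : ℝ) * _ := mul_le_mul_of_nonneg_left h1 (by positivity)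
    _ = C * ((2 : ℝ) ^ (p : ℝ) * (2 : ℝ) ^ (((-p : ℤ) : ℝ) *
        (-(n * (q⁻¹.toReal - r⁻¹.toReal)))) /
        (2 : ℝ) ^ ((((-p : ℤ) : ℝ) * ((2 : ℕ) : ℝ)) * (-η))) * τ ^ (-η) * nrm q φ := by ring
    _ = _ := by
      rw [← Real.rpow_add (by norm_num), ← Real.rpow_sub (by norm_num)]
      congr 4
      unfold invGap
      push_cast
      ring

end MildNS


namespace MildNS

variable {n : ℕ}

/-! ### Dyadic resolution of ℙ∇ and bounds for its action on test functions -/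

namespace IsLittlewoodPaleyPair

variable {χ φ : E n → ℝ}

theorem isCutoff_low (h : IsLittlewoodPaleyPair χ φ) : IsCutoff χ where
  smooth := h.smooth_low
  compact := (Metric.isBounded_ball.subset h.support_low).isCompact_closure.of_isClosed_subset
    (isClosed_tsupport _) subset_closure
  even := fun ξ => h.radial_low _ _ (norm_neg ξ)

theorem isAnnular_high (h : IsLittlewoodPaleyPair χ φ) : IsAnnular φ where
  smooth := h.smooth_high
  compact := (Metric.isBounded_ball.subset (h.support_high.trans Set.sdiff_subset)
    ).isCompact_closure.of_isClosed_subset (isClosed_tsupport _) subset_closure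
  even := fun ξ => h.radial_high _ _ (norm_neg ξ)
  zero_notMem := fun h0 => (h.support_high h0).2 (by simp; norm_num)

theorem hasSum_symS (h : IsLittlewoodPaleyPair χ φ) {ξ : E n} (hξ : ξ ≠ 0) :
    HasSum (fun p : ℤ => symS h.isAnnular_high.toIsCutoff ((2 : ℝ) ^ (-p) • ξ)) 1 := by
  have hη : (2 * Real.pi) • ξ ≠ 0 := smul_ne_zero two_pi_ne_zero hξ
  have h1 := h.sum_homogeneous _ hη
  have hs : Summable fun j : ℤ => φ ((2 : ℝ) ^ (-j) • (2 * Real.pi) • ξ) := by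
    -- A `tsum` without summability would be 0 and not 1, so the partition of unity contains its own
    -- convergence.
    by_contra hns
    rw [tsum_eq_zero_of_not_summable hns] at h1
    exact zero_ne_one h1
  have h2 := hs.hasSum
  rw [h1] at h2
  have h3 := Complex.hasSum_ofReal.2 h2
  simp only [symS_apply, smul_comm (2 * Real.pi), Complex.ofReal_one] at h3 ⊢
  exact h3

end IsLittlewoodPaleyPair

theorem symS_eq_norm {χ φ : E n → ℝ} (h : IsLittlewoodPaleyPair χ φ) (ξ : E n) :
    symS h.isAnnular_high.toIsCutoff ξ = (‖symS h.isAnnular_high.toIsCutoff ξ‖ : ℂ) := by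
  rw [symS_apply, Complex.norm_real, Real.norm_of_nonneg (h.range_high _).1]

theorem lerayGrad_apply (i j k : Fin n) (ψ : 𝓢(E n, ℂ)) (x : E n) :
    lerayGrad i j k ψ x = 𝓕⁻ (fun ξ => lsym i j k ξ * (𝓕 ψ : 𝓢(E n, ℂ)) ξ) x := rfl

theorem integrable_lsym_mul (i j k : Fin n) (ψ : 𝓢(E n, ℂ)) :
    Integrable fun ξ => lsym i j k ξ * ψ ξ := by
  have h1 := (ψ.integrable_pow_mul volume 1).const_mul (4 * Real.pi)
  refine h1.mono' ((measurable_lsym i j k).aestronglyMeasurable.mul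
    ψ.continuous.aestronglyMeasurable) (Eventually.of_forall fun ξ => ?_)
  rw [norm_mul, pow_one, ← mul_assoc]
  gcongr
  exact norm_lsym_le i j k ξ

/-- Every estimate of ℙ∇ψ goes through this resolution into Schwartz pieces. Dominated convergence
applies on the Fourier side because the cutoffs are nonnegative with sum 1, so the absolute values
also sum to the integrable function ‖F‖. -/
theorem hasSum_lam {χ φ : E n → ℝ} (h : IsLittlewoodPaleyPair χ φ) (i j k : Fin n)
    (ψ : 𝓢(E n, ℂ)) (x : E n) :
    HasSum (fun p : ℤ => lam h.isAnnular_high i j k p ψ x) (lerayGrad i j k ψ x) := by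
  set F : E n → ℂ := fun ξ => lsym i j k ξ * (𝓕 ψ : 𝓢(E n, ℂ)) ξ with hF
  have hFi : Integrable F := integrable_lsym_mul i j k _
  set a := symS h.isAnnular_high.toIsCutoff
  have h1 : ∀ p : ℤ, lam h.isAnnular_high i j k p ψ x =
      ∫ ξ, Real.fourierChar (inner ℝ ξ x) • (a ((2 : ℝ) ^ (-p) • ξ) * F ξ) := fun p => by
    have h2 : lam h.isAnnular_high i j k p ψ =
        𝓕⁻ (𝓕 (lam h.isAnnular_high i j k p ψ) : 𝓢(E n, ℂ)) :=
      (FourierTransform.fourierInv_fourier_eq (F := 𝓢(E n, ℂ)) _).symm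
    rw [h2, SchwartzMap.fourierInv_coe, Real.fourierInv_eq]
    congr 1
    ext ξ
    rw [fourier_lam]
  have h3 : lerayGrad i j k ψ x = ∫ ξ, Real.fourierChar (inner ℝ ξ x) • F ξ := by
    rw [lerayGrad_apply, Real.fourierInv_eq]
  -- The partition of unity is only available away from ξ = 0, where the symbol of ℙ∇ vanishes.
  have ha : ∀ ξ : E n, F ξ ≠ 0 → ξ ≠ 0 := fun ξ hξ h0 => hξ (by
    rw [hF]; simp [h0, lsym])
  have hsumF : ∀ ξ, HasSum (fun p : ℤ => a ((2 : ℝ) ^ (-p) • ξ) * F ξ) (F ξ) := fun ξ => by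
    by_cases hξ : F ξ = 0
    · simp only [hξ, mul_zero]; exact hasSum_zero
    · simpa using (h.hasSum_symS (ha ξ hξ)).mul_right (F ξ)
  have hsumN : ∀ ξ, HasSum (fun p : ℤ => ‖a ((2 : ℝ) ^ (-p) • ξ) * F ξ‖) ‖F ξ‖ := fun ξ => by
    by_cases hξ : F ξ = 0
    · simp only [hξ, mul_zero, norm_zero]; exact hasSum_zero
    · have h4 := h.hasSum_symS (ha ξ hξ)
      have h5 : HasSum (fun p : ℤ => ‖a ((2 : ℝ) ^ (-p) • ξ)‖) 1 := by
        rw [← Complex.hasSum_ofReal]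
        exact (congrArg (HasSum · 1) (funext fun p => symS_eq_norm h _)).mp h4
      simpa using h5.mul_right ‖F ξ‖
  simp_rw [h1, h3]
  have hchar : Continuous fun ξ : E n => Real.fourierChar (inner ℝ ξ x) :=
    Real.continuous_fourierChar.comp (by fun_prop)
  have hnorm : ∀ (ξ : E n) (z : ℂ), ‖Real.fourierChar (inner ℝ ξ x) • z‖ = ‖z‖ := fun ξ z => by
    simp [Circle.smul_def, Circle.norm_coe]
  refine hasSum_integral_of_dominated_convergence (fun p ξ => ‖a ((2 : ℝ) ^ (-p) • ξ) * F ξ‖)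
    (fun p => ?_) (fun p => Eventually.of_forall fun ξ => ?_)
    (Eventually.of_forall fun ξ => (hsumN ξ).summable) ?_
    (Eventually.of_forall fun ξ => ?_)
  · refine hchar.aestronglyMeasurable.smul (AEStronglyMeasurable.mul ?_ hFi.1)
    exact (a.continuous.comp (continuous_const_smul _)).aestronglyMeasurable
  · rw [hnorm]
  · simp_rw [fun ξ => (hsumN ξ).tsum_eq]
    exact hFi.norm
  · exact (hsumF ξ).const_smul _

/-- Minkowski's inequality for pointwise convergent series. -/
theorem eLpNorm_le_tsum_of_hasSum {ι : Type*} [Countable ι] {f : ι → E n → ℂ} {F : E n → ℂ}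
    {r : ℝ≥0∞} (hr : 1 ≤ r) (hf : ∀ i, AEStronglyMeasurable (f i) volume)
    (hs : ∀ x, HasSum (fun i => f i x) (F x)) :
    AEStronglyMeasurable F volume ∧ eLpNorm F r volume ≤ ∑' i, eLpNorm (f i) r volume := by
  obtain ⟨S, hS⟩ := (atTop : Filter (Finset ι)).exists_seq_tendsto
  have hlim : ∀ x, Tendsto (fun N => (∑ i ∈ S N, f i) x) atTop (𝓝 (F x)) := fun x => by
    simp_rw [Finset.sum_apply]
    exact (hs x).comp hS
  have hm : ∀ N, AEStronglyMeasurable (∑ i ∈ S N, f i) volume := fun N =>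
    Finset.aestronglyMeasurable_sum _ fun i _ => hf i
  refine ⟨aestronglyMeasurable_of_tendsto_ae atTop hm (Eventually.of_forall hlim), ?_⟩
  refine (Lp.eLpNorm_lim_le_liminf_eLpNorm hm _ (Eventually.of_forall hlim)).trans ?_
  refine liminf_le_of_le (by isBoundedDefault) fun b hb => ?_
  obtain ⟨N, hN⟩ := hb.exists
  exact hN.trans ((eLpNorm_sum_le (fun i _ => hf i) hr).trans (ENNReal.sum_le_tsum _))

theorem eLpNorm_eq_ofReal_nrm {q : ℝ≥0∞} (φ : 𝓢(E n, ℂ)) :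
    eLpNorm φ q volume = ENNReal.ofReal (nrm q φ) :=
  (ENNReal.ofReal_toReal (φ.eLpNorm_lt_top q volume).ne).symm

/-- A bound for `lerayGrad` from a summable bound of its dyadic pieces. -/
theorem lerayGrad_memLp_of_summable {χ φ : E n → ℝ} (h : IsLittlewoodPaleyPair χ φ)
    (i j k : Fin n) (ψ : 𝓢(E n, ℂ)) {r : ℝ≥0∞} (hr : 1 ≤ r) {b : ℤ → ℝ} (hb : Summable b)
    (hle : ∀ p, nrm r (lam h.isAnnular_high i j k p ψ) ≤ b p) :
    MemLp (lerayGrad i j k ψ) r volume ∧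
      (eLpNorm (lerayGrad i j k ψ) r volume).toReal ≤ ∑' p, b p := by
  have hb0 : ∀ p, 0 ≤ b p := fun p => (nrm_nonneg _ _).trans (hle p)
  obtain ⟨h1, h2⟩ := eLpNorm_le_tsum_of_hasSum hr
    (fun p => (lam h.isAnnular_high i j k p ψ).continuous.aestronglyMeasurable)
    (hasSum_lam h i j k ψ)
  have h3 : eLpNorm (lerayGrad i j k ψ) r volume ≤ ENNReal.ofReal (∑' p, b p) := by
    refine h2.trans ?_
    rw [ENNReal.ofReal_tsum_of_nonneg hb0 hb]
    refine ENNReal.tsum_le_tsum fun p => ?_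
    rw [eLpNorm_eq_ofReal_nrm]
    exact ENNReal.ofReal_le_ofReal (hle p)
  exact ⟨⟨h1, h3.trans_lt ENNReal.ofReal_lt_top⟩,
    ENNReal.toReal_le_of_le_ofReal (tsum_nonneg hb0) h3⟩

theorem exists_lerayGrad_bound {χ φ : E n → ℝ} (h : IsLittlewoodPaleyPair χ φ)
    (i j k : Fin n) {r : ℝ≥0∞} (hr : 1 ≤ r) : ∃ C : ℝ, 0 ≤ C ∧ ∀ ψ : 𝓢(E n, ℂ),
      MemLp (lerayGrad i j k ψ) r volume ∧
      (eLpNorm (lerayGrad i j k ψ) r volume).toReal ≤ C * (nrm r ψ + nrm r (lap ψ)) := by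
  obtain ⟨C, hC0, hC⟩ := exists_nrm_lam_le h.isAnnular_high i j k hr
  have hs := summable_two_rpow_neg_abs one_pos
  simp only [one_mul] at hs
  refine ⟨C * ∑' p : ℤ, (2 : ℝ) ^ (-|(p : ℝ)|), mul_nonneg hC0 (tsum_nonneg fun p => by positivity),
    fun ψ => ?_⟩
  have := lerayGrad_memLp_of_summable h i j k ψ hr
    ((hs.mul_left C).mul_right (nrm r ψ + nrm r (lap ψ))) (hC · ψ)
  rwa [tsum_mul_right, tsum_mul_left] at this

/-- With a = 1 + n(1/q - 1/r), low scales p ≤ 0 are summed with η = 0, which leaves 2^{pa}, and high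
scales with η = κ, which leaves 2^{p(a-2κ)}. Both decay, since a > 0 and 2κ > a; the strict second
inequality is what makes the sum converge. -/
theorem exists_lerayGrad_heatS_bound {χ φ : E n → ℝ} (h : IsLittlewoodPaleyPair χ φ)
    (i j k : Fin n) {q r : ℝ≥0∞} (hq : 1 ≤ q) (hqr : q ≤ r) {κ : ℝ} (hκ1 : κ ≤ 1)
    (hκ : 1 + n * invGap q r < 2 * κ) (hgap : 0 ≤ invGap q r) :
    ∃ C : ℝ, 0 ≤ C ∧ ∀ τ : ℝ, 0 < τ → ∀ ψ : 𝓢(E n, ℂ),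
      (eLpNorm (lerayGrad i j k (heatS τ ψ)) r volume).toReal ≤
        C * (1 + τ ^ (-κ)) * nrm q ψ := by
  obtain ⟨C, hC0, hC⟩ := exists_nrm_lam_heatS_le h.isAnnular_high i j k hq hqr
  set a := 1 + n * invGap q r with ha
  have ha1 : 1 ≤ a := by have : 0 ≤ (n : ℝ) * invGap q r := by positivity
                         linarith
  set δ := min a (2 * κ - a) with hδ
  have hδ0 : 0 < δ := lt_min (by linarith) (by linarith)
  have hs := summable_two_rpow_neg_abs hδ0
  refine ⟨C * ∑' p : ℤ, (2 : ℝ) ^ (-(δ * |(p : ℝ)|)),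
    mul_nonneg hC0 (tsum_nonneg fun p => by positivity), fun τ hτ ψ => ?_⟩
  have hN := nrm_nonneg q ψ
  have hle : ∀ p : ℤ, nrm r (lam h.isAnnular_high i j k p (heatS τ ψ)) ≤
      C * (2 : ℝ) ^ (-(δ * |(p : ℝ)|)) * ((1 + τ ^ (-κ)) * nrm q ψ) := fun p => by
    have hτκ : 0 ≤ τ ^ (-κ) := by positivity
    rcases le_total (p : ℝ) 0 with hp | hp
    · have h1 := hC p τ hτ 0 le_rfl zero_le_one ψ
      simp only [mul_zero, sub_zero, neg_zero, Real.rpow_zero, mul_one] at h1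
      refine h1.trans ?_
      rw [← mul_assoc]
      have h2 : (2 : ℝ) ^ ((p : ℝ) * a) ≤ (2 : ℝ) ^ (-(δ * |(p : ℝ)|)) := by
        refine Real.rpow_le_rpow_of_exponent_le (by norm_num) ?_
        rw [abs_of_nonpos hp]
        have : δ ≤ a := min_le_left _ _
        nlinarith
      calc _ ≤ C * (2 : ℝ) ^ (-(δ * |(p : ℝ)|)) * 1 * nrm q ψ := by rw [mul_one]; gcongr
        _ ≤ _ := by gcongr; linarith
    · have h1 := hC p τ hτ κ (by linarith) hκ1 ψ
      refine h1.trans ?_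
      rw [← mul_assoc]
      have h2 : (2 : ℝ) ^ ((p : ℝ) * (a - 2 * κ)) ≤ (2 : ℝ) ^ (-(δ * |(p : ℝ)|)) := by
        refine Real.rpow_le_rpow_of_exponent_le (by norm_num) ?_
        rw [abs_of_nonneg hp]
        have : δ ≤ 2 * κ - a := min_le_right _ _
        nlinarith
      gcongr
      linarith
  have h3 := (lerayGrad_memLp_of_summable h i j k _ (hq.trans hqr)
    ((hs.mul_left C).mul_right ((1 + τ ^ (-κ)) * nrm q ψ)) hle).2
  rw [tsum_mul_right, tsum_mul_left] at h3
  linarith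

theorem lerayGrad_add (i j k : Fin n) (ψ θ : 𝓢(E n, ℂ)) (x : E n) :
    lerayGrad i j k (ψ + θ) x = lerayGrad i j k ψ x + lerayGrad i j k θ x := by
  simp_rw [lerayGrad_apply, Real.fourierInv_eq]
  have hi : ∀ ψ : 𝓢(E n, ℂ), Integrable fun ξ => Real.fourierChar (inner ℝ ξ x) •
      (lsym i j k ξ * (𝓕 ψ : 𝓢(E n, ℂ)) ξ) := fun ψ => by
    refine (integrable_lsym_mul i j k (𝓕 ψ : 𝓢(E n, ℂ))).norm.mono' ?_ (Eventually.of_forall fun ξ => ?_)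
    · exact (Continuous.aestronglyMeasurable (Real.continuous_fourierChar.comp (by fun_prop))).smul
        (integrable_lsym_mul i j k _).1
    · simp [Circle.smul_def, Circle.norm_coe]
  rw [← integral_add (hi ψ) (hi θ)]
  congr 1
  ext ξ
  rw [← smul_add, ← mul_add, FourierTransform.fourier_add]
  rfl

theorem lerayGrad_smul (i j k : Fin n) (c : ℂ) (ψ : 𝓢(E n, ℂ)) (x : E n) :
    lerayGrad i j k (c • ψ) x = c * lerayGrad i j k ψ x := by
  simp_rw [lerayGrad_apply, Real.fourierInv_eq]
  rw [← integral_const_mul]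
  congr 1
  ext ξ
  rw [FourierTransform.fourier_smul]
  change _ • (_ * (c * (𝓕 ψ : 𝓢(E n, ℂ)) ξ)) = _
  simp only [Circle.smul_def, smul_eq_mul]
  ring

/-! ### Joint measurability in time and space -/

/-- Stated for the explicit Fourier integral and for all s, where joint measurability is evident;
`lerayGrad_heatS` and `lam_heatS` identify it with the operators when s < t. -/
theorem measurable_fourierInv_heat {σ : E n → ℂ} (hσ : Measurable σ) (ψ : 𝓢(E n, ℂ)) (t : ℝ) :
    Measurable (Function.uncurry fun (s : ℝ) (x : E n) =>
      𝓕⁻ (fun ξ => σ ξ * (heatSym (t - s) ξ * ψ ξ)) x) := by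
  have h1 : Measurable fun z : (ℝ × E n) × E n => (Real.fourierChar (inner ℝ z.2 z.1.2) : ℂ) *
      (σ z.2 * (heatSym (t - z.1.1) z.2 * ψ z.2)) := by
    refine Measurable.mul ?_ ?_
    · have h0 : Continuous fun z : (ℝ × E n) × E n => inner ℝ z.2 z.1.2 := by fun_prop
      exact (continuous_subtype_val.comp (Real.continuous_fourierChar.comp h0)).measurable
    · refine (hσ.comp measurable_snd).mul (Measurable.mul ?_ ?_)
      · unfold heatSym
        fun_prop
      · exact (ψ.continuous.comp continuous_snd).measurable
  have h2 := (h1.stronglyMeasurable.integral_prod_right' (ν := (volume : Measure (E n)))).measurable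
  refine (congrArg Measurable (funext fun z => ?_)).mp h2
  simp only [Function.uncurry]
  rw [Real.fourierInv_eq]
  rfl

theorem lerayGrad_heatS (i j k : Fin n) {τ : ℝ} (hτ : 0 < τ) (ψ : 𝓢(E n, ℂ)) :
    lerayGrad i j k (heatS τ ψ) =
      𝓕⁻ (fun ξ => lsym i j k ξ * (heatSym τ ξ * (𝓕 ψ : 𝓢(E n, ℂ)) ξ)) := by
  ext x
  rw [lerayGrad_apply]
  refine congrFun (congrArg _ (funext fun ξ => ?_)) x
  rw [heatS, fourier_mult (hasTemperateGrowth_heatSym hτ)]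

theorem lam_heatS {m : E n → ℝ} (hm : IsAnnular m) (i j k : Fin n) (p : ℤ) {τ : ℝ} (hτ : 0 < τ)
    (ψ : 𝓢(E n, ℂ)) : (lam hm i j k p (heatS τ ψ) : E n → ℂ) =
      𝓕⁻ (fun ξ => (symS hm.toIsCutoff ((2 : ℝ) ^ (-p) • ξ) * lsym i j k ξ) *
        (heatSym τ ξ * (𝓕 ψ : 𝓢(E n, ℂ)) ξ)) := by
  have h2 : lam hm i j k p (heatS τ ψ) = 𝓕⁻ (𝓕 (lam hm i j k p (heatS τ ψ)) : 𝓢(E n, ℂ)) :=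
    (FourierTransform.fourierInv_fourier_eq (F := 𝓢(E n, ℂ)) _).symm
  rw [h2, SchwartzMap.fourierInv_coe]
  congr 1
  ext ξ
  rw [fourier_lam, heatS, fourier_mult (hasTemperateGrowth_heatSym hτ), mul_assoc]

end MildNS


namespace MildNS

variable {n : ℕ}

/-! ### A Gronwall inequality with a weakly singular kernel -/

/-- As N → ∞ the weight e^{-Nτ} tends to 0 for τ > 0, and k dominates, so the weighted mass of the
kernel becomes as small as desired. This takes the place of a short time interval. -/
theorem exists_exp_weight_lt {k : ℝ → ℝ≥0∞} (hk : Measurable k) (h0 : ∀ τ ≤ 0, k τ = 0)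
    (hki : ∫⁻ τ, k τ ≠ ⊤) {A : ℝ≥0∞} (hA : A ≠ ⊤) :
    ∃ c : ℝ, A * ∫⁻ τ, ENNReal.ofReal (Real.exp (-(c * τ))) * k τ < 1 := by
  have hlim : Tendsto (fun N : ℕ => ∫⁻ τ, ENNReal.ofReal (Real.exp (-(N * τ))) * k τ) atTop
      (𝓝 (∫⁻ _ : ℝ, 0)) := by
    refine tendsto_lintegral_of_dominated_convergence' k (fun N => ?_) (fun N => ?_) hki ?_
    · exact (Measurable.mul (by fun_prop) hk).aemeasurable
    · refine Eventually.of_forall fun τ => ?_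
      rcases le_or_gt τ 0 with hτ | hτ
      · simp [h0 τ hτ]
      · refine mul_le_of_le_one_left zero_le ?_
        rw [ENNReal.ofReal_le_one, Real.exp_le_one_iff]
        have : (0 : ℝ) ≤ N * τ := by positivity
        linarith
    · filter_upwards [ae_lt_top hk hki] with τ hτk
      rcases le_or_gt τ 0 with hτ | hτ
      · simp [h0 τ hτ]
      · have h1 : Tendsto (fun N : ℕ => ENNReal.ofReal (Real.exp (-(N * τ)))) atTop (𝓝 0) := by
          rw [← ENNReal.ofReal_zero]
          refine (ENNReal.continuous_ofReal.tendsto 0).comp ?_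
          refine Real.tendsto_exp_atBot.comp (tendsto_neg_atTop_atBot.comp ?_)
          exact tendsto_natCast_atTop_atTop.atTop_mul_const hτ
        simpa using ENNReal.Tendsto.mul_const h1 (Or.inr hτk.ne)
  rw [lintegral_zero] at hlim
  have h2 : Tendsto (fun N : ℕ => A * ∫⁻ τ, ENNReal.ofReal (Real.exp (-(N * τ))) * k τ) atTop
      (𝓝 0) := by
    simpa using ENNReal.Tendsto.const_mul hlim (Or.inr hA)
  obtain ⟨N, hN⟩ := (h2.eventually (gt_mem_nhds (zero_lt_one))).exists
  exact ⟨N, hN⟩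

/-- The weight e^{-ct} is multiplicative along a convolution, so the weighted integrals Y of g and X
of k satisfy Y ≤ A X Y. With A X < 1 and Y finite this gives Y = 0. -/
theorem ae_eq_zero_of_le_convolution {k g : ℝ → ℝ≥0∞} {T : ℝ} {A : ℝ≥0∞} (hA : A ≠ ⊤)
    (hk : Measurable k) (hki : ∫⁻ τ in Set.Ioo 0 T, k τ ≠ ⊤)
    (hg : AEMeasurable g (volume.restrict (Set.Ioo 0 T)))
    (hgi : ∫⁻ τ in Set.Ioo 0 T, g τ ≠ ⊤)
    (h : ∀ᵐ t ∂(volume.restrict (Set.Ioo 0 T)), g t ≤ A * ∫⁻ s in Set.Ioo 0 t, k (t - s) * g s) :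
    ∀ᵐ t ∂(volume.restrict (Set.Ioo 0 T)), g t = 0 := by
  have hI : MeasurableSet (Set.Ioo 0 T) := measurableSet_Ioo
  set k' := (Set.Ioo 0 T).indicator k with hk'
  have hk'm : Measurable k' := hk.indicator hI
  have hk'i : ∫⁻ τ, k' τ ≠ ⊤ := by rwa [hk', lintegral_indicator hI]
  set g₀ := hg.mk g
  have hg₀m : Measurable g₀ := hg.measurable_mk
  set g' := (Set.Ioo 0 T).indicator g₀ with hg'
  have hg'm : Measurable g' := hg₀m.indicator hI
  have hg'ae : (Set.Ioo 0 T).indicator g =ᵐ[volume] g' := by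
    filter_upwards [(ae_restrict_iff' hI).1 hg.ae_eq_mk] with t ht
    by_cases htI : t ∈ Set.Ioo 0 T
    · simp [hg', Set.indicator_of_mem htI, ht htI, g₀]
    · simp [hg', Set.indicator_of_notMem htI]
  have hg'i : ∫⁻ s, g' s ≠ ⊤ := by
    rw [← lintegral_congr_ae hg'ae, lintegral_indicator hI]; exact hgi
  obtain ⟨c, hc⟩ := exists_exp_weight_lt hk'm (fun τ hτ => by
    rw [hk', Set.indicator_of_notMem]; exact fun h => not_lt.2 hτ h.1) hk'i hA
  set e : ℝ → ℝ≥0∞ := fun τ => ENNReal.ofReal (Real.exp (-(c * τ))) with he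
  have hem : Measurable e := by rw [he]; fun_prop
  have hemul : ∀ a b, e (a + b) = e a * e b := fun a b => by
    simp only [he]
    rw [← ENNReal.ofReal_mul (Real.exp_pos _).le, ← Real.exp_add]
    congr 2; ring
  have hpt : ∀ᵐ t, g' t ≤ A * ∫⁻ s, k' (t - s) * g' s := by
    have h1 := (ae_restrict_iff' hI).1 h
    filter_upwards [h1, hg'ae] with t ht hgt
    rw [← hgt]
    by_cases htI : t ∈ Set.Ioo 0 T
    · rw [Set.indicator_of_mem htI]
      refine (ht htI).trans (mul_le_mul_right ?_ A)
      rw [← lintegral_indicator measurableSet_Ioo]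
      refine lintegral_mono_ae ?_
      filter_upwards [hg'ae] with s hs
      rw [← hs]
      by_cases hst : s ∈ Set.Ioo 0 t
      · have h2 : s ∈ Set.Ioo 0 T := ⟨hst.1, hst.2.trans htI.2⟩
        have h3 : t - s ∈ Set.Ioo 0 T := ⟨by linarith [hst.2], by linarith [hst.1, htI.2]⟩
        rw [Set.indicator_of_mem hst, Set.indicator_of_mem h2, hk', Set.indicator_of_mem h3]
      · rw [Set.indicator_of_notMem hst]; exact zero_le
    · rw [Set.indicator_of_notMem htI]; exact zero_le
  set Y := ∫⁻ t, e t * g' t with hY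
  set X := ∫⁻ τ, e τ * k' τ with hX
  have hYle : Y ≤ A * X * Y := by
    calc Y ≤ ∫⁻ t, A * ∫⁻ s, (e (t - s) * k' (t - s)) * (e s * g' s) := by
          refine lintegral_mono_ae ?_
          filter_upwards [hpt] with t ht
          refine (mul_le_mul_right ht (e t)).trans_eq ?_
          rw [mul_left_comm, ← lintegral_const_mul _ (by fun_prop)]
          congr 2
          ext s
          have : e t = e (t - s) * e s := by rw [← hemul]; congr 1; ring
          rw [this]; ring
      _ = A * ∫⁻ s, ∫⁻ t, (e (t - s) * k' (t - s)) * (e s * g' s) := by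
          rw [lintegral_const_mul, lintegral_lintegral_swap]
          · exact (by unfold Function.uncurry; fun_prop : Measurable _).aemeasurable
          · exact Measurable.lintegral_prod_right' (f := fun z : ℝ × ℝ =>
              (e (z.1 - z.2) * k' (z.1 - z.2)) * (e z.2 * g' z.2)) (by fun_prop)
      _ = A * ∫⁻ s, X * (e s * g' s) := by
          congr 1
          refine lintegral_congr fun s => ?_
          rw [lintegral_mul_const _ (by fun_prop)]
          congr 1
          exact lintegral_sub_right_eq_self (fun t => e t * k' t) s
      _ = _ := by rw [lintegral_const_mul _ (by fun_prop), mul_assoc]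
  -- Without finiteness Y ≤ A X Y would be void. The sign of c is not recorded, hence the bound by
  -- e^{|c|T}.
  have hYfin : Y ≠ ⊤ := by
    have h1 : Y ≤ ∫⁻ t, ENNReal.ofReal (Real.exp (|c| * T)) * g' t := by
      refine lintegral_mono fun t => ?_
      by_cases htI : t ∈ Set.Ioo 0 T
      · refine mul_le_mul_left (ENNReal.ofReal_le_ofReal (Real.exp_le_exp.2 ?_)) _
        have h2 : -(c * t) ≤ |c| * t := by
          have := neg_abs_le c
          nlinarith [htI.1]
        have h3 : |c| * t ≤ |c| * T := mul_le_mul_of_nonneg_left htI.2.le (abs_nonneg _)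
        linarith
      · simp [hg', Set.indicator_of_notMem htI]
    rw [lintegral_const_mul _ hg'm] at h1
    exact (h1.trans_lt (ENNReal.mul_lt_top ENNReal.ofReal_lt_top hg'i.lt_top)).ne
  have hY0 : Y = 0 := by
    by_contra hne
    have : A * X * Y < 1 * Y := ENNReal.mul_lt_mul_left hne hYfin hc
    rw [one_mul] at this
    exact absurd hYle (not_le.2 this)
  rw [hY, lintegral_eq_zero_iff (f := fun t => e t * g' t) (hem.mul hg'm)] at hY0
  rw [ae_restrict_iff' hI]
  filter_upwards [hY0, hg'ae] with t ht hgt htI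
  rw [Set.indicator_of_mem htI] at hgt
  rw [hgt]
  have he0 : e t ≠ 0 := by simp [he, Real.exp_pos]
  simpa [he0] using ht

/-- Uniqueness for a linear Volterra inequality with weakly singular kernel. -/
theorem ae_eq_zero_of_le_singular {N W : ℝ → ℝ≥0∞} {T α κ C : ℝ} (hT : 0 < T) (hα : 2 ≤ α)
    (hκ0 : 0 ≤ κ) (hκ : κ < 1 - 1 / α) (hC : 0 ≤ C)
    (hN : AEMeasurable N (volume.restrict (Set.Ioo 0 T)))
    (hW : AEMeasurable W (volume.restrict (Set.Ioo 0 T)))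
    (hNi : ∫⁻ s in Set.Ioo 0 T, N s ^ α ≠ ⊤) (hWi : ∫⁻ s in Set.Ioo 0 T, W s ^ α ≠ ⊤)
    (h : ∀ᵐ t ∂(volume.restrict (Set.Ioo 0 T)), N t ≤
      ∫⁻ s in Set.Ioo 0 t, ENNReal.ofReal (C * (1 + (t - s) ^ (-κ))) * (W s * N s)) :
    ∀ᵐ t ∂(volume.restrict (Set.Ioo 0 T)), N t = 0 := by
  have hα0 : 0 < α := by linarith
  have hpq : α.HolderConjugate (Real.conjExponent α) :=
    Real.HolderConjugate.conjExponent (by linarith)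
  set β := Real.conjExponent α with hβ
  have hβ1 : 1 < β := hpq.symm.lt
  have hβ0 : 0 < β := by linarith
  have hinv : α⁻¹ + β⁻¹ = 1 := hpq.inv_add_inv_eq_one
  -- This is where α ≥ 2 enters: it puts N into L^β on the bounded interval, so that N^β can play
  -- the role of g above.
  have hβα : β ≤ α := by
    have h1 : α⁻¹ ≤ 1 / 2 := by rw [inv_eq_one_div]; exact one_div_le_one_div_of_le (by norm_num) hα
    have h2 : 1 / 2 ≤ β⁻¹ := by linarith
    have h3 : β ≤ 2 := by
      rw [inv_eq_one_div, div_le_div_iff₀ (by norm_num) hβ0] at h2; linarith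
    linarith
  -- The hypothesis κ < 1 - 1/α = 1/β is exactly the integrability of τ^{-κβ} at 0.
  have hκβ : κ * β < 1 := by
    have h1 : κ < β⁻¹ := by rw [one_div] at hκ; linarith
    calc κ * β < β⁻¹ * β := by gcongr
      _ = 1 := inv_mul_cancel₀ hβ0.ne'
  -- For 0 < τ < T one has 1 ≤ T^κ τ^{-κ}, so D τ^{-κ} dominates C(1 + τ^{-κ}) and the kernel
  -- becomes a pure power.
  set D := C * (T ^ κ + 1) with hD
  have hD0 : 0 ≤ D := by positivity
  set k : ℝ → ℝ≥0∞ := fun τ => ENNReal.ofReal (τ ^ (-(κ * β))) with hk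
  have hkm : Measurable k := by rw [hk]; fun_prop
  have hki : ∫⁻ τ in Set.Ioo 0 T, k τ ≠ ⊤ := by
    have h1 := (intervalIntegral.intervalIntegrable_rpow' (a := 0) (b := T)
      (r := -(κ * β)) (by linarith)).1
    have h2 := (h1.mono_set Set.Ioo_subset_Ioc_self).lintegral_lt_top
    exact h2.ne
  have hNβ : ∫⁻ s in Set.Ioo 0 T, N s ^ β ≠ ⊤ := by
    have h1 : ∫⁻ s in Set.Ioo 0 T, N s ^ β ≤ ∫⁻ s in Set.Ioo 0 T, (1 + N s ^ α) := by
      refine lintegral_mono fun s => ?_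
      rcases le_total (N s) 1 with h1 | h1
      · exact (ENNReal.rpow_le_one h1 hβ0.le).trans le_self_add
      · exact (ENNReal.rpow_le_rpow_of_exponent_le h1 hβα).trans le_add_self
    rw [lintegral_add_left measurable_const] at h1
    refine (h1.trans_lt (ENNReal.add_lt_top.2 ⟨?_, hNi.lt_top⟩)).ne
    simp
  set V := ∫⁻ s in Set.Ioo 0 T, W s ^ α with hV
  have key : ∀ᵐ t ∂(volume.restrict (Set.Ioo 0 T)), N t ^ β ≤
      (ENNReal.ofReal D ^ β * V ^ (1 / α * β)) * ∫⁻ s in Set.Ioo 0 t, k (t - s) * N s ^ β := by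
    filter_upwards [h, ae_restrict_mem measurableSet_Ioo] with t ht htI
    have hsub : Set.Ioo 0 t ⊆ Set.Ioo 0 T := Set.Ioo_subset_Ioo_right htI.2.le
    have hWt := hW.mono_measure (Measure.restrict_mono hsub le_rfl)
    have hNt := hN.mono_measure (Measure.restrict_mono hsub le_rfl)
    set K : ℝ → ℝ≥0∞ := fun s => ENNReal.ofReal ((t - s) ^ (-κ)) with hK
    have hKm : Measurable K := by rw [hK]; fun_prop
    have h1 : N t ≤ ENNReal.ofReal D * ∫⁻ s in Set.Ioo 0 t, (W * fun s => K s * N s) s := by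
      refine ht.trans ?_
      rw [← lintegral_const_mul' _ _ ENNReal.ofReal_ne_top]
      refine setLIntegral_mono_ae' measurableSet_Ioo (Eventually.of_forall fun s hs => ?_)
      have hτ : 0 < t - s := by linarith [hs.2]
      have h2 : C * (1 + (t - s) ^ (-κ)) ≤ D * (t - s) ^ (-κ) := by
        have h3 : 1 ≤ T ^ κ * (t - s) ^ (-κ) := by
          rw [Real.rpow_neg hτ.le, ← div_eq_mul_inv, ← Real.div_rpow hT.le hτ.le]
          refine Real.one_le_rpow ?_ hκ0
          rw [one_le_div hτ]
          linarith [hs.1, htI.2]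
        rw [hD]
        nlinarith
      calc _ ≤ ENNReal.ofReal (D * (t - s) ^ (-κ)) * (W s * N s) := by gcongr
        _ = _ := by
          rw [ENNReal.ofReal_mul hD0]
          simp only [Pi.mul_apply, hK]
          ring
    have h2 := ENNReal.lintegral_mul_le_Lp_mul_Lq (volume.restrict (Set.Ioo 0 t)) hpq hWt
      (hKm.aemeasurable.mul hNt)
    have h3 : N t ≤ ENNReal.ofReal D * (V ^ (1 / α) *
        (∫⁻ s in Set.Ioo 0 t, k (t - s) * N s ^ β) ^ (1 / β)) := by
      refine h1.trans (mul_le_mul_right (h2.trans (mul_le_mul' ?_ ?_)) _)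
      · exact ENNReal.rpow_le_rpow (lintegral_mono_set hsub) (by positivity)
      · refine ENNReal.rpow_le_rpow (le_of_eq ?_) (by positivity)
        refine setLIntegral_congr_fun measurableSet_Ioo fun s hs => ?_
        have hτ : 0 < t - s := by linarith [hs.2]
        simp only [hK, hk]
        rw [Pi.mul_apply, ENNReal.mul_rpow_of_nonneg _ _ hβ0.le,
          ENNReal.ofReal_rpow_of_pos (by positivity), ← Real.rpow_mul hτ.le, neg_mul]
    refine (ENNReal.rpow_le_rpow h3 hβ0.le).trans_eq ?_
    rw [ENNReal.mul_rpow_of_nonneg _ _ hβ0.le, ENNReal.mul_rpow_of_nonneg _ _ hβ0.le,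
      ← ENNReal.rpow_mul, ← ENNReal.rpow_mul, one_div_mul_cancel hβ0.ne', ENNReal.rpow_one,
      mul_assoc]
  have hA : ENNReal.ofReal D ^ β * V ^ (1 / α * β) ≠ ⊤ :=
    ENNReal.mul_ne_top (ENNReal.rpow_ne_top_of_nonneg hβ0.le ENNReal.ofReal_ne_top)
      (ENNReal.rpow_ne_top_of_nonneg (by positivity) hWi)
  filter_upwards [ae_eq_zero_of_le_convolution hA hkm hki (hN.pow_const β) hNβ key] with t ht
  exact (ENNReal.rpow_eq_zero_iff_of_pos hβ0).1 ht

end MildNS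


namespace MildNS

variable {n : ℕ}

/-! ### Uniqueness from bounds on the spatial nonlinearity -/

/-- Bounds on a bilinear map `b` of distributions, in terms of a size `N` on a class `Good`, that
imply uniqueness for the equation `u = S[f] - G[b(u,u)]`. -/
structure SpatialBound (b : VTD n → VTD n → VTD n) (Good : VTD n → Prop) (N : VTD n → ℝ≥0∞)
    (α : ℝ) : Prop where
  two_le : 2 ≤ α
  good_sub : ∀ u v, Good u → Good v → Good (u - v)
  size_sub : ∀ u v, Good u → Good v → N (u - v) ≤ N u + N v
  sub_eq : ∀ u v, Good u → Good v → ∀ i φ,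
    b u u i φ - b v v i φ = b (u - v) u i φ + b v (u - v) i φ
  -- No singularity in τ, but the seminorm may contain derivatives of φ. This is used to make the
  -- Duhamel pairing a distribution and, at the end, to pass from almost every time to every time.
  bound : ∃ p : Seminorm ℂ 𝓢(E n, ℂ), Continuous p ∧ ∀ u v, Good u → Good v → ∀ i τ, 0 < τ → ∀ φ,
    ‖b u v i (heatS τ φ)‖ₑ ≤ ENNReal.ofReal (p φ) * (N u * N v)
  -- Θ is a norming set for N. On it the estimate must close with N itself, which is where the
  -- singular factor τ^{-κ} appears.
  smoothing : ∃ (Θ : Set 𝓢(E n, ℂ)) (C κ : ℝ), 0 ≤ C ∧ 0 ≤ κ ∧ κ < 1 - 1 / α ∧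
    (∀ w, Good w → ∀ A : ℝ≥0∞, (∀ i, ∀ θ ∈ Θ, ‖w i θ‖ₑ ≤ A) → N w ≤ A) ∧
    ∀ u v, Good u → Good v → ∀ i, ∀ θ ∈ Θ, ∀ τ, 0 < τ →
      ‖b u v i (heatS τ θ)‖ₑ ≤ ENNReal.ofReal (C * (1 + τ ^ (-κ))) * (N u * N v)
  meas : ∀ (u v : ℝ → VTD n) (t : ℝ), (∀ i φ, Measurable fun s => u s i φ) →
    (∀ i φ, Measurable fun s => v s i φ) →
    (∀ᵐ s ∂(volume.restrict (Set.Ioo 0 t)), Good (u s)) →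
    (∀ᵐ s ∂(volume.restrict (Set.Ioo 0 t)), Good (v s)) → ∀ i φ,
    AEStronglyMeasurable (fun s => b (u s) (v s) i (heatS (t - s) φ))
      (volume.restrict (Set.Ioo 0 t))
  size_meas : ∀ (u : ℝ → VTD n) (t : ℝ), (∀ i φ, Measurable fun s => u s i φ) →
    (∀ᵐ s ∂(volume.restrict (Set.Ioo 0 t)), Good (u s)) →
    AEMeasurable (fun s => N (u s)) (volume.restrict (Set.Ioo 0 t))

/-- The endpoint s = t is dropped because the heat operator is transposed only for positive times.
-/
theorem heat_apply_Ioo (w : ℝ → TD n) (t : ℝ) (ht : 0 ≤ t) (φ : 𝓢(E n, ℂ)) :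
    ∫ s in (0 : ℝ)..t, heat (t - s) (w s) φ =
      ∫ s in Set.Ioo 0 t, w s (heatS (t - s) φ) := by
  rw [intervalIntegral.integral_of_le ht, integral_Ioc_eq_integral_Ioo]
  refine setIntegral_congr_fun measurableSet_Ioo fun s hs => ?_
  exact heat_apply (by linarith [hs.2]) _ _

theorem duhamel_congr {w w' : ℝ → VTD n} {t : ℝ} (ht : 0 ≤ t) (h : ∀ s ∈ Set.Ioo 0 t, w s = w' s) :
    duhamel w t = duhamel w' t := by
  ext1 i
  unfold duhamel
  congr 1
  ext1 φ
  rw [heat_apply_Ioo (fun s => w s i) t ht, heat_apply_Ioo (fun s => w' s i) t ht]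
  refine setIntegral_congr_fun measurableSet_Ioo fun s hs => ?_
  simp only [h s hs]

/-- A curve that is measurable on the time interval agrees on `(0, t]` with a measurable curve. -/
theorem exists_measurable_extension {T : ℝ≥0∞} {u : ℝ → VTD n}
    (hu : ∀ i (φ : 𝓢(E n, ℂ)), Measurable fun t : timeInterval T => u t i φ)
    {t : ℝ} (ht : t ∈ timeInterval T) : ∃ w : ℝ → VTD n,
      (∀ i (φ : 𝓢(E n, ℂ)), Measurable fun s => w s i φ) ∧ ∀ s ∈ Set.Ioc 0 t, w s = u s := by
  classical
  have hmem : ∀ s ∈ Set.Ioc 0 t, s ∈ timeInterval T := fun s hs =>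
    ⟨hs.1, (ENNReal.ofReal_le_ofReal hs.2).trans_lt ht.2⟩
  let w : ℝ → VTD n := fun s => if s ∈ Set.Ioc 0 t then u s else 0
  have hw : ∀ s ∈ Set.Ioc 0 t, w s = u s := fun s hs => if_pos hs
  refine ⟨w, fun i φ => measurable_of_restrict_of_restrict_compl
    (measurableSet_Ioc (a := (0 : ℝ)) (b := t)) ?_ ?_, hw⟩
  · have h1 : Measurable fun s : Set.Ioc 0 t => u s i φ :=
      (hu i φ).comp (f := fun s : Set.Ioc 0 t =>
        (⟨s.1, hmem s.1 s.2⟩ : timeInterval T)) (measurable_subtype_coe.subtype_mk)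
    refine (congrArg Measurable (funext fun s => ?_)).mp h1
    change _ = w s i φ
    rw [hw s s.2]
  · refine (congrArg Measurable (funext fun s => ?_)).mp (measurable_const (a := (0 : ℂ)))
    change _ = w s i φ
    simp only [w, if_neg s.2]
    rfl

namespace SpatialBound

variable {b : VTD n → VTD n → VTD n} {Good : VTD n → Prop} {N : VTD n → ℝ≥0∞} {α : ℝ}

/-- Pointwise xy ≤ max(x,y)² ≤ 1 + x^α + y^α, by α ≥ 2. In this form the quadratic nonlinearity is
integrable in time. -/
theorem lintegral_mul_ne_top (hα : 2 ≤ α) {f g : ℝ → ℝ≥0∞} {μ : Measure ℝ} [IsFiniteMeasure μ]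
    (hf : ∫⁻ s, f s ^ α ∂μ ≠ ⊤) (hg : ∫⁻ s, g s ^ α ∂μ ≠ ⊤) (hfm : AEMeasurable f μ) :
    ∫⁻ s, f s * g s ∂μ ≠ ⊤ := by
  have hα0 : 0 < α := by linarith
  have h1 : ∀ x y : ℝ≥0∞, x * y ≤ 1 + (x ^ α + y ^ α) := by
    intro x y
    have h2 : ∀ z : ℝ≥0∞, z * z ≤ 1 + z ^ α := fun z => by
      rcases le_total z 1 with hz | hz
      · exact (mul_le_one' hz hz).trans le_self_add
      · have : z * z = z ^ (2 : ℝ) := by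
          rw [← sq]; exact (ENNReal.rpow_two z).symm
        rw [this]
        exact (ENNReal.rpow_le_rpow_of_exponent_le hz hα).trans le_add_self
    rcases le_total x y with hxy | hxy
    · calc x * y ≤ y * y := mul_le_mul_left hxy y
        _ ≤ 1 + y ^ α := h2 y
        _ ≤ _ := by gcongr; exact le_add_self
    · calc x * y ≤ x * x := mul_le_mul_right hxy x
        _ ≤ 1 + x ^ α := h2 x
        _ ≤ _ := by gcongr; exact le_self_add
  refine ne_top_of_le_ne_top ?_ (lintegral_mono fun s => h1 (f s) (g s))
  rw [lintegral_add_left measurable_const, lintegral_add_left' (hfm.pow_const α)]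
  simp [hf, hg]

/-- A curve of distributions in the class on which `b` is controlled. -/
structure Curve (b : VTD n → VTD n → VTD n) (Good : VTD n → Prop) (N : VTD n → ℝ≥0∞)
    (α T : ℝ) (u : ℝ → VTD n) : Prop where
  meas : ∀ i φ, Measurable fun s => u s i φ
  good : ∀ᵐ s ∂(volume.restrict (Set.Ioo 0 T)), Good (u s)
  size : ∫⁻ s in Set.Ioo 0 T, N (u s) ^ α ≠ ⊤

theorem Curve.mono {T t : ℝ} {u : ℝ → VTD n} (hu : Curve b Good N α T u) (ht : t ≤ T) :
    Curve b Good N α t u where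
  meas := hu.meas
  good := ae_restrict_of_ae_restrict_of_subset (Set.Ioo_subset_Ioo_right ht) hu.good
  size := ne_top_of_le_ne_top hu.size (lintegral_mono_set (Set.Ioo_subset_Ioo_right ht))

variable (h : SpatialBound b Good N α)
include h

theorem curve_sub {T : ℝ} {u v : ℝ → VTD n} (hu : Curve b Good N α T u)
    (hv : Curve b Good N α T v) : Curve b Good N α T (fun s => u s - v s) where
  meas i φ := (hu.meas i φ).sub (hv.meas i φ)
  good := by
    filter_upwards [hu.good, hv.good] with s h1 h2 using h.good_sub _ _ h1 h2
  size := by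
    have hα := h.two_le
    have h1 : ∫⁻ s in Set.Ioo 0 T, N (u s - v s) ^ α ≤
        ∫⁻ s in Set.Ioo 0 T, 2 ^ (α - 1) * (N (u s) ^ α + N (v s) ^ α) := by
      refine lintegral_mono_ae ?_
      filter_upwards [hu.good, hv.good] with s h1 h2
      refine (ENNReal.rpow_le_rpow (h.size_sub _ _ h1 h2) (by linarith)).trans ?_
      exact ENNReal.rpow_add_le_mul_rpow_add_rpow _ _ (by linarith)
    refine ne_top_of_le_ne_top ?_ h1
    have h2 : (2 : ℝ≥0∞) ^ (α - 1) ≠ ⊤ :=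
      ENNReal.rpow_ne_top_of_nonneg (by linarith) (by norm_num)
    rw [lintegral_const_mul' _ _ h2,
      lintegral_add_left' ((h.size_meas u T hu.meas hu.good).pow_const α)]
    exact ENNReal.mul_ne_top h2 (ENNReal.add_ne_top.2 ⟨hu.size, hv.size⟩)

theorem integrable {t : ℝ} {u v : ℝ → VTD n} (hu : Curve b Good N α t u)
    (hv : Curve b Good N α t v) (i : Fin n) (φ : 𝓢(E n, ℂ)) :
    Integrable (fun s => b (u s) (v s) i (heatS (t - s) φ)) (volume.restrict (Set.Ioo 0 t)) := by
  refine ⟨h.meas u v t hu.meas hv.meas hu.good hv.good i φ, ?_⟩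
  obtain ⟨p, -, hp⟩ := h.bound
  have h1 : ∫⁻ s in Set.Ioo 0 t, ‖b (u s) (v s) i (heatS (t - s) φ)‖ₑ ≤
      ∫⁻ s in Set.Ioo 0 t, ENNReal.ofReal (p φ) * (N (u s) * N (v s)) := by
    refine lintegral_mono_ae ?_
    filter_upwards [hu.good, hv.good, ae_restrict_mem measurableSet_Ioo] with s h1 h2 hs
    exact hp _ _ h1 h2 i _ (by linarith [hs.2]) φ
  refine h1.trans_lt ?_
  rw [lintegral_const_mul' _ _ ENNReal.ofReal_ne_top]
  refine ENNReal.mul_lt_top ENNReal.ofReal_lt_top (Ne.lt_top ?_)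
  exact lintegral_mul_ne_top h.two_le hu.size hv.size (h.size_meas u t hu.meas hu.good)

/-- The time integral of the pairings is bounded by p φ times ∫ N(u)², so it is a tempered
distribution and `ofPairing` does not take its default value. -/
theorem duhamel_apply {t : ℝ} (ht : 0 ≤ t) {u : ℝ → VTD n} (hu : Curve b Good N α t u)
    (i : Fin n) (φ : 𝓢(E n, ℂ)) :
    duhamel (fun s => b (u s) (u s)) t i φ =
      ∫ s in Set.Ioo 0 t, b (u s) (u s) i (heatS (t - s) φ) := by
  unfold duhamel
  rw [ofPairing_apply, heat_apply_Ioo (fun s => b (u s) (u s) i) t ht]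
  obtain ⟨p, hpc, hp⟩ := h.bound
  have hN := lintegral_mul_ne_top h.two_le hu.size hu.size (h.size_meas u t hu.meas hu.good)
  refine exists_td_of_bound (p := p) (fun φ ψ => ?_) (fun c φ => ?_) hpc
    (C := (∫⁻ s in Set.Ioo 0 t, N (u s) * N (u s)).toReal) fun φ => ?_
  · rw [heat_apply_Ioo (fun s => b (u s) (u s) i) t ht,
      heat_apply_Ioo (fun s => b (u s) (u s) i) t ht,
      heat_apply_Ioo (fun s => b (u s) (u s) i) t ht,
      ← integral_add (h.integrable hu hu i φ) (h.integrable hu hu i ψ)]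
    simp only [map_add]
  · rw [heat_apply_Ioo (fun s => b (u s) (u s) i) t ht,
      heat_apply_Ioo (fun s => b (u s) (u s) i) t ht, ← integral_const_mul]
    simp only [map_smul, smul_eq_mul]
  · rw [heat_apply_Ioo (fun s => b (u s) (u s) i) t ht]
    have h1 : ‖∫ s in Set.Ioo 0 t, b (u s) (u s) i (heatS (t - s) φ)‖ₑ ≤
        ENNReal.ofReal (p φ) * ∫⁻ s in Set.Ioo 0 t, N (u s) * N (u s) := by
      refine (enorm_integral_le_lintegral_enorm _).trans ?_
      rw [← lintegral_const_mul' _ _ ENNReal.ofReal_ne_top]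
      refine lintegral_mono_ae ?_
      filter_upwards [hu.good, ae_restrict_mem measurableSet_Ioo] with s h1 hs
      exact hp _ _ h1 h1 i _ (by linarith [hs.2]) φ
    have h2 := ENNReal.toReal_mono (ENNReal.mul_ne_top ENNReal.ofReal_ne_top hN) h1
    rw [toReal_enorm, ENNReal.toReal_mul, ENNReal.toReal_ofReal (apply_nonneg p φ)] at h2
    linarith

/-- Polarization b(u,u) - b(v,v) = b(u-v,u) + b(v,u-v) under the integral. The factor K is left
open: it is the singular kernel for tests in Θ and a constant for an arbitrary test function. -/
theorem enorm_sub_le {t : ℝ} (ht : 0 ≤ t) {u v : ℝ → VTD n} (hu : Curve b Good N α t u)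
    (hv : Curve b Good N α t v)
    (heq : u t + duhamel (fun s => b (u s) (u s)) t = v t + duhamel (fun s => b (v s) (v s)) t)
    (i : Fin n) (φ : 𝓢(E n, ℂ)) {K : ℝ → ℝ≥0∞} (hK : ∀ u v, Good u → Good v → ∀ τ, 0 < τ →
      ‖b u v i (heatS τ φ)‖ₑ ≤ K τ * (N u * N v)) :
    ‖(u t - v t) i φ‖ₑ ≤ ∫⁻ s in Set.Ioo 0 t,
      K (t - s) * ((N (u s) + N (v s)) * N (u s - v s)) := by
  have hz := h.curve_sub hu hv
  have h1 : (u t - v t) i φ = -∫ s in Set.Ioo 0 t, (b (u s - v s) (u s) i (heatS (t - s) φ) +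
      b (v s) (u s - v s) i (heatS (t - s) φ)) := by
    have h2 := congrArg (fun w : VTD n => w i φ) heq
    simp only [Pi.add_apply, _root_.add_apply] at h2
    rw [h.duhamel_apply ht hu, h.duhamel_apply ht hv] at h2
    have h3 : ∫ s in Set.Ioo 0 t, (b (u s - v s) (u s) i (heatS (t - s) φ) +
        b (v s) (u s - v s) i (heatS (t - s) φ)) =
        (∫ s in Set.Ioo 0 t, b (u s) (u s) i (heatS (t - s) φ)) -
        ∫ s in Set.Ioo 0 t, b (v s) (v s) i (heatS (t - s) φ) := by
      rw [← integral_sub (h.integrable hu hu i φ) (h.integrable hv hv i φ)]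
      refine integral_congr_ae ?_
      filter_upwards [hu.good, hv.good] with s hs1 hs2
      exact (h.sub_eq _ _ hs1 hs2 i _).symm
    rw [h3]
    change u t i φ - v t i φ = _
    linear_combination h2
  rw [h1, enorm_neg]
  refine (enorm_integral_le_lintegral_enorm _).trans (lintegral_mono_ae ?_)
  filter_upwards [hu.good, hv.good, ae_restrict_mem measurableSet_Ioo] with s h1 h2 hs
  have hτ : 0 < t - s := by linarith [hs.2]
  have h3 := h.good_sub _ _ h1 h2
  refine (enorm_add_le _ _).trans ((add_le_add (hK _ _ h3 h1 _ hτ) (hK _ _ h2 h3 _ hτ)).trans_eq ?_)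
  ring

/-- Two curves that solve the same equation up to time `T` agree at time `T`. -/
theorem eq_of_curve {T : ℝ} (hT : 0 < T) {u v : ℝ → VTD n} (hu : Curve b Good N α T u)
    (hv : Curve b Good N α T v)
    (heq : ∀ t ∈ Set.Ioc 0 T, u t + duhamel (fun s => b (u s) (u s)) t =
      v t + duhamel (fun s => b (v s) (v s)) t) : u T = v T := by
  have hz := h.curve_sub hu hv
  obtain ⟨Θ, C, κ, hC, hκ0, hκ, hΘ, hsm⟩ := h.smoothing
  have hα := h.two_le
  have hUm := h.size_meas u T hu.meas hu.good
  have hVm := h.size_meas v T hv.meas hv.good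
  have hWi : ∫⁻ s in Set.Ioo 0 T, (N (u s) + N (v s)) ^ α ≠ ⊤ := by
    have h1 : ∫⁻ s in Set.Ioo 0 T, (N (u s) + N (v s)) ^ α ≤
        ∫⁻ s in Set.Ioo 0 T, 2 ^ (α - 1) * (N (u s) ^ α + N (v s) ^ α) :=
      lintegral_mono fun s => ENNReal.rpow_add_le_mul_rpow_add_rpow _ _ (by linarith)
    refine ne_top_of_le_ne_top ?_ h1
    have h2 : (2 : ℝ≥0∞) ^ (α - 1) ≠ ⊤ :=
      ENNReal.rpow_ne_top_of_nonneg (by linarith) (by norm_num)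
    rw [lintegral_const_mul' _ _ h2, lintegral_add_left' (hUm.pow_const α)]
    exact ENNReal.mul_ne_top h2 (ENNReal.add_ne_top.2 ⟨hu.size, hv.size⟩)
  -- The difference estimate on the norming set Θ gives a closed Volterra inequality for N(u - v),
  -- with W = N(u) + N(v) in L^α.
  have h0 : ∀ᵐ t ∂(volume.restrict (Set.Ioo 0 T)), N (u t - v t) = 0 := by
    refine ae_eq_zero_of_le_singular hT hα hκ0 hκ hC
      (h.size_meas _ T hz.meas hz.good) (hUm.add hVm) hz.size hWi ?_
    filter_upwards [hz.good, ae_restrict_mem measurableSet_Ioo] with t htg ht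
    refine hΘ _ htg _ fun i θ hθ => ?_
    exact h.enorm_sub_le ht.1.le (hu.mono ht.2.le) (hv.mono ht.2.le) (heq t ⟨ht.1, ht.2.le⟩) i θ
      (K := fun τ => ENNReal.ofReal (C * (1 + τ ^ (-κ))))
      fun u v hu hv τ hτ => hsm u v hu hv i θ hθ τ hτ
  -- The equation at the final time sees only almost every earlier time, where the size of the
  -- difference is 0. Hence the difference vanishes at T itself, against every test function.
  obtain ⟨p, -, hp⟩ := h.bound
  ext i φ
  have h1 := h.enorm_sub_le hT.le hu hv (heq T ⟨hT, le_rfl⟩) i φ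
    (K := fun _ => ENNReal.ofReal (p φ)) fun u v hu hv τ hτ => hp u v hu hv i τ hτ φ
  have h2 : ∫⁻ s in Set.Ioo 0 T,
      ENNReal.ofReal (p φ) * ((N (u s) + N (v s)) * N (u s - v s)) = 0 := by
    rw [← lintegral_zero (μ := volume.restrict (Set.Ioo 0 T))]
    refine lintegral_congr_ae ?_
    filter_upwards [h0] with s hs
    rw [hs, mul_zero, mul_zero]
  rw [h2] at h1
  have h3 : u T i φ - v T i φ = 0 := by
    have : ‖(u T - v T) i φ‖ₑ = 0 := le_antisymm h1 zero_le
    exact enorm_eq_zero.1 this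
  exact sub_eq_zero.1 h3

/-- Uniqueness of solutions, for curves that are only measurable on the time interval. -/
theorem eq_of_isSolution {T : ℝ≥0∞} {f : VTD n} {u v : ℝ → VTD n}
    (hu : IsSolution T f (fun u v => duhamel fun s => b (u s) (v s)) u)
    (hv : IsSolution T f (fun u v => duhamel fun s => b (u s) (v s)) v)
    {t : ℝ} (ht : t ∈ timeInterval T)
    (hug : ∀ᵐ s ∂(volume.restrict (Set.Ioo 0 t)), Good (u s))
    (hvg : ∀ᵐ s ∂(volume.restrict (Set.Ioo 0 t)), Good (v s))
    (hus : ∫⁻ s in Set.Ioo 0 t, N (u s) ^ α ≠ ⊤) (hvs : ∫⁻ s in Set.Ioo 0 t, N (v s) ^ α ≠ ⊤) :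
    u t = v t := by
  have hmem : ∀ s ∈ Set.Ioc 0 t, s ∈ timeInterval T := fun s hs =>
    ⟨hs.1, (ENNReal.ofReal_le_ofReal hs.2).trans_lt ht.2⟩
  have hcurve : ∀ w w' : ℝ → VTD n, (∀ i (φ : 𝓢(E n, ℂ)), Measurable fun s => w' s i φ) →
      (∀ s ∈ Set.Ioc 0 t, w' s = w s) → (∀ᵐ s ∂(volume.restrict (Set.Ioo 0 t)), Good (w s)) →
      (∫⁻ s in Set.Ioo 0 t, N (w s) ^ α ≠ ⊤) → Curve b Good N α t w' := by
    intro w w' hm hw hg hs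
    refine ⟨hm, ?_, ?_⟩
    · filter_upwards [hg, ae_restrict_mem measurableSet_Ioo] with s hs hsI
      rwa [hw s ⟨hsI.1, hsI.2.le⟩]
    · rw [setLIntegral_congr_fun (g := fun s => N (w s) ^ α) measurableSet_Ioo
        fun s hs => by simp only [hw s ⟨hs.1, hs.2.le⟩]]
      exact hs
  obtain ⟨u', hum, hu'⟩ := exists_measurable_extension hu.measurable ht
  obtain ⟨v', hvm, hv'⟩ := exists_measurable_extension hv.measurable ht
  have ht1 : t ∈ Set.Ioc 0 t := ⟨ht.1, le_rfl⟩
  have h1 := h.eq_of_curve ht.1 (hcurve u u' hum hu' hug hus) (hcurve v v' hvm hv' hvg hvs)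
    fun s hs => by
      have h2 : ∀ w w' : ℝ → VTD n, (∀ s ∈ Set.Ioc 0 t, w' s = w s) →
          duhamel (fun r => b (w' r) (w' r)) s = duhamel (fun r => b (w r) (w r)) s :=
        fun w w' hw => duhamel_congr hs.1.le fun r hr => by rw [hw r ⟨hr.1, hr.2.le.trans hs.2⟩]
      rw [h2 u u' hu', h2 v v' hv', hu' s hs, hv' s hs]
      ext1 i
      rw [Pi.add_apply, Pi.add_apply, hu.eq s (hmem s hs) i, hv.eq s (hmem s hs) i]
      simp
  rwa [hu' t ht1, hv' t ht1] at h1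

end SpatialBound

end MildNS


namespace MildNS

variable {n : ℕ}

/-! ### Products of functions in Lebesgue spaces, tested against a function -/

/-- `∫ u v G` for distributions `u`, `v` that are given by functions. -/
noncomputable def tri (u v : TD n) (G : E n → ℂ) : ℂ := ∫ x, toFun u x * toFun v x * G x

theorem memLp_toFun_mul {a b ρ : ℝ≥0∞} [ENNReal.HolderTriple a b ρ]
    {u v : TD n} (hu : InLp a u) (hv : InLp b v) :
    MemLp (fun x => toFun u x * toFun v x) ρ volume :=
  hv.memLp.mul hu.memLp

theorem eLpNorm_toFun_mul_le {a b ρ : ℝ≥0∞} [ENNReal.HolderTriple a b ρ]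
    {u v : TD n} (hu : InLp a u) (hv : InLp b v) :
    eLpNorm (fun x => toFun u x * toFun v x) ρ volume ≤ lpNorm a u * lpNorm b v := by
  rw [hu.lpNorm_eq, hv.lpNorm_eq]
  exact eLpNorm_smul_le_mul_eLpNorm (φ := toFun u) hv.memLp.1 hu.memLp.1

theorem enorm_tri_le {a b ρ r : ℝ≥0∞} [ENNReal.HolderTriple a b ρ]
    [ρ.HolderConjugate r] {u v : TD n} (hu : InLp a u) (hv : InLp b v) {G : E n → ℂ}
    (hG : AEStronglyMeasurable G volume) :
    ‖tri u v G‖ₑ ≤ lpNorm a u * lpNorm b v * eLpNorm G r volume :=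
  (enorm_integral_mul_le (p := ρ) (q := r) (memLp_toFun_mul (ρ := ρ) hu hv).1 hG).trans
    (mul_le_mul_left (eLpNorm_toFun_mul_le (ρ := ρ) hu hv) _)

theorem integrable_tri {a b ρ r : ℝ≥0∞} [ENNReal.HolderTriple a b ρ]
    [ρ.HolderConjugate r] {u v : TD n} (hu : InLp a u) (hv : InLp b v) {G : E n → ℂ}
    (hG : MemLp G r volume) : Integrable fun x => toFun u x * toFun v x * G x :=
  integrable_mul_of_memLp (p := ρ) (q := r) (memLp_toFun_mul hu hv) hG

theorem tri_sub_tri {a b ρ r : ℝ≥0∞} [ENNReal.HolderTriple a b ρ]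
    [ρ.HolderConjugate r] {u v u' v' : TD n} (hu : InLp a u) (hv : InLp a v) (hu' : InLp b u')
    (hv' : InLp b v') {G : E n → ℂ} (hG : MemLp G r volume) :
    tri u u' G - tri v v' G = tri (u - v) u' G + tri v (u' - v') G := by
  unfold tri
  rw [← integral_sub (integrable_tri (ρ := ρ) (r := r) hu hu' hG)
      (integrable_tri (ρ := ρ) (r := r) hv hv' hG),
    ← integral_add (integrable_tri (ρ := ρ) (r := r) (hu.sub hv) hu' hG)
      (integrable_tri (ρ := ρ) (r := r) hv (hu'.sub hv') hG)]
  refine integral_congr_ae ?_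
  filter_upwards [hu.toFun_sub hv, hu'.toFun_sub hv'] with x h1 h2
  rw [h1, h2, Pi.sub_apply, Pi.sub_apply]
  ring

/-- The opposite polarization is needed for the paraproduct whose arguments are swapped, so that all
three parts of the Bony product in `bony_sub` split in the same way. -/
theorem tri_sub_tri_right {a b ρ r : ℝ≥0∞} [ENNReal.HolderTriple a b ρ]
    [ρ.HolderConjugate r] {u v u' v' : TD n} (hu : InLp a u) (hv : InLp a v) (hu' : InLp b u')
    (hv' : InLp b v') {G : E n → ℂ} (hG : MemLp G r volume) :
    tri u u' G - tri v v' G = tri u (u' - v') G + tri (u - v) v' G := by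
  unfold tri
  rw [← integral_sub (integrable_tri (ρ := ρ) (r := r) hu hu' hG)
      (integrable_tri (ρ := ρ) (r := r) hv hv' hG),
    ← integral_add (integrable_tri (ρ := ρ) (r := r) hu (hu'.sub hv') hG)
      (integrable_tri (ρ := ρ) (r := r) (hu.sub hv) hv' hG)]
  refine integral_congr_ae ?_
  filter_upwards [hu.toFun_sub hv, hu'.toFun_sub hv'] with x h1 h2
  rw [h1, h2, Pi.sub_apply, Pi.sub_apply]
  ring

theorem represents_pmul {a b ρ : ℝ≥0∞} [ENNReal.HolderTriple a b ρ] (hρ : 1 ≤ ρ)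
    {u v : TD n} (hu : InLp a u) (hv : InLp b v) :
    Represents (fun x => toFun u x * toFun v x) (pmul u v) :=
  represents_ofFun hρ (memLp_toFun_mul hu hv)

theorem pmul_apply {a b ρ : ℝ≥0∞} [ENNReal.HolderTriple a b ρ] (hρ : 1 ≤ ρ)
    {u v : TD n} (hu : InLp a u) (hv : InLp b v) (φ : 𝓢(E n, ℂ)) :
    pmul u v φ = tri u v φ :=
  ofFun_apply hρ (memLp_toFun_mul hu hv) φ

/-- Converse Hölder inequality on the unit ball of Schwartz functions. -/
theorem InLp.lpNorm_le_of_unitBall {p q : ℝ≥0∞} [p.HolderConjugate q] (hp : 2 ≤ p) {u : TD n}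
    (hu : InLp p u) {A : ℝ≥0∞} (h : ∀ θ : 𝓢(E n, ℂ), nrm q θ ≤ 1 → ‖u θ‖ₑ ≤ A) :
    lpNorm p u ≤ A := by
  rcases eq_or_ne A ⊤ with rfl | hA
  · exact le_top
  rw [← ENNReal.ofReal_toReal hA]
  refine hu.lpNorm_le_of_bound (q := q) hp fun φ => ?_
  set a := nrm q φ with ha
  have ha0 : 0 ≤ a := nrm_nonneg _ _
  have hA0 := @ENNReal.toReal_nonneg A
  refine le_of_forall_pos_le_add fun ε hε => ?_
  -- The norm a of φ may be 0, so φ is divided by a + η; the resulting error η A is at most ε.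
  set η := ε / (A.toReal + 1) with hη
  have hη0 : 0 < η := by positivity
  have hc : 0 < a + η := by linarith
  have h1 := h ((((a + η)⁻¹ : ℝ) : ℂ) • φ) (by
    rw [nrm_smul, Complex.norm_real, Real.norm_of_nonneg (by positivity), inv_mul_le_iff₀ hc]
    linarith)
  rw [map_smul, smul_eq_mul] at h1
  have h2 := ENNReal.toReal_mono hA h1
  rw [toReal_enorm, norm_mul, Complex.norm_real, Real.norm_of_nonneg (by positivity),
    inv_mul_le_iff₀ hc] at h2
  have h3 : η * A.toReal ≤ ε := by
    rw [hη, div_mul_eq_mul_div, div_le_iff₀ (by positivity)]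
    nlinarith
  linarith

/-! ### The pointwise product in `L^α L^ℓ` -/

/-- The spatial nonlinearity of `bilin`. -/
noncomputable def spatial (u v : VTD n) : VTD n := lerayDiv fun j k => pmul (u j) (v k)

section Lebesgue

variable {χ φ : E n → ℝ}

/-- The heat operator commutes with the Laplacian and is bounded on L^r uniformly in τ, so a single
seminorm of ψ controls all the functions e^{τΔ}ψ. -/
theorem exists_lerayGrad_seminorm (h : IsLittlewoodPaleyPair χ φ) {r : ℝ≥0∞} (hr : 1 ≤ r) :
    ∃ P : Seminorm ℂ 𝓢(E n, ℂ), Continuous P ∧ ∀ i j k ψ, MemLp (lerayGrad i j k ψ) r volume ∧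
      (eLpNorm (lerayGrad i j k ψ) r volume).toReal ≤ P ψ ∧ ∀ τ, 0 < τ →
      (eLpNorm (lerayGrad i j k (heatS τ ψ)) r volume).toReal ≤ P ψ := by
  choose C hC0 hC using fun i j k : Fin n => exists_lerayGrad_bound h i j k hr
  obtain ⟨p, hpc, hp⟩ := exists_seminorm_nrm (n := n) hr
  obtain ⟨D, hD0, hD⟩ := exists_nrm_heatS_le (n := n) hr
  set S := ∑ i, ∑ j, ∑ k, C i j k with hS
  have hCS : ∀ i j k, C i j k ≤ S := fun i j k =>
    (Finset.single_le_sum (f := fun k => C i j k) (fun k _ => hC0 i j k) (Finset.mem_univ k)).trans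
    ((Finset.single_le_sum (f := fun j => ∑ k, C i j k)
      (fun j _ => Finset.sum_nonneg fun k _ => hC0 i j k) (Finset.mem_univ j)).trans
    (Finset.single_le_sum (f := fun i => ∑ j, ∑ k, C i j k) (fun i _ =>
      Finset.sum_nonneg fun j _ => Finset.sum_nonneg fun k _ => hC0 i j k) (Finset.mem_univ i)))
  have hS0 : 0 ≤ S := Finset.sum_nonneg fun i _ =>
    Finset.sum_nonneg fun j _ => Finset.sum_nonneg fun k _ => hC0 i j k
  let A : ℝ := S * (1 + D)
  have hA0 : 0 ≤ A := by positivity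
  refine ⟨A.toNNReal • (p + p.comp (lap (n := n)).toLinearMap), ?_, fun i j k ψ => ?_⟩
  · exact (hpc.add (hpc.comp (lap (n := n)).continuous)).const_smul A.toNNReal
  · have hPe : (A.toNNReal • (p + p.comp (lap (n := n)).toLinearMap)) ψ =
        A * (nrm r ψ + nrm r (lap ψ)) := by
      rw [← hp, ← hp]
      change (A.toNNReal : ℝ) * _ = _
      rw [Real.coe_toNNReal A hA0]; rfl
    have h1 := nrm_nonneg r ψ
    have h2 := nrm_nonneg r (lap ψ)
    rw [hPe]
    refine ⟨(hC i j k ψ).1, (hC i j k ψ).2.trans ?_, fun τ hτ => (hC i j k _).2.trans ?_⟩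
    · have : C i j k ≤ A := (hCS i j k).trans (le_mul_of_one_le_right hS0 (by linarith))
      gcongr
    · rw [lap_heatS hτ]
      have h3 := hD τ hτ ψ
      have h4 := hD τ hτ (lap ψ)
      calc _ ≤ S * (D * nrm r ψ + D * nrm r (lap ψ)) :=
            mul_le_mul (hCS i j k) (by linarith) (add_nonneg (nrm_nonneg _ _) (nrm_nonneg _ _)) hS0
        _ = S * D * (nrm r ψ + nrm r (lap ψ)) := by ring
        _ ≤ _ := by gcongr; simp only [A]; gcongr; linarith

/-- Rules out both default values: the pointwise product lies in L^ρ with ρ ≥ 1, and its pairing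
with ℙ∇ψ in the dual L^r is continuous in ψ. -/
theorem spatial_apply {l ρ r : ℝ≥0∞} [ENNReal.HolderTriple l l ρ]
    [ρ.HolderConjugate r]
    (h : IsLittlewoodPaleyPair χ φ) (hρ : 1 ≤ ρ) (hr : 1 ≤ r) {u v : VTD n}
    (hu : ∀ i, InLp l (u i)) (hv : ∀ i, InLp l (v i)) (i : Fin n) (ψ : 𝓢(E n, ℂ)) :
    spatial u v i ψ = -∑ j, ∑ k, tri (u j) (v k) (lerayGrad i j k ψ) := by
  obtain ⟨P, hPc, hP⟩ := exists_lerayGrad_seminorm (n := n) h hr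
  have h0 : ∀ ψ, -∑ j, ∑ k, ∫ x, toFun (pmul (u j) (v k)) x * lerayGrad i j k ψ x =
      -∑ j, ∑ k, tri (u j) (v k) (lerayGrad i j k ψ) := fun ψ => by
    congr 1
    refine Finset.sum_congr rfl fun j _ => Finset.sum_congr rfl fun k _ => ?_
    refine integral_congr_ae ?_
    filter_upwards [(represents_pmul hρ (hu j) (hv k)).toFun_ae_eq] with x hx
    rw [hx]
  unfold spatial lerayDiv
  simp only [h0]
  refine ofPairing_apply (exists_td_of_bound (p := P) (fun ψ θ => ?_) (fun c ψ => ?_) hPc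
    (C := ∑ j, ∑ k, (lpNorm l (u j) * lpNorm l (v k)).toReal) fun ψ => ?_) ψ
  · rw [← neg_add, ← Finset.sum_add_distrib]
    congr 1
    refine Finset.sum_congr rfl fun j _ => ?_
    rw [← Finset.sum_add_distrib]
    refine Finset.sum_congr rfl fun k _ => ?_
    unfold tri
    rw [← integral_add (integrable_tri (ρ := ρ) (r := r) (hu j) (hv k) (hP i j k ψ).1)
      (integrable_tri (ρ := ρ) (r := r) (hu j) (hv k) (hP i j k θ).1)]
    simp only [lerayGrad_add, mul_add]
  · rw [mul_neg, Finset.mul_sum]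
    congr 1
    refine Finset.sum_congr rfl fun j _ => ?_
    rw [Finset.mul_sum]
    refine Finset.sum_congr rfl fun k _ => ?_
    unfold tri
    rw [← integral_const_mul]
    simp only [lerayGrad_smul]
    congr 1; ext x; ring
  · rw [norm_neg, Finset.sum_mul]
    refine (norm_sum_le _ _).trans (Finset.sum_le_sum fun j _ => ?_)
    rw [Finset.sum_mul]
    refine (norm_sum_le _ _).trans (Finset.sum_le_sum fun k _ => ?_)
    have h1 := enorm_tri_le (ρ := ρ) (r := r) (hu j) (hv k) (hP i j k ψ).1.1
    have hfin : lpNorm l (u j) * lpNorm l (v k) ≠ ⊤ :=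
      ENNReal.mul_ne_top (inLp_iff.1 (hu j)).ne (inLp_iff.1 (hv k)).ne
    have h2 := ENNReal.toReal_mono (ENNReal.mul_ne_top hfin (hP i j k ψ).1.2.ne) h1
    rw [toReal_enorm, ENNReal.toReal_mul] at h2
    exact h2.trans (mul_le_mul_of_nonneg_left (hP i j k ψ).2.1 ENNReal.toReal_nonneg)

/-- The size of a vector field in `L^ℓ`. -/
noncomputable def supLp (l : ℝ≥0∞) (u : VTD n) : ℝ≥0∞ := ⨆ i, lpNorm l (u i)

theorem enorm_spatial_le {l ρ r : ℝ≥0∞} [ENNReal.HolderTriple l l ρ]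
    [ρ.HolderConjugate r]
    (h : IsLittlewoodPaleyPair χ φ) (hρ : 1 ≤ ρ) (hr : 1 ≤ r) {u v : VTD n}
    (hu : ∀ i, InLp l (u i)) (hv : ∀ i, InLp l (v i)) (i : Fin n) (ψ : 𝓢(E n, ℂ)) {A : ℝ}
    (hA : ∀ j k, (eLpNorm (lerayGrad i j k ψ) r volume).toReal ≤ A) :
    ‖spatial u v i ψ‖ₑ ≤ ENNReal.ofReal (n * n * A) * (supLp l u * supLp l v) := by
  obtain ⟨P, hPc, hP⟩ := exists_lerayGrad_seminorm (n := n) h hr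
  rw [spatial_apply h hρ hr hu hv, enorm_neg]
  have h1 : ∀ j k, ‖tri (u j) (v k) (lerayGrad i j k ψ)‖ₑ ≤
      ENNReal.ofReal A * (supLp l u * supLp l v) := fun j k => by
    refine (enorm_tri_le (ρ := ρ) (r := r) (hu j) (hv k) (hP i j k ψ).1.1).trans ?_
    rw [mul_comm]
    refine mul_le_mul' ?_ (mul_le_mul' (le_iSup (fun i => lpNorm l (u i)) j)
      (le_iSup (fun i => lpNorm l (v i)) k))
    rw [← ENNReal.ofReal_toReal (hP i j k ψ).1.2.ne]
    exact ENNReal.ofReal_le_ofReal (hA j k)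
  calc _ ≤ ∑ j : Fin n, ∑ k : Fin n, ENNReal.ofReal A * (supLp l u * supLp l v) :=
        (enorm_sum_le _ _).trans (Finset.sum_le_sum fun j _ =>
          (enorm_sum_le _ _).trans (Finset.sum_le_sum fun k _ => h1 j k))
    _ = _ := by
      rw [Finset.sum_const, Finset.sum_const, Finset.card_univ, Fintype.card_fin,
        nsmul_eq_mul, nsmul_eq_mul, ENNReal.ofReal_mul (by positivity),
        ENNReal.ofReal_mul (by positivity), ENNReal.ofReal_natCast]
      ring

end Lebesgue

/-- The exponents with `1/ρ = 2/l`, `1/r = 1 - 2/l`, `1/q = 1 - 1/l`. -/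
theorem exists_holder_exponents {l : ℝ≥0∞} (hl : 2 ≤ l) : ∃ ρ r q : ℝ≥0∞,
    ENNReal.HolderTriple l l ρ ∧ ρ.HolderConjugate r ∧ l.HolderConjugate q ∧ 1 ≤ ρ ∧ 1 ≤ r ∧
      1 ≤ q ∧ q ≤ r ∧ invGap q r = l⁻¹.toReal := by
  have hl1 : 1 ≤ l := le_trans (by norm_num) hl
  have hinv : l⁻¹ ≤ 2⁻¹ := ENNReal.inv_le_inv.2 hl
  have hinvt : l⁻¹ ≠ ⊤ := ne_top_of_le_ne_top (by simp) hinv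
  have h1 : l.HolderConjugate l.conjExponent := ENNReal.HolderConjugate.conjExponent hl1
  set q := l.conjExponent with hq
  set ρ := (l⁻¹ + l⁻¹)⁻¹ with hρd
  have h2 : ENNReal.HolderTriple l l ρ := ⟨by rw [hρd, inv_inv]⟩
  have hρ : 1 ≤ ρ := by
    rw [hρd, ENNReal.one_le_inv, ← ENNReal.inv_two_add_inv_two]
    gcongr
  have h3 : ρ.HolderConjugate ρ.conjExponent := ENNReal.HolderConjugate.conjExponent hρ
  set r := ρ.conjExponent with hrd
  have hr : 1 ≤ r := ENNReal.HolderConjugate.one_le r ρ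
  have hq1 : 1 ≤ q := ENNReal.HolderConjugate.one_le q l
  have e1 : l⁻¹ + q⁻¹ = 1 := by
    simpa using ENNReal.HolderTriple.inv_add_inv_eq_inv l q 1
  have e2 : l⁻¹ + l⁻¹ + r⁻¹ = 1 := by
    have := ENNReal.HolderTriple.inv_add_inv_eq_inv ρ r 1
    rw [hρd, inv_inv] at this
    simpa using this
  have hqt : q⁻¹ ≠ ⊤ := ne_top_of_le_ne_top ENNReal.one_ne_top (e1 ▸ le_add_self)
  have hrt : r⁻¹ ≠ ⊤ := ne_top_of_le_ne_top ENNReal.one_ne_top (e2 ▸ le_add_self)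
  have hqr : q ≤ r := by
    rw [← ENNReal.inv_le_inv]
    refine (ENNReal.add_le_add_iff_left hinvt).1 ?_
    rw [e1, ← e2, add_assoc]
    exact le_add_self
  have hgap : invGap q r = l⁻¹.toReal := by
    have e1' := congrArg ENNReal.toReal e1
    have e2' := congrArg ENNReal.toReal e2
    rw [ENNReal.toReal_add hinvt hqt] at e1'
    rw [ENNReal.toReal_add (ENNReal.add_ne_top.2 ⟨hinvt, hinvt⟩) hrt,
      ENNReal.toReal_add hinvt hinvt] at e2'
    unfold invGap
    linarith
  exact ⟨ρ, r, q, h2, h3, h1, hρ, hr, hq1, hqr, hgap⟩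

/-- On test functions ℙ∇e^{τΔ} maps L^q to L^r with 1/q - 1/r = 1/l, at the price 1 + τ^{-κ} for any
κ ≤ 1 above (1 + n/l)/2. The norming set is the unit ball of L^q. -/
theorem spatialBound_lebesgue {χ φ : E n → ℝ} (h : IsLittlewoodPaleyPair χ φ) {l : ℝ≥0∞}
    (hl : 2 ≤ l) {α : ℝ} (hα : 2 ≤ α) (hlα : n * l⁻¹.toReal + 2 / α < 1) :
    SpatialBound (n := n) spatial (fun u => ∀ i, InLp l (u i)) (supLp l) α := by
  have hl1 : 1 ≤ l := le_trans (by norm_num) hl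
  obtain ⟨ρ, r, q, _, _, _, hρ, hr, hq1, hqr, hgap⟩ := exists_holder_exponents hl
  have hsub : ∀ u v : VTD n, (∀ i, InLp l (u i)) → (∀ i, InLp l (v i)) →
      ∀ i, InLp l ((u - v) i) := fun u v hu hv i => (hu i).sub (hv i)
  have hl0 := @ENNReal.toReal_nonneg l⁻¹
  refine ⟨hα, hsub, fun u v _ _ => ?_, fun u v hu hv i ψ => ?_, ?_, ?_, ?_, ?_⟩
  · refine iSup_le fun i => (lpNorm_sub_le hl1 _ _).trans (add_le_add ?_ ?_)
    exacts [le_iSup (fun i => lpNorm l (u i)) i, le_iSup (fun i => lpNorm l (v i)) i]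
  · obtain ⟨P, -, hP⟩ := exists_lerayGrad_seminorm (n := n) h hr
    rw [spatial_apply (ρ := ρ) (r := r) h hρ hr hu hu, spatial_apply (ρ := ρ) (r := r) h hρ hr hv hv,
      spatial_apply (ρ := ρ) (r := r) h hρ hr (hsub u v hu hv) hu,
      spatial_apply (ρ := ρ) (r := r) h hρ hr hv (hsub u v hu hv), ← neg_add, neg_sub_neg,
      ← neg_sub, ← Finset.sum_sub_distrib, ← Finset.sum_add_distrib]
    congr 1
    refine Finset.sum_congr rfl fun j _ => ?_
    rw [← Finset.sum_sub_distrib, ← Finset.sum_add_distrib]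
    exact Finset.sum_congr rfl fun k _ =>
      tri_sub_tri (ρ := ρ) (r := r) (hu j) (hv j) (hu k) (hv k) (hP i j k ψ).1
  · obtain ⟨P, hPc, hP⟩ := exists_lerayGrad_seminorm (n := n) h hr
    refine ⟨(n * n : NNReal) • P, hPc.const_smul (n * n : NNReal), fun u v hu hv i τ hτ ψ => ?_⟩
    have := enorm_spatial_le (ρ := ρ) (r := r) h hρ hr hu hv i (heatS τ ψ)
      (fun j k => (hP i j k ψ).2.2 τ hτ)
    exact this
  -- The hypothesis n/l + 2/α < 1 says precisely that an admissible κ fits between the smoothing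
  -- threshold and 1 - 1/α.
  · obtain ⟨κ, hκ1, hκ2⟩ := exists_between (show (1 + n * l⁻¹.toReal) / 2 < 1 - 1 / α by
      have : 2 / α = 2 * (1 / α) := by ring
      linarith)
    have hα1 : 0 < 1 / α := by positivity
    have hnl : 0 ≤ n * l⁻¹.toReal := by positivity
    choose C hC0 hC using fun i j k : Fin n => exists_lerayGrad_heatS_bound h i j k hq1 hqr
      (κ := κ) (by linarith) (by rw [hgap]; linarith) (by rw [hgap]; exact hl0)
    set S := ∑ i, ∑ j, ∑ k, C i j k with hS
    have hCS : ∀ i j k, C i j k ≤ S := fun i j k =>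
      (Finset.single_le_sum (f := fun k => C i j k) (fun k _ => hC0 i j k) (Finset.mem_univ k)).trans
      ((Finset.single_le_sum (f := fun j => ∑ k, C i j k)
        (fun j _ => Finset.sum_nonneg fun k _ => hC0 i j k) (Finset.mem_univ j)).trans
      (Finset.single_le_sum (f := fun i => ∑ j, ∑ k, C i j k) (fun i _ =>
        Finset.sum_nonneg fun j _ => Finset.sum_nonneg fun k _ => hC0 i j k) (Finset.mem_univ i)))
    have hS0 : 0 ≤ S := Finset.sum_nonneg fun i _ =>
      Finset.sum_nonneg fun j _ => Finset.sum_nonneg fun k _ => hC0 i j k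
    refine ⟨{θ | nrm q θ ≤ 1}, n * n * S, κ, by positivity, by linarith, hκ2,
      fun w hw A hA => ?_, fun u v hu hv i θ hθ τ hτ => ?_⟩
    · exact iSup_le fun i => (hw i).lpNorm_le_of_unitBall (q := q) hl fun θ hθ => hA i θ hθ
    · have h1 := enorm_spatial_le (ρ := ρ) (r := r) h hρ hr hu hv i (heatS τ θ)
        (A := S * (1 + τ ^ (-κ))) fun j k => by
          refine (hC i j k τ hτ θ).trans ?_
          have : 0 ≤ τ ^ (-κ) := by positivity
          calc _ ≤ S * (1 + τ ^ (-κ)) * 1 := by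
                gcongr
                · exact nrm_nonneg _ _
                · exact hCS i j k
                · exact hθ
            _ = _ := mul_one _
      rwa [← mul_assoc (n * n : ℝ)] at h1
  · intro u v t hu hv hug hvg i ψ
    have h1 : (fun s => -∑ j, ∑ k, tri (u s j) (v s k)
        (𝓕⁻ (fun ξ => lsym i j k ξ * (heatSym (t - s) ξ * (𝓕 ψ : 𝓢(E n, ℂ)) ξ))))
        =ᵐ[volume.restrict (Set.Ioo 0 t)] fun s => spatial (u s) (v s) i (heatS (t - s) ψ) := by
      filter_upwards [hug, hvg, ae_restrict_mem measurableSet_Ioo] with s h1 h2 hs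
      have hτ : 0 < t - s := by linarith [hs.2]
      rw [spatial_apply (ρ := ρ) (r := r) h hρ hr h1 h2]
      simp only [lerayGrad_heatS _ _ _ hτ]
    refine AEStronglyMeasurable.congr ?_ h1
    refine AEStronglyMeasurable.neg ?_
    refine Finset.aestronglyMeasurable_fun_sum _ fun j _ =>
      Finset.aestronglyMeasurable_fun_sum _ fun k _ => ?_
    refine aestronglyMeasurable_integral_toFun_mul (fun φ => hu j φ) (fun φ => hv k φ) ?_ ?_
      (measurable_fourierInv_heat (measurable_lsym i j k) _ t)
    · filter_upwards [hug] with s hs using ⟨_, (hs j).represents⟩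
    · filter_upwards [hvg] with s hs using ⟨_, (hs k).represents⟩
  · intro u t hu hug
    refine AEMeasurable.iSup fun i => aemeasurable_lpNorm (fun φ => hu i φ) hl1 ?_
    filter_upwards [hug] with s hs using hs i

end MildNS


namespace MildNS

variable {n : ℕ}

/-! ### Spectral localization of products -/

/-- A multiplier with Schwartz symbol acts on bounded functions by convolution. -/
theorem integral_mul_mult {g : E n → ℂ} (hg : MemLp g ⊤ volume) (k : 𝓢(E n, ℂ)) {h : E n → ℂ}
    (hh : Integrable h) :
    ∫ y, (∫ x, g x * k (x - y)) * h y = ∫ x, g x * ∫ y, k (x - y) * h y := by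
  have h1 : Integrable (fun z : E n × E n => g z.1 * (k (z.1 - z.2) * h z.2))
      (volume.prod volume) := by
    have h2 : Integrable (fun z : E n × E n => k (z.1 - z.2) * h z.2) (volume.prod volume) := by
      have h3 := hh.convolution_integrand (ContinuousLinearMap.mul ℂ ℂ) (k.integrable (μ := volume))
      refine h3.congr (Eventually.of_forall fun z => ?_)
      simp only [ContinuousLinearMap.mul_apply']
      ring
    have hgm : AEStronglyMeasurable (fun z : E n × E n => g z.1) (volume.prod volume) :=
      hg.1.comp_fst
    have hgb : ∀ᵐ z : E n × E n ∂(volume.prod volume), ‖g z.1‖ ≤ (eLpNorm g ⊤ volume).toReal := by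
      have h4 : ∀ᵐ x : E n, ‖g x‖ ≤ (eLpNorm g ⊤ volume).toReal := by
        rw [eLpNorm_exponent_top]
        filter_upwards [enorm_ae_le_eLpNormEssSup g volume] with x hx
        rw [← toReal_enorm]
        refine ENNReal.toReal_mono ?_ hx
        have := hg.2.ne
        rwa [eLpNorm_exponent_top] at this
      exact Measure.quasiMeasurePreserving_fst.ae h4
    exact h2.bdd_mul hgm hgb
  have h2 := integral_integral_swap (f := fun x y => g x * (k (x - y) * h y)) h1
  calc _ = ∫ y, ∫ x, g x * (k (x - y) * h y) := by
        congr 1; ext y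
        rw [← integral_mul_const]
        congr 1; ext x; ring
    _ = ∫ x, ∫ y, g x * (k (x - y) * h y) := h2.symm
    _ = _ := by
        congr 1; ext x
        rw [integral_const_mul]

theorem norm_le_of_memLp_top {g : E n → ℂ} (hg : MemLp g ⊤ volume) :
    ∀ᵐ x : E n, ‖g x‖ ≤ (eLpNorm g ⊤ volume).toReal := by
  have := hg.2.ne
  rw [eLpNorm_exponent_top] at this ⊢
  filter_upwards [enorm_ae_le_eLpNormEssSup g volume] with x hx
  rw [← toReal_enorm]
  exact ENNReal.toReal_mono this hx

/-- A bounded function reproduced by a multiplier equals its convolution with the kernel. -/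
theorem ae_eq_of_mult_eq {g : TD n} (hg : InLp ⊤ g) (β : 𝓢(E n, ℂ))
    (hgb : ∀ ψ : 𝓢(E n, ℂ), g (mult β ψ) = g ψ) :
    toFun g =ᵐ[volume] fun y => ∫ x, toFun g x * (𝓕⁻ β : 𝓢(E n, ℂ)) (x - y) := by
  set k : 𝓢(E n, ℂ) := 𝓕⁻ β
  refine Represents.toFun_ae_eq (represents_of_forall (p := ⊤) le_top ?_ fun ψ => ?_)
  · have hm : AEStronglyMeasurable (fun z : E n × E n => toFun g z.2 * k (z.2 - z.1))
        (volume.prod volume) :=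
      hg.memLp.1.comp_snd.mul
        (k.continuous.comp (continuous_snd.sub continuous_fst)).aestronglyMeasurable
    refine memLp_top_of_bound hm.integral_prod_right'
      ((eLpNorm (toFun g) ⊤ volume).toReal * ∫ x, ‖k x‖) (Eventually.of_forall fun y => ?_)
    calc _ ≤ ∫ x, ‖toFun g x * k (x - y)‖ := norm_integral_le_integral_norm _
      _ ≤ ∫ x, (eLpNorm (toFun g) ⊤ volume).toReal * ‖k (x - y)‖ := by
        refine integral_mono_of_nonneg (Eventually.of_forall fun x => norm_nonneg _)
          ((k.integrable.comp_sub_right y).norm.const_mul _) ?_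
        filter_upwards [norm_le_of_memLp_top hg.memLp] with x hx
        rw [norm_mul]
        gcongr
      _ = _ := by
        rw [integral_const_mul, integral_sub_right_eq_self (fun x => ‖k x‖) y]
  · rw [integral_mul_mult hg.memLp k ψ.integrable, ← hgb, hg.apply le_top]
    congr 1; ext x
    rw [mult_eq_convolution]

/-- The Schwartz function `y ↦ k(x - y)`, where `k` is the kernel of the multiplier `β`,
written as a Fourier transform. -/
theorem exists_kernel_schwartz (β : 𝓢(E n, ℂ)) (hβ : HasCompactSupport (β : E n → ℂ)) (x : E n) :
    ∃ B : 𝓢(E n, ℂ), (∀ ζ, β ζ = 0 → B ζ = 0) ∧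
      ∀ y, (𝓕 B : 𝓢(E n, ℂ)) y = (𝓕⁻ β : 𝓢(E n, ℂ)) (x - y) := by
  have hsm : ContDiff ℝ ∞ fun ζ : E n => (Real.fourierChar (inner ℝ ζ x) : ℂ) * β ζ := by
    have h1 : ContDiff ℝ ∞ fun ζ : E n => (Real.fourierChar (inner ℝ ζ x) : ℂ) := by
      simp_rw [Real.fourierChar_apply]
      have h2 : ContDiff ℝ ∞ fun ζ : E n => 2 * Real.pi * inner ℝ ζ x :=
        contDiff_const.mul (contDiff_id.inner ℝ contDiff_const)
      exact ((Complex.ofRealCLM.contDiff.comp h2).mul contDiff_const).cexp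
    exact h1.mul (β.smooth ⊤)
  refine ⟨(hβ.mul_left (f := fun ζ => (Real.fourierChar (inner ℝ ζ x) : ℂ))).toSchwartzMap hsm,
    fun ζ hζ => ?_, fun y => ?_⟩
  · change (Real.fourierChar (inner ℝ ζ x) : ℂ) * β ζ = 0
    rw [hζ, mul_zero]
  · rw [SchwartzMap.fourier_coe, SchwartzMap.fourierInv_coe, Real.fourier_eq, Real.fourierInv_eq]
    congr 1; ext ζ
    change Real.fourierChar (-inner ℝ ζ y) • ((Real.fourierChar (inner ℝ ζ x) : ℂ) * β ζ) = _
    rw [Circle.smul_def, Circle.smul_def, smul_eq_mul, smul_eq_mul, ← mul_assoc, inner_sub_right,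
      ← Circle.coe_mul, ← AddChar.map_add_eq_mul]
    congr 3
    ring

theorem fourierInv_pairing (A B : 𝓢(E n, ℂ)) (η : E n) :
    (𝓕⁻ (SchwartzMap.pairing (ContinuousLinearMap.mul ℂ ℂ) A B) : 𝓢(E n, ℂ)) η =
      ∫ ζ, (𝓕⁻ A : 𝓢(E n, ℂ)) (η - ζ) * (𝓕⁻ B : 𝓢(E n, ℂ)) ζ := by
  have h1 : (𝓕⁻ (SchwartzMap.pairing (ContinuousLinearMap.mul ℂ ℂ) A B) : 𝓢(E n, ℂ)) =
      SchwartzMap.convolution (ContinuousLinearMap.mul ℂ ℂ) (𝓕⁻ A : 𝓢(E n, ℂ)) (𝓕⁻ B) := by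
    simp only [SchwartzMap.convolution]
    change _ = (𝓕⁻ (SchwartzMap.pairing (ContinuousLinearMap.mul ℂ ℂ)
        (𝓕 (𝓕⁻ A : 𝓢(E n, ℂ)) : 𝓢(E n, ℂ)) (𝓕 (𝓕⁻ B : 𝓢(E n, ℂ)) : 𝓢(E n, ℂ)) :
          𝓢(E n, ℂ)) : 𝓢(E n, ℂ))
    rw [FourierTransform.fourier_fourierInv_eq, FourierTransform.fourier_fourierInv_eq]
  rw [h1, SchwartzMap.convolution_apply, convolution_eq_swap]
  rfl

/-- The product of two functions with localized spectra does not see test functions with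
incompatible spectrum. -/
theorem tri_eq_zero_of_spectrum {m b : E n → ℝ} (hm : IsCutoff m) (hb : IsCutoff b) (j k : ℤ)
    {v g : TD n} (hf : InLp ⊤ (dyadic m j v)) (hg : InLp ⊤ g)
    (hgb : ∀ ψ : 𝓢(E n, ℂ), g (dyS hb k ψ) = g ψ) (Ψ : 𝓢(E n, ℂ))
    (hloc : ∀ ζ ξ, symS hb ((2 : ℝ) ^ (-k) • ζ) ≠ 0 → (𝓕 Ψ : 𝓢(E n, ℂ)) ξ ≠ 0 →
      symS hm ((2 : ℝ) ^ (-j) • (ξ - ζ)) = 0) :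
    tri g (dyadic m j v) Ψ = 0 := by
  set β := dilate (symS hb) ((2 : ℝ) ^ (-k)) (two_zpow_ne_zero _) with hβ
  have hβc : HasCompactSupport (β : E n → ℂ) :=
    hasCompactSupport_comp_smul ((hasCompactSupport_comp_smul hb.compact two_pi_ne_zero).comp_left
        (g := fun x : ℝ => (x : ℂ)) Complex.ofReal_zero) (two_zpow_ne_zero (-k))
  set f := dyadic m j v with hfd
  have hh : Integrable fun y => toFun f y * Ψ y :=
    integrable_mul_of_memLp (p := ⊤) (q := 1) hf.memLp (Ψ.memLp 1 volume)
  have h1 : tri g f Ψ = ∫ y, toFun g y * (toFun f y * Ψ y) := by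
    unfold tri; simp only [mul_assoc]
  -- Once g is replaced by its average against the kernel of β and the integrals are exchanged, what
  -- remains at each x is f tested against Ψ times a translate of the reflected kernel.
  have h2 : ∫ y, toFun g y * (toFun f y * Ψ y) =
      ∫ y, (∫ x, toFun g x * (𝓕⁻ β : 𝓢(E n, ℂ)) (x - y)) * (toFun f y * Ψ y) := by
    refine integral_congr_ae ?_
    filter_upwards [ae_eq_of_mult_eq hg β hgb] with y hy
    rw [hy]
  rw [h1, h2, integral_mul_mult hg.memLp _ hh]
  refine integral_eq_zero_of_ae (Eventually.of_forall fun x => ?_)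
  obtain ⟨B, hB0, hB⟩ := exists_kernel_schwartz β hβc x
  set θ := SchwartzMap.pairing (ContinuousLinearMap.mul ℂ ℂ) Ψ (𝓕 B : 𝓢(E n, ℂ)) with hθ
  have h3 : ∫ y, (𝓕⁻ β : 𝓢(E n, ℂ)) (x - y) * (toFun f y * Ψ y) = f θ := by
    rw [hf.apply le_top]
    congr 1; ext y
    rw [hθ, SchwartzMap.pairing_apply_apply, ← hB y, ContinuousLinearMap.mul_apply']
    ring
  -- The Fourier transform of the product θ lives on differences ξ - ζ, with ξ in the spectrum of Ψ
  -- and ζ in the support of β. There the symbol of m(2^{-j}D) vanishes by `hloc`.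
  have h4 : dyS hm j θ = 0 := by
    refine ext_of_fourier fun ξ => ?_
    rw [fourier_dyS, FourierTransform.fourier_zero, _root_.zero_apply]
    by_contra hne
    obtain ⟨ha, hθξ⟩ := mul_ne_zero_iff.1 hne
    have h5 : (𝓕 θ : 𝓢(E n, ℂ)) ξ = (𝓕⁻ θ : 𝓢(E n, ℂ)) (-ξ) := by
      change _ = (𝓕 θ : 𝓢(E n, ℂ)) (- -ξ)
      rw [neg_neg]
    rw [h5, hθ, fourierInv_pairing, FourierTransform.fourierInv_fourier_eq] at hθξ
    refine hθξ (integral_eq_zero_of_ae (Eventually.of_forall fun ζ => ?_))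
    by_contra hz
    obtain ⟨hz1, hz2⟩ := mul_ne_zero_iff.1 hz
    have h6 : (𝓕 Ψ : 𝓢(E n, ℂ)) (ξ + ζ) ≠ 0 := by
      change (𝓕 Ψ : 𝓢(E n, ℂ)) (-(-ξ - ζ)) ≠ 0 at hz1
      rwa [neg_sub_left, neg_neg, add_comm] at hz1
    have h7 := hloc ζ (ξ + ζ) (fun h0 => hz2 (hB0 ζ h0)) h6
    rw [add_sub_cancel_right] at h7
    exact ha h7
  change toFun g x * ∫ y, (𝓕⁻ β : 𝓢(E n, ℂ)) (x - y) * (toFun f y * Ψ y) = 0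
  rw [h3, hfd, dyadic_apply hm, h4, map_zero, mul_zero]

end MildNS


namespace MildNS

variable {n : ℕ}

/-! ### Supports and identities between cutoffs -/

theorem isCutoff_bump (f : ContDiffBump (0 : E n)) : IsCutoff (f : E n → ℝ) where
  smooth := f.contDiff
  compact := f.hasCompactSupport
  even := f.neg

/-- A bump that is `1` on the ball that contains the support of the dyadic cutoffs. -/
noncomputable def ballBump (n : ℕ) : ContDiffBump (0 : E n) :=
  ⟨8 / 3, 14 / 5, by norm_num, by norm_num⟩

theorem isCutoff_ballBump : IsCutoff (ballBump n : E n → ℝ) := isCutoff_bump _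

/-- A cutoff that is `1` on a large annulus. -/
noncomputable def annBump (n : ℕ) (ξ : E n) : ℝ :=
  (⟨16, 32, by norm_num, by norm_num⟩ : ContDiffBump (0 : E n)) ξ -
    (⟨1 / 32, 1 / 24, by norm_num, by norm_num⟩ : ContDiffBump (0 : E n)) ξ

theorem isAnnular_annBump : IsAnnular (annBump n) where
  smooth := ContDiff.sub (ContDiffBump.contDiff _) (ContDiffBump.contDiff _)
  compact := HasCompactSupport.sub (ContDiffBump.hasCompactSupport _)
    (ContDiffBump.hasCompactSupport _)
  even ξ := by simp only [annBump, ContDiffBump.neg]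
  zero_notMem := by
    rw [notMem_tsupport_iff_eventuallyEq]
    filter_upwards [Metric.ball_mem_nhds (0 : E n) (by norm_num : (0 : ℝ) < 1 / 32)] with ξ hξ
    have h1 := mem_ball_zero_iff.1 hξ
    rw [annBump, ContDiffBump.one_of_mem_closedBall, ContDiffBump.one_of_mem_closedBall, sub_self]
    · rfl
    · exact mem_closedBall_zero_iff.2 h1.le
    · exact mem_closedBall_zero_iff.2 (h1.le.trans (by norm_num))

theorem annBump_eq_one {ξ : E n} (h1 : 1 / 24 ≤ ‖ξ‖) (h2 : ‖ξ‖ ≤ 16) : annBump n ξ = 1 := by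
  rw [annBump, ContDiffBump.one_of_mem_closedBall, ContDiffBump.zero_of_le_dist, sub_zero]
  · simpa using h1
  · exact mem_closedBall_zero_iff.2 h2

theorem norm_two_pi_smul (k : ℤ) (ξ : E n) :
    ‖(2 * Real.pi) • (2 : ℝ) ^ (-k) • ξ‖ = 2 * Real.pi * ‖ξ‖ / 2 ^ k := by
  rw [norm_smul, norm_smul, Real.norm_of_nonneg (by positivity), Real.norm_of_nonneg (by positivity),
    zpow_neg]
  field_simp

theorem symS_ballBump_ne_zero {k : ℤ} {ξ : E n}
    (h : symS isCutoff_ballBump ((2 : ℝ) ^ (-k) • ξ) ≠ 0) :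
    2 * Real.pi * ‖ξ‖ < 14 / 5 * 2 ^ k := by
  by_contra hle
  refine h ?_
  rw [symS_apply, ContDiffBump.zero_of_le_dist, Complex.ofReal_zero]
  rw [dist_zero_right, norm_two_pi_smul, le_div_iff₀ (by positivity)]
  exact not_lt.1 hle

theorem symS_ballBump_eq_one {k : ℤ} {ξ : E n} (h : 2 * Real.pi * ‖ξ‖ ≤ 8 / 3 * 2 ^ k) :
    symS isCutoff_ballBump ((2 : ℝ) ^ (-k) • ξ) = 1 := by
  rw [symS_apply, ContDiffBump.one_of_mem_closedBall, Complex.ofReal_one]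
  rw [mem_closedBall_zero_iff, norm_two_pi_smul, div_le_iff₀ (by positivity)]
  exact h

theorem symS_annBump_eq_one {k : ℤ} {ξ : E n} (h1 : 1 / 24 * 2 ^ k ≤ 2 * Real.pi * ‖ξ‖)
    (h2 : 2 * Real.pi * ‖ξ‖ ≤ 16 * 2 ^ k) :
    symS isAnnular_annBump.toIsCutoff ((2 : ℝ) ^ (-k) • ξ) = 1 := by
  rw [symS_apply, annBump_eq_one, Complex.ofReal_one]
  · rwa [norm_two_pi_smul, le_div_iff₀ (by positivity)]
  · rwa [norm_two_pi_smul, div_le_iff₀ (by positivity)]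

namespace IsLittlewoodPaleyPair

variable {χ φ : E n → ℝ} (h : IsLittlewoodPaleyPair χ φ)
include h

theorem high_ne_zero {k : ℤ} {ξ : E n}
    (hξ : symS h.isAnnular_high.toIsCutoff ((2 : ℝ) ^ (-k) • ξ) ≠ 0) :
    3 / 4 * 2 ^ k < 2 * Real.pi * ‖ξ‖ ∧ 2 * Real.pi * ‖ξ‖ < 8 / 3 * 2 ^ k := by
  have h1 : (2 * Real.pi) • (2 : ℝ) ^ (-k) • ξ ∈ tsupport φ := by
    refine subset_tsupport _ fun h0 => hξ ?_
    rw [symS_apply, h0, Complex.ofReal_zero]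
  obtain ⟨h2, h3⟩ := h.support_high h1
  rw [mem_ball_zero_iff, norm_two_pi_smul, div_lt_iff₀ (by positivity)] at h2
  rw [mem_closedBall_zero_iff, norm_two_pi_smul, not_le, lt_div_iff₀ (by positivity)] at h3
  exact ⟨h3, h2⟩

theorem low_ne_zero {k : ℤ} {ξ : E n}
    (hξ : symS h.isCutoff_low ((2 : ℝ) ^ (-k) • ξ) ≠ 0) :
    2 * Real.pi * ‖ξ‖ < 4 / 3 * 2 ^ k := by
  have h1 : (2 * Real.pi) • (2 : ℝ) ^ (-k) • ξ ∈ tsupport χ := by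
    refine subset_tsupport _ fun h0 => hξ ?_
    rw [symS_apply, h0, Complex.ofReal_zero]
  have h2 := h.support_low h1
  rwa [mem_ball_zero_iff, norm_two_pi_smul, div_lt_iff₀ (by positivity)] at h2

theorem dyS_high_ball (j : ℤ) (ψ : 𝓢(E n, ℂ)) :
    dyS h.isAnnular_high.toIsCutoff j (dyS isCutoff_ballBump j ψ) =
      dyS h.isAnnular_high.toIsCutoff j ψ := by
  refine ext_of_fourier fun ξ => ?_
  rw [fourier_dyS, fourier_dyS, fourier_dyS]
  by_cases hξ : symS h.isAnnular_high.toIsCutoff ((2 : ℝ) ^ (-j) • ξ) = 0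
  · rw [hξ, zero_mul, zero_mul]
  · rw [symS_ballBump_eq_one (h.high_ne_zero hξ).2.le, one_mul]

/-- The support radius 4/3 of χ is half of 8/3, which allows the smaller scale j - 1. The separation
of low and high frequencies in `low_high_eq_zero` depends on this gain. -/
theorem dyS_low_ball (j : ℤ) (ψ : 𝓢(E n, ℂ)) :
    dyS h.isCutoff_low j (dyS isCutoff_ballBump (j - 1) ψ) = dyS h.isCutoff_low j ψ := by
  refine ext_of_fourier fun ξ => ?_
  rw [fourier_dyS, fourier_dyS, fourier_dyS]
  by_cases hξ : symS h.isCutoff_low ((2 : ℝ) ^ (-j) • ξ) = 0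
  · rw [hξ, zero_mul, zero_mul]
  · rw [symS_ballBump_eq_one, one_mul]
    have := h.low_ne_zero hξ
    rw [zpow_sub_one₀ (by norm_num)]
    linarith

/-- Subtract the inhomogeneous partition of unity at ξ from the one at 2ξ: all terms but the first
cancel. -/
theorem low_eq (ξ : E n) : χ ξ = χ ((2 : ℝ) • ξ) + φ ((2 : ℝ) • ξ) := by
  by_cases hξ : ξ = 0
  · subst hξ
    have : φ 0 = 0 := image_eq_zero_of_notMem_tsupport h.isAnnular_high.zero_notMem
    simp [this]
  have hs : ∀ η : E n, η ≠ 0 → Summable fun j : ℕ => φ ((2 : ℝ) ^ (-(j : ℤ)) • η) := fun η hη => by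
    have h1 : Summable fun j : ℤ => φ ((2 : ℝ) ^ (-j) • η) := by
      by_contra hns
      have := h.sum_homogeneous η hη
      rw [tsum_eq_zero_of_not_summable hns] at this
      exact zero_ne_one this
    exact h1.comp_injective (i := fun j : ℕ => (j : ℤ)) Nat.cast_injective
  have h1 := h.sum_inhomogeneous ξ
  have h2 := h.sum_inhomogeneous ((2 : ℝ) • ξ)
  rw [(hs _ (smul_ne_zero two_ne_zero hξ)).tsum_eq_zero_add] at h2
  have h3 : ∀ j : ℕ, (2 : ℝ) ^ (-((j + 1 : ℕ) : ℤ)) • (2 : ℝ) • ξ = (2 : ℝ) ^ (-(j : ℤ)) • ξ :=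
    fun j => by
      rw [smul_smul]
      congr 1
      push_cast
      rw [neg_add, zpow_add₀ (by norm_num)]
      norm_num
      ring
  simp_rw [h3] at h2
  simp only [Nat.cast_zero, neg_zero, zpow_zero, one_smul] at h2
  linarith

theorem dyS_low_add_one (j : ℤ) (ψ : 𝓢(E n, ℂ)) :
    dyS h.isCutoff_low (j + 1) ψ =
      dyS h.isCutoff_low j ψ + dyS h.isAnnular_high.toIsCutoff j ψ := by
  refine ext_of_fourier fun ξ => ?_
  rw [FourierTransform.fourier_add, _root_.add_apply, fourier_dyS, fourier_dyS, fourier_dyS,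
    ← add_mul]
  congr 1
  rw [symS_apply, symS_apply, symS_apply, h.low_eq, Complex.ofReal_add]
  have : (2 : ℝ) • (2 * Real.pi) • (2 : ℝ) ^ (-(j + 1)) • ξ = (2 * Real.pi) • (2 : ℝ) ^ (-j) • ξ := by
    rw [smul_comm, smul_smul (2 : ℝ)]
    congr 2
    rw [neg_add, zpow_add₀ (by norm_num)]
    norm_num
    ring
  rw [this]

theorem high_apply (j : ℤ) (u : TD n) (ψ : 𝓢(E n, ℂ)) :
    dyadic φ j u ψ = u (dyS h.isAnnular_high.toIsCutoff j ψ) := dyadic_apply _ j u ψ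

theorem low_apply (j : ℤ) (u : TD n) (ψ : 𝓢(E n, ℂ)) :
    dyadic χ j u ψ = u (dyS h.isCutoff_low j ψ) := dyadic_apply _ j u ψ

theorem high_ball (j : ℤ) (u : TD n) (ψ : 𝓢(E n, ℂ)) :
    dyadic φ j u (dyS isCutoff_ballBump j ψ) = dyadic φ j u ψ := by
  rw [h.high_apply, h.high_apply, h.dyS_high_ball]

theorem low_ball (j : ℤ) (u : TD n) (ψ : 𝓢(E n, ℂ)) :
    dyadic χ j u (dyS isCutoff_ballBump (j - 1) ψ) = dyadic χ j u ψ := by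
  rw [h.low_apply, h.low_apply, h.dyS_low_ball]

theorem low_sub_apply (j : ℤ) (N : ℕ) (u : TD n) (ψ : 𝓢(E n, ℂ)) :
    dyadic χ j u ψ = dyadic χ (j - N) u ψ + ∑ i ∈ Finset.range N, dyadic φ (j - (i + 1)) u ψ := by
  induction N with
  | zero => simp
  | succ N ih =>
    rw [ih, Finset.sum_range_succ]
    have h1 : dyadic χ (j - N) u ψ = dyadic χ (j - (N + 1 : ℕ)) u ψ +
        dyadic φ (j - (N + 1)) u ψ := by
      rw [h.low_apply, h.low_apply, h.high_apply]
      have : j - (N : ℤ) = j - (N + 1 : ℕ) + 1 := by push_cast; ring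
      rw [this, h.dyS_low_add_one, map_add]
      push_cast
      rfl
    rw [h1]; ring

/-! ### Vanishing of blocks of products -/

/-- The low factor is reproduced by the ball bump at scale j - 2, hence has frequency radius at most
(14/5)/4 = 7/10 in units of 2^j, below the inner radius 3/4 of the high factor. Sums of frequencies
lie between 3/4 - 7/10 = 1/20 and 8/3 + 7/10, inside [1/24, 4]. -/
theorem low_high_eq_zero {u v : TD n} (j : ℤ) (hu : InLp ⊤ (dyadic χ (j - 1) u))
    (hv : InLp ⊤ (dyadic φ j v)) {Ψ : 𝓢(E n, ℂ)} (hΨ : ∀ ξ, (𝓕 Ψ : 𝓢(E n, ℂ)) ξ ≠ 0 →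
      2 * Real.pi * ‖ξ‖ < 1 / 24 * 2 ^ j ∨ 4 * 2 ^ j < 2 * Real.pi * ‖ξ‖) :
    tri (dyadic χ (j - 1) u) (dyadic φ j v) Ψ = 0 := by
  refine tri_eq_zero_of_spectrum h.isAnnular_high.toIsCutoff isCutoff_ballBump j (j - 1 - 1) hv hu
    (fun ψ => h.low_ball _ _ _) Ψ fun ζ ξ hζ hξ => ?_
  by_contra hne
  obtain ⟨h1, h2⟩ := h.high_ne_zero hne
  have h3 := symS_ballBump_ne_zero hζ
  rw [zpow_sub_one₀ (by norm_num), zpow_sub_one₀ (by norm_num)] at h3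
  have hpow : (0 : ℝ) < 2 ^ j := by positivity
  have hπ := Real.pi_pos
  have h4 : 2 * Real.pi * ‖ξ - ζ‖ ≤ 2 * Real.pi * ‖ξ‖ + 2 * Real.pi * ‖ζ‖ := by
    rw [← mul_add]; gcongr; exact norm_sub_le _ _
  have h5 : 2 * Real.pi * ‖ξ‖ ≤ 2 * Real.pi * ‖ξ - ζ‖ + 2 * Real.pi * ‖ζ‖ := by
    rw [← mul_add]; gcongr; exact norm_le_norm_sub_add _ _
  rcases hΨ ξ hξ with h6 | h6 <;> linarith

/-- Two comparable frequencies may cancel, so only high test frequencies are excluded: the sum is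
below 14/5 + 2 · 8/3 < 9 in units of 2^j. -/
theorem high_high_eq_zero {u v : TD n} (j ν : ℤ) (hν : -1 ≤ ν) (hu : InLp ⊤ (dyadic φ j u))
    (hv : InLp ⊤ (dyadic φ (j - ν) v)) {Ψ : 𝓢(E n, ℂ)} (hΨ : ∀ ξ, (𝓕 Ψ : 𝓢(E n, ℂ)) ξ ≠ 0 →
      9 * 2 ^ j < 2 * Real.pi * ‖ξ‖) :
    tri (dyadic φ j u) (dyadic φ (j - ν) v) Ψ = 0 := by
  refine tri_eq_zero_of_spectrum h.isAnnular_high.toIsCutoff isCutoff_ballBump (j - ν) j hv hu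
    (fun ψ => h.high_ball _ _ _) Ψ fun ζ ξ hζ hξ => ?_
  by_contra hne
  obtain ⟨h1, h2⟩ := h.high_ne_zero hne
  have h3 := symS_ballBump_ne_zero hζ
  have hpow : (0 : ℝ) < 2 ^ j := by positivity
  have hπ := Real.pi_pos
  have h5 : 2 * Real.pi * ‖ξ‖ ≤ 2 * Real.pi * ‖ξ - ζ‖ + 2 * Real.pi * ‖ζ‖ := by
    rw [← mul_add]; gcongr; exact norm_le_norm_sub_add _ _
  have h6 : (2 : ℝ) ^ (j - ν) ≤ 2 ^ j * 2 := by
    rw [← zpow_add_one₀ (by norm_num)]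
    exact zpow_le_zpow_right₀ (by norm_num) (by omega)
  have h7 := hΨ ξ hξ
  linarith

/-- The annular cutoff is 1 on all frequencies of the product. Inserting it on the test function
makes Laplacians available, as used in `exists_paraBlock_lap_le`. -/
theorem low_high_eq_ann {u v : TD n} (j : ℤ) (hu : InLp ⊤ (dyadic χ (j - 1) u))
    (hv : InLp ⊤ (dyadic φ j v)) (Ψ : 𝓢(E n, ℂ)) :
    tri (dyadic χ (j - 1) u) (dyadic φ j v) Ψ =
      tri (dyadic χ (j - 1) u) (dyadic φ j v) (dyS isAnnular_annBump.toIsCutoff j Ψ) := by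
  set A := dyS isAnnular_annBump.toIsCutoff j Ψ with hA
  have h1 : tri (dyadic χ (j - 1) u) (dyadic φ j v) (Ψ - A : 𝓢(E n, ℂ)) = 0 := by
    refine h.low_high_eq_zero j hu hv fun ξ hξ => ?_
    have hpow : (0 : ℝ) < 2 ^ j := by positivity
    by_contra hcon
    rw [not_or, not_lt, not_lt] at hcon
    refine hξ ?_
    rw [sub_eq_add_neg, FourierTransform.fourier_add, FourierTransform.fourier_neg,
      _root_.add_apply, _root_.neg_apply, hA, fourier_dyS,
      symS_annBump_eq_one hcon.1 (by linarith), one_mul, add_neg_cancel]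
  rw [← sub_eq_zero, ← h1]
  unfold tri
  rw [← integral_sub]
  · congr 1; ext x
    change _ = _ * (Ψ x - A x)
    ring
  · exact integrable_tri (ρ := ⊤) (r := 1) hu hv (Ψ.memLp 1 volume)
  · exact integrable_tri (ρ := ⊤) (r := 1) hu hv (A.memLp 1 volume)

end IsLittlewoodPaleyPair

end MildNS


namespace MildNS

variable {n : ℕ}

/-! ### Quantitative bounds for distributions of Besov type -/

theorem InLp.norm_apply_le {p q : ℝ≥0∞} [p.HolderConjugate q] {u : TD n} (hu : InLp p u) {A : ℝ}
    (hA0 : 0 ≤ A) (hA : lpNorm p u ≤ ENNReal.ofReal A) (φ : 𝓢(E n, ℂ)) :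
    ‖u φ‖ ≤ A * nrm q φ := by
  have h1 := (hu.enorm_apply_le (q := q) φ).trans (mul_le_mul_left hA _)
  rw [eLpNorm_eq_ofReal_nrm, ← ENNReal.ofReal_mul hA0, ← ofReal_norm] at h1
  exact (ENNReal.ofReal_le_ofReal_iff (mul_nonneg hA0 (nrm_nonneg _ _))).1 h1

theorem norm_tri_le {a b ρ r : ℝ≥0∞} [ENNReal.HolderTriple a b ρ] [ρ.HolderConjugate r]
    {u v : TD n} (hu : InLp a u) (hv : InLp b v) {A B : ℝ} (hA0 : 0 ≤ A) (hB0 : 0 ≤ B)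
    (hA : lpNorm a u ≤ ENNReal.ofReal A) (hB : lpNorm b v ≤ ENNReal.ofReal B) (Ψ : 𝓢(E n, ℂ)) :
    ‖tri u v Ψ‖ ≤ A * B * nrm r Ψ := by
  have h1 := (enorm_tri_le (ρ := ρ) (r := r) hu hv Ψ.continuous.aestronglyMeasurable).trans
    (mul_le_mul_left (mul_le_mul' hA hB) _)
  rw [eLpNorm_eq_ofReal_nrm, ← ENNReal.ofReal_mul hA0, ← ENNReal.ofReal_mul (by positivity),
    ← ofReal_norm] at h1
  exact (ENNReal.ofReal_le_ofReal_iff (mul_nonneg (by positivity) (nrm_nonneg _ _))).1 h1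

/-- Bernstein's inequality for functions whose spectrum lies in a ball. -/
theorem exists_bernstein {l : ℝ≥0∞} (hl : 1 ≤ l) : ∃ C : ℝ, 0 ≤ C ∧
    ∀ (j : ℤ) (w : TD n) (A : ℝ), InLp l w → 0 ≤ A → lpNorm l w ≤ ENNReal.ofReal A →
      (∀ ψ : 𝓢(E n, ℂ), w (dyS isCutoff_ballBump j ψ) = w ψ) →
      InLp ⊤ w ∧ lpNorm ⊤ w ≤ ENNReal.ofReal (C * (2 : ℝ) ^ ((j : ℝ) * (n * l⁻¹.toReal)) * A) := by
  have : l.HolderConjugate l.conjExponent := ENNReal.HolderConjugate.conjExponent hl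
  set q := l.conjExponent
  have hq1 : 1 ≤ q := ENNReal.HolderConjugate.one_le q l
  have e1 : l⁻¹ + q⁻¹ = 1 := by
    simpa using ENNReal.HolderTriple.inv_add_inv_eq_inv l q 1
  have hgap : invGap 1 q = l⁻¹.toReal := by
    have hlt : l⁻¹ ≠ ⊤ := ne_top_of_le_ne_top ENNReal.one_ne_top (e1 ▸ le_self_add)
    have hqt : q⁻¹ ≠ ⊤ := ne_top_of_le_ne_top ENNReal.one_ne_top (e1 ▸ le_add_self)
    have e1' := congrArg ENNReal.toReal e1
    rw [ENNReal.toReal_add hlt hqt, ENNReal.toReal_one] at e1'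
    unfold invGap
    rw [inv_one, ENNReal.toReal_one]
    linarith
  obtain ⟨C, hC0, hC⟩ := exists_nrm_dyS_le (n := n) isCutoff_ballBump le_rfl hq1
  refine ⟨C, hC0, fun j w A hw hA0 hA hrep => inLp_top_of_bound fun ψ => ?_⟩
  rw [← hrep]
  refine (hw.norm_apply_le (q := q) hA0 hA _).trans ?_
  have h1 := hC j ψ
  rw [hgap] at h1
  calc _ ≤ A * (C * (2 : ℝ) ^ ((j : ℝ) * (n * l⁻¹.toReal)) * nrm 1 ψ) := by gcongr
    _ = _ := by ring

/-- The bound `‖Δ̇_j u‖_{L^ℓ} ≤ A 2^{-js + δ|j|}`, for `u ∈ 𝓢'_h`. -/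
structure BesovBound (χ φ : E n → ℝ) (l : ℝ≥0∞) (s δ : ℝ) (u : TD n) (A : ℝ) : Prop where
  low : IsSh χ u
  nonneg : 0 ≤ A
  mem : ∀ j : ℤ, InLp l (dyadic φ j u)
  le : ∀ j : ℤ, lpNorm l (dyadic φ j u) ≤
    ENNReal.ofReal (A * (2 : ℝ) ^ (-((j : ℝ) * s) + δ * |(j : ℝ)|))

/-- The exponents for which the Bony product is estimated. -/
structure BonyExp (n : ℕ) (l : ℝ≥0∞) (s g δ : ℝ) : Prop where
  two_le : 2 ≤ l
  s_eq : s = -1 + n * l⁻¹.toReal + g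
  δ_pos : 0 < δ
  δ_lt_s : δ < s
  δ_lt_g : δ < g
  δ_lt : δ < 1 - g

theorem BonyExp.one_le {l : ℝ≥0∞} {s g δ : ℝ} (he : BonyExp n l s g δ) : 1 ≤ l :=
  le_trans (by norm_num) he.two_le

section Bounds

variable {χ φ : E n → ℝ} {l : ℝ≥0∞} {s g δ : ℝ}

/-- Bernstein's inequality costs 2^{jn/l}, and n/l - s = 1 - g by the relation between the
exponents. -/
theorem exists_high_top_le (h : IsLittlewoodPaleyPair χ φ) (he : BonyExp n l s g δ) :
    ∃ C : ℝ, 0 ≤ C ∧ ∀ (u : TD n) (A : ℝ), BesovBound χ φ l s δ u A → ∀ j : ℤ,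
      InLp ⊤ (dyadic φ j u) ∧ lpNorm ⊤ (dyadic φ j u) ≤
        ENNReal.ofReal (C * A * (2 : ℝ) ^ ((j : ℝ) * (1 - g) + δ * |(j : ℝ)|)) := by
  obtain ⟨C, hC0, hC⟩ := exists_bernstein (n := n) he.one_le
  refine ⟨C, hC0, fun u A hu j => ?_⟩
  have h1 := hC j (dyadic φ j u) _ (hu.mem j) (mul_nonneg hu.nonneg (by positivity)) (hu.le j)
    (h.high_ball j u)
  refine ⟨h1.1, h1.2.trans_eq ?_⟩
  congr 1
  have h2 : (2 : ℝ) ^ ((j : ℝ) * (1 - g) + δ * |(j : ℝ)|) =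
      (2 : ℝ) ^ ((j : ℝ) * (n * l⁻¹.toReal)) * (2 : ℝ) ^ (-((j : ℝ) * s) + δ * |(j : ℝ)|) := by
    rw [← Real.rpow_add (by norm_num)]
    congr 1
    rw [he.s_eq]; ring
  rw [h2]; ring

/-- Membership in 𝓢'_h kills the remainder at frequency 0, so Ṡ_{j-1}u is the sum of the blocks
below j - 1. These bounds are geometric with ratio 2^{-(1-g-δ)}, whence the condition δ < 1 - g. -/
theorem exists_low_top_le (h : IsLittlewoodPaleyPair χ φ) (he : BonyExp n l s g δ) :
    ∃ C : ℝ, 0 ≤ C ∧ ∀ (u : TD n) (A : ℝ), BesovBound χ φ l s δ u A → ∀ j : ℤ,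
      InLp ⊤ (dyadic χ (j - 1) u) ∧ lpNorm ⊤ (dyadic χ (j - 1) u) ≤
        ENNReal.ofReal (C * A * (2 : ℝ) ^ ((j : ℝ) * (1 - g) + δ * |(j : ℝ)|)) := by
  obtain ⟨C, hC0, hC⟩ := exists_high_top_le h he
  set θ : ℝ := (2 : ℝ) ^ (-(1 - g - δ)) with hθ
  have hθ0 : 0 ≤ θ := by positivity
  have hθ1 : θ < 1 := Real.rpow_lt_one_of_one_lt_of_neg (by norm_num) (by linarith [he.δ_lt])
  refine ⟨C * (1 - θ)⁻¹, mul_nonneg hC0 (inv_nonneg.2 (by linarith)),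
    fun u A hu j => inLp_top_of_bound fun ψ => ?_⟩
  set D := (2 : ℝ) ^ ((j : ℝ) * (1 - g) + δ * |(j : ℝ)|) with hD
  have hN := nrm_nonneg 1 ψ
  have hA := hu.nonneg
  have hblock : ∀ i : ℕ, ‖dyadic φ (j - 1 - (i + 1)) u ψ‖ ≤ C * A * D * nrm 1 ψ * θ ^ i := fun i => by
    have h1 := (hC u A hu (j - 1 - (i + 1))).1.norm_apply_le (q := 1) (by positivity)
      (hC u A hu (j - 1 - (i + 1))).2 ψ
    refine h1.trans ?_
    have h2 : (2 : ℝ) ^ (((j - 1 - (i + 1) : ℤ) : ℝ) * (1 - g) +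
        δ * |((j - 1 - (i + 1) : ℤ) : ℝ)|) ≤ D * θ ^ i := by
      rw [hθ, ← Real.rpow_natCast, ← Real.rpow_mul (by norm_num), hD,
        ← Real.rpow_add (by norm_num)]
      refine Real.rpow_le_rpow_of_exponent_le (by norm_num) ?_
      push_cast
      have h3 : |(j : ℝ) - 1 - (i + 1)| ≤ |(j : ℝ)| + (i + 2) := by
        have h4 : (j : ℝ) - 1 - (i + 1) = j - (i + 2) := by ring
        rw [h4]
        have h5 := abs_sub (j : ℝ) (i + 2)
        rwa [abs_of_nonneg (by positivity : (0 : ℝ) ≤ (i : ℝ) + 2)] at h5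
      have h4 := mul_le_mul_of_nonneg_left h3 he.δ_pos.le
      have h5 := he.δ_lt
      have h6 : (0 : ℝ) ≤ i := Nat.cast_nonneg i
      nlinarith
    calc _ ≤ C * A * (D * θ ^ i) * nrm 1 ψ := by gcongr
      _ = _ := by ring
  have hlim : Tendsto (fun N : ℕ => ‖dyadic χ (j - 1 - N) u ψ‖) atTop (𝓝 0) := by
    have h1 : Tendsto (fun N : ℕ => j - 1 - (N : ℤ)) atTop atBot := by
      refine tendsto_atBot.2 fun b => ?_
      filter_upwards [eventually_ge_atTop (j - 1 - b).toNat] with N hN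
      omega
    have h2 := hu.low.comp h1
    have h3 : ∀ᶠ N : ℕ in atTop, InLp ⊤ (dyadic χ (j - 1 - (N : ℤ)) u) := by
      filter_upwards [h2.eventually (gt_mem_nhds ENNReal.zero_lt_top)] with N hN
      exact inLp_iff.2 hN
    have h4 : Tendsto (fun N : ℕ => lpNorm ⊤ (dyadic χ (j - 1 - (N : ℤ)) u) *
        eLpNorm ψ 1 volume) atTop (𝓝 0) := by
      simpa using ENNReal.Tendsto.mul_const h2 (Or.inr (ψ.eLpNorm_lt_top 1 volume).ne)
    have h5 : Tendsto (fun N : ℕ => ‖dyadic χ (j - 1 - N) u ψ‖ₑ) atTop (𝓝 0) := by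
      refine tendsto_of_tendsto_of_tendsto_of_le_of_le' tendsto_const_nhds h4
        (Eventually.of_forall fun _ => zero_le) ?_
      filter_upwards [h3] with N hN
      exact hN.enorm_apply_le (q := 1) ψ
    have h6 := (ENNReal.tendsto_toReal ENNReal.zero_ne_top).comp h5
    simpa [Function.comp_def] using h6
  have hle : ∀ N : ℕ, ‖dyadic χ (j - 1) u ψ‖ ≤ ‖dyadic χ (j - 1 - N) u ψ‖ +
      C * A * D * nrm 1 ψ * (1 - θ)⁻¹ := fun N => by
    rw [h.low_sub_apply (j - 1) N u ψ]
    refine (norm_add_le _ _).trans (add_le_add le_rfl ((norm_sum_le _ _).trans ?_))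
    refine (Finset.sum_le_sum fun i _ => hblock i).trans ?_
    rw [← Finset.mul_sum]
    refine mul_le_mul_of_nonneg_left ?_ (by positivity)
    rw [← tsum_geometric_of_lt_one hθ0 hθ1]
    exact (summable_geometric_of_lt_one hθ0 hθ1).sum_le_tsum _ fun i _ => by positivity
  have := ge_of_tendsto' (hlim.add_const (C * A * D * nrm 1 ψ * (1 - θ)⁻¹)) hle
  rw [zero_add] at this
  calc _ ≤ _ := this
    _ = _ := by ring

/-! ### Series of distributions -/

/-- A common continuous seminorm with summable coefficients makes the limit functional continuous.
The series then converges in the topology of 𝓢' and its `tsum` is not the default 0. -/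
theorem td_hasSum {ι : Type*} {w : ι → TD n} {p : Seminorm ℂ 𝓢(E n, ℂ)} (hp : Continuous p)
    {b : ι → ℝ} (hb : Summable b) (hw : ∀ i ψ, ‖w i ψ‖ ≤ b i * p ψ) (ψ : 𝓢(E n, ℂ)) :
    HasSum (fun i => w i ψ) ((∑' i, w i) ψ) := by
  have hs : ∀ ψ, Summable fun i => w i ψ := fun ψ =>
    Summable.of_norm_bounded (hb.mul_right (p ψ)) fun i => hw i ψ
  obtain ⟨W, hW⟩ := exists_td_of_bound (L := fun ψ => ∑' i, w i ψ) (p := p)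
    (fun ψ θ => by simp only [map_add]; exact (hs ψ).tsum_add (hs θ))
    (fun c ψ => by simp only [map_smul, smul_eq_mul]; exact tsum_mul_left) hp
    (C := ∑' i, b i) fun ψ => by
      rw [← tsum_mul_right]
      exact tsum_of_norm_bounded (hb.mul_right (p ψ)).hasSum fun i => hw i ψ
  have hsum : HasSum w W := by
    refine (PointwiseConvergenceCLM.tendsto_iff_forall_tendsto).2 fun ψ => ?_
    have h1 := (hs ψ).hasSum
    rw [← hW ψ] at h1
    refine Tendsto.congr (fun S => ?_) h1
    classical
    induction S using Finset.induction_on with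
    | empty => simp
    | insert a S ha ih => rw [Finset.sum_insert ha, Finset.sum_insert ha, ih]; rfl
  rw [hsum.tsum_eq, hW]
  exact (hs ψ).hasSum

end Bounds

end MildNS


namespace MildNS

variable {n : ℕ}

/-! ### Blocks of the Bony product -/

/-- The `j`-th block of the paraproduct, tested against `G`. -/
noncomputable def paraBlock (χ φ : E n → ℝ) (u v : TD n) (j : ℤ) (G : E n → ℂ) : ℂ :=
  tri (dyadic χ (j - 1) u) (dyadic φ j v) G

/-- The `j`-th block of the remainder, tested against `G`. -/
noncomputable def remBlock (φ : E n → ℝ) (u v : TD n) (j : ℤ) (G : E n → ℂ) : ℂ :=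
  ∑ ν ∈ Finset.Icc (-1 : ℤ) 1, tri (dyadic φ j u) (dyadic φ (j - ν) v) G

section Blocks

variable {χ φ : E n → ℝ} {l ρ r q : ℝ≥0∞} {s g δ : ℝ}

theorem two_rpow_le_of_le {x y : ℝ} (h : x ≤ y) : (2 : ℝ) ^ x ≤ (2 : ℝ) ^ y :=
  Real.rpow_le_rpow_of_exponent_le (by norm_num) h

theorem abs_sub_le_add_one (j ν : ℤ) (hν : ν ∈ Finset.Icc (-1 : ℤ) 1) :
    |((j - ν : ℤ) : ℝ)| ≤ |(j : ℝ)| + 1 ∧ |(ν : ℝ)| ≤ 1 := by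
  rw [Finset.mem_Icc] at hν
  have h1 : |(ν : ℝ)| ≤ 1 := by
    rw [abs_le]; exact ⟨by exact_mod_cast hν.1, by exact_mod_cast hν.2⟩
  refine ⟨?_, h1⟩
  push_cast
  have := abs_sub (j : ℝ) ν
  linarith

/-- The bound for low frequencies: both factors in L^∞ give decay as j → -∞, because g + δ < 1. -/
theorem exists_paraBlock_top_le (h : IsLittlewoodPaleyPair χ φ) (he : BonyExp n l s g δ) :
    ∃ C : ℝ, 0 ≤ C ∧ ∀ (u v : TD n) (A B : ℝ), BesovBound χ φ l s δ u A →
      BesovBound χ φ l s δ v B → ∀ (j : ℤ) (Ψ : 𝓢(E n, ℂ)), ‖paraBlock χ φ u v j Ψ‖ ≤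
        C * (A * B) * (2 : ℝ) ^ (2 * ((j : ℝ) * (1 - g) + δ * |(j : ℝ)|)) * nrm 1 Ψ := by
  obtain ⟨C₁, hC₁0, hC₁⟩ := exists_low_top_le h he
  obtain ⟨C₂, hC₂0, hC₂⟩ := exists_high_top_le h he
  refine ⟨C₁ * C₂, by positivity, fun u v A B hu hv j Ψ => ?_⟩
  have hA := hu.nonneg
  have hB := hv.nonneg
  have h1 := norm_tri_le (ρ := ⊤) (r := 1) (hC₁ u A hu j).1 (hC₂ v B hv j).1 (by positivity)
    (by positivity) (hC₁ u A hu j).2 (hC₂ v B hv j).2 Ψ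
  refine h1.trans_eq ?_
  have hX : ∀ x : ℝ, (2 : ℝ) ^ (2 * x) = (2 : ℝ) ^ x * (2 : ℝ) ^ x := fun x => by
    rw [two_mul, Real.rpow_add (by norm_num)]
  rw [hX]
  ring

/-- Keeps the high factor in L^ℓ, so that the test function is measured in L^q, the dual exponent of
the size that is to be closed. -/
theorem exists_paraBlock_le (h : IsLittlewoodPaleyPair χ φ) (he : BonyExp n l s g δ)
    [l.HolderConjugate q] :
    ∃ C : ℝ, 0 ≤ C ∧ ∀ (u v : TD n) (A B : ℝ), BesovBound χ φ l s δ u A →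
      BesovBound χ φ l s δ v B → ∀ (j : ℤ) (Ψ : 𝓢(E n, ℂ)), ‖paraBlock χ φ u v j Ψ‖ ≤
        C * (A * B) * (2 : ℝ) ^ ((j : ℝ) * (1 - g - s) + 2 * δ * |(j : ℝ)|) * nrm q Ψ := by
  obtain ⟨C₁, hC₁0, hC₁⟩ := exists_low_top_le h he
  refine ⟨C₁, by positivity, fun u v A B hu hv j Ψ => ?_⟩
  have hA := hu.nonneg
  have hB := hv.nonneg
  have h1 := norm_tri_le (ρ := l) (r := q) (hC₁ u A hu j).1 (hv.mem j) (by positivity)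
    (by positivity) (hC₁ u A hu j).2 (hv.le j) Ψ
  refine h1.trans_eq ?_
  have : (2 : ℝ) ^ ((j : ℝ) * (1 - g - s) + 2 * δ * |(j : ℝ)|) =
      (2 : ℝ) ^ ((j : ℝ) * (1 - g) + δ * |(j : ℝ)|) * (2 : ℝ) ^ (-((j : ℝ) * s) + δ * |(j : ℝ)|) := by
    rw [← Real.rpow_add (by norm_num)]; congr 1; ring
  rw [this]; ring

/-- The bound for high frequencies: the spectrum of the block is an annulus, so two derivatives pass
to Ψ and 2(1-g) - 2 = -2g gives decay as j → ∞, because δ < g. -/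
theorem exists_paraBlock_lap_le (h : IsLittlewoodPaleyPair χ φ) (he : BonyExp n l s g δ) :
    ∃ C : ℝ, 0 ≤ C ∧ ∀ (u v : TD n) (A B : ℝ), BesovBound χ φ l s δ u A →
      BesovBound χ φ l s δ v B → ∀ (j : ℤ) (Ψ : 𝓢(E n, ℂ)), ‖paraBlock χ φ u v j Ψ‖ ≤
        C * (A * B) * (2 : ℝ) ^ (2 * ((j : ℝ) * (-g) + δ * |(j : ℝ)|)) * nrm 1 (lap Ψ) := by
  obtain ⟨C₁, hC₁0, hC₁⟩ := exists_paraBlock_top_le h he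
  obtain ⟨a', ha'⟩ := exists_symS_factor (n := n) isAnnular_annBump
  obtain ⟨C₂, hC₂0, hC₂⟩ := exists_nrm_annular_le_lap ha' (le_refl (1 : ℝ≥0∞)) le_rfl
  obtain ⟨C₃, hC₃0, hC₃⟩ := exists_low_top_le h he
  obtain ⟨C₄, hC₄0, hC₄⟩ := exists_high_top_le h he
  refine ⟨C₁ * C₂, by positivity, fun u v A B hu hv j Ψ => ?_⟩
  have hA := hu.nonneg
  have hB := hv.nonneg
  have h0 : paraBlock χ φ u v j Ψ =
      paraBlock χ φ u v j (dyS isAnnular_annBump.toIsCutoff j Ψ) :=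
    h.low_high_eq_ann j (hC₃ u A hu j).1 (hC₄ v B hv j).1 Ψ
  rw [h0]
  have h1 := hC₂ ((2 : ℝ) ^ (-j)) (by positivity) Ψ
  simp only [sub_self, mul_zero, neg_zero, Real.rpow_zero, mul_one] at h1
  have h2 : ((2 : ℝ) ^ (-j)) ^ 2 = (2 : ℝ) ^ (-2 * (j : ℝ)) := by
    rw [← Real.rpow_natCast, two_zpow_rpow]; congr 1; push_cast; ring
  rw [h2] at h1
  refine (hC₁ u v A B hu hv j _).trans ?_
  calc _ ≤ C₁ * (A * B) * (2 : ℝ) ^ (2 * ((j : ℝ) * (1 - g) + δ * |(j : ℝ)|)) *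
        (C₂ * (2 : ℝ) ^ (-2 * (j : ℝ)) * nrm 1 (lap Ψ)) := by gcongr; exact h1
    _ = C₁ * C₂ * (A * B) * ((2 : ℝ) ^ (2 * ((j : ℝ) * (1 - g) + δ * |(j : ℝ)|)) *
        (2 : ℝ) ^ (-2 * (j : ℝ))) * nrm 1 (lap Ψ) := by ring
    _ = _ := by
      rw [← Real.rpow_add (by norm_num)]
      congr 3; ring

theorem exists_remBlock_top_le (h : IsLittlewoodPaleyPair χ φ) (he : BonyExp n l s g δ) :
    ∃ C : ℝ, 0 ≤ C ∧ ∀ (u v : TD n) (A B : ℝ), BesovBound χ φ l s δ u A →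
      BesovBound χ φ l s δ v B → ∀ (j : ℤ) (Ψ : 𝓢(E n, ℂ)), ‖remBlock φ u v j Ψ‖ ≤
        C * (A * B) * (2 : ℝ) ^ (2 * ((j : ℝ) * (1 - g) + δ * |(j : ℝ)|)) * nrm 1 Ψ := by
  obtain ⟨C₂, hC₂0, hC₂⟩ := exists_high_top_le h he
  refine ⟨3 * (C₂ * C₂ * 2 ^ (1 - g + δ)), by positivity, fun u v A B hu hv j Ψ => ?_⟩
  have hA := hu.nonneg
  have hB := hv.nonneg
  have hN := nrm_nonneg 1 Ψ
  set X := (2 : ℝ) ^ ((j : ℝ) * (1 - g) + δ * |(j : ℝ)|) with hX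
  have hX2 : (2 : ℝ) ^ (2 * ((j : ℝ) * (1 - g) + δ * |(j : ℝ)|)) = X * X := by
    rw [two_mul, Real.rpow_add (by norm_num)]
  have h1 : ∀ ν ∈ Finset.Icc (-1 : ℤ) 1, ‖tri (dyadic φ j u) (dyadic φ (j - ν) v) Ψ‖ ≤
      C₂ * C₂ * 2 ^ (1 - g + δ) * (A * B) * (X * X) * nrm 1 Ψ := fun ν hν => by
    have h2 := norm_tri_le (ρ := ⊤) (r := 1) (hC₂ u A hu j).1 (hC₂ v B hv (j - ν)).1
      (by positivity) (by positivity) (hC₂ u A hu j).2 (hC₂ v B hv (j - ν)).2 Ψ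
    have h3 : (2 : ℝ) ^ (((j - ν : ℤ) : ℝ) * (1 - g) + δ * |((j - ν : ℤ) : ℝ)|) ≤
        X * 2 ^ (1 - g + δ) := by
      rw [hX, ← Real.rpow_add (by norm_num)]
      refine two_rpow_le_of_le ?_
      obtain ⟨h4, h5⟩ := abs_sub_le_add_one j ν hν
      have h6 := mul_le_mul_of_nonneg_left h4 he.δ_pos.le
      have h7 := he.δ_lt
      have h8 := he.δ_pos
      push_cast at h6 ⊢
      nlinarith [neg_abs_le (ν : ℝ)]
    calc _ ≤ _ := h2
      _ ≤ C₂ * A * X * (C₂ * B * (X * 2 ^ (1 - g + δ))) * nrm 1 Ψ := by gcongr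
      _ = _ := by ring
  refine (norm_sum_le _ _).trans ((Finset.sum_le_card_nsmul _ _ _ h1).trans_eq ?_)
  rw [hX2]
  have hcard : (Finset.Icc (-1 : ℤ) 1).card = 3 := rfl
  rw [hcard, nsmul_eq_mul]
  push_cast; ring

/-- A remainder block has no spectral gap at 0, so the Laplacian cannot be used as for the
paraproduct. Decay as j → ∞ comes instead from s > δ, with both factors in L^ℓ. -/
theorem exists_remBlock_le (he : BonyExp n l s g δ)
    [ENNReal.HolderTriple l l ρ] [ρ.HolderConjugate r] :
    ∃ C : ℝ, 0 ≤ C ∧ ∀ (u v : TD n) (A B : ℝ), BesovBound χ φ l s δ u A →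
      BesovBound χ φ l s δ v B → ∀ (j : ℤ) (Ψ : 𝓢(E n, ℂ)), ‖remBlock φ u v j Ψ‖ ≤
        C * (A * B) * (2 : ℝ) ^ (2 * (-((j : ℝ) * s) + δ * |(j : ℝ)|)) * nrm r Ψ := by
  refine ⟨3 * 2 ^ (s + δ), by positivity, fun u v A B hu hv j Ψ => ?_⟩
  have hA := hu.nonneg
  have hB := hv.nonneg
  have hN := nrm_nonneg r Ψ
  set X := (2 : ℝ) ^ (-((j : ℝ) * s) + δ * |(j : ℝ)|) with hX
  have hX2 : (2 : ℝ) ^ (2 * (-((j : ℝ) * s) + δ * |(j : ℝ)|)) = X * X := by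
    rw [two_mul, Real.rpow_add (by norm_num)]
  have h1 : ∀ ν ∈ Finset.Icc (-1 : ℤ) 1, ‖tri (dyadic φ j u) (dyadic φ (j - ν) v) Ψ‖ ≤
      2 ^ (s + δ) * (A * B) * (X * X) * nrm r Ψ := fun ν hν => by
    have h2 := norm_tri_le (ρ := ρ) (r := r) (hu.mem j) (hv.mem (j - ν))
      (by positivity) (by positivity) (hu.le j) (hv.le (j - ν)) Ψ
    have h3 : (2 : ℝ) ^ (-(((j - ν : ℤ) : ℝ) * s) + δ * |((j - ν : ℤ) : ℝ)|) ≤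
        X * 2 ^ (s + δ) := by
      rw [hX, ← Real.rpow_add (by norm_num)]
      refine two_rpow_le_of_le ?_
      obtain ⟨h4, h5⟩ := abs_sub_le_add_one j ν hν
      have h6 := mul_le_mul_of_nonneg_left h4 he.δ_pos.le
      have h7 := he.δ_lt_s
      have h8 := he.δ_pos
      push_cast at h6 ⊢
      nlinarith [le_abs_self (ν : ℝ)]
    calc _ ≤ _ := h2
      _ ≤ A * X * (B * (X * 2 ^ (s + δ))) * nrm r Ψ := by gcongr
      _ = _ := by ring
  refine (norm_sum_le _ _).trans ((Finset.sum_le_card_nsmul _ _ _ h1).trans_eq ?_)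
  rw [hX2]
  have hcard : (Finset.Icc (-1 : ℤ) 1).card = 3 := rfl
  rw [hcard, nsmul_eq_mul]
  push_cast; ring

/-! ### Summability of the blocks over all scales -/

/-- The size of a test function that controls the Bony product. -/
noncomputable def testSize (r : ℝ≥0∞) (Ψ : 𝓢(E n, ℂ)) : ℝ := nrm 1 Ψ + nrm r Ψ + nrm 1 (lap Ψ)

/-- The decay rate of the blocks of the Bony product. -/
noncomputable def bonyRate (s g δ : ℝ) : ℝ := 2 * min (min (1 - g - δ) (g - δ)) (s - δ)

theorem BonyExp.bonyRate_pos (he : BonyExp n l s g δ) : 0 < bonyRate s g δ := by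
  have h1 := he.δ_lt_s
  have h2 := he.δ_lt_g
  have h3 := he.δ_lt
  unfold bonyRate
  have : 0 < min (min (1 - g - δ) (g - δ)) (s - δ) :=
    lt_min (lt_min (by linarith) (by linarith)) (by linarith)
  linarith

theorem bonyRate_le (s g δ : ℝ) : bonyRate s g δ ≤ 2 * (1 - g - δ) ∧ bonyRate s g δ ≤ 2 * (g - δ) ∧
    bonyRate s g δ ≤ 2 * (s - δ) := by
  unfold bonyRate
  have h1 := min_le_left (min (1 - g - δ) (g - δ)) (s - δ)
  have h2 := min_le_right (min (1 - g - δ) (g - δ)) (s - δ)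
  have h3 := min_le_left (1 - g - δ) (g - δ)
  have h4 := min_le_right (1 - g - δ) (g - δ)
  exact ⟨by linarith, by linarith, by linarith⟩

/-- For j ≤ 0 both kinds of block use the L^1 norm of the test function; for j ≥ 0 the paraproduct
uses its Laplacian and the remainder uses s > δ. -/
theorem exists_block_le (h : IsLittlewoodPaleyPair χ φ) (he : BonyExp n l s g δ)
    [ENNReal.HolderTriple l l ρ] [ρ.HolderConjugate r] :
    ∃ C : ℝ, 0 ≤ C ∧ ∀ (u v : TD n) (A B : ℝ), BesovBound χ φ l s δ u A →
      BesovBound χ φ l s δ v B → ∀ (j : ℤ) (Ψ : 𝓢(E n, ℂ)),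
      ‖paraBlock χ φ u v j Ψ‖ ≤
        C * (A * B) * (2 : ℝ) ^ (-(bonyRate s g δ * |(j : ℝ)|)) * testSize r Ψ ∧
      ‖remBlock φ u v j Ψ‖ ≤
        C * (A * B) * (2 : ℝ) ^ (-(bonyRate s g δ * |(j : ℝ)|)) * testSize r Ψ := by
  obtain ⟨C₁, hC₁0, hC₁⟩ := exists_paraBlock_top_le h he
  obtain ⟨C₂, hC₂0, hC₂⟩ := exists_paraBlock_lap_le h he
  obtain ⟨C₃, hC₃0, hC₃⟩ := exists_remBlock_top_le h he
  obtain ⟨C₄, hC₄0, hC₄⟩ := exists_remBlock_le (χ := χ) (φ := φ) (ρ := ρ) (r := r) he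
  obtain ⟨hr1, hr2, hr3⟩ := bonyRate_le s g δ
  refine ⟨C₁ + C₂ + C₃ + C₄, by positivity, fun u v A B hu hv j Ψ => ?_⟩
  have hA := hu.nonneg
  have hB := hv.nonneg
  have n1 := nrm_nonneg 1 Ψ
  have n2 := nrm_nonneg r Ψ
  have n3 := nrm_nonneg 1 (lap Ψ)
  set X := (2 : ℝ) ^ (-(bonyRate s g δ * |(j : ℝ)|)) with hX
  have key : ∀ (c e N : ℝ), 0 ≤ c → c ≤ C₁ + C₂ + C₃ + C₄ → 0 ≤ N → N ≤ testSize r Ψ →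
      e ≤ -(bonyRate s g δ * |(j : ℝ)|) → c * (A * B) * (2 : ℝ) ^ e * N ≤
        (C₁ + C₂ + C₃ + C₄) * (A * B) * X * testSize r Ψ := by
    intro c e N hc hcC hN hNt hee
    have := two_rpow_le_of_le hee
    gcongr
  have t1 : nrm 1 Ψ ≤ testSize r Ψ := by unfold testSize; linarith
  have t2 : nrm r Ψ ≤ testSize r Ψ := by unfold testSize; linarith
  have t3 : nrm 1 (lap Ψ) ≤ testSize r Ψ := by unfold testSize; linarith
  rcases le_total (j : ℝ) 0 with hj | hj
  · have hexp : 2 * ((j : ℝ) * (1 - g) + δ * |(j : ℝ)|) ≤ -(bonyRate s g δ * |(j : ℝ)|) := by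
      rw [abs_of_nonpos hj]; nlinarith
    exact ⟨(hC₁ u v A B hu hv j Ψ).trans (key _ _ _ hC₁0 (by linarith) n1 t1 hexp),
      (hC₃ u v A B hu hv j Ψ).trans (key _ _ _ hC₃0 (by linarith) n1 t1 hexp)⟩
  · refine ⟨(hC₂ u v A B hu hv j Ψ).trans (key _ _ _ hC₂0 (by linarith) n3 t3 ?_),
      (hC₄ u v A B hu hv j Ψ).trans (key _ _ _ hC₄0 (by linarith) n2 t2 ?_)⟩
    · rw [abs_of_nonneg hj]; nlinarith
    · rw [abs_of_nonneg hj]; nlinarith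

/-! ### Blocks tested against functions with annular spectrum -/

/-- The test function has its spectrum in the `m`-th dyadic annulus. -/
def AnnularSpectrum (m : ℤ) (Ψ : 𝓢(E n, ℂ)) : Prop := ∀ ξ, (𝓕 Ψ : 𝓢(E n, ℂ)) ξ ≠ 0 →
  3 / 4 * 2 ^ m < 2 * Real.pi * ‖ξ‖ ∧ 2 * Real.pi * ‖ξ‖ < 8 / 3 * 2 ^ m

theorem two_zpow_mul_le {j m : ℤ} (k : ℕ) (h : j + k ≤ m) : (2 : ℝ) ^ j * 2 ^ k ≤ 2 ^ m := by
  rw [← zpow_natCast, ← zpow_add₀ (by norm_num)]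
  exact zpow_le_zpow_right₀ (by norm_num) h

theorem paraBlock_eq_zero (h : IsLittlewoodPaleyPair χ φ) (he : BonyExp n l s g δ) {u v : TD n}
    {A B : ℝ} (hu : BesovBound χ φ l s δ u A) (hv : BesovBound χ φ l s δ v B) {j m : ℤ}
    {Ψ : 𝓢(E n, ℂ)} (hΨ : AnnularSpectrum m Ψ) (hjm : 6 < |j - m|) :
    paraBlock χ φ u v j Ψ = 0 := by
  obtain ⟨C₃, hC₃0, hC₃⟩ := exists_low_top_le h he
  obtain ⟨C₄, hC₄0, hC₄⟩ := exists_high_top_le h he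
  refine h.low_high_eq_zero j (hC₃ u A hu j).1 (hC₄ v B hv j).1 fun ξ hξ => ?_
  obtain ⟨h1, h2⟩ := hΨ ξ hξ
  rcases lt_abs.1 hjm with h3 | h3
  · left
    have := two_zpow_mul_le (j := m) (m := j) 7 (by push_cast; omega)
    have hp : (0 : ℝ) < 2 ^ m := by positivity
    linarith
  · right
    have := two_zpow_mul_le (j := j) (m := m) 7 (by push_cast; omega)
    have hp : (0 : ℝ) < 2 ^ j := by positivity
    linarith

theorem remBlock_eq_zero (h : IsLittlewoodPaleyPair χ φ) (he : BonyExp n l s g δ) {u v : TD n}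
    {A B : ℝ} (hu : BesovBound χ φ l s δ u A) (hv : BesovBound χ φ l s δ v B) {j m : ℤ}
    {Ψ : 𝓢(E n, ℂ)} (hΨ : AnnularSpectrum m Ψ) (hjm : j < m - 6) :
    remBlock φ u v j Ψ = 0 := by
  obtain ⟨C₄, hC₄0, hC₄⟩ := exists_high_top_le h he
  refine Finset.sum_eq_zero fun ν hν => ?_
  rw [Finset.mem_Icc] at hν
  refine h.high_high_eq_zero j ν hν.1 (hC₄ u A hu j).1 (hC₄ v B hv _).1 fun ξ hξ => ?_
  obtain ⟨h1, h2⟩ := hΨ ξ hξ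
  have := two_zpow_mul_le (j := j) (m := m) 7 (by push_cast; omega)
  have hp : (0 : ℝ) < 2 ^ j := by positivity
  linarith

/-- The size of a test function with spectrum in the `m`-th annulus that controls the Bony
product. -/
noncomputable def annSize (s g δ : ℝ) (q r : ℝ≥0∞) (m : ℤ) (Ψ : 𝓢(E n, ℂ)) : ℝ :=
  (2 : ℝ) ^ ((m : ℝ) * (1 - g - s) + 2 * δ * |(m : ℝ)|) * nrm q Ψ +
    (2 : ℝ) ^ (2 * (-((m : ℝ) * s) + δ * |(m : ℝ)|)) * nrm r Ψ

/-- Paraproduct blocks survive only for |j - m| ≤ 6, so weights at j and at m are comparable.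
Remainder blocks survive for all j ≥ m - 6 and decay away from m because s > δ. -/
theorem exists_block_ann_le (h : IsLittlewoodPaleyPair χ φ) (he : BonyExp n l s g δ)
    [ENNReal.HolderTriple l l ρ] [ρ.HolderConjugate r] [l.HolderConjugate q] :
    ∃ C : ℝ, 0 ≤ C ∧ ∀ (u v : TD n) (A B : ℝ), BesovBound χ φ l s δ u A →
      BesovBound χ φ l s δ v B → ∀ (j m : ℤ) (Ψ : 𝓢(E n, ℂ)), AnnularSpectrum m Ψ →
      ‖paraBlock χ φ u v j Ψ‖ ≤ C * (A * B) *
        (2 : ℝ) ^ (-(bonyRate s g δ * |(((j - m : ℤ)) : ℝ)|)) * annSize s g δ q r m Ψ ∧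
      ‖remBlock φ u v j Ψ‖ ≤ C * (A * B) *
        (2 : ℝ) ^ (-(bonyRate s g δ * |(((j - m : ℤ)) : ℝ)|)) * annSize s g δ q r m Ψ := by
  obtain ⟨C₁, hC₁0, hC₁⟩ := exists_paraBlock_le (q := q) h he
  obtain ⟨C₄, hC₄0, hC₄⟩ := exists_remBlock_le (χ := χ) (φ := φ) (ρ := ρ) (r := r) he
  obtain ⟨hr1, hr2, hr3⟩ := bonyRate_le s g δ
  have hrate := he.bonyRate_pos
  have hδ := he.δ_pos
  have hδs := he.δ_lt_s
  -- 2^D pays for moving the weights across at most six scales. In D' the number is 24 s since, for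
  -- x = j - m ≥ -6, the sum -2xs + 2s|x| is at most 24 s.
  set D : ℝ := 6 * (|1 - g - s| + 2 * δ + bonyRate s g δ) with hD
  set D' : ℝ := 24 * s with hD'
  refine ⟨C₁ * 2 ^ D + C₄ * 2 ^ D', by positivity, fun u v A B hu hv j m Ψ hΨ => ?_⟩
  have hA := hu.nonneg
  have hB := hv.nonneg
  have n1 := nrm_nonneg q Ψ
  have n2 := nrm_nonneg r Ψ
  set Y := (2 : ℝ) ^ ((m : ℝ) * (1 - g - s) + 2 * δ * |(m : ℝ)|) with hY
  set Z := (2 : ℝ) ^ (2 * (-((m : ℝ) * s) + δ * |(m : ℝ)|)) with hZ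
  set X := (2 : ℝ) ^ (-(bonyRate s g δ * |(((j - m : ℤ)) : ℝ)|)) with hX
  have hY0 : 0 < Y := by positivity
  have hZ0 : 0 < Z := by positivity
  have hX0 : 0 < X := by positivity
  have hann : annSize s g δ q r m Ψ = Y * nrm q Ψ + Z * nrm r Ψ := rfl
  rw [hann]
  have habs : |(j : ℝ)| ≤ |(m : ℝ)| + |((j - m : ℤ) : ℝ)| := by
    have := abs_add_le (m : ℝ) ((j - m : ℤ) : ℝ)
    push_cast at this ⊢
    rwa [add_sub_cancel] at this
  have hδabs := mul_le_mul_of_nonneg_left habs hδ.le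
  constructor
  · by_cases hjm : 6 < |j - m|
    · rw [paraBlock_eq_zero h he hu hv hΨ hjm, norm_zero]
      positivity
    · have h6 : |((j - m : ℤ) : ℝ)| ≤ 6 := by
        rw [← Int.cast_abs]; exact_mod_cast not_lt.1 hjm
      have h1 : (2 : ℝ) ^ ((j : ℝ) * (1 - g - s) + 2 * δ * |(j : ℝ)|) ≤ 2 ^ D * X * Y := by
        rw [hX, hY, ← Real.rpow_add (by norm_num), ← Real.rpow_add (by norm_num)]
        refine two_rpow_le_of_le ?_
        have h2 : ((j - m : ℤ) : ℝ) * (1 - g - s) ≤ |((j - m : ℤ) : ℝ)| * |1 - g - s| := by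
          rw [← abs_mul]; exact le_abs_self _
        have h3 : |((j - m : ℤ) : ℝ)| * |1 - g - s| ≤ 6 * |1 - g - s| := by gcongr
        have h4 : bonyRate s g δ * |((j - m : ℤ) : ℝ)| ≤ bonyRate s g δ * 6 := by gcongr
        have h5 : δ * |((j - m : ℤ) : ℝ)| ≤ δ * 6 := by gcongr
        have h7 : ((j - m : ℤ) : ℝ) = j - m := by push_cast; ring
        rw [h7] at h2 h3 h4 h5 hδabs ⊢
        rw [hD]
        linarith
      calc _ ≤ _ := hC₁ u v A B hu hv j Ψ
        _ ≤ C₁ * (A * B) * (2 ^ D * X * Y) * nrm q Ψ := by gcongr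
        _ = (C₁ * 2 ^ D) * (A * B) * X * (Y * nrm q Ψ) := by ring
        _ ≤ _ := by
          gcongr
          · exact le_add_of_nonneg_right (by positivity)
          · exact le_add_of_nonneg_right (by positivity)
  · by_cases hjm : j < m - 6
    · rw [remBlock_eq_zero h he hu hv hΨ hjm, norm_zero]
      positivity
    · have h6 : -6 ≤ (j : ℝ) - m := by
        have : -6 ≤ j - m := by omega
        exact_mod_cast this
      have h1 : (2 : ℝ) ^ (2 * (-((j : ℝ) * s) + δ * |(j : ℝ)|)) ≤ 2 ^ D' * X * Z := by
        rw [hX, hZ, ← Real.rpow_add (by norm_num), ← Real.rpow_add (by norm_num)]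
        refine two_rpow_le_of_le ?_
        have h7 : ((j - m : ℤ) : ℝ) = j - m := by push_cast; ring
        rw [h7] at hδabs ⊢
        have h8 : bonyRate s g δ * |(j : ℝ) - m| ≤ 2 * (s - δ) * |(j : ℝ) - m| := by gcongr
        have h9 : -((j : ℝ) - m) * s + s * |(j : ℝ) - m| ≤ 12 * s := by
          rcases le_total ((j : ℝ) - m) 0 with h0 | h0
          · rw [abs_of_nonpos h0]; nlinarith
          · rw [abs_of_nonneg h0]; nlinarith
        rw [hD']
        linarith
      calc _ ≤ _ := hC₄ u v A B hu hv j Ψ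
        _ ≤ C₄ * (A * B) * (2 ^ D' * X * Z) * nrm r Ψ := by gcongr
        _ = (C₄ * 2 ^ D') * (A * B) * X * (Z * nrm r Ψ) := by ring
        _ ≤ _ := by
          gcongr
          · exact le_add_of_nonneg_left (by positivity)
          · exact le_add_of_nonneg_left (by positivity)

end Blocks

end MildNS


namespace MildNS

variable {n : ℕ}

/-! ### The Bony product as a distribution -/

theorem exists_testSize_seminorm {r : ℝ≥0∞} (hr : 1 ≤ r) :
    ∃ p : Seminorm ℂ 𝓢(E n, ℂ), Continuous p ∧ ∀ Ψ, p Ψ = testSize r Ψ := by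
  obtain ⟨p₁, hc₁, hp₁⟩ := exists_seminorm_nrm (n := n) (le_refl (1 : ℝ≥0∞))
  obtain ⟨p₂, hc₂, hp₂⟩ := exists_seminorm_nrm (n := n) hr
  refine ⟨p₁ + p₂ + p₁.comp (lap (n := n)).toLinearMap,
    (hc₁.add hc₂).add (hc₁.comp (lap (n := n)).continuous), fun Ψ => ?_⟩
  unfold testSize
  rw [← hp₁, ← hp₂, ← hp₁]
  rfl

section Bony

variable {χ φ : E n → ℝ} {l ρ r q : ℝ≥0∞} {s g δ : ℝ}

/-- The `j`-th block of the Bony product, tested against `G`. -/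
noncomputable def bonyBlock (χ φ : E n → ℝ) (u v : TD n) (j : ℤ) (G : E n → ℂ) : ℂ :=
  paraBlock χ φ u v j G + paraBlock χ φ v u j G + remBlock φ u v j G

theorem hasSum_paraproduct (h : IsLittlewoodPaleyPair χ φ) (he : BonyExp n l s g δ)
    [ENNReal.HolderTriple l l ρ] [ρ.HolderConjugate r] (hr : 1 ≤ r) {u v : TD n} {A B : ℝ}
    (hu : BesovBound χ φ l s δ u A) (hv : BesovBound χ φ l s δ v B) (Ψ : 𝓢(E n, ℂ)) :
    HasSum (fun j => paraBlock χ φ u v j Ψ) (paraproduct χ φ u v Ψ) := by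
  obtain ⟨C₃, hC₃0, hC₃⟩ := exists_low_top_le h he
  obtain ⟨C₄, hC₄0, hC₄⟩ := exists_high_top_le h he
  obtain ⟨C, hC0, hC⟩ := exists_block_le (ρ := ρ) (r := r) h he
  obtain ⟨p, hpc, hp⟩ := exists_testSize_seminorm (n := n) hr
  have h1 : ∀ (j : ℤ) (Ψ : 𝓢(E n, ℂ)), pmul (dyadic χ (j - 1) u) (dyadic φ j v) Ψ =
      paraBlock χ φ u v j Ψ := fun j Ψ =>
    pmul_apply (ρ := ⊤) le_top (hC₃ u A hu j).1 (hC₄ v B hv j).1 Ψ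
  have h2 := td_hasSum (w := fun j => pmul (dyadic χ (j - 1) u) (dyadic φ j v)) hpc
    ((summable_two_rpow_neg_abs he.bonyRate_pos).mul_left (C * (A * B)))
    (fun j Ψ => by rw [h1, hp]; exact (hC u v A B hu hv j Ψ).1) Ψ
  simp only [h1] at h2
  exact h2

theorem hasSum_remainder (h : IsLittlewoodPaleyPair χ φ) (he : BonyExp n l s g δ)
    [ENNReal.HolderTriple l l ρ] [ρ.HolderConjugate r] (hr : 1 ≤ r) {u v : TD n} {A B : ℝ}
    (hu : BesovBound χ φ l s δ u A) (hv : BesovBound χ φ l s δ v B) (Ψ : 𝓢(E n, ℂ)) :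
    HasSum (fun j => remBlock φ u v j Ψ) (remainder φ u v Ψ) := by
  obtain ⟨C₄, hC₄0, hC₄⟩ := exists_high_top_le h he
  obtain ⟨C, hC0, hC⟩ := exists_block_le (ρ := ρ) (r := r) h he
  obtain ⟨p, hpc, hp⟩ := exists_testSize_seminorm (n := n) hr
  have h1 : ∀ (j : ℤ) (Ψ : 𝓢(E n, ℂ)),
      (∑ ν ∈ Finset.Icc (-1 : ℤ) 1, pmul (dyadic φ j u) (dyadic φ (j - ν) v)) Ψ =
      remBlock φ u v j Ψ := fun j Ψ => by
    have h3 : ∀ S : Finset ℤ, (∑ ν ∈ S, pmul (dyadic φ j u) (dyadic φ (j - ν) v)) Ψ =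
        ∑ ν ∈ S, tri (dyadic φ j u) (dyadic φ (j - ν) v) Ψ := fun S => by
      induction S using Finset.induction_on with
      | empty => simp
      | insert a S ha ih =>
        rw [Finset.sum_insert ha, Finset.sum_insert ha, ← ih, _root_.add_apply,
          pmul_apply (ρ := ⊤) le_top (hC₄ u A hu j).1 (hC₄ v B hv _).1 Ψ]
    exact h3 _
  have h2 := td_hasSum
    (w := fun j => ∑ ν ∈ Finset.Icc (-1 : ℤ) 1, pmul (dyadic φ j u) (dyadic φ (j - ν) v)) hpc
    ((summable_two_rpow_neg_abs he.bonyRate_pos).mul_left (C * (A * B)))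
    (fun j Ψ => by rw [h1, hp]; exact (hC u v A B hu hv j Ψ).2) Ψ
  simp only [h1] at h2
  exact h2

theorem hasSum_bony (h : IsLittlewoodPaleyPair χ φ) (he : BonyExp n l s g δ)
    [ENNReal.HolderTriple l l ρ] [ρ.HolderConjugate r] (hr : 1 ≤ r) {u v : TD n} {A B : ℝ}
    (hu : BesovBound χ φ l s δ u A) (hv : BesovBound χ φ l s δ v B) (Ψ : 𝓢(E n, ℂ)) :
    HasSum (fun j => bonyBlock χ φ u v j Ψ) (bony χ φ u v Ψ) :=
  ((hasSum_paraproduct (ρ := ρ) (r := r) h he hr hu hv Ψ).add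
    (hasSum_paraproduct (ρ := ρ) (r := r) h he hr hv hu Ψ)).add
    (hasSum_remainder (ρ := ρ) (r := r) h he hr hu hv Ψ)

theorem summable_shift {ε : ℝ} (hε : 0 < ε) (m : ℤ) :
    HasSum (fun j : ℤ => (2 : ℝ) ^ (-(ε * |((j - m : ℤ) : ℝ)|)))
      (∑' j : ℤ, (2 : ℝ) ^ (-(ε * |(j : ℝ)|))) :=
  (Equiv.subRight m).hasSum_iff.2 (summable_two_rpow_neg_abs hε).hasSum

/-- The first bound holds for all test functions and makes the outer series converge in 𝓢'. The
second, for one frequency annulus, has the right powers of 2^m for the smoothing estimate. -/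
theorem exists_bony_le (h : IsLittlewoodPaleyPair χ φ) (he : BonyExp n l s g δ)
    [ENNReal.HolderTriple l l ρ] [ρ.HolderConjugate r] (hr : 1 ≤ r) [l.HolderConjugate q] :
    ∃ C : ℝ, 0 ≤ C ∧ ∀ (u v : TD n) (A B : ℝ), BesovBound χ φ l s δ u A →
      BesovBound χ φ l s δ v B → ∀ Ψ : 𝓢(E n, ℂ),
      ‖bony χ φ u v Ψ‖ ≤ C * (A * B) * testSize r Ψ ∧
      ∀ m : ℤ, AnnularSpectrum m Ψ → ‖bony χ φ u v Ψ‖ ≤ C * (A * B) * annSize s g δ q r m Ψ := by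
  obtain ⟨C₁, hC₁0, hC₁⟩ := exists_block_le (ρ := ρ) (r := r) h he
  obtain ⟨C₂, hC₂0, hC₂⟩ := exists_block_ann_le (ρ := ρ) (r := r) (q := q) h he
  set S := ∑' j : ℤ, (2 : ℝ) ^ (-(bonyRate s g δ * |(j : ℝ)|)) with hS
  have hS0 : 0 ≤ S := tsum_nonneg fun j => by positivity
  refine ⟨3 * (C₁ + C₂) * S, by positivity, fun u v A B hu hv Ψ => ?_⟩
  have hA := hu.nonneg
  have hB := hv.nonneg
  have hsum := hasSum_bony (ρ := ρ) (r := r) h he hr hu hv Ψ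
  have n1 := nrm_nonneg 1 Ψ
  have n2 := nrm_nonneg r Ψ
  have n3 := nrm_nonneg 1 (lap Ψ)
  have n4 := nrm_nonneg q Ψ
  constructor
  · have hT : 0 ≤ testSize r Ψ := by unfold testSize; positivity
    have h1 : ∀ j, ‖bonyBlock χ φ u v j Ψ‖ ≤ (3 * C₁ * (A * B) * testSize r Ψ) *
        (2 : ℝ) ^ (-(bonyRate s g δ * |(j : ℝ)|)) := fun j => by
      have a1 := (hC₁ u v A B hu hv j Ψ).1
      have a2 := (hC₁ v u B A hv hu j Ψ).1
      have a3 := (hC₁ u v A B hu hv j Ψ).2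
      have a4 := norm_add₃_le (a := paraBlock χ φ u v j Ψ) (b := paraBlock χ φ v u j Ψ)
        (c := remBlock φ u v j Ψ)
      rw [mul_comm B A] at a2
      unfold bonyBlock
      linarith
    have h2 := tsum_of_norm_bounded
      ((summable_two_rpow_neg_abs he.bonyRate_pos).hasSum.mul_left _) h1
    rw [hsum.tsum_eq] at h2
    refine h2.trans ?_
    calc _ = 3 * C₁ * S * (A * B) * testSize r Ψ := by ring
      _ ≤ _ := by gcongr; linarith
  · intro m hΨ
    have hT : 0 ≤ annSize s g δ q r m Ψ := by unfold annSize; positivity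
    have h1 : ∀ j : ℤ, ‖bonyBlock χ φ u v j Ψ‖ ≤ (3 * C₂ * (A * B) * annSize s g δ q r m Ψ) *
        (2 : ℝ) ^ (-(bonyRate s g δ * |((j - m : ℤ) : ℝ)|)) := fun j => by
      have a1 := (hC₂ u v A B hu hv j m Ψ hΨ).1
      have a2 := (hC₂ v u B A hv hu j m Ψ hΨ).1
      have a3 := (hC₂ u v A B hu hv j m Ψ hΨ).2
      have a4 := norm_add₃_le (a := paraBlock χ φ u v j Ψ) (b := paraBlock χ φ v u j Ψ)
        (c := remBlock φ u v j Ψ)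
      rw [mul_comm B A] at a2
      unfold bonyBlock
      linarith
    have h2 := tsum_of_norm_bounded ((summable_shift he.bonyRate_pos m).mul_left _) h1
    rw [hsum.tsum_eq] at h2
    refine h2.trans ?_
    calc _ = 3 * C₂ * S * (A * B) * annSize s g δ q r m Ψ := by ring
      _ ≤ _ := by gcongr; linarith

theorem BesovBound.sub {u v : TD n} {A B : ℝ} (hl : 1 ≤ l) (hu : BesovBound χ φ l s δ u A)
    (hv : BesovBound χ φ l s δ v B) : BesovBound χ φ l s δ (u - v) (A + B) where
  low := by
    have h1 := hu.low.add hv.low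
    rw [add_zero] at h1
    refine tendsto_of_tendsto_of_tendsto_of_le_of_le tendsto_const_nhds h1 (fun _ => zero_le)
      fun j => ?_
    simp only [map_sub]
    exact lpNorm_sub_le le_top _ _
  nonneg := add_nonneg hu.nonneg hv.nonneg
  mem j := by rw [map_sub]; exact (hu.mem j).sub (hv.mem j)
  le j := by
    rw [map_sub, add_mul, ENNReal.ofReal_add (mul_nonneg hu.nonneg (by positivity))
      (mul_nonneg hv.nonneg (by positivity))]
    exact (lpNorm_sub_le hl _ _).trans (add_le_add (hu.le j) (hv.le j))

theorem paraBlock_sub (h : IsLittlewoodPaleyPair χ φ) (he : BonyExp n l s g δ) {u v u' v' : TD n}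
    {A B A' B' : ℝ} (hu : BesovBound χ φ l s δ u A) (hv : BesovBound χ φ l s δ v B)
    (hu' : BesovBound χ φ l s δ u' A') (hv' : BesovBound χ φ l s δ v' B') (j : ℤ)
    (Ψ : 𝓢(E n, ℂ)) : paraBlock χ φ u u' j Ψ - paraBlock χ φ v v' j Ψ =
      paraBlock χ φ (u - v) u' j Ψ + paraBlock χ φ v (u' - v') j Ψ := by
  obtain ⟨C₃, hC₃0, hC₃⟩ := exists_low_top_le h he
  obtain ⟨C₄, hC₄0, hC₄⟩ := exists_high_top_le h he
  unfold paraBlock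
  rw [map_sub, map_sub]
  exact tri_sub_tri (ρ := ⊤) (r := 1) (hC₃ u A hu j).1 (hC₃ v B hv j).1 (hC₄ u' A' hu' j).1
    (hC₄ v' B' hv' j).1 (Ψ.memLp 1 volume)

theorem paraBlock_sub_right (h : IsLittlewoodPaleyPair χ φ) (he : BonyExp n l s g δ) {u v u' v' : TD n}
    {A B A' B' : ℝ} (hu : BesovBound χ φ l s δ u A) (hv : BesovBound χ φ l s δ v B)
    (hu' : BesovBound χ φ l s δ u' A') (hv' : BesovBound χ φ l s δ v' B') (j : ℤ)
    (Ψ : 𝓢(E n, ℂ)) : paraBlock χ φ u u' j Ψ - paraBlock χ φ v v' j Ψ =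
      paraBlock χ φ u (u' - v') j Ψ + paraBlock χ φ (u - v) v' j Ψ := by
  obtain ⟨C₃, hC₃0, hC₃⟩ := exists_low_top_le h he
  obtain ⟨C₄, hC₄0, hC₄⟩ := exists_high_top_le h he
  unfold paraBlock
  rw [map_sub, map_sub]
  exact tri_sub_tri_right (ρ := ⊤) (r := 1) (hC₃ u A hu j).1 (hC₃ v B hv j).1 (hC₄ u' A' hu' j).1
    (hC₄ v' B' hv' j).1 (Ψ.memLp 1 volume)

theorem remBlock_sub (h : IsLittlewoodPaleyPair χ φ) (he : BonyExp n l s g δ) {u v u' v' : TD n}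
    {A B A' B' : ℝ} (hu : BesovBound χ φ l s δ u A) (hv : BesovBound χ φ l s δ v B)
    (hu' : BesovBound χ φ l s δ u' A') (hv' : BesovBound χ φ l s δ v' B') (j : ℤ)
    (Ψ : 𝓢(E n, ℂ)) : remBlock φ u u' j Ψ - remBlock φ v v' j Ψ =
      remBlock φ (u - v) u' j Ψ + remBlock φ v (u' - v') j Ψ := by
  obtain ⟨C₄, hC₄0, hC₄⟩ := exists_high_top_le h he
  unfold remBlock
  rw [← Finset.sum_sub_distrib, ← Finset.sum_add_distrib]
  refine Finset.sum_congr rfl fun ν _ => ?_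
  rw [map_sub, map_sub]
  exact tri_sub_tri (ρ := ⊤) (r := 1) (hC₄ u A hu j).1 (hC₄ v B hv j).1 (hC₄ u' A' hu' _).1
    (hC₄ v' B' hv' _).1 (Ψ.memLp 1 volume)

theorem bony_sub (h : IsLittlewoodPaleyPair χ φ) (he : BonyExp n l s g δ)
    [ENNReal.HolderTriple l l ρ] [ρ.HolderConjugate r] (hr : 1 ≤ r) {u v u' v' : TD n}
    {A B A' B' : ℝ} (hu : BesovBound χ φ l s δ u A) (hv : BesovBound χ φ l s δ v B)
    (hu' : BesovBound χ φ l s δ u' A') (hv' : BesovBound χ φ l s δ v' B') (Ψ : 𝓢(E n, ℂ)) :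
    bony χ φ u u' Ψ - bony χ φ v v' Ψ = bony χ φ (u - v) u' Ψ + bony χ φ v (u' - v') Ψ := by
  have h1 := (hasSum_bony (ρ := ρ) (r := r) h he hr hu hu' Ψ).sub
    (hasSum_bony (ρ := ρ) (r := r) h he hr hv hv' Ψ)
  have h2 := (hasSum_bony (ρ := ρ) (r := r) h he hr (hu.sub he.one_le hv) hu' Ψ).add
    (hasSum_bony (ρ := ρ) (r := r) h he hr hv (hu'.sub he.one_le hv') Ψ)
  refine h1.unique ((congrArg (HasSum · _) (funext fun j => ?_)).mpr h2)
  have e1 := paraBlock_sub h he hu hv hu' hv' j Ψ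
  have e2 := paraBlock_sub_right h he hu' hv' hu hv j Ψ
  have e3 := remBlock_sub h he hu hv hu' hv' j Ψ
  unfold bonyBlock
  linear_combination e1 + e2 + e3

end Bony

end MildNS


namespace MildNS

variable {n : ℕ}

/-! ### The Leray divergence of the Bony product -/

theorem exists_td_of_continuous {L : 𝓢(E n, ℂ) → ℂ} (hadd : ∀ φ ψ, L (φ + ψ) = L φ + L ψ)
    (hsmul : ∀ (c : ℂ) φ, L (c • φ) = c * L φ) (hL : Continuous L) :
    ∃ w : TD n, ∀ φ, w φ = L φ :=
  ⟨(⟨⟨⟨L, hadd⟩, hsmul⟩, hL⟩ : 𝓢(E n, ℂ) →L[ℂ] ℂ), fun _ => rfl⟩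

theorem nrm_one_eq (ψ : 𝓢(E n, ℂ)) : nrm 1 ψ = ∫ x, ‖ψ x‖ := by
  unfold nrm
  rw [eLpNorm_one_eq_lintegral_enorm, integral_norm_eq_lintegral_enorm
    ψ.continuous.aestronglyMeasurable]

variable {χ φ : E n → ℝ}

/-- Sum and integral may be exchanged because w is bounded and the L^1 norms of the pieces are
summable. -/
theorem hasSum_apply_lam (h : IsLittlewoodPaleyPair χ φ) {w : TD n} (hw : InLp ⊤ w)
    (i j k : Fin n) (ψ : 𝓢(E n, ℂ)) :
    HasSum (fun p => w (lam h.isAnnular_high i j k p ψ))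
      (∫ x, toFun w x * lerayGrad i j k ψ x) := by
  obtain ⟨C, hC0, hC⟩ := exists_nrm_lam_le h.isAnnular_high i j k (le_refl (1 : ℝ≥0∞))
  set K := (eLpNorm (toFun w) ⊤ volume).toReal with hK
  have hint : ∀ p : ℤ, Integrable fun x => toFun w x * lam h.isAnnular_high i j k p ψ x := fun p =>
    integrable_mul_of_memLp (p := ⊤) (q := 1) hw.memLp (SchwartzMap.memLp _ 1 volume)
  have hle : ∀ p : ℤ, ∫ x, ‖toFun w x * lam h.isAnnular_high i j k p ψ x‖ ≤
      K * (C * (2 : ℝ) ^ (-|(p : ℝ)|) * (nrm 1 ψ + nrm 1 (lap ψ))) := fun p => by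
    refine le_trans ?_ (mul_le_mul_of_nonneg_left (hC p ψ) ENNReal.toReal_nonneg)
    rw [nrm_one_eq, ← integral_const_mul]
    refine integral_mono_ae (hint p).norm
      (((lam h.isAnnular_high i j k p ψ).integrable).norm.const_mul _) ?_
    filter_upwards [norm_le_of_memLp_top hw.memLp] with x hx
    rw [norm_mul]
    gcongr
  have hs := summable_two_rpow_neg_abs one_pos
  simp only [one_mul] at hs
  have h1 := hasSum_integral_of_summable_integral_norm hint (Summable.of_nonneg_of_le
    (fun p => integral_nonneg fun x => norm_nonneg _) hle
    (((hs.mul_left C).mul_right _).mul_left K))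
  have h2 : ∀ x, ∑' p, toFun w x * lam h.isAnnular_high i j k p ψ x =
      toFun w x * lerayGrad i j k ψ x := fun x =>
    ((hasSum_lam h i j k ψ x).mul_left _).tsum_eq
  simp only [h2] at h1
  refine (congrArg (HasSum · _) (funext fun p => ?_)).mpr h1
  rw [hw.apply le_top]

theorem symS_mul_symS_eq_zero (h : IsLittlewoodPaleyPair χ φ) {m p : ℤ} (hmp : 2 ≤ |m - p|)
    (ξ : E n) : symS h.isAnnular_high.toIsCutoff ((2 : ℝ) ^ (-m) • ξ) *
      symS h.isAnnular_high.toIsCutoff ((2 : ℝ) ^ (-p) • ξ) = 0 := by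
  by_contra hne
  obtain ⟨h1, h2⟩ := mul_ne_zero_iff.1 hne
  obtain ⟨a1, a2⟩ := h.high_ne_zero h1
  obtain ⟨b1, b2⟩ := h.high_ne_zero h2
  have hm : (0 : ℝ) < 2 ^ m := by positivity
  have hp : (0 : ℝ) < 2 ^ p := by positivity
  rcases le_abs.1 hmp with h3 | h3
  · have := two_zpow_mul_le (j := p) (m := m) 2 (by push_cast; omega)
    linarith
  · have := two_zpow_mul_le (j := m) (m := p) 2 (by push_cast; omega)
    linarith

theorem dyS_lam_eq_zero (h : IsLittlewoodPaleyPair χ φ) {m p : ℤ} (hmp : 2 ≤ |m - p|)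
    (i j k : Fin n) (ψ : 𝓢(E n, ℂ)) :
    dyS h.isAnnular_high.toIsCutoff m (lam h.isAnnular_high i j k p ψ) = 0 := by
  refine ext_of_fourier fun ξ => ?_
  rw [fourier_dyS, fourier_lam, ← mul_assoc, symS_mul_symS_eq_zero h hmp,
    FourierTransform.fourier_zero, zero_mul, _root_.zero_apply]

theorem lam_dyS_eq_zero (h : IsLittlewoodPaleyPair χ φ) {m p : ℤ} (hmp : 2 ≤ |m - p|)
    (i j k : Fin n) (ψ : 𝓢(E n, ℂ)) :
    lam h.isAnnular_high i j k m (dyS h.isAnnular_high.toIsCutoff p ψ) = 0 := by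
  refine ext_of_fourier fun ξ => ?_
  rw [fourier_lam, fourier_dyS, FourierTransform.fourier_zero, _root_.zero_apply]
  have := symS_mul_symS_eq_zero h hmp ξ
  linear_combination (lsym i j k ξ * (𝓕 ψ : 𝓢(E n, ℂ)) ξ) * this

/-- Only the neighbours |p - m| ≤ 1 overlap the m-th annulus, and there they add up to 1. The series
is therefore finite, and V may be any distribution. -/
theorem hasSum_dyS_lam (h : IsLittlewoodPaleyPair χ φ) (V : TD n) (m : ℤ) (i j k : Fin n)
    (ψ : 𝓢(E n, ℂ)) :
    HasSum (fun p => V (dyS h.isAnnular_high.toIsCutoff m (lam h.isAnnular_high i j k p ψ)))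
      (V (lam h.isAnnular_high i j k m ψ)) := by
  have hout : ∀ p ∉ Finset.Icc (m - 1) (m + 1), 2 ≤ |m - p| := fun p hp => by
    rw [Finset.mem_Icc] at hp
    rw [le_abs]
    omega
  have h1 : lam h.isAnnular_high i j k m ψ = ∑ p ∈ Finset.Icc (m - 1) (m + 1),
      dyS h.isAnnular_high.toIsCutoff m (lam h.isAnnular_high i j k p ψ) := by
    refine ext_of_fourier fun ξ => ?_
    rw [FourierTransform.fourier_sum]
    have hsum : ∀ S : Finset ℤ, (∑ p ∈ S,
        (𝓕 (dyS h.isAnnular_high.toIsCutoff m (lam h.isAnnular_high i j k p ψ)) :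
          𝓢(E n, ℂ))) ξ = ∑ p ∈ S, (𝓕 (dyS h.isAnnular_high.toIsCutoff m
            (lam h.isAnnular_high i j k p ψ)) : 𝓢(E n, ℂ)) ξ := fun S => by
      rw [_root_.sum_apply]
    rw [hsum]
    simp only [fourier_dyS, fourier_lam]
    by_cases hξ : symS h.isAnnular_high.toIsCutoff ((2 : ℝ) ^ (-m) • ξ) = 0
    · simp only [hξ, zero_mul, Finset.sum_const_zero]
    · have hξ0 : ξ ≠ 0 := fun h0 => by
        have := (h.high_ne_zero hξ).1
        rw [h0, norm_zero, mul_zero] at this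
        have hm : (0 : ℝ) < 2 ^ m := by positivity
        linarith
      have h2 := h.hasSum_symS hξ0
      have h3 : ∑ p ∈ Finset.Icc (m - 1) (m + 1),
          symS h.isAnnular_high.toIsCutoff ((2 : ℝ) ^ (-p) • ξ) = 1 := by
        refine (hasSum_sum_of_ne_finset_zero fun p hp => ?_).unique h2
        have := symS_mul_symS_eq_zero h (hout p hp) ξ
        exact (mul_eq_zero.1 this).resolve_left hξ
      rw [← Finset.mul_sum, ← Finset.sum_mul, h3, one_mul]
  rw [h1, map_sum]
  exact hasSum_sum_of_ne_finset_zero fun p hp => by rw [dyS_lam_eq_zero h (hout p hp), map_zero]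

/-- On one frequency block the integral against ℙ∇ψ becomes an honest pairing of W with a Schwartz
function. Boundedness of the blocks is needed only to give the integral a meaning. -/
theorem lerayDiv_dyadic (h : IsLittlewoodPaleyPair χ φ) {W : Fin n → Fin n → TD n} (m : ℤ)
    (hW : ∀ j k, InLp ⊤ (dyadic φ m (W j k))) (i : Fin n) (ψ : 𝓢(E n, ℂ)) :
    lerayDiv (fun j k => dyadic φ m (W j k)) i ψ =
      -∑ j, ∑ k, W j k (lam h.isAnnular_high i j k m ψ) := by
  have h1 : ∀ ψ, -∑ j, ∑ k, ∫ x, toFun (dyadic φ m (W j k)) x * lerayGrad i j k ψ x =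
      -∑ j, ∑ k, W j k (lam h.isAnnular_high i j k m ψ) := fun ψ => by
    congr 1
    refine Finset.sum_congr rfl fun j _ => Finset.sum_congr rfl fun k _ => ?_
    refine (hasSum_apply_lam h (hW j k) i j k ψ).unique ?_
    simp only [h.high_apply]
    exact hasSum_dyS_lam h (W j k) m i j k ψ
  unfold lerayDiv
  simp only [h1]
  refine ofPairing_apply (exists_td_of_continuous (fun ψ θ => ?_) (fun c ψ => ?_) ?_) ψ
  · simp only [map_add, Finset.sum_add_distrib, neg_add]
  · simp only [map_smul, smul_eq_mul, mul_neg, Finset.mul_sum]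
  · refine Continuous.neg (continuous_finsetSum _ fun j _ => continuous_finsetSum _ fun k _ => ?_)
    exact (W j k).continuous.comp (lam h.isAnnular_high i j k m).continuous

theorem annularSpectrum_dyS (h : IsLittlewoodPaleyPair χ φ) (m : ℤ) (ψ : 𝓢(E n, ℂ)) :
    AnnularSpectrum m (dyS h.isAnnular_high.toIsCutoff m ψ) := fun ξ hξ => by
  rw [fourier_dyS] at hξ
  exact h.high_ne_zero (left_ne_zero_of_mul hξ)

theorem annularSpectrum_lam (h : IsLittlewoodPaleyPair χ φ) (i j k : Fin n) (m : ℤ)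
    (ψ : 𝓢(E n, ℂ)) : AnnularSpectrum m (lam h.isAnnular_high i j k m ψ) := fun ξ hξ => by
  rw [fourier_lam] at hξ
  exact h.high_ne_zero (left_ne_zero_of_mul hξ)

variable {l ρ r q : ℝ≥0∞} {s g δ : ℝ}

/-- The localized test function has annular spectrum, and Bernstein's inequality bounds its L^q and
L^r norms by its L^1 norm; duality with L^1 then gives a bounded function. -/
theorem inLp_dyadic_bony (h : IsLittlewoodPaleyPair χ φ) (he : BonyExp n l s g δ)
    [ENNReal.HolderTriple l l ρ] [ρ.HolderConjugate r] (hr : 1 ≤ r) [l.HolderConjugate q]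
    (hq : 1 ≤ q) {u v : TD n} {A B : ℝ} (hu : BesovBound χ φ l s δ u A)
    (hv : BesovBound χ φ l s δ v B) (m : ℤ) : InLp ⊤ (dyadic φ m (bony χ φ u v)) := by
  obtain ⟨C, hC0, hC⟩ := exists_bony_le (ρ := ρ) (r := r) (q := q) h he hr
  obtain ⟨C₁, hC₁0, hC₁⟩ := exists_nrm_dyS_le h.isAnnular_high.toIsCutoff le_rfl hq
  obtain ⟨C₂, hC₂0, hC₂⟩ := exists_nrm_dyS_le h.isAnnular_high.toIsCutoff le_rfl hr
  have hA := hu.nonneg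
  have hB := hv.nonneg
  refine (inLp_top_of_bound (C := C * (A * B) *
    ((2 : ℝ) ^ ((m : ℝ) * (1 - g - s) + 2 * δ * |(m : ℝ)|) *
        (C₁ * (2 : ℝ) ^ ((m : ℝ) * (n * invGap 1 q))) +
      (2 : ℝ) ^ (2 * (-((m : ℝ) * s) + δ * |(m : ℝ)|)) *
        (C₂ * (2 : ℝ) ^ ((m : ℝ) * (n * invGap 1 r))))) fun ψ => ?_).1
  rw [h.high_apply]
  refine ((hC u v A B hu hv _).2 m (annularSpectrum_dyS h m ψ)).trans ?_
  rw [mul_assoc (C * (A * B))]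
  refine mul_le_mul_of_nonneg_left ?_ (by positivity)
  unfold annSize
  refine (add_le_add (mul_le_mul_of_nonneg_left (hC₁ m ψ) (by positivity))
    (mul_le_mul_of_nonneg_left (hC₂ m ψ) (by positivity))).trans_eq (by ring)

/-- The size of a test function that controls the Leray divergence of the Bony product. -/
noncomputable def testSize₂ (r : ℝ≥0∞) (ψ : 𝓢(E n, ℂ)) : ℝ := testSize r ψ + testSize r (lap ψ)

theorem lam_lap (hm : IsAnnular φ) (i j k : Fin n) (m : ℤ) (ψ : 𝓢(E n, ℂ)) :
    lap (lam hm i j k m ψ) = lam hm i j k m (lap ψ) := by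
  refine ext_of_fourier fun ξ => ?_
  rw [lap, fourier_mult hasTemperateGrowth_lapSym, fourier_lam, fourier_lam,
    fourier_mult hasTemperateGrowth_lapSym]
  ring

theorem exists_testSize_lam_le (hm : IsAnnular φ) (i j k : Fin n) (hr : 1 ≤ r) :
    ∃ C : ℝ, 0 ≤ C ∧ ∀ (m : ℤ) (ψ : 𝓢(E n, ℂ)),
      testSize r (lam hm i j k m ψ) ≤ C * (2 : ℝ) ^ (-|(m : ℝ)|) * testSize₂ r ψ := by
  obtain ⟨C₁, hC₁0, hC₁⟩ := exists_nrm_lam_le hm i j k (le_refl (1 : ℝ≥0∞))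
  obtain ⟨C₂, hC₂0, hC₂⟩ := exists_nrm_lam_le hm i j k hr
  refine ⟨C₁ + C₂, by positivity, fun m ψ => ?_⟩
  have h1 := hC₁ m ψ
  have h2 := hC₂ m ψ
  have h3 := hC₁ m (lap ψ)
  rw [← lam_lap] at h3
  set X := (2 : ℝ) ^ (-|(m : ℝ)|)
  have hX : 0 ≤ X := by positivity
  have n1 := nrm_nonneg 1 ψ
  have n2 := nrm_nonneg r ψ
  have n3 := nrm_nonneg 1 (lap ψ)
  have n4 := nrm_nonneg r (lap ψ)
  have n5 := nrm_nonneg 1 (lap (lap ψ))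
  have e1 : C₁ * X * (nrm 1 ψ + nrm 1 (lap ψ)) + C₂ * X * (nrm r ψ + nrm r (lap ψ)) +
      C₁ * X * (nrm 1 (lap ψ) + nrm 1 (lap (lap ψ))) ≤ (C₁ + C₂) * X * testSize₂ r ψ := by
    have p1 : 0 ≤ C₁ * X := by positivity
    have p2 : 0 ≤ C₂ * X := by positivity
    unfold testSize₂ testSize
    nlinarith [mul_nonneg p1 n2, mul_nonneg p1 n4, mul_nonneg p2 n1, mul_nonneg p2 n3,
      mul_nonneg p2 n5]
  unfold testSize at *
  linarith

theorem exists_testSize₂_seminorm (hr : 1 ≤ r) : ∃ p : Seminorm ℂ 𝓢(E n, ℂ), Continuous p ∧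
    ∀ ψ, testSize₂ r ψ ≤ p ψ ∧ ∀ τ, 0 < τ → testSize₂ r (heatS τ ψ) ≤ p ψ := by
  obtain ⟨p, hpc, hp⟩ := exists_testSize_seminorm (n := n) hr
  obtain ⟨C₁, hC₁0, hC₁⟩ := exists_nrm_heatS_le (n := n) (le_refl (1 : ℝ≥0∞))
  obtain ⟨C₂, hC₂0, hC₂⟩ := exists_nrm_heatS_le (n := n) hr
  set D := 1 + C₁ + C₂ with hD
  have hD0 : 0 ≤ D := by positivity
  have ht : ∀ ψ : 𝓢(E n, ℂ), 0 ≤ testSize r ψ := fun ψ => by rw [← hp]; exact apply_nonneg p ψ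
  have hh : ∀ τ, 0 < τ → ∀ ψ : 𝓢(E n, ℂ), testSize r (heatS τ ψ) ≤ D * testSize r ψ :=
    fun τ hτ ψ => by
      have h1 := hC₁ τ hτ ψ
      have h2 := hC₂ τ hτ ψ
      have h3 := hC₁ τ hτ (lap ψ)
      rw [← lap_heatS hτ] at h3
      have n1 := nrm_nonneg 1 ψ
      have n2 := nrm_nonneg r ψ
      have n3 := nrm_nonneg 1 (lap ψ)
      unfold testSize
      rw [hD]
      nlinarith [mul_nonneg hC₁0 n2, mul_nonneg hC₂0 n1, mul_nonneg hC₂0 n3]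
  refine ⟨D.toNNReal • (p + p.comp (lap (n := n)).toLinearMap),
    (hpc.add (hpc.comp (lap (n := n)).continuous)).const_smul D.toNNReal, fun ψ => ?_⟩
  have hPe : (D.toNNReal • (p + p.comp (lap (n := n)).toLinearMap)) ψ = D * testSize₂ r ψ := by
    unfold testSize₂
    rw [← hp, ← hp]
    change (D.toNNReal : ℝ) * _ = _
    rw [Real.coe_toNNReal D hD0]; rfl
  rw [hPe]
  have h0 : 0 ≤ testSize₂ r ψ := add_nonneg (ht _) (ht _)
  refine ⟨le_mul_of_one_le_left h0 (by rw [hD]; linarith), fun τ hτ => ?_⟩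
  unfold testSize₂
  rw [lap_heatS hτ, mul_add]
  exact add_le_add (hh τ hτ _) (hh τ hτ _)

/-- The spatial nonlinearity of `bilinBony`. -/
noncomputable def spatialBony (χ φ : E n → ℝ) (u v : VTD n) : VTD n :=
  lerayDivLP φ fun j k => bony χ φ (u j) (v k)

theorem exists_sum_testSize_lam_le (hm : IsAnnular φ) (hr : 1 ≤ r) :
    ∃ C : ℝ, 0 ≤ C ∧ ∀ (i j k : Fin n) (m : ℤ) (ψ : 𝓢(E n, ℂ)),
      testSize r (lam hm i j k m ψ) ≤ C * (2 : ℝ) ^ (-|(m : ℝ)|) * testSize₂ r ψ := by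
  choose C hC0 hC using fun i j k : Fin n => exists_testSize_lam_le hm i j k hr
  obtain ⟨D, hD⟩ := (Set.finite_range fun z : Fin n × Fin n × Fin n => C z.1 z.2.1 z.2.2).bddAbove
  refine ⟨max D 0, le_max_right _ _, fun i j k m ψ => (hC i j k m ψ).trans ?_⟩
  have h1 : C i j k ≤ D := hD ⟨(i, j, k), rfl⟩
  have h0 : 0 ≤ testSize₂ r ψ := by
    have n1 := nrm_nonneg 1 ψ
    have n2 := nrm_nonneg r ψ
    have n3 := nrm_nonneg 1 (lap ψ)
    have n4 := nrm_nonneg r (lap ψ)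
    have n5 := nrm_nonneg 1 (lap (lap ψ))
    unfold testSize₂ testSize; positivity
  gcongr
  exact h1.trans (le_max_left _ _)

theorem norm_neg_sum_sum_le {c : Fin n → Fin n → ℂ} {D : ℝ} (hc : ∀ j k, ‖c j k‖ ≤ D) :
    ‖-∑ j, ∑ k, c j k‖ ≤ n * n * D := by
  rw [norm_neg]
  calc _ ≤ ∑ _j : Fin n, ∑ _k : Fin n, D := (norm_sum_le _ _).trans
        (Finset.sum_le_sum fun j _ => (norm_sum_le _ _).trans (Finset.sum_le_sum fun k _ => hc j k))
    _ = _ := by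
      rw [Finset.sum_const, Finset.sum_const, Finset.card_univ, Fintype.card_fin,
        nsmul_eq_mul, nsmul_eq_mul, mul_assoc]

/-- One more Laplacian on the test function, hence `testSize₂`, gives the factor 2^{-|m|} that makes
the series over m converge absolutely. -/
theorem exists_spatialBony (h : IsLittlewoodPaleyPair χ φ) (he : BonyExp n l s g δ)
    [ENNReal.HolderTriple l l ρ] [ρ.HolderConjugate r] (hr : 1 ≤ r) [l.HolderConjugate q]
    (hq : 1 ≤ q) : ∃ C : ℝ, 0 ≤ C ∧ ∀ (u v : VTD n) (A B : ℝ),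
      (∀ i, BesovBound χ φ l s δ (u i) A) → (∀ i, BesovBound χ φ l s δ (v i) B) →
      ∀ i (ψ : 𝓢(E n, ℂ)), HasSum (fun m => -∑ j, ∑ k, bony χ φ (u j) (v k)
        (lam h.isAnnular_high i j k m ψ)) (spatialBony χ φ u v i ψ) ∧
        ‖spatialBony χ φ u v i ψ‖ ≤ C * (A * B) * testSize₂ r ψ := by
  obtain ⟨C, hC0, hC⟩ := exists_bony_le (ρ := ρ) (r := r) (q := q) h he hr
  obtain ⟨D, hD0, hD⟩ := exists_sum_testSize_lam_le h.isAnnular_high hr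
  obtain ⟨p, hpc, hp⟩ := exists_testSize₂_seminorm (n := n) hr
  have hs := summable_two_rpow_neg_abs one_pos
  simp only [one_mul] at hs
  set S := ∑' m : ℤ, (2 : ℝ) ^ (-|(m : ℝ)|) with hS
  have hS0 : 0 ≤ S := tsum_nonneg fun m => by positivity
  refine ⟨n * n * (C * D) * S, by positivity, fun u v A B hu hv i ψ => ?_⟩
  have hA := (hu i).nonneg
  have hB := (hv i).nonneg
  have h1 : ∀ (m : ℤ) ψ, lerayDiv (fun j k => dyadic φ m (bony χ φ (u j) (v k))) i ψ =
      -∑ j, ∑ k, bony χ φ (u j) (v k) (lam h.isAnnular_high i j k m ψ) := fun m ψ =>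
    lerayDiv_dyadic h m (fun j k =>
      inLp_dyadic_bony (ρ := ρ) (r := r) (q := q) h he hr hq (hu j) (hv k) m) i ψ
  have h2 : ∀ (m : ℤ) (ψ : 𝓢(E n, ℂ)), ‖-∑ j, ∑ k, bony χ φ (u j) (v k)
      (lam h.isAnnular_high i j k m ψ)‖ ≤
      (n * n * (C * D) * (A * B)) * (2 : ℝ) ^ (-|(m : ℝ)|) * testSize₂ r ψ := fun m ψ => by
    refine (norm_neg_sum_sum_le fun j k => ((hC _ _ A B (hu j) (hv k) _).1.trans
      (mul_le_mul_of_nonneg_left (hD i j k m ψ) (by positivity)))).trans_eq ?_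
    ring
  have h3 := td_hasSum
    (w := fun m => lerayDiv (fun j k => dyadic φ m (bony χ φ (u j) (v k))) i) hpc
    (hs.mul_left (n * n * (C * D) * (A * B))) (fun m ψ => by
      rw [h1]
      refine (h2 m ψ).trans ?_
      gcongr
      exact (hp ψ).1) ψ
  simp only [h1] at h3
  have h4 : HasSum (fun m => -∑ j, ∑ k, bony χ φ (u j) (v k)
        (lam h.isAnnular_high i j k m ψ)) (spatialBony χ φ u v i ψ) := h3
  refine ⟨h4, ?_⟩
  rw [← h4.tsum_eq]
  refine (tsum_of_norm_bounded ((hs.hasSum.mul_left _).mul_right _) (h2 · ψ)).trans_eq ?_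
  ring

end MildNS


namespace MildNS

variable {n : ℕ}

/-! ### The spatial estimates for the Bony product -/

section BesovSize

variable {χ φ : E n → ℝ} {l ρ r q : ℝ≥0∞} {s g δ : ℝ}

/-- The size `sup_j 2^{js - δ|j|} ‖Δ̇_j u‖_{L^l}` of a vector field. -/
noncomputable def besovSize (φ : E n → ℝ) (l : ℝ≥0∞) (s δ : ℝ) (u : VTD n) : ℝ≥0∞ :=
  ⨆ i, ⨆ j : ℤ, ENNReal.ofReal ((2 : ℝ) ^ ((j : ℝ) * s - δ * |(j : ℝ)|)) *
    lpNorm l (dyadic φ j (u i))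

/-- The vector fields of finite size with components in `𝓢'_h`. -/
structure BesovFinite (χ φ : E n → ℝ) (l : ℝ≥0∞) (s δ : ℝ) (u : VTD n) : Prop where
  low : ∀ i, IsSh χ (u i)
  mem : ∀ i, ∀ j : ℤ, InLp l (dyadic φ j (u i))
  size_lt : besovSize φ l s δ u < ⊤

theorem le_besovSize (u : VTD n) (i : Fin n) (j : ℤ) :
    ENNReal.ofReal ((2 : ℝ) ^ ((j : ℝ) * s - δ * |(j : ℝ)|)) * lpNorm l (dyadic φ j (u i)) ≤
      besovSize φ l s δ u :=
  le_iSup₂ (f := fun i (j : ℤ) => ENNReal.ofReal ((2 : ℝ) ^ ((j : ℝ) * s - δ * |(j : ℝ)|)) *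
    lpNorm l (dyadic φ j (u i))) i j

theorem BesovFinite.bound {u : VTD n} (hu : BesovFinite χ φ l s δ u) (i : Fin n) :
    BesovBound χ φ l s δ (u i) (besovSize φ l s δ u).toReal where
  low := hu.low i
  nonneg := ENNReal.toReal_nonneg
  mem := hu.mem i
  le j := by
    rw [ENNReal.ofReal_mul ENNReal.toReal_nonneg, ENNReal.ofReal_toReal hu.size_lt.ne]
    refine le_trans ?_ (mul_le_mul_left (le_besovSize (φ := φ) (l := l) (s := s) (δ := δ) u i j) _)
    rw [mul_comm, ← mul_assoc, ← ENNReal.ofReal_mul (by positivity), ← Real.rpow_add two_pos]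
    simp

theorem besovSize_sub_le (hl : 1 ≤ l) (u v : VTD n) :
    besovSize φ l s δ (u - v) ≤ besovSize φ l s δ u + besovSize φ l s δ v := by
  refine iSup₂_le fun i j => ?_
  rw [Pi.sub_apply, map_sub]
  refine (mul_le_mul_right (lpNorm_sub_le hl _ _) _).trans ?_
  rw [mul_add]
  exact add_le_add (le_besovSize u i j) (le_besovSize v i j)

theorem BesovFinite.sub (hl : 1 ≤ l) {u v : VTD n} (hu : BesovFinite χ φ l s δ u)
    (hv : BesovFinite χ φ l s δ v) : BesovFinite χ φ l s δ (u - v) where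
  low i := ((hu.bound i).sub hl (hv.bound i)).low
  mem i := ((hu.bound i).sub hl (hv.bound i)).mem
  size_lt := (besovSize_sub_le hl u v).trans_lt (ENNReal.add_lt_top.2 ⟨hu.size_lt, hv.size_lt⟩)

theorem BesovFinite.enorm_le {u v : VTD n} (hu : BesovFinite χ φ l s δ u)
    (hv : BesovFinite χ φ l s δ v) {z : ℂ} {D : ℝ} (hD : 0 ≤ D)
    (hz : ‖z‖ ≤ D * ((besovSize φ l s δ u).toReal * (besovSize φ l s δ v).toReal)) :
    ‖z‖ₑ ≤ ENNReal.ofReal D * (besovSize φ l s δ u * besovSize φ l s δ v) := by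
  rw [← ofReal_norm]
  refine (ENNReal.ofReal_le_ofReal hz).trans_eq ?_
  rw [ENNReal.ofReal_mul hD, ENNReal.ofReal_mul ENNReal.toReal_nonneg,
    ENNReal.ofReal_toReal hu.size_lt.ne, ENNReal.ofReal_toReal hv.size_lt.ne]

/-- Each block norm is recovered by duality, with the block and its weight transposed to the test
function. These weighted localized functions form the norming set of the Besov size. -/
theorem besovSize_le_of_test (h : IsLittlewoodPaleyPair χ φ) (hl : 2 ≤ l) [l.HolderConjugate q]
    {w : VTD n} (hw : ∀ i, ∀ j : ℤ, InLp l (dyadic φ j (w i))) {A : ℝ≥0∞}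
    (hA : ∀ i (j : ℤ) θ, nrm q θ ≤ 1 →
      ‖w i ((((2 : ℝ) ^ ((j : ℝ) * s - δ * |(j : ℝ)|) : ℝ) : ℂ) •
        dyS h.isAnnular_high.toIsCutoff j θ)‖ₑ ≤ A) : besovSize φ l s δ w ≤ A := by
  refine iSup₂_le fun i j => ?_
  set c := (2 : ℝ) ^ ((j : ℝ) * s - δ * |(j : ℝ)|) with hc
  have hc0 : 0 < c := by positivity
  have h1 : lpNorm l (dyadic φ j (w i)) ≤ A / ENNReal.ofReal c := by
    refine (hw i j).lpNorm_le_of_unitBall (q := q) hl fun θ hθ => ?_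
    rw [ENNReal.le_div_iff_mul_le (Or.inl (by simpa using hc0)) (Or.inl ENNReal.ofReal_ne_top),
      h.high_apply, mul_comm]
    refine le_trans (le_of_eq ?_) (hA i j θ hθ)
    rw [map_smul, smul_eq_mul, enorm_mul, ← ofReal_norm (c : ℂ), Complex.norm_real,
      Real.norm_of_nonneg hc0.le]
  exact (mul_le_mul_right h1 _).trans ENNReal.mul_div_le

/-! ### Smoothing -/

theorem lam_heatS_dyS_eq_zero (h : IsLittlewoodPaleyPair χ φ) {m p : ℤ} (hmp : 2 ≤ |m - p|)
    (i j k : Fin n) {τ : ℝ} (hτ : 0 < τ) (c : ℂ) (θ : 𝓢(E n, ℂ)) :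
    lam h.isAnnular_high i j k m (heatS τ (c • dyS h.isAnnular_high.toIsCutoff p θ)) = 0 := by
  rw [map_smul, map_smul, dyS, ← heatS_comm_mult (hasTemperateGrowth_dyadicSym _ p) hτ, ← dyS,
    lam_dyS_eq_zero h hmp, smul_zero]

/-- One block of the smoothing estimate: the heat kernel regains the regularity that the Leray
divergence and the Bony product lose. -/
theorem exists_annSize_heatS_le (h : IsLittlewoodPaleyPair χ φ) (he : BonyExp n l s g δ)
    (hq : 1 ≤ q) (hqr : q ≤ r) (hgap : invGap q r = l⁻¹.toReal) (i j k : Fin n) :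
    ∃ C : ℝ, 0 ≤ C ∧ ∀ (m p : ℤ), |m - p| ≤ 1 → ∀ τ, 0 < τ → ∀ θ, nrm q θ ≤ 1 →
      annSize s g δ q r m (lam h.isAnnular_high i j k m (heatS τ
        ((((2 : ℝ) ^ ((p : ℝ) * s - δ * |(p : ℝ)|) : ℝ) : ℂ) •
          dyS h.isAnnular_high.toIsCutoff p θ))) ≤ C * (1 + τ ^ (-((2 - g + δ) / 2))) := by
  obtain ⟨C₀, hC₀0, hC₀⟩ := exists_nrm_dyS_le h.isAnnular_high.toIsCutoff hq (le_refl q)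
  obtain ⟨C₁, hC₁0, hC₁⟩ := exists_nrm_lam_heatS_le h.isAnnular_high i j k hq (le_refl q)
  obtain ⟨C₂, hC₂0, hC₂⟩ := exists_nrm_lam_heatS_le h.isAnnular_high i j k hq hqr
  have hs := he.s_eq
  have hδ := he.δ_pos
  have hδs := he.δ_lt_s
  have hδg := he.δ_lt_g
  have hδ1 := he.δ_lt
  have hqq : invGap q q = 0 := sub_self _
  set κ := (2 - g + δ) / 2 with hκ
  refine ⟨2 ^ (s + δ) * ((C₁ + C₂) * C₀), by positivity, fun m p hmp τ hτ θ hθ => ?_⟩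
  set c := (2 : ℝ) ^ ((p : ℝ) * s - δ * |(p : ℝ)|) with hc
  have hc0 : 0 < c := by positivity
  set θ' := dyS h.isAnnular_high.toIsCutoff p θ with hθ'
  have hθ'1 : nrm q θ' ≤ C₀ := by
    refine (hC₀ p θ).trans ?_
    rw [hqq, mul_zero, mul_zero, Real.rpow_zero, mul_one]
    exact mul_le_of_le_one_right hC₀0 hθ
  have hmp' : |(m : ℝ) - p| ≤ 1 := by exact_mod_cast hmp
  have hcm : c ≤ 2 ^ (s + δ) * (2 : ℝ) ^ ((m : ℝ) * s - δ * |(m : ℝ)|) := by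
    rw [← Real.rpow_add two_pos]
    refine two_rpow_le_of_le ?_
    have h1 : |(m : ℝ)| ≤ |(p : ℝ)| + 1 := by
      have := abs_sub_abs_le_abs_sub (m : ℝ) p
      linarith
    have h2 : (p : ℝ) - m ≤ 1 := by
      have := neg_abs_le ((m : ℝ) - p)
      linarith
    nlinarith
  -- Both terms of `annSize` lead to the same power of 2, with exponent m(2 - g - 2η) + δ|m|, so a
  -- single choice of η serves both.
  have key : ∀ η, 0 ≤ η → η ≤ 1 → (m : ℝ) * (2 - g - 2 * η) + δ * |(m : ℝ)| ≤ 0 →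
      c * annSize s g δ q r m (lam h.isAnnular_high i j k m (heatS τ θ')) ≤
        2 ^ (s + δ) * ((C₁ + C₂) * C₀) * τ ^ (-η) := fun η h0 h1 hη => by
    have e1 := hC₁ m τ hτ η h0 h1 θ'
    have e2 := hC₂ m τ hτ η h0 h1 θ'
    rw [hqq, mul_zero, add_zero] at e1
    rw [hgap, show 1 + n * l⁻¹.toReal - 2 * η = 2 + s - g - 2 * η by rw [hs]; ring] at e2
    have hτη : 0 ≤ τ ^ (-η) := by positivity
    have n1 := nrm_nonneg q θ'
    have p1 : (2 : ℝ) ^ ((m : ℝ) * s - δ * |(m : ℝ)|) *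
        ((2 : ℝ) ^ ((m : ℝ) * (1 - g - s) + 2 * δ * |(m : ℝ)|) *
          (2 : ℝ) ^ ((m : ℝ) * (1 - 2 * η))) ≤ 1 := by
      rw [← Real.rpow_add two_pos, ← Real.rpow_add two_pos]
      refine Real.rpow_le_one_of_one_le_of_nonpos one_le_two (le_of_eq_of_le ?_ hη)
      ring
    have p2 : (2 : ℝ) ^ ((m : ℝ) * s - δ * |(m : ℝ)|) *
        ((2 : ℝ) ^ (2 * (-((m : ℝ) * s) + δ * |(m : ℝ)|)) *
          (2 : ℝ) ^ ((m : ℝ) * (2 + s - g - 2 * η))) ≤ 1 := by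
      rw [← Real.rpow_add two_pos, ← Real.rpow_add two_pos]
      refine Real.rpow_le_one_of_one_le_of_nonpos one_le_two (le_of_eq_of_le ?_ hη)
      ring
    unfold annSize
    calc _ ≤ 2 ^ (s + δ) * (2 : ℝ) ^ ((m : ℝ) * s - δ * |(m : ℝ)|) *
          ((2 : ℝ) ^ ((m : ℝ) * (1 - g - s) + 2 * δ * |(m : ℝ)|) *
            (C₁ * (2 : ℝ) ^ ((m : ℝ) * (1 - 2 * η)) * τ ^ (-η) * C₀) +
          (2 : ℝ) ^ (2 * (-((m : ℝ) * s) + δ * |(m : ℝ)|)) *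
            (C₂ * (2 : ℝ) ^ ((m : ℝ) * (2 + s - g - 2 * η)) * τ ^ (-η) * C₀)) := by
          have f1 := e1.trans (mul_le_mul_of_nonneg_left hθ'1 (by positivity))
          have f2 := e2.trans (mul_le_mul_of_nonneg_left hθ'1 (by positivity))
          have g1 := nrm_nonneg q (lam h.isAnnular_high i j k m (heatS τ θ'))
          have g2 := nrm_nonneg r (lam h.isAnnular_high i j k m (heatS τ θ'))
          gcongr
      _ = 2 ^ (s + δ) * ((C₁ * C₀ * τ ^ (-η)) * ((2 : ℝ) ^ ((m : ℝ) * s - δ * |(m : ℝ)|) *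
        ((2 : ℝ) ^ ((m : ℝ) * (1 - g - s) + 2 * δ * |(m : ℝ)|) *
          (2 : ℝ) ^ ((m : ℝ) * (1 - 2 * η)))) +
          (C₂ * C₀ * τ ^ (-η)) * ((2 : ℝ) ^ ((m : ℝ) * s - δ * |(m : ℝ)|) *
        ((2 : ℝ) ^ (2 * (-((m : ℝ) * s) + δ * |(m : ℝ)|)) *
          (2 : ℝ) ^ ((m : ℝ) * (2 + s - g - 2 * η))))) := by ring
      _ ≤ 2 ^ (s + δ) * ((C₁ * C₀ * τ ^ (-η)) * 1 + (C₂ * C₀ * τ ^ (-η)) * 1) := by gcongr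
      _ = _ := by ring
  have hsm : annSize s g δ q r m (lam h.isAnnular_high i j k m (heatS τ ((c : ℂ) • θ'))) =
      c * annSize s g δ q r m (lam h.isAnnular_high i j k m (heatS τ θ')) := by
    unfold annSize
    rw [map_smul, map_smul, nrm_smul, nrm_smul, Complex.norm_real, Real.norm_of_nonneg hc0.le]
    ring
  rw [hsm]
  have hD : 0 ≤ 2 ^ (s + δ) * ((C₁ + C₂) * C₀) := by positivity
  have hτκ : 0 ≤ τ ^ (-κ) := by positivity
  -- For m ≥ 0 the choice η = κ makes the exponent exactly 0, since 2 - g - 2κ = -δ. For m ≤ 0 no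
  -- smoothing is needed, because δ < 2 - g.
  rcases le_total 0 (m : ℝ) with hm | hm
  · refine (key κ (by linarith) (by linarith) (le_of_eq ?_)).trans
      (mul_le_mul_of_nonneg_left (by linarith) hD)
    rw [abs_of_nonneg hm, hκ]
    ring
  · refine (key 0 le_rfl zero_le_one ?_).trans (mul_le_mul_of_nonneg_left ?_ hD)
    · rw [abs_of_nonpos hm]
      nlinarith
    · rw [neg_zero, Real.rpow_zero]
      linarith

/-- A test function localized at scale p meets only the three blocks |m - p| ≤ 1. No summation over
m is required, so bounds without decay in m are enough. -/
theorem exists_spatialBony_smoothing (h : IsLittlewoodPaleyPair χ φ) (he : BonyExp n l s g δ)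
    [ENNReal.HolderTriple l l ρ] [ρ.HolderConjugate r] (hr : 1 ≤ r) [l.HolderConjugate q]
    (hq : 1 ≤ q) (hqr : q ≤ r) (hgap : invGap q r = l⁻¹.toReal) :
    ∃ C : ℝ, 0 ≤ C ∧ ∀ (u v : VTD n) (A B : ℝ),
      (∀ i, BesovBound χ φ l s δ (u i) A) → (∀ i, BesovBound χ φ l s δ (v i) B) →
      ∀ i (p : ℤ) τ, 0 < τ → ∀ θ, nrm q θ ≤ 1 →
      ‖spatialBony χ φ u v i (heatS τ ((((2 : ℝ) ^ ((p : ℝ) * s - δ * |(p : ℝ)|) : ℝ) : ℂ) •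
          dyS h.isAnnular_high.toIsCutoff p θ))‖ ≤
        C * (1 + τ ^ (-((2 - g + δ) / 2))) * (A * B) := by
  obtain ⟨C, hC0, hC⟩ := exists_bony_le (ρ := ρ) (r := r) (q := q) h he hr
  obtain ⟨_, _, hsum⟩ := exists_spatialBony (ρ := ρ) (r := r) (q := q) h he hr hq
  choose D hD0 hD using fun i j k : Fin n => exists_annSize_heatS_le h he hq hqr hgap i j k
  obtain ⟨K, hK⟩ := (Set.finite_range fun z : Fin n × Fin n × Fin n => D z.1 z.2.1 z.2.2).bddAbove
  set M := max K 0 with hM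
  have hM0 : 0 ≤ M := le_max_right _ _
  have hDM : ∀ i j k, D i j k ≤ M := fun i j k => (hK ⟨(i, j, k), rfl⟩).trans (le_max_left _ _)
  refine ⟨3 * (n * n * (C * M)), by positivity, fun u v A B hu hv i p τ hτ θ hθ => ?_⟩
  set ψ := heatS τ ((((2 : ℝ) ^ ((p : ℝ) * s - δ * |(p : ℝ)|) : ℝ) : ℂ) •
    dyS h.isAnnular_high.toIsCutoff p θ) with hψ
  have hA := (hu i).nonneg
  have hB := (hv i).nonneg
  have hτκ : 0 ≤ τ ^ (-((2 - g + δ) / 2)) := by positivity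
  have h0 : ∀ m ∉ Finset.Icc (p - 1) (p + 1), -∑ j, ∑ k, bony χ φ (u j) (v k)
      (lam h.isAnnular_high i j k m ψ) = 0 := fun m hm => by
    have hmp : 2 ≤ |m - p| := by
      rw [Finset.mem_Icc] at hm
      rw [le_abs]
      omega
    simp only [hψ, lam_heatS_dyS_eq_zero h hmp _ _ _ hτ, map_zero, Finset.sum_const_zero, neg_zero]
  rw [(hsum u v A B hu hv i ψ).1.unique (hasSum_sum_of_ne_finset_zero h0)]
  refine (norm_sum_le_of_le _ (f := fun m => -∑ j, ∑ k, bony χ φ (u j) (v k)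
      (lam h.isAnnular_high i j k m ψ)) (n := fun _ => n * n * (C * (A * B) *
        (M * (1 + τ ^ (-((2 - g + δ) / 2)))))) fun m hm =>
    norm_neg_sum_sum_le fun j k => ((hC _ _ A B (hu j) (hv k) _).2 m
      (annularSpectrum_lam h i j k m ψ)).trans (mul_le_mul_of_nonneg_left ?_ (by positivity))).trans ?_
  · refine (hD i j k m p ?_ τ hτ θ hθ).trans (mul_le_mul_of_nonneg_right (hDM i j k) (by positivity))
    rw [Finset.mem_Icc] at hm
    rw [abs_le]
    omega
  · rw [Finset.sum_const, Int.card_Icc, nsmul_eq_mul,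
      show (p + 1 + 1 - (p - 1)).toNat = 3 by omega]
    push_cast
    exact le_of_eq (by ring)

/-! ### Measurability -/

theorem aestronglyMeasurable_tri_dyadic {m m' : E n → ℝ} (hm : IsCutoff m) (hm' : IsCutoff m')
    {a b : ℝ → TD n} (ha : ∀ ψ, Measurable fun s => a s ψ) (hb : ∀ ψ, Measurable fun s => b s ψ)
    {μ : Measure ℝ} [SFinite μ] (j j' : ℤ) (hra : ∀ᵐ s ∂μ, InLp ⊤ (dyadic m j (a s)))
    (hrb : ∀ᵐ s ∂μ, InLp ⊤ (dyadic m' j' (b s))) {Ψ : ℝ → E n → ℂ}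
    (hΨ : Measurable (Function.uncurry Ψ)) :
    AEStronglyMeasurable (fun s => tri (dyadic m j (a s)) (dyadic m' j' (b s)) (Ψ s)) μ := by
  refine aestronglyMeasurable_integral_toFun_mul (fun ψ => ?_) (fun ψ => ?_) ?_ ?_ hΨ
  · simp only [dyadic_apply hm]
    exact ha _
  · simp only [dyadic_apply hm']
    exact hb _
  · filter_upwards [hra] with s hs using ⟨_, hs.represents⟩
  · filter_upwards [hrb] with s hs using ⟨_, hs.represents⟩

theorem aestronglyMeasurable_of_hasSum {μ : Measure ℝ} {f : ℤ → ℝ → ℂ} {F : ℝ → ℂ}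
    (hf : ∀ j, AEStronglyMeasurable (f j) μ) (hF : ∀ᵐ s ∂μ, HasSum (fun j => f j s) (F s)) :
    AEStronglyMeasurable F μ :=
  aestronglyMeasurable_of_tendsto_ae (atTop : Filter (Finset ℤ))
    (f := fun S s => ∑ j ∈ S, f j s)
    (fun S => Finset.aestronglyMeasurable_fun_sum S fun j _ => hf j) hF

/-- The curve of test functions comes with no measurability of its own; the jointly measurable G
replaces it in each block, and the series over blocks converges at almost every time. -/
theorem aestronglyMeasurable_bony (h : IsLittlewoodPaleyPair χ φ) (he : BonyExp n l s g δ)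
    [ENNReal.HolderTriple l l ρ] [ρ.HolderConjugate r] (hr : 1 ≤ r)
    {a b : ℝ → TD n} (ha : ∀ ψ, Measurable fun s => a s ψ) (hb : ∀ ψ, Measurable fun s => b s ψ)
    {μ : Measure ℝ} [SFinite μ] {A B : ℝ → ℝ} (hua : ∀ᵐ t ∂μ, BesovBound χ φ l s δ (a t) (A t))
    (hub : ∀ᵐ t ∂μ, BesovBound χ φ l s δ (b t) (B t)) {Ψ : ℝ → 𝓢(E n, ℂ)} {G : ℝ → E n → ℂ}
    (hG : Measurable (Function.uncurry G)) (hΨ : ∀ᵐ t ∂μ, (Ψ t : E n → ℂ) = G t) :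
    AEStronglyMeasurable (fun t => bony χ φ (a t) (b t) (Ψ t)) μ := by
  obtain ⟨_, _, hlow⟩ := exists_low_top_le h he
  obtain ⟨_, _, hhigh⟩ := exists_high_top_le h he
  have hχ := h.isCutoff_low
  have hφ := h.isAnnular_high.toIsCutoff
  have la : ∀ j : ℤ, ∀ᵐ t ∂μ, InLp ⊤ (dyadic χ (j - 1) (a t)) := fun j => by
    filter_upwards [hua] with t ht using (hlow _ _ ht j).1
  have lb : ∀ j : ℤ, ∀ᵐ t ∂μ, InLp ⊤ (dyadic χ (j - 1) (b t)) := fun j => by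
    filter_upwards [hub] with t ht using (hlow _ _ ht j).1
  have ka : ∀ j : ℤ, ∀ᵐ t ∂μ, InLp ⊤ (dyadic φ j (a t)) := fun j => by
    filter_upwards [hua] with t ht using (hhigh _ _ ht j).1
  have kb : ∀ j : ℤ, ∀ᵐ t ∂μ, InLp ⊤ (dyadic φ j (b t)) := fun j => by
    filter_upwards [hub] with t ht using (hhigh _ _ ht j).1
  refine aestronglyMeasurable_of_hasSum (f := fun j t => bonyBlock χ φ (a t) (b t) j (G t))
    (fun j => ?_) ?_
  · refine ((aestronglyMeasurable_tri_dyadic hχ hφ ha hb (j - 1) j (la j) (kb j) hG).add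
      (aestronglyMeasurable_tri_dyadic hχ hφ hb ha (j - 1) j (lb j) (ka j) hG)).add
      (Finset.aestronglyMeasurable_fun_sum _ fun ν _ =>
        aestronglyMeasurable_tri_dyadic hφ hφ ha hb j (j - ν) (ka j) (kb (j - ν)) hG)
  · filter_upwards [hua, hub, hΨ] with t h1 h2 h3
    rw [← h3]
    exact hasSum_bony (ρ := ρ) (r := r) h he hr h1 h2 (Ψ t)

theorem spatialBony_sub (h : IsLittlewoodPaleyPair χ φ) (he : BonyExp n l s g δ)
    [ENNReal.HolderTriple l l ρ] [ρ.HolderConjugate r] (hr : 1 ≤ r) [l.HolderConjugate q]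
    (hq : 1 ≤ q) {u v : VTD n} (hu : BesovFinite χ φ l s δ u) (hv : BesovFinite χ φ l s δ v)
    (i : Fin n) (ψ : 𝓢(E n, ℂ)) :
    spatialBony χ φ u u i ψ - spatialBony χ φ v v i ψ =
      spatialBony χ φ (u - v) u i ψ + spatialBony χ φ v (u - v) i ψ := by
  obtain ⟨C, -, hC⟩ := exists_spatialBony (ρ := ρ) (r := r) (q := q) h he hr hq
  have huv := hu.sub he.one_le hv
  set X : VTD n → VTD n → ℤ → ℂ := fun u v m =>
    -∑ j, ∑ k, bony χ φ (u j) (v k) (lam h.isAnnular_high i j k m ψ) with hX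
  have h1 : HasSum (fun m => X u u m - X v v m) _ :=
    (hC u u _ _ hu.bound hu.bound i ψ).1.sub (hC v v _ _ hv.bound hv.bound i ψ).1
  have h2 : HasSum (fun m => X (u - v) u m + X v (u - v) m) _ :=
    (hC (u - v) u _ _ huv.bound hu.bound i ψ).1.add (hC v (u - v) _ _ hv.bound huv.bound i ψ).1
  have e : ∀ m, X u u m - X v v m = X (u - v) u m + X v (u - v) m := fun m => by
    rw [hX]
    change -_ - -_ = -_ + -_
    rw [← neg_add, neg_sub_neg, ← neg_sub, ← Finset.sum_sub_distrib, ← Finset.sum_add_distrib]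
    refine congrArg _ (Finset.sum_congr rfl fun j _ => ?_)
    rw [← Finset.sum_sub_distrib, ← Finset.sum_add_distrib]
    exact Finset.sum_congr rfl fun k _ => bony_sub (ρ := ρ) (r := r) h he hr (hu.bound j)
      (hv.bound j) (hu.bound k) (hv.bound k) _
  rw [show (fun m => X u u m - X v v m) = _ from funext e] at h1
  exact h1.unique h2

/-- The smoothing exponent is κ = (2 - g + δ)/2, and κ < 1 - 1/α is the hypothesis 2/α < g - δ. -/
theorem spatialBound_bony (h : IsLittlewoodPaleyPair χ φ) (he : BonyExp n l s g δ) {α : ℝ}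
    (hα : 2 ≤ α) (hαg : 2 / α < g - δ) :
    SpatialBound (spatialBony χ φ) (BesovFinite χ φ l s δ) (besovSize φ l s δ) α := by
  obtain ⟨ρ, r, q, _, _, _, hρ, hr, hq, hqr, hgap⟩ := exists_holder_exponents he.two_le
  obtain ⟨C, hC0, hC⟩ := exists_spatialBony (ρ := ρ) (r := r) (q := q) h he hr hq
  have hl := he.one_le
  refine ⟨hα, fun u v => .sub hl, fun u v _ _ => besovSize_sub_le hl u v,
    fun u v hu hv i ψ => ?_, ?_, ?_, fun u v t hu hv hug hvg i ψ => ?_, fun u t hu hug => ?_⟩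
  · exact spatialBony_sub (ρ := ρ) (r := r) (q := q) h he hr hq hu hv i ψ
  · obtain ⟨p, hpc, hp⟩ := exists_testSize₂_seminorm (n := n) hr
    refine ⟨C.toNNReal • p, hpc.const_smul C.toNNReal, fun u v hu hv i τ hτ ψ => ?_⟩
    have hPe : (C.toNNReal • p) ψ = C * p ψ := by
      change (C.toNNReal : ℝ) * _ = _
      rw [Real.coe_toNNReal C hC0]
    rw [hPe]
    refine hu.enorm_le hv (mul_nonneg hC0 (apply_nonneg p ψ)) ?_
    refine ((hC _ _ _ _ hu.bound hv.bound i _).2.trans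
      (mul_le_mul_of_nonneg_left ((hp ψ).2 τ hτ) ?_)).trans_eq (by ring)
    have := @ENNReal.toReal_nonneg (besovSize φ l s δ u)
    have := @ENNReal.toReal_nonneg (besovSize φ l s δ v)
    positivity
  · obtain ⟨D, hD0, hD⟩ := exists_spatialBony_smoothing (ρ := ρ) (r := r) (q := q) h he hr hq hqr
      hgap
    have hδ := he.δ_pos
    have hδ1 := he.δ_lt
    refine ⟨{θ | ∃ (p : ℤ) (θ₀ : 𝓢(E n, ℂ)), nrm q θ₀ ≤ 1 ∧
      θ = (((2 : ℝ) ^ ((p : ℝ) * s - δ * |(p : ℝ)|) : ℝ) : ℂ) •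
        dyS h.isAnnular_high.toIsCutoff p θ₀}, D, (2 - g + δ) / 2, hD0, by linarith, ?_,
      fun w hw A hA => ?_, ?_⟩
    · have : 2 / α = 2 * (1 / α) := by ring
      linarith
    · exact besovSize_le_of_test (q := q) h he.two_le hw.mem fun i j θ hθ =>
        hA i _ ⟨j, θ, hθ, rfl⟩
    · rintro u v hu hv i _ ⟨p, θ₀, hθ, rfl⟩ τ hτ
      refine hu.enorm_le hv ?_ (hD _ _ _ _ hu.bound hv.bound i p τ hτ θ₀ hθ)
      have : 0 ≤ τ ^ (-((2 - g + δ) / 2)) := by positivity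
      positivity
  · refine aestronglyMeasurable_of_hasSum (f := fun m s => -∑ j, ∑ k, bony χ φ (u s j) (v s k)
      (lam h.isAnnular_high i j k m (heatS (t - s) ψ))) (fun m => ?_) ?_
    · refine AEStronglyMeasurable.neg (Finset.aestronglyMeasurable_fun_sum _ fun j _ =>
        Finset.aestronglyMeasurable_fun_sum _ fun k _ => ?_)
      refine aestronglyMeasurable_bony (ρ := ρ) (r := r) h he hr (fun φ => hu j φ) (fun φ => hv k φ)
        (by filter_upwards [hug] with s hs using hs.bound j)
        (by filter_upwards [hvg] with s hs using hs.bound k)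
        (measurable_fourierInv_heat (σ := fun ξ =>
          symS h.isAnnular_high.toIsCutoff ((2 : ℝ) ^ (-m) • ξ) * lsym i j k ξ) ?_ (𝓕 ψ) t) ?_
      · exact ((symS h.isAnnular_high.toIsCutoff).continuous.comp
          (continuous_const_smul _)).measurable.mul (measurable_lsym i j k)
      · filter_upwards [ae_restrict_mem measurableSet_Ioo] with s hs
        exact lam_heatS _ i j k m (by linarith [hs.2]) ψ
    · filter_upwards [hug, hvg] with s h1 h2 using (hC _ _ _ _ h1.bound h2.bound i _).1
  · refine AEMeasurable.iSup fun i => AEMeasurable.iSup fun j => AEMeasurable.const_mul ?_ _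
    refine aemeasurable_lpNorm (fun ψ => ?_) hl ?_
    · simp only [h.high_apply]
      exact hu i _
    · filter_upwards [hug] with s hs using hs.mem i j

end BesovSize

end MildNS


namespace MildNS

variable {n : ℕ}

/-! ### From the path spaces to the size functions -/

/-- A finite α already satisfies α ≥ 2, because 2/α < x ≤ 1. For α = ∞ any large exponent works, as
the time intervals are bounded. -/
theorem exists_real_exponent {α : ℝ≥0∞} {x : ℝ} (hα : α ≠ 0) (hx : x ≤ 1)
    (h : 2 * α⁻¹.toReal < x) : ∃ a : ℝ, 2 ≤ a ∧ ENNReal.ofReal a ≤ α ∧ 2 / a < x := by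
  rcases eq_or_ne α ⊤ with rfl | hαt
  · have hx0 : 0 < x := by simpa using h
    refine ⟨4 / x, ?_, le_top, ?_⟩
    · rw [le_div_iff₀ hx0]
      linarith
    · rw [div_div_eq_mul_div, div_lt_iff₀ (by norm_num)]
      linarith
  · have ha : 0 < α.toReal := ENNReal.toReal_pos hα hαt
    rw [ENNReal.toReal_inv] at h
    refine ⟨α.toReal, ?_, ENNReal.ofReal_toReal_le, by rwa [div_eq_mul_inv]⟩
    have h1 : α.toReal * (2 * α.toReal⁻¹) = 2 := by field_simp
    have := mul_le_mul_of_nonneg_left (h.le.trans hx) ha.le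
    linarith

/-- The inclusion of L^α in L^a on a finite measure space, with K depending on M but not on c and f:
the same K must serve every dyadic block. -/
theorem exists_lintegral_rpow_le {α : ℝ≥0∞} {a : ℝ} (ha : 0 < a) (haα : ENNReal.ofReal a ≤ α)
    {M : ℝ≥0∞} (hM : M ≠ ⊤) (μ : Measure ℝ) [IsFiniteMeasure μ] : ∃ K : ℝ≥0∞, K ≠ ⊤ ∧
      ∀ (c : ℝ≥0∞) (f : ℝ → ℝ≥0∞), c ≠ ⊤ → c * eLpNorm f α μ ≤ M →
        ∫⁻ s, (c * f s) ^ a ∂μ ≤ K := by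
  rcases eq_or_ne α ⊤ with rfl | hαt
  · refine ⟨M ^ a * μ Set.univ, ENNReal.mul_ne_top (ENNReal.rpow_ne_top_of_nonneg ha.le hM)
      (measure_ne_top _ _), fun c f _ hcf => ?_⟩
    rw [eLpNorm_exponent_top] at hcf
    calc ∫⁻ s, (c * f s) ^ a ∂μ ≤ ∫⁻ _, M ^ a ∂μ := by
          refine lintegral_mono_ae ?_
          filter_upwards [ae_le_eLpNormEssSup (f := f) (μ := μ)] with s hs
          rw [enorm_eq_self] at hs
          exact ENNReal.rpow_le_rpow ((mul_le_mul_right hs c).trans hcf) ha.le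
      _ = _ := lintegral_const _
  · have hα0 : α ≠ 0 := fun h0 => by
      rw [h0, nonpos_iff_eq_zero, ENNReal.ofReal_eq_zero] at haα
      linarith
    set p := α.toReal with hp
    have hap : a ≤ p := (ENNReal.ofReal_le_iff_le_toReal hαt).1 haα
    have hp0 : 0 < p := ha.trans_le hap
    refine ⟨μ Set.univ + M ^ p, ENNReal.add_ne_top.2 ⟨measure_ne_top _ _,
      ENNReal.rpow_ne_top_of_nonneg hp0.le hM⟩, fun c f hc hcf => ?_⟩
    have h1 : ∀ x : ℝ≥0∞, x ^ a ≤ 1 + x ^ p := fun x => by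
      rcases le_total x 1 with hx | hx
      · exact (ENNReal.rpow_le_one hx ha.le).trans le_self_add
      · exact (ENNReal.rpow_le_rpow_of_exponent_le hx hap).trans le_add_self
    calc ∫⁻ s, (c * f s) ^ a ∂μ ≤ ∫⁻ s, 1 + (c * f s) ^ p ∂μ := lintegral_mono fun s => h1 _
      _ = μ Set.univ + c ^ p * ∫⁻ s, f s ^ p ∂μ := by
        rw [lintegral_add_left measurable_const, lintegral_one]
        simp only [ENNReal.mul_rpow_of_nonneg _ _ hp0.le]
        rw [lintegral_const_mul' _ _ (ENNReal.rpow_ne_top_of_nonneg hp0.le hc)]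
      _ ≤ μ Set.univ + M ^ p := by
        gcongr
        refine le_trans (le_of_eq ?_) (ENNReal.rpow_le_rpow hcf hp0.le)
        rw [ENNReal.mul_rpow_of_nonneg _ _ hp0.le, eLpNorm_eq_lintegral_rpow_enorm_toReal hα0 hαt,
          ← ENNReal.rpow_mul, one_div_mul_cancel hp0.ne', ENNReal.rpow_one]
        simp only [enorm_eq_self, hp]

theorem iSup_rpow_le_tsum {ι : Type*} {a : ℝ} (ha : 0 < a) (x : ι → ℝ≥0∞) :
    (⨆ i, x i) ^ a ≤ ∑' i, x i ^ a := by
  rw [← ENNReal.le_rpow_inv_iff ha]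
  refine iSup_le fun i => ?_
  rw [ENNReal.le_rpow_inv_iff ha]
  exact ENNReal.le_tsum i

theorem aemeasurable_lpNorm_of_eqOn {t : ℝ} {u w : ℝ → TD n} (hw : ∀ ψ, Measurable fun s => w s ψ)
    (hwu : ∀ s ∈ Set.Ioc 0 t, w s = u s) {p : ℝ≥0∞} (hp : 1 ≤ p)
    (hu : ∀ᵐ s ∂(volume.restrict (Set.Ioo 0 t)), InLp p (u s)) :
    AEMeasurable (fun s => lpNorm p (u s)) (volume.restrict (Set.Ioo 0 t)) := by
  have hI : ∀ᵐ s ∂(volume.restrict (Set.Ioo 0 t)), w s = u s := by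
    filter_upwards [ae_restrict_mem measurableSet_Ioo] with s hs using hwu s ⟨hs.1, hs.2.le⟩
  refine (aemeasurable_lpNorm hw hp ?_).congr ?_
  · filter_upwards [hu, hI] with s h1 h2
    rwa [h2]
  · filter_upwards [hI] with s h2
    rw [h2]

theorem MemLeb.lintegral_supLp {α l : ℝ≥0∞} {t a : ℝ} {u w : ℝ → VTD n}
    (hw : ∀ i (ψ : 𝓢(E n, ℂ)), Measurable fun s => w s i ψ) (hwu : ∀ s ∈ Set.Ioc 0 t, w s = u s)
    (hl : 1 ≤ l) (ha : 0 < a) (haα : ENNReal.ofReal a ≤ α) (hu : MemLeb α l t u) :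
    (∀ᵐ s ∂(volume.restrict (Set.Ioo 0 t)), ∀ i, InLp l (u s i)) ∧
      ∫⁻ s in Set.Ioo 0 t, supLp l (u s) ^ a ≠ ⊤ := by
  have h1 : ∀ i, ∀ᵐ s ∂(volume.restrict (Set.Ioo 0 t)), InLp l (u s i) := fun i => by
    filter_upwards [(hu i).1] with s hs using inLp_iff.2 hs
  refine ⟨ae_all_iff.2 h1, ne_top_of_le_ne_top ?_
    (lintegral_mono fun s => iSup_rpow_le_tsum ha fun i => lpNorm l (u s i))⟩
  rw [lintegral_tsum fun i => (aemeasurable_lpNorm_of_eqOn (hw i)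
    (fun s hs => by rw [hwu s hs]) hl (h1 i)).pow_const a, tsum_fintype]
  refine ENNReal.sum_ne_top.2 fun i _ => ?_
  obtain ⟨K, hK, hle⟩ := exists_lintegral_rpow_le ha haα (hu i).2.ne
    (volume.restrict (Set.Ioo 0 t))
  have := hle 1 (fun s => lpNorm l (u s i)) ENNReal.one_ne_top (by rw [one_mul]; rfl)
  simp only [one_mul] at this
  exact ne_top_of_le_ne_top hK this

variable {χ φ : E n → ℝ}

/-- Interpolation between L^l and the L^∞ bound of Bernstein's inequality. It allows an exponent
below 2 to be raised to 2. -/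
theorem exists_dyadic_lpNorm_le (h : IsLittlewoodPaleyPair χ φ) {l l' : ℝ≥0∞} (hl : 1 ≤ l)
    (hll : l ≤ l') : ∃ C : ℝ, 0 ≤ C ∧ ∀ (j : ℤ) (u : TD n), InLp l (dyadic φ j u) →
      InLp l' (dyadic φ j u) ∧ lpNorm l' (dyadic φ j u) ≤
        ENNReal.ofReal (C * (2 : ℝ) ^ ((j : ℝ) * (n * invGap l l'))) * lpNorm l (dyadic φ j u) := by
  rcases eq_or_ne l ⊤ with rfl | hlt
  · rw [top_le_iff.1 hll]
    exact ⟨1, zero_le_one, fun j u hu => ⟨hu, by simp [invGap]⟩⟩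
  obtain ⟨C, hC0, hC⟩ := exists_bernstein (n := n) hl
  have hl0 : l ≠ 0 := (zero_lt_one.trans_le hl).ne'
  have hlp : 0 < l.toReal := ENNReal.toReal_pos hl0 hlt
  set θ := l.toReal * l'⁻¹.toReal with hθ
  have hθ0 : 0 ≤ θ := by positivity
  have hinv : l'⁻¹.toReal ≤ l⁻¹.toReal :=
    ENNReal.toReal_mono (ENNReal.inv_ne_top.2 hl0) (ENNReal.inv_le_inv.2 hll)
  have hlinv : l⁻¹.toReal * l.toReal = 1 := by
    rw [ENNReal.toReal_inv, inv_mul_cancel₀ hlp.ne']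
  have hθ1 : θ ≤ 1 := by
    rw [hθ, ← hlinv, mul_comm]
    gcongr
  refine ⟨C ^ (1 - θ), by positivity, fun j u hu => ?_⟩
  set w := dyadic φ j u with hw
  have hA := inLp_iff.1 hu
  obtain ⟨h1, h2⟩ := hC j w (lpNorm l w).toReal hu ENNReal.toReal_nonneg
    (ENNReal.ofReal_toReal hA.ne).ge (h.high_ball j u)
  have hD : 0 ≤ C * (2 : ℝ) ^ ((j : ℝ) * (n * l⁻¹.toReal)) := by positivity
  rw [ENNReal.ofReal_mul hD, ENNReal.ofReal_toReal hA.ne] at h2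
  have h3 : lpNorm l' w ≤
      ENNReal.ofReal (C ^ (1 - θ) * (2 : ℝ) ^ ((j : ℝ) * (n * invGap l l'))) * lpNorm l w := by
    have h4 : lpNorm l' w ≤ lpNorm ⊤ w ^ (1 - θ) * lpNorm l w ^ θ := by
      rw [hu.represents.lpNorm_eq, hu.represents.lpNorm_eq, hu.represents.lpNorm_eq]
      exact eLpNorm_le_interpolate hu.memLp.1 hl0 hlt hll
    refine (h4.trans (mul_le_mul_left (ENNReal.rpow_le_rpow h2 (by linarith)) _)).trans_eq ?_
    rw [ENNReal.mul_rpow_of_nonneg _ _ (by linarith), mul_assoc,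
      ← ENNReal.rpow_add_of_nonneg _ _ (by linarith) hθ0, sub_add_cancel, ENNReal.rpow_one,
      ENNReal.ofReal_rpow_of_nonneg hD (by linarith), Real.mul_rpow hC0 (by positivity),
      ← Real.rpow_mul (by norm_num)]
    congr 4
    unfold invGap
    rw [hθ]
    linear_combination -((j : ℝ) * n * l'⁻¹.toReal) * hlinv
  exact ⟨inLp_iff.2 (h3.trans_lt (ENNReal.mul_lt_top ENNReal.ofReal_lt_top hA)), h3⟩

/-- In the Chemin-Lerner norm the supremum over j stands outside the time norm. The a-th power of a
supremum is at most the sum of the a-th powers, and the weight 2^{-δ|j|} makes the sum over j of the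
time integrals converge. -/
theorem MemCheminLerner.lintegral_besovSize (h : IsLittlewoodPaleyPair χ φ) {α l l' : ℝ≥0∞}
    {t a s s' δ : ℝ} {u w : ℝ → VTD n} (hw : ∀ i (ψ : 𝓢(E n, ℂ)), Measurable fun r => w r i ψ)
    (hwu : ∀ r ∈ Set.Ioc 0 t, w r = u r) (hl : 1 ≤ l) (hll : l ≤ l') (ha : 0 < a)
    (haα : ENNReal.ofReal a ≤ α) (hδ : 0 < δ) (hs : s' + n * invGap l l' = s)
    (hu : MemCheminLerner χ φ α l s t u) :
    (∀ᵐ r ∂(volume.restrict (Set.Ioo 0 t)), BesovFinite χ φ l' s' δ (u r)) ∧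
      ∫⁻ r in Set.Ioo 0 t, besovSize φ l' s' δ (u r) ^ a ≠ ⊤ := by
  obtain ⟨C, hC0, hC⟩ := exists_dyadic_lpNorm_le h hl hll
  have hl' : 1 ≤ l' := hl.trans hll
  have hin : ∀ i (j : ℤ), ∀ᵐ r ∂(volume.restrict (Set.Ioo 0 t)), InLp l (dyadic φ j (u r i)) :=
    fun i j => by filter_upwards [(hu i).2.1 j] with r hr using inLp_iff.2 hr
  have hin' : ∀ i (j : ℤ), ∀ᵐ r ∂(volume.restrict (Set.Ioo 0 t)), InLp l' (dyadic φ j (u r i)) :=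
    fun i j => by filter_upwards [hin i j] with r hr using (hC j _ hr).1
  set x : Fin n → ℤ → ℝ → ℝ≥0∞ := fun i j r =>
    ENNReal.ofReal ((2 : ℝ) ^ ((j : ℝ) * s' - δ * |(j : ℝ)|)) * lpNorm l' (dyadic φ j (u r i))
    with hx
  have hxm : ∀ i j, AEMeasurable (x i j) (volume.restrict (Set.Ioo 0 t)) := fun i j => by
    refine AEMeasurable.const_mul (aemeasurable_lpNorm_of_eqOn (w := fun r => dyadic φ j (w r i))
      (fun ψ => ?_) (fun r hr => by rw [hwu r hr]) hl' (hin' i j)) _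
    simp only [h.high_apply]
    exact hw i _
  have hxint : ∀ i, ∑' j, ∫⁻ r in Set.Ioo 0 t, x i j r ^ a ≠ ⊤ := fun i => by
    obtain ⟨K, hK, hle⟩ := exists_lintegral_rpow_le ha haα (hu i).2.2.ne
      (volume.restrict (Set.Ioo 0 t))
    have h1 : ∀ j : ℤ, ∫⁻ r in Set.Ioo 0 t, x i j r ^ a ≤
        ENNReal.ofReal (C ^ a * (2 : ℝ) ^ (-((δ * a) * |(j : ℝ)|))) * K := fun j => by
      have h2 := hle (ENNReal.ofReal ((2 : ℝ) ^ ((j : ℝ) * s)))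
        (fun r => lpNorm l (dyadic φ j (u r i))) ENNReal.ofReal_ne_top
        (le_iSup (fun j : ℤ => ENNReal.ofReal ((2 : ℝ) ^ ((j : ℝ) * s)) *
          lebNorm α l t (fun t => dyadic φ j (u t i))) j)
      refine le_trans ?_ (mul_le_mul_right h2 _)
      rw [← lintegral_const_mul' _ _ ENNReal.ofReal_ne_top]
      refine lintegral_mono_ae ?_
      filter_upwards [hin i j] with r hr
      have h3 : ENNReal.ofReal (C ^ a * (2 : ℝ) ^ (-((δ * a) * |(j : ℝ)|))) =
          ENNReal.ofReal (C * (2 : ℝ) ^ (-(δ * |(j : ℝ)|))) ^ a := by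
        rw [ENNReal.ofReal_rpow_of_nonneg (by positivity) ha.le, Real.mul_rpow hC0 (by positivity),
          ← Real.rpow_mul (by norm_num)]
        congr 3
        ring
      rw [h3, ← ENNReal.mul_rpow_of_nonneg _ _ ha.le]
      refine ENNReal.rpow_le_rpow ((mul_le_mul_right (hC j _ hr).2 _).trans_eq ?_) ha.le
      rw [← mul_assoc (ENNReal.ofReal _), ← mul_assoc (ENNReal.ofReal _),
        ← ENNReal.ofReal_mul (by positivity), ← ENNReal.ofReal_mul (by positivity)]
      congr 2
      rw [mul_left_comm, mul_assoc C, ← Real.rpow_add two_pos, ← Real.rpow_add two_pos, ← hs]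
      congr 2
      ring
    refine ne_top_of_le_ne_top ?_ (ENNReal.tsum_le_tsum h1)
    rw [ENNReal.tsum_mul_right]
    exact ENNReal.mul_ne_top
      ((summable_two_rpow_neg_abs (mul_pos hδ ha)).mul_left (C ^ a)).tsum_ofReal_ne_top hK
  have hint : ∫⁻ r in Set.Ioo 0 t, besovSize φ l' s' δ (u r) ^ a ≠ ⊤ := by
    have h1 : ∀ r, besovSize φ l' s' δ (u r) ^ a ≤ ∑' i, ∑' j, x i j r ^ a := fun r =>
      (iSup_rpow_le_tsum ha fun i => ⨆ j, x i j r).trans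
        (ENNReal.tsum_le_tsum fun i => iSup_rpow_le_tsum ha fun j => x i j r)
    refine ne_top_of_le_ne_top ?_ (lintegral_mono h1)
    rw [lintegral_tsum fun i => AEMeasurable.tsum fun j => (hxm i j).pow_const a,
      tsum_fintype]
    refine ENNReal.sum_ne_top.2 fun i _ => ?_
    rw [lintegral_tsum fun j => (hxm i j).pow_const a]
    exact hxint i
  have hsm : AEMeasurable (fun r => besovSize φ l' s' δ (u r)) (volume.restrict (Set.Ioo 0 t)) :=
    AEMeasurable.iSup fun i => AEMeasurable.iSup fun j => hxm i j
  refine ⟨?_, hint⟩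
  filter_upwards [ae_all_iff.2 fun i => (hu i).1, ae_all_iff.2 fun i => ae_all_iff.2 (hin' i),
    ae_lt_top' (hsm.pow_const a) hint] with r h1 h2 h3
  exact ⟨h1, h2, (ENNReal.rpow_lt_top_iff_of_pos ha).1 h3⟩

/-! ### Uniqueness in the path spaces -/

/-- The two solutions may have different time exponents; only a common real lower bound a matters.
The second statement of the theorem needs this freedom. -/
theorem eq_of_memLeb (h : IsLittlewoodPaleyPair χ φ) {T l α β : ℝ≥0∞} {f : VTD n}
    {u v : ℝ → VTD n} {t a : ℝ} (hl : 2 ≤ l) (ha : 2 ≤ a) (hla : n * l⁻¹.toReal + 2 / a < 1)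
    (hα : ENNReal.ofReal a ≤ α) (hβ : ENNReal.ofReal a ≤ β) (hu : IsSolution T f bilin u)
    (hv : IsSolution T f bilin v) (ht : t ∈ timeInterval T) (hmu : MemLeb α l t u)
    (hmv : MemLeb β l t v) : u t = v t := by
  have hl1 : 1 ≤ l := le_trans (by norm_num) hl
  have ha0 : 0 < a := by linarith
  obtain ⟨u', hum, hu'⟩ := exists_measurable_extension hu.measurable ht
  obtain ⟨v', hvm, hv'⟩ := exists_measurable_extension hv.measurable ht
  obtain ⟨h1, h2⟩ := hmu.lintegral_supLp hum hu' hl1 ha0 hα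
  obtain ⟨h3, h4⟩ := hmv.lintegral_supLp hvm hv' hl1 ha0 hβ
  exact (spatialBound_lebesgue h hl ha hla).eq_of_isSolution hu hv ht h1 h3 h2 h4

theorem eq_of_memCheminLerner (h : IsLittlewoodPaleyPair χ φ) {T l α : ℝ≥0∞} {f : VTD n}
    {u v : ℝ → VTD n} {t s g : ℝ} (hl : 1 ≤ l) (hα : α ≠ 0) (hs : s = sExp n l + g) (hs0 : 0 < s)
    (hg2 : -sExp n 2 < g) (hg1 : g < 1) (hαg : 2 * α⁻¹.toReal < g)
    (hu : IsSolution T f (bilinBony χ φ) u) (hv : IsSolution T f (bilinBony χ φ) v)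
    (ht : t ∈ timeInterval T) (hmu : MemCheminLerner χ φ α l s t u)
    (hmv : MemCheminLerner χ φ α l s t v) : u t = v t := by
  obtain ⟨a, ha2, haα, hag⟩ := exists_real_exponent hα hg1.le hαg
  have ha0 : 0 < a := by linarith
  set s' := sExp n (max l 2) + g with hs'
  -- The two cases of the maximum use the two lower bounds of admissibility: s > 0 if ℓ ≥ 2, and g >
  -- -s_2 if ℓ is raised to 2.
  have hs'0 : 0 < s' := by
    rcases max_choice l 2 with hm | hm
    · rwa [hs', hm, ← hs]
    · rw [hs', hm]
      linarith
  -- δ is smaller than each open margin: s' for the remainder, 1 - g for the low-frequency sums, and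
  -- g - 2/a for the smoothing exponent, which also gives δ < g.
  obtain ⟨δ, hδ0, hδ⟩ := exists_between (show 0 < min (min s' (1 - g)) (g - 2 / a) from
    lt_min (lt_min hs'0 (by linarith)) (by linarith))
  rw [lt_min_iff, lt_min_iff] at hδ
  have h2a : 0 < 2 / a := by positivity
  have he : BonyExp n (max l 2) s' g δ := ⟨le_max_right _ _, rfl, hδ0, hδ.1.1, by linarith, hδ.1.2⟩
  have hss : s' + n * invGap l (max l 2) = s := by
    rw [hs, hs', sExp, sExp, invGap]
    ring
  obtain ⟨u', hum, hu'⟩ := exists_measurable_extension hu.measurable ht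
  obtain ⟨v', hvm, hv'⟩ := exists_measurable_extension hv.measurable ht
  obtain ⟨h1, h2⟩ := hmu.lintegral_besovSize h hum hu' hl (le_max_left l 2) ha0 haα hδ0 hss
  obtain ⟨h3, h4⟩ := hmv.lintegral_besovSize h hvm hv' hl (le_max_left l 2) ha0 haα hδ0 hss
  exact (spatialBound_bony h he ha2 (by linarith)).eq_of_isSolution hu hv ht h1 h3 h2 h4

theorem eq_of_memX (h : IsLittlewoodPaleyPair χ φ) (hn : 1 ≤ n) {T l α : ℝ≥0∞} {ε : ℝ} {f : VTD n}
    {u v : ℝ → VTD n} {t : ℝ} (had : Admissible n α l ε) (hu : IsSolution T f (bilinX χ φ α l ε) u)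
    (hv : IsSolution T f (bilinX χ φ α l ε) v) (ht : t ∈ timeInterval T)
    (hmu : MemX χ φ α l ε t u) (hmv : MemX χ φ α l ε t v) : u t = v t := by
  obtain ⟨hα1, hl1, hε, -, hcase⟩ := had
  have hα0 : α ≠ 0 := (zero_lt_one.trans_le hα1).ne'
  have hαg : 2 * α⁻¹.toReal < gain α ε := by
    unfold gain
    linarith
  unfold MemX at hmu hmv
  by_cases hs : sExp n l + gain α ε = 0
  · have hb : bilinX χ φ α l ε = bilin := by
      funext u v
      exact if_pos hs
    rw [if_pos hs] at hmu hmv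
    rw [hb] at hu hv
    obtain ⟨-, h2, h1⟩ := hcase.resolve_right fun h0 => h0.1.ne' hs
    obtain ⟨a, ha2, haα, hag⟩ := exists_real_exponent hα0 h1 hαg
    have hnl : n * l⁻¹.toReal = 1 - gain α ε := by
      unfold sExp at hs
      linarith
    -- Here the scaling relation gives n/ℓ = 1 - g, and -s_2 ≤ g reads 1 - n/2 ≤ g. Together they
    -- give n/ℓ ≤ n/2, and n > 0 may be cancelled.
    have hl2 : 2 ≤ l := by
      have hn0 : (0 : ℝ) < n := by exact_mod_cast hn
      unfold sExp at hs h2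
      have h3 : n * l⁻¹.toReal ≤ n * (2 : ℝ≥0∞)⁻¹.toReal := by linarith
      have h4 := le_of_mul_le_mul_left h3 hn0
      rwa [ENNReal.toReal_le_toReal (ENNReal.inv_ne_top.2 (zero_lt_one.trans_le hl1).ne')
        (by simp), ENNReal.inv_le_inv] at h4
    exact eq_of_memLeb h hl2 ha2 (by linarith) haα haα hu hv ht hmu hmv
  · have hb : bilinX χ φ α l ε = bilinBony χ φ := by
      funext u v
      exact if_neg hs
    rw [if_neg hs] at hmu hmv
    rw [hb] at hu hv
    obtain ⟨h0, h2, h1⟩ := hcase.resolve_left fun h0 => hs h0.1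
    exact eq_of_memCheminLerner h hl1 hα0 rfl h0 h2 h1 hαg hu hv ht hmu hmv

/-- For ℓ = ∞ the condition n/ℓ + 2/a < 1 reduces to a > 2; on a bounded interval both solutions are
controlled with an exponent a ≤ min(α, β). -/
theorem eq_of_memLeb_top (h : IsLittlewoodPaleyPair χ φ) {T α β : ℝ≥0∞} {f : VTD n}
    {u v : ℝ → VTD n} {t : ℝ} (hα : 2 < α) (hβ : 2 < β) (hu : IsSolution T f bilin u)
    (hv : IsSolution T f bilin v) (ht : t ∈ timeInterval T) (hmu : MemLeb α ⊤ t u)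
    (hmv : MemLeb β ⊤ t v) : u t = v t := by
  have hm : 2 < min α β := lt_min hα hβ
  have h1 : 2 * (min α β)⁻¹.toReal < 1 := by
    have h2 := (ENNReal.toReal_lt_toReal (ENNReal.inv_ne_top.2 (zero_lt_two.trans hm).ne')
      (by simp)).2 (ENNReal.inv_lt_inv.2 hm)
    rw [ENNReal.toReal_inv 2, ENNReal.toReal_ofNat] at h2
    linarith
  obtain ⟨a, ha2, ha, hag⟩ := exists_real_exponent (zero_lt_two.trans hm).ne' le_rfl h1
  exact eq_of_memLeb h le_top ha2 (by simpa using hag) (ha.trans (min_le_left _ _))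
    (ha.trans (min_le_right _ _)) hu hv ht hmu hmv

end MildNS

/-! ### Assembly of the two statements -/

theorem mainTheorem2 (n : ℕ) (hn : 1 ≤ n) (χ φ : MildNS.E n → ℝ)
    (hχφ : MildNS.IsLittlewoodPaleyPair χ φ)
    (T : ℝ≥0∞) (hT : 0 < T) (f : MildNS.VTD n) (hf : ∀ i, MildNS.IsReal (f i)) :
    (∀ (α l : ℝ≥0∞) (ε : ℝ), MildNS.Admissible n α l ε →
      ∀ u v : ℝ → MildNS.VTD n,
        MildNS.IsSolution T f (MildNS.bilinX χ φ α l ε) u →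
        MildNS.IsSolution T f (MildNS.bilinX χ φ α l ε) v →
        (∀ T' ∈ MildNS.timeInterval T, MildNS.MemX χ φ α l ε T' u) →
        (∀ T' ∈ MildNS.timeInterval T, MildNS.MemX χ φ α l ε T' v) →
        ∀ t ∈ MildNS.timeInterval T, u t = v t) ∧
    (∀ u v : ℝ → MildNS.VTD n,
      MildNS.IsSolution T f MildNS.bilin u →
      MildNS.IsSolution T f MildNS.bilin v →
      (∀ T' ∈ MildNS.timeInterval T, ∃ α : ℝ≥0∞, 2 < α ∧ MildNS.MemLeb α ⊤ T' u) →
      (∀ T' ∈ MildNS.timeInterval T, ∃ α : ℝ≥0∞, 2 < α ∧ MildNS.MemLeb α ⊤ T' v) →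
      ∀ t ∈ MildNS.timeInterval T, u t = v t) := by
  exact ⟨fun α l ε had u v hu hv hmu hmv t ht =>
    MildNS.eq_of_memX hχφ hn had hu hv ht (hmu t ht) (hmv t ht),
    fun u v hu hv hmu hmv t ht => by
      obtain ⟨α, hα, hmu⟩ := hmu t ht
      obtain ⟨β, hβ, hmv⟩ := hmv t ht
      exact MildNS.eq_of_memLeb_top hχφ hα hβ hu hv ht hmu hmv⟩
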